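/- **Setting.** Holomorphic delta functions are $\bar\delta(f)=\frac1{2\pi i}\bar\partial\frac1f$; an integral of $h\prod_j\bar\delta(F_j)\,du_j$ is the sum over all solutions $u$ of $F=0$ (finitely many and nondegenerate, by assumption on the kinematics) of $(2\pi i)^{-m}\oint h\prod_j du_j/F_j$ over the torus $|F_1|=\dots=|F_m|=\rho$ around $u$. A soft operator $V_s^l=\frac1{2\pi i}\oint d\sigma_s(\cdot)$ is the coefficient of order $l$ in the soft momentum of the contour integrand of a vertex operator, and is inserted on infinitesimal circles around all hard punctures. $V_{[\mu}W_{\nu]}=V_\mu W_\nu-V_\nu W_\mu$. **A. Any dimension $D\ge1$.** Ambitwistor space is $T^*\mathscr I$ with coordinates $(u,p,w,q)$, symplectic potential $w\,du-q\cdot dp$ and fermions $\Psi_r$ ($r=1,2$ for gravity, $r=1$ for Yang–Mills); the Hamiltonian lift of $\delta u\,\partial_u+\delta p\cdot\partial_p$ is $w\,\delta u-q\cdot\delta p$. Let $J_{\mu\nu}=p_{[\mu}q_{\nu]}+w\sum_r\Psi_{r\mu}\Psi_{r\nu}$. The soft graviton ($\epsilon_1=\epsilon_2=\epsilon$) and the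 soft gluon have contour integrands $$\frac{w\,e^{is\cdot q/w}}{s\cdot p}\prod_{r=1}^2(\epsilon\cdot p+i\,\epsilon\cdot\Psi_r\,s\cdot\Psi_r),\qquad \frac{w\,e^{is\cdot q/w}}{s\cdot p}(\epsilon\cdot p+i\,\epsilon\cdot\Psi\,s\cdot\Psi)\,j .$$ (A1) *Generators*, for $w\neq0$, $s\cdot p\ne0$. The graviton term of order $0$ is $w f(p)$, $f=(\epsilon\cdot p)^2/s\cdot p$: the Hamiltonian lift of the supertranslation $\delta u=f$, of weight one in $p$. The term of order $1$ is $$H_r=r^{\mu\nu}(p)J_{\mu\nu}=i\,\frac{\epsilon\cdot p}{s\cdot p}\,\epsilon^\mu s^\nu J_{\mu\nu},\qquad r^{\mu\nu}=\frac i2\,\frac{\epsilon\cdot p}{s\cdot p}\,\epsilon^{[\mu}s^{\nu]},$$ a superrotation generator with $r^{\mu\nu}$ antisymmetric of weight zero (its $\Psi$-independent part is the Hamiltonian lift of $\delta p^\mu=2r^{\mu\nu}p_\nu$, $\delta u=0$), up to the term $i\,\epsilon\cdot p\,\epsilon\cdot q$, which has no pole at $s\cdot p=0$. For gluons the two terms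 are $w\frac{\epsilon\cdot p}{s\cdot p}\,j$ and $\frac{i}{s\cdot p}\epsilon^\mu s^\nu J_{\mu\nu}\,j$, the latter up to $i\,\epsilon\cdot q\,j$. (A2) *Ward identities.* Let $\langle V_1\cdots V_n\rangle$, $n\ge3$, be the genus-zero correlator with $w=1$, before integration over the zero mode $x$ of $q$: it contains the factor $e^{ix\cdot\sum_ak_a}$, whose integral over $x$ is the momentum delta function; three punctures are fixed, two particles enter as $e^{ik\cdot q}\epsilon_r\cdot\Psi_r$, the third as $e^{ik\cdot q}\prod_r\epsilon_{r}\cdot(p+i\Psi_r\Psi_r\cdot k)$, the others in addition with $\bar\delta(k\cdot p)$; $p(\sigma)=\sum_ak_a/(\sigma-\sigma_a)$, the fermions are contracted by Wick's theorem, and for gluons there is the single-trace factor $\prod_a(\sigma_a-\sigma_{a+1})^{-1}$ (soft gluon between $n$ and $1$). It is a function of the independent vectors $k_a,\epsilon_{r,a}$. Put $$J_a^{\mu\nu}=k_a^{[\mu}\frac{\partial}{\partial k_{a,\nu]}}+\sum_r\epsilon_{r,a}^{[\mu}\frac{\partial}{\partial\epsilon_{r,a,\nu]}} .$$ If $s\cdot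 k_a\ne0$ for all $a$ at given kinematics, then for all sufficiently small tori, all nearby kinematics and all $x$, the correlator is differentiable in the kinematics and $$\langle V_1\cdots V_nV_s^0\rangle=\sum_a\frac{(\epsilon\cdot k_a)^2}{s\cdot k_a}\langle V_1\cdots V_n\rangle,\qquad \langle V_1\cdots V_nV_s^1\rangle=\sum_a\frac{\epsilon_{\mu}\epsilon_\nu k_a^\mu s_\lambda J_a^{\nu\lambda}}{s\cdot k_a}\langle V_1\cdots V_n\rangle,$$ where $V_s^1=\frac1{2\pi i}\oint H_r$; the second identity also holds with the full term of order $1$ of the vertex operator in place of $H_r$ if $\sum_ak_a=0$. For gluons $$\langle V_1\cdots V_nV^{ym,0}_s\rangle=\Big(\frac{\epsilon\cdot k_1}{s\cdot k_1}-\frac{\epsilon\cdot k_n}{s\cdot k_n}\Big)\langle V_1\cdots V_n\rangle,\qquad \langle V_1\cdots V_nV^{ym,1}_s\rangle=\Big(\frac{\epsilon_\mu s_\nu J_1^{\mu\nu}}{s\cdot k_1}-\frac{\epsilon_\mu s_\nu J_n^{\mu\nu}}{s\cdot k_n}\Big)\langle V_1\cdots V_n\rangle,$$ the latter both for $V_s^{ym,1}=\frac1{2\pi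 i}\oint\frac{i}{s\cdot p}\epsilon^\mu s^\nu J_{\mu\nu}\,j$ and for the full term of order $1$. **B. Four dimensions, twistorial model.** $Z=(\mu,\lambda)$, $W=(\tilde\lambda,\tilde\mu)$, with fermionic partners $\rho,\tilde\rho$ for gravity; $\xi$ is a reference spinor. The positive-helicity soft gluon and graviton with momentum $\lambda_s\tilde\lambda_s$ have contour integrands (on circles around the hard punctures) $$\frac{\langle\xi\lambda\rangle}{\langle\xi s\rangle\langle s\lambda\rangle}\,e^{i\frac{\langle\xi s\rangle}{\langle\xi\lambda\rangle}[\mu s]}\,j,\qquad (1+\rho\cdot\partial_Z\,\tilde\rho\cdot\partial_W)\,\frac{\langle\xi\lambda\rangle^2[s\tilde\lambda]}{\langle\xi s\rangle^2\langle s\lambda\rangle}\,e^{i\frac{\langle\xi s\rangle}{\langle\xi\lambda\rangle}[\mu s]} ,$$ with $[\mu s]=\mu^{\dot\alpha}\tilde\lambda_{s\dot\alpha}$; orders are counted in $\tilde\lambda_s$ in the exponent. (B1) *Generators*, where $\langle\xi s\rangle,\langle s\lambda\rangle,\langle\xi\lambda\rangle\neq0$. The graviton terms of order $0,1,2$ are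 $(1+\rho\cdot\partial_Z\tilde\rho\cdot\partial_W)h_l$ with $h_0=\frac{\langle\xi\lambda\rangle^2[s\tilde\lambda]}{\langle\xi s\rangle^2\langle s\lambda\rangle}$, a supertranslation Hamiltonian of weight $(1,1)$; $h_1=[\mu\tilde r]$, $\tilde r=i\frac{\langle\xi\lambda\rangle[s\tilde\lambda]}{\langle\xi s\rangle\langle s\lambda\rangle}\tilde\lambda_s$, a superrotation Hamiltonian with $\tilde r$ of weight $(0,1)$ and $\partial\tilde r_{\dot\alpha}/\partial\tilde\lambda_{\dot\alpha}=0$; and $h_2=-\frac{[s\tilde\lambda][\mu s]^2}{2\langle s\lambda\rangle}$. The extended Hamiltonians $\hat h_l$ obey $2\hat h_0\hat h_2=\hat h_1^2$ ("square" of the superrotation). The gluon terms of order $0,1$ are $\frac{\langle\xi\lambda\rangle}{\langle\xi s\rangle\langle s\lambda\rangle}j$ and $\frac{i[\mu s]}{\langle s\lambda\rangle}j$. (B2) *Ward identities.* Let $\langle\cdots\rangle$ be the correlator of $k$ operators $\tilde V_i$ and $m$ operators $V_p$, $n=k+m\ge3$, with any number $\mathcal N$ of supersymmetries: $$\int\frac{\prod_ad\sigma_a\,ds_a}{\mathrm{Vol}\,GL(2)}\;\mathcal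 I\;\prod_i\bar\delta^2(\tilde\lambda_i-s_i\tilde\lambda(\sigma_i))\prod_p\bar\delta^{2|\mathcal N}(\lambda_p-s_p\lambda(\sigma_p)\,|\,\eta_p-s_p\chi(\sigma_p)),$$ with $(\lambda,\chi)(\sigma)=\sum_i\frac{s_i(\lambda_i,\eta_i)}{\sigma-\sigma_i}$ and $\tilde\lambda(\sigma)=\sum_p\frac{s_p\tilde\lambda_p}{\sigma-\sigma_p}$. For gluons $\mathcal I=\prod_a\frac1{s_a(\sigma_a-\sigma_{a+1})}$. For gravitons $\mathcal I$ is $\prod_as_a^{-2}$ times $s_{i_0}^{-1}s_{p_0}^{-1}$ times the $\rho\tilde\rho$ correlator (a product of two determinants) of the factors $\langle\lambda\,i\rangle$, $i\neq i_0$, and $[\tilde\lambda\,p]$, $p\ne p_0$, extended to $\rho,\tilde\rho$, where one $\tilde V_{i_0}$ and one $V_{p_0}$ are unintegrated. A correlator is a distribution containing the momentum delta function, and is paired with entire test functions of the spinors $\tilde\lambda$ of any two chosen particles. If $\langle\xi s\rangle\ne0$ and $\langle s\,a\rangle\neq0$ for all $a$, then for gluons, in the colour order $1,\dots,n$, $$\langle\cdots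 V_s^{ym,0}\rangle=\frac{\langle1n\rangle}{\langle s1\rangle\langle sn\rangle}\langle\cdots\rangle,\qquad \langle\cdots V_s^{ym,1}\rangle=\Big(\frac1{\langle s1\rangle}\tilde\lambda_s\cdot\frac{\partial}{\partial\tilde\lambda_1}+\frac1{\langle ns\rangle}\tilde\lambda_s\cdot\frac{\partial}{\partial\tilde\lambda_n}\Big)\langle\cdots\rangle,$$ and for gravitons $$\langle\cdots V_s^0\rangle=\sum_a\frac{[as]\langle\xi a\rangle^2}{\langle as\rangle\langle\xi s\rangle^2}\langle\cdots\rangle,\qquad \langle\cdots V_s^1\rangle=\sum_a\frac{[as]\langle\xi a\rangle}{\langle as\rangle\langle\xi s\rangle}\,\tilde\lambda_s\cdot\frac{\partial}{\partial\tilde\lambda_a}\langle\cdots\rangle,$$ $$\langle\cdots V_s^2\rangle=\frac12\sum_a\frac{[as]}{\langle as\rangle}\,\tilde\lambda_s^{\dot\alpha}\tilde\lambda_s^{\dot\beta}\frac{\partial^2}{\partial\tilde\lambda_a^{\dot\alpha}\partial\tilde\lambda_a^{\dot\beta}}\langle\cdots\rangle .$$ -/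

import Mathlib

noncomputable section

namespace Ambi

open Complex Filter Finset
open scoped Topology

-- ## Contours, soft expansion, localisation on solutions

/-- The contour integral `(1/2πi)∮ f(z) dz` over the circle `|z - c| = δ` in the limit `δ → 0`. -/
def residueAt (f : ℂ → ℂ) (c : ℂ) : ℂ :=
  limUnder (𝓝[>] (0 : ℝ)) fun δ => (2 * (Real.pi : ℂ) * I)⁻¹ * ∮ z in C(c, δ), f z

/-- Coefficient of `τ ^ l` in the Taylor expansion at `τ = 0`; the soft momentum is `τ s`. -/
def softTerm (l : ℕ) (f : ℂ → ℂ) : ℂ := iteratedDeriv l f 0 / (l.factorial : ℂ)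

/-- `φ` is a holomorphic local inverse of `F` at a zero `u` of `F`. -/
def IsLocalInverse {n : ℕ} (F : (Fin n → ℂ) → (Fin n → ℂ)) (u : Fin n → ℂ)
    (φ : (Fin n → ℂ) → (Fin n → ℂ)) : Prop :=
  φ 0 = u ∧ (∀ᶠ y in 𝓝 (0 : Fin n → ℂ), DifferentiableAt ℂ φ y) ∧
    ∀ᶠ y in 𝓝 (0 : Fin n → ℂ), F (φ y) = y

/-- `S` is the set of all solutions of `F = 0` in the domain `D`; they are finite in number and
nondegenerate, and `φ u` is a holomorphic local inverse of `F` at the solution `u`. -/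
def IsSolutionSet {n : ℕ} (D : (Fin n → ℂ) → Prop) (F : (Fin n → ℂ) → (Fin n → ℂ))
    (S : Finset (Fin n → ℂ)) (φ : (Fin n → ℂ) → (Fin n → ℂ) → (Fin n → ℂ)) : Prop :=
  (∀ u, u ∈ S ↔ D u ∧ F u = 0) ∧ ∀ u ∈ S, IsLocalInverse F u (φ u)

/-- The integral of the top form `f du₁ ⋯ duₙ`, `(1/2πi)ⁿ∮ ⋯ ∮`, over the tori
`|F₁| = ⋯ = |Fₙ| = r` around the solutions `u ∈ S` of `F = 0`.  With `f = h / (F₁ ⋯ Fₙ)` this is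
the integral of `h` against the holomorphic delta functions of `F₁, …, Fₙ`. -/
def contourSum {n : ℕ} (S : Finset (Fin n → ℂ)) (φ : (Fin n → ℂ) → (Fin n → ℂ) → (Fin n → ℂ))
    (r : ℝ) (f : (Fin n → ℂ) → ℂ) : ℂ :=
  ∑ u ∈ S, ((2 * (Real.pi : ℂ) * I)⁻¹) ^ n *
    torusIntegral (fun y => f (φ u y) * (fderiv ℂ (φ u) y).det) 0 (fun _ => r)

/-- Parke-Taylor factor `∏ⱼ 1 / (zⱼ - zⱼ₊₁)`, cyclic in `j`: the single trace term of the
current algebra correlator. -/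
def parkeTaylor {n : ℕ} (z : Fin (n + 1) → ℂ) : ℂ := ∏ j, (z j - z (j + 1))⁻¹

-- ## The model in `d + 1` space-time dimensions

/-- Complexified Minkowski vectors (components with upper indices) in `d + 1` dimensions. -/
abbrev Vec (d : ℕ) := Fin (d + 1) → ℂ

def eta {d : ℕ} (μ : Fin (d + 1)) : ℂ := if μ = 0 then -1 else 1

/-- Lowering of the index of a vector. -/
def low {d : ℕ} (x : Vec d) (μ : Fin (d + 1)) : ℂ := eta μ * x μ

def mdot {d : ℕ} (x y : Vec d) : ℂ := ∑ μ, eta μ * x μ * y μ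

/-- Labels of the hard particles: three with gauge fixed punctures and `m` with integrated
punctures, `n = m + 3` in total. -/
abbrev Hard (m : ℕ) := Fin 3 ⊕ Fin m

/-- Momenta `k_a` and polarisations `ε_{r,a}` of the hard particles; `N = 2` for gravity,
`N = 1` for Yang-Mills. -/
abbrev Kin (N m d : ℕ) := (Hard m → Vec d) × (Fin N → Hard m → Vec d)

/-- All punctures, from the gauge fixed ones `g` and the moduli `u`. -/
def punctures {m : ℕ} (g : Fin 3 → ℂ) (u : Fin m → ℂ) : Hard m → ℂ := Sum.elim g u

/-- `p(z) = ∑ₐ k_a / (z - σ_a)`. -/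
def pField {m d : ℕ} (σ : Hard m → ℂ) (k : Hard m → Vec d) (z : ℂ) : Vec d :=
  ∑ a, (z - σ a)⁻¹ • k a

/-- `p(σ_b)` without the self-contraction of particle `b`. -/
def pAt {m d : ℕ} (σ : Hard m → ℂ) (k : Hard m → Vec d) (b : Hard m) : Vec d :=
  ∑ a ∈ univ.erase b, (σ b - σ a)⁻¹ • k a

/-- The scattering functions `k_j · p(σ_j)` of the particles with integrated punctures. -/
def scatteringMap {m d : ℕ} (g : Fin 3 → ℂ) (k : Hard m → Vec d) (u : Fin m → ℂ) : Fin m → ℂ :=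
  fun j => mdot (k (.inr j)) (pAt (punctures g u) k (.inr j))

/-- A local worldsheet operator
`pre * exp (i src·q) * ∏ᵣ (cnum_r + i (fl_r·Ψ_r) (fr_r·Ψ_r))`. -/
structure LocalOp (N d : ℕ) where
  pre : ℂ
  src : Vec d
  cnum : Fin N → ℂ
  fl : Fin N → Vec d
  fr : Fin N → Vec d

/-- Contour integrand of the vertex operator with soft momentum `τ s` and polarisation(s) `ε`,
`w exp (i τ s·q / w) / (s·p) * ∏ᵣ (ε·p + i ε·Ψ_r τ s·Ψ_r)`.
It is a graviton for `N = 2` and (stripped of its current) a gluon for `N = 1`. -/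
def softVertex (N : ℕ) {d : ℕ} (w : ℂ) (ε s : Vec d) (τ : ℂ) (p : Vec d) : LocalOp N d where
  pre := w / mdot s p
  src := (τ / w) • s
  cnum := fun _ => mdot ε p
  fl := fun _ => ε
  fr := fun _ => τ • s

/-- An operator whose term of first order in `τ` is `i c ε^μ s^ν J_{μν}`. -/
def rotationOp (N : ℕ) {d : ℕ} (c w : ℂ) (ε s : Vec d) (τ : ℂ) (p : Vec d) : LocalOp N d where
  pre := c
  src := τ • (mdot ε p • s - mdot s p • ε)
  cnum := fun _ => 1
  fl := fun _ => ε
  fr := fun _ => (τ * w) • s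

/-- Superrotation charge `i (ε·p / s·p) ε^μ s^ν J_{μν}` (the term of first order in `τ`). -/
def superrotationOp {d : ℕ} (w : ℂ) (ε s : Vec d) (τ : ℂ) (p : Vec d) : LocalOp 2 d :=
  rotationOp 2 (mdot ε p / mdot s p) w ε s τ p

/-- Its Yang-Mills analogue `i ε^μ s^ν J_{μν} / s·p` (the term of first order in `τ`). -/
def gaugeRotationOp {d : ℕ} (w : ℂ) (ε s : Vec d) (τ : ℂ) (p : Vec d) : LocalOp 1 d :=
  rotationOp 1 (1 / mdot s p) w ε s τ p

-- ### Operators as functions on the cotangent bundle of null infinity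

/-- Grassmann algebra of the variables `Ψ_r^μ`. -/
abbrev Grass (N d : ℕ) := ExteriorAlgebra ℂ (Fin N × Fin (d + 1) → ℂ)

/-- `Ψ_{rμ}`, with lower index. -/
def psiLow {N d : ℕ} (r : Fin N) (μ : Fin (d + 1)) : Grass N d :=
  ExteriorAlgebra.ι ℂ (Pi.single (r, μ) (eta μ))

/-- `v·Ψ_r`. -/
def psi {N d : ℕ} (r : Fin N) (v : Vec d) : Grass N d := ∑ μ, v μ • psiLow r μ

/-- The operator as a function of `q` and of the variables `Ψ_r`. -/
def LocalOp.symbol {N d : ℕ} (O : LocalOp N d) (q : Vec d) : Grass N d :=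
  (O.pre * exp (I * mdot O.src q)) •
    (List.ofFn fun r => algebraMap ℂ (Grass N d) (O.cnum r) +
      I • (psi r (O.fl r) * psi r (O.fr r))).prod

/-- `J_{μν} = p_μ q_ν - p_ν q_μ + w ∑ᵣ Ψ_{rμ} Ψ_{rν}`. -/
def angMomentum {N d : ℕ} (w : ℂ) (p q : Vec d) (μ ν : Fin (d + 1)) : Grass N d :=
  algebraMap ℂ (Grass N d) (low p μ * low q ν - low p ν * low q μ) +
    w • ∑ r : Fin N, psiLow r μ * psiLow r ν

/-- Hamiltonian lift of the vector field `δu ∂_u + δp·∂_p` on null infinity: its contraction with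
the symplectic potential `w du - q·dp`. -/
def hamiltonianLift {d : ℕ} (w : ℂ) (q : Vec d) (δu : ℂ) (δp : Vec d) : ℂ := w * δu - mdot q δp

/-- `H_r = J_{μν} r^{μν}(p)`. -/
def superrotationH {N d : ℕ} (r : Vec d → Fin (d + 1) → Fin (d + 1) → ℂ) (w : ℂ) (p q : Vec d) :
    Grass N d :=
  ∑ μ, ∑ ν, r p μ ν • angMomentum w p q μ ν

/-- `f(p) = (ε·p)² / s·p`. -/
def softTranslation {d : ℕ} (ε s p : Vec d) : ℂ := mdot ε p ^ 2 / mdot s p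

/-- `r^{μν}(p) = (i/2) (ε^μ s^ν - ε^ν s^μ) ε·p / s·p`. -/
def softRotation {d : ℕ} (ε s p : Vec d) (μ ν : Fin (d + 1)) : ℂ :=
  I / 2 * (ε μ * s ν - ε ν * s μ) * (mdot ε p / mdot s p)

-- ### Correlators

/-- Propagator of the fields `x.1·Ψ(x.2)` and `y.1·Ψ(y.2)`; no contraction at coincident points. -/
def contract {d : ℕ} (x y : Vec d × ℂ) : ℂ :=
  if x.2 = y.2 then 0 else I * mdot x.1 y.1 / (x.2 - y.2)

/-- The correlator of a product of fermion fields `v·Ψ(z)`, by the fermionic Wick expansion. -/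
def wick {d : ℕ} : List (Vec d × ℂ) → ℂ
  | [] => 1
  | x :: l => ∑ j : Fin l.length,
      (-1) ^ (j : ℕ) * contract x (l.get j) * wick (l.eraseIdx j)
termination_by l => l.length
decreasing_by
  have hj := j.isLt
  simp only [List.length_eraseIdx, List.length_cons]
  split <;> omega

/-- `wickProd [(c₁, a₁, b₁, z₁), …] L` is the correlator of the product of the fields in `L` and
of the factors `cᵢ + i (aᵢ·Ψ bᵢ·Ψ)(zᵢ)`. -/
def wickProd {d : ℕ} : List (ℂ × Vec d × Vec d × ℂ) → List (Vec d × ℂ) → ℂ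
  | [], L => wick L
  | (c, a, b, z) :: T, L => c * wickProd T L + I * wickProd T (L ++ [(a, z), (b, z)])

/-- `p(σ_b)` including the contributions of additional local operators. -/
def pTot {N m d : ℕ} (σ : Hard m → ℂ) (k : Hard m → Vec d) (ins : List (ℂ × LocalOp N d))
    (b : Hard m) : Vec d :=
  pAt σ k b + (ins.map fun i => (σ b - i.1)⁻¹ • i.2.src).sum

/-- Correlator of the `r`-th fermion system.  Two hard particles enter through the unintegrated
factor `ε·Ψ`, the others through `ε·p + i ε·Ψ k·Ψ`. -/
def fermionCorr {N m d : ℕ} (σ : Hard m → ℂ) (κ : Kin N m d) (ins : List (ℂ × LocalOp N d))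
    (r : Fin N) : ℂ :=
  wickProd
    (((Sum.inl 2 :: List.ofFn fun j : Fin m => (Sum.inr j : Hard m)).map fun b =>
        (mdot (κ.2 r b) (pTot σ κ.1 ins b), κ.2 r b, κ.1 b, σ b)) ++
      ins.map fun i => (i.2.cnum r, i.2.fl r, i.2.fr r, i.1))
    [(κ.2 r (.inl 0), σ (.inl 0)), (κ.2 r (.inl 1), σ (.inl 1))]

/-- The genus zero correlator of the hard vertex operators with additional local operators `ins`,
before the integration over the moduli and over the zero mode `x` of `q`; `w` is fixed to `1`.
The factors are: the zero mode exponential, the `c` and `c̃` ghosts, for each `r` the ghost `γ_r`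
and the fermions, the delta functions of the integrated vertex operators, and the current
algebra correlator `colour`. -/
def kernel {N m d : ℕ} (colour : ℂ) (x : Vec d) (σ : Hard m → ℂ) (κ : Kin N m d)
    (ins : List (ℂ × LocalOp N d)) : ℂ :=
  exp (I * mdot x (∑ a, κ.1 a + (ins.map fun i => i.2.src).sum)) *
    ((σ (.inl 0) - σ (.inl 1)) * (σ (.inl 1) - σ (.inl 2)) * (σ (.inl 2) - σ (.inl 0))) ^ 2 *
    (∏ r, (σ (.inl 0) - σ (.inl 1))⁻¹ * fermionCorr σ κ ins r) *
    (∏ j : Fin m, (mdot (κ.1 (.inr j)) (pTot σ κ.1 ins (.inr j)))⁻¹) *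
    (ins.map fun i => i.2.pre).prod * colour

/-- The correlator `⟨V_1 ⋯ V_n⟩`, as a density in the zero mode `x`. -/
def correlator {N m d : ℕ} (g : Fin 3 → ℂ) (S : Finset (Fin m → ℂ))
    (φ : (Fin m → ℂ) → (Fin m → ℂ) → (Fin m → ℂ)) (r : ℝ)
    (colour : (Hard m → ℂ) → ℂ) (x : Vec d) (κ : Kin N m d) : ℂ :=
  contourSum S φ r fun u => kernel (colour (punctures g u)) x (punctures g u) κ []

/-- The correlator `⟨V_1 ⋯ V_n V_s^l⟩` with an insertion of the term of order `l` of the operator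
`V`, integrated over circles around all the punctures. -/
def softCorrelator {N m d : ℕ} (g : Fin 3 → ℂ) (S : Finset (Fin m → ℂ))
    (φ : (Fin m → ℂ) → (Fin m → ℂ) → (Fin m → ℂ)) (r : ℝ)
    (colour : (Hard m → ℂ) → ℂ → ℂ) (x : Vec d) (κ : Kin N m d)
    (V : ℂ → Vec d → LocalOp N d) (l : ℕ) : ℂ :=
  contourSum S φ r fun u => ∑ a : Hard m,
    residueAt (fun z => softTerm l fun τ =>
      kernel (colour (punctures g u) z) x (punctures g u) κ
        [(z, V τ (pField (punctures g u) κ.1 z))]) (punctures g u a)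

/-- Current algebra correlator of the hard gluons in the colour order `col`. -/
def ptHard {ι : Type} {n : ℕ} (col : Fin (n + 1) ≃ ι) (σ : ι → ℂ) : ℂ :=
  parkeTaylor fun j => σ (col j)

/-- The same with a soft gluon at `z` between the last and the first hard gluon. -/
def ptSoft {ι : Type} {n : ℕ} (col : Fin (n + 1) ≃ ι) (σ : ι → ℂ) (z : ℂ) : ℂ :=
  parkeTaylor (Fin.snoc (α := fun _ => ℂ) (fun j => σ (col j)) z : Fin (n + 2) → ℂ)

-- ### Angular momentum acting on amplitudes

/-- `∂F / ∂k_{a,ν}`. -/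
def dMom {N m d : ℕ} (F : Kin N m d → ℂ) (κ : Kin N m d) (a : Hard m) (ν : Fin (d + 1)) : ℂ :=
  eta ν * fderiv ℂ F κ (Pi.single a (Pi.single ν 1), 0)

/-- `∂F / ∂ε_{r,a,ν}`. -/
def dPol {N m d : ℕ} (F : Kin N m d → ℂ) (κ : Kin N m d) (r : Fin N) (a : Hard m)
    (ν : Fin (d + 1)) : ℂ :=
  eta ν * fderiv ℂ F κ (0, Pi.single r (Pi.single a (Pi.single ν 1)))

/-- `J_a^{μν} F`, with `J_a^{μν} = k_a^{[μ} ∂/∂k_{a,ν]} + ∑ᵣ ε_{r,a}^{[μ} ∂/∂ε_{r,a,ν]}`. -/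
def angMomOp {N m d : ℕ} (a : Hard m) (μ ν : Fin (d + 1)) (F : Kin N m d → ℂ) (κ : Kin N m d) :
    ℂ :=
  κ.1 a μ * dMom F κ a ν - κ.1 a ν * dMom F κ a μ +
    ∑ r, (κ.2 r a μ * dPol F κ r a ν - κ.2 r a ν * dPol F κ r a μ)

/-- `∑ₐ (ε·k_a)² / s·k_a`. -/
def gravitonS0 {N m d : ℕ} (ε s : Vec d) (κ : Kin N m d) : ℂ :=
  ∑ a, mdot ε (κ.1 a) ^ 2 / mdot s (κ.1 a)

/-- `∑ₐ ε_{μν} k_a^μ s_ρ J_a^{νρ} / s·k_a` acting on `F`, with `ε_{μν} = ε_μ ε_ν`. -/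
def gravitonS1 {N m d : ℕ} (ε s : Vec d) (F : Kin N m d → ℂ) (κ : Kin N m d) : ℂ :=
  ∑ a, (∑ μ, ∑ ν, ∑ ρ, low ε μ * low ε ν * κ.1 a μ * low s ρ * angMomOp a ν ρ F κ) /
    mdot s (κ.1 a)

/-- `ε·k_1 / s·k_1 - ε·k_n / s·k_n`. -/
def gluonS0 {N m d : ℕ} (ε s : Vec d) (first last : Hard m) (κ : Kin N m d) : ℂ :=
  mdot ε (κ.1 first) / mdot s (κ.1 first) - mdot ε (κ.1 last) / mdot s (κ.1 last)

/-- `ε_μ s_ν J_1^{μν} / s·k_1 - ε_μ s_ν J_n^{μν} / s·k_n` acting on `F`. -/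
def gluonS1 {N m d : ℕ} (ε s : Vec d) (first last : Hard m) (F : Kin N m d → ℂ)
    (κ : Kin N m d) : ℂ :=
  (∑ μ, ∑ ν, low ε μ * low s ν * angMomOp first μ ν F κ) / mdot s (κ.1 first) -
    (∑ μ, ∑ ν, low ε μ * low s ν * angMomOp last μ ν F κ) / mdot s (κ.1 last)

-- ## The twistorial model in four dimensions

abbrev Spinor := Fin 2 → ℂ

/-- The bracket `⟨x y⟩` of undotted and `[x y]` of dotted spinors. -/
def br (x y : Spinor) : ℂ := x 0 * y 1 - x 1 * y 0

-- ### Hamiltonians on ambitwistor space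

/-- `Z = (μ, λ)` (in this order) or `W = (λ̃, μ̃)` (in this order), so that `Z·W` is the plain sum
of products of components. -/
abbrev Tw := Fin 2 ⊕ Fin 2 → ℂ

/-- Grassmann algebra of the components of `ρ` and `ρ̃`. -/
abbrev GrassTw := ExteriorAlgebra ℂ ((Fin 2 ⊕ Fin 2) ⊕ (Fin 2 ⊕ Fin 2) → ℂ)

def rho (i : Fin 2 ⊕ Fin 2) : GrassTw := ExteriorAlgebra.ι ℂ (Pi.single (.inl i) 1)

def rhoTilde (i : Fin 2 ⊕ Fin 2) : GrassTw := ExteriorAlgebra.ι ℂ (Pi.single (.inr i) 1)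

/-- `(1 + ρ·∂_Z ρ̃·∂_W) h`. -/
def extend (h : Tw → Tw → ℂ) (Z W : Tw) : GrassTw :=
  algebraMap ℂ GrassTw (h Z W) +
    ∑ i, ∑ j, deriv (fun a : ℂ => deriv (fun b : ℂ =>
      h (Z + a • Pi.single i 1) (W + b • Pi.single j 1)) 0) 0 • (rho i * rhoTilde j)

/-- Hamiltonian of the supertranslation `f(λ, λ̃)`. -/
def translationTw (f : Spinor → Spinor → ℂ) (Z W : Tw) : ℂ :=
  f (fun α => Z (.inr α)) (fun α => W (.inl α))

/-- Hamiltonian `[μ r̃] + ⟨μ̃ r⟩` of the superrotation `(r, r̃)(λ, λ̃)`. -/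
def rotationTw (r rt : Spinor → Spinor → Spinor) (Z W : Tw) : ℂ :=
  ∑ α, Z (.inl α) * rt (fun β => Z (.inr β)) (fun β => W (.inl β)) α +
    ∑ α, W (.inr α) * r (fun β => Z (.inr β)) (fun β => W (.inl β)) α

/-- Contour integrand of the gluon vertex operator (stripped of its current) with soft momentum
`τ λ_s λ̃_s`:  `⟨ξ λ⟩ / (⟨ξ s⟩ ⟨s λ⟩) exp (i τ ⟨ξ s⟩ [μ s] / ⟨ξ λ⟩)`. -/
def softGluonTw (ξ ls lts : Spinor) (τ : ℂ) (Z : Tw) : ℂ :=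
  br ξ (fun α => Z (.inr α)) / (br ξ ls * br ls (fun α => Z (.inr α))) *
    exp (I * τ * (br ξ ls / br ξ (fun α => Z (.inr α))) * ∑ α, Z (.inl α) * lts α)

/-- Contour integrand of the graviton vertex operator with soft momentum `τ λ_s λ̃_s`, before the
extension to `ρ`, `ρ̃`:
`⟨ξ λ⟩² [s λ̃] / (⟨ξ s⟩² ⟨s λ⟩) exp (i τ ⟨ξ s⟩ [μ s] / ⟨ξ λ⟩)`. -/
def softGravitonTw (ξ ls lts : Spinor) (τ : ℂ) (Z W : Tw) : ℂ :=
  br ξ (fun α => Z (.inr α)) ^ 2 * br lts (fun α => W (.inl α)) /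
      (br ξ ls ^ 2 * br ls (fun α => Z (.inr α))) *
    exp (I * τ * (br ξ ls / br ξ (fun α => Z (.inr α))) * ∑ α, Z (.inl α) * lts α)

/-- `f(λ, λ̃) = ⟨ξ λ⟩² [s λ̃] / (⟨ξ s⟩² ⟨s λ⟩)`. -/
def softTranslationTw (ξ ls lts l lt : Spinor) : ℂ :=
  br ξ l ^ 2 * br lts lt / (br ξ ls ^ 2 * br ls l)

/-- `r̃(λ, λ̃) = i ⟨ξ λ⟩ [s λ̃] / (⟨ξ s⟩ ⟨s λ⟩) λ̃_s`. -/
def softRotationTw (ξ ls lts l lt : Spinor) : Spinor :=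
  (I * (br ξ l * br lts lt / (br ξ ls * br ls l))) • lts

/-- `- [s λ̃] [μ s]² / (2 ⟨s λ⟩)`. -/
def softSquareTw (ls lts : Spinor) (Z W : Tw) : ℂ :=
  -(br lts (fun α => W (.inl α)) * (∑ α, Z (.inl α) * lts α) ^ 2) /
    (2 * br ls (fun α => Z (.inr α)))

-- ### Correlators

/-- Particle labels: `inl i` enters through a dual twistor vertex operator `Ṽ_i`, `inr p` through
a twistor vertex operator `V_p`. -/
abbrev Leg (k m : ℕ) := Fin k ⊕ Fin m

/-- `λ(z) = ∑ᵢ s_i λ_i / (z - σ_i)`. -/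
def lamField {k m : ℕ} (σ s : Leg k m → ℂ) (lam : Leg k m → Spinor) (z : ℂ) : Spinor :=
  ∑ i : Fin k, (s (.inl i) / (z - σ (.inl i))) • lam (.inl i)

/-- `λ̃(z) = ∑ₚ s_p λ̃_p / (z - σ_p)`, and contributions `c / (z - z')` of further sources
`(z', c)`.  At `z = σ_p` the term of `p` itself is zero by the convention for division by zero. -/
def ltField {k m : ℕ} (σ s : Leg k m → ℂ) (lt : Leg k m → Spinor) (src : List (ℂ × Spinor))
    (z : ℂ) : Spinor :=
  ∑ p : Fin m, (s (.inr p) / (z - σ (.inr p))) • lt (.inr p) +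
    (src.map fun i => (z - i.1)⁻¹ • i.2).sum

/-- Arguments of the delta functions: `λ̃_i - s_i λ̃(σ_i)` and `λ_p - s_p λ(σ_p)`. -/
def deltaArg {k m : ℕ} (σ s : Leg k m → ℂ) (lam lt : Leg k m → Spinor)
    (src : List (ℂ × Spinor)) : Leg k m → Spinor
  | .inl i => lt (.inl i) - s (.inl i) • ltField σ s lt src (σ (.inl i))
  | .inr p => lam (.inr p) - s (.inr p) • lamField σ s lam (σ (.inr p))

/-- Grassmann algebra of the supermomenta `η_a^r`. -/
abbrev GrassEta (𝒩 k m : ℕ) := ExteriorAlgebra ℂ (Fin 𝒩 × Leg k m → ℂ)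

/-- `∏ₚ ∏ᵣ (η_p^r - s_p χ^r(σ_p))` with `χ^r(z) = ∑ᵢ s_i η_i^r / (z - σ_i)`. -/
def superDelta (𝒩 : ℕ) {k m : ℕ} (σ s : Leg k m → ℂ) : GrassEta 𝒩 k m :=
  (List.ofFn fun p : Fin m => (List.ofFn fun r : Fin 𝒩 =>
    ExteriorAlgebra.ι ℂ (Pi.single (r, (.inr p : Leg k m)) (1 : ℂ) -
      ∑ i : Fin k, (s (.inr p) * (s (.inl i) / (σ (.inr p) - σ (.inl i)))) •
        Pi.single (r, (.inl i : Leg k m)) (1 : ℂ))).prod).prod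

/-- Correlator of the factors `d_v + [a_v ρ(z_v)] [b_v ρ̃(z_v)]` in a free fermion system, with
at each site no contraction of `ρ` and `ρ̃` of that site. -/
def rhoCorr {V : Type} [Fintype V] [DecidableEq V] (d : V → ℂ) (a b : V → Spinor) (z : V → ℂ) :
    ℂ :=
  (Matrix.of fun v w => if v = w then d v else br (a v) (b w) / (z v - z w)).det

/-- The fixing of `GL(2)` and the choice of integration variables.  The variables are the
punctures and scales of all particles except for three punctures and one scale, which have the
values `value`, and the spinors `λ̃` of the two particles `smear`.  There are as many of them as
delta functions; the order of either is immaterial. -/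
structure Gauge (N k m : ℕ) where
  coord : Fin N ⊕ Fin 4 ≃ (Leg k m ⊕ Leg k m) ⊕ (Fin 2 × Fin 2)
  row : Fin N ≃ Leg k m × Fin 2
  puncture : Fin 3 → Leg k m
  scale : Leg k m
  smear : Fin 2 → Leg k m
  value : Fin 4 → ℂ
  coord_puncture : ∀ j : Fin 3, coord (.inr j.castSucc) = .inl (.inl (puncture j))
  coord_scale : coord (.inr (Fin.last 3)) = .inl (.inr scale)
  smear_injective : Function.Injective smear

namespace Gauge

variable {N k m : ℕ} (G : Gauge N k m)

/-- The punctures `σ_a`. -/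
def sig (x : Fin N → ℂ) (a : Leg k m) : ℂ := Sum.elim x G.value (G.coord.symm (.inl (.inl a)))

/-- The scales `s_a`. -/
def scl (x : Fin N → ℂ) (a : Leg k m) : ℂ := Sum.elim x G.value (G.coord.symm (.inl (.inr a)))

/-- The spinors `λ̃_a`: integration variables for the two particles `smear`, and `lt₀` else. -/
def tilde (lt₀ : Leg k m → Spinor) (x : Fin N → ℂ) : Leg k m → Spinor :=
  Function.update
    (Function.update lt₀ (G.smear 0) fun α => Sum.elim x G.value (G.coord.symm (.inr (0, α))))
    (G.smear 1) fun α => Sum.elim x G.value (G.coord.symm (.inr (1, α)))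

/-- The equations imposed by the delta functions. -/
def equations (lam lt₀ : Leg k m → Spinor) (x : Fin N → ℂ) : Fin N → ℂ :=
  fun j => deltaArg (G.sig x) (G.scl x) lam (G.tilde lt₀ x) [] (G.row j).1 (G.row j).2

/-- Distinct punctures and nonzero scales. -/
def domain (x : Fin N → ℂ) : Prop := Function.Injective (G.sig x) ∧ ∀ a, G.scl x a ≠ 0

/-- Faddeev-Popov factor of the fixing of `GL(2)`. -/
def ghost (σ s : Leg k m → ℂ) : ℂ :=
  (σ (G.puncture 0) - σ (G.puncture 1)) * (σ (G.puncture 1) - σ (G.puncture 2)) *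
    (σ (G.puncture 2) - σ (G.puncture 0)) * s G.scale

end Gauge

/-- The factors common to gluons and gravitons: ghosts, bosonic and fermionic delta functions.
`ell` extracts a component of the dependence on the supermomenta. -/
def baseKernel {N k m 𝒩 : ℕ} (G : Gauge N k m) (ell : GrassEta 𝒩 k m →ₗ[ℂ] ℂ)
    (lam : Leg k m → Spinor) (src : List (ℂ × Spinor)) (σ s : Leg k m → ℂ)
    (lt : Leg k m → Spinor) : ℂ :=
  G.ghost σ s * (∏ a, ∏ α, (deltaArg σ s lam lt src a α)⁻¹) * ell (superDelta 𝒩 σ s)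

/-- Correlator of gluon vertex operators with measure `ds_a / s_a`, before integration. -/
def gluonKernel {N k m n 𝒩 : ℕ} (G : Gauge N k m) (ell : GrassEta 𝒩 k m →ₗ[ℂ] ℂ)
    (col : Fin (n + 1) ≃ Leg k m) (lam : Leg k m → Spinor) (σ s : Leg k m → ℂ)
    (lt : Leg k m → Spinor) : ℂ :=
  baseKernel G ell lam [] σ s lt * (∏ a, (s a)⁻¹) * ptHard col σ

/-- Correlator of graviton vertex operators with measure `ds_a / s_a²` (integrated) and
`ds_a / s_a³` (unintegrated, for one particle `i₀` and one particle `p₀`), before integration. -/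
def gravitonKernel {N k m 𝒩 : ℕ} (G : Gauge N k m) (ell : GrassEta 𝒩 k m →ₗ[ℂ] ℂ)
    (i₀ : Fin k) (p₀ : Fin m) (lam : Leg k m → Spinor) (σ s : Leg k m → ℂ)
    (lt : Leg k m → Spinor) : ℂ :=
  baseKernel G ell lam [] σ s lt * (∏ a, (s a ^ 2)⁻¹) * (s (.inl i₀) * s (.inr p₀))⁻¹ *
    rhoCorr (V := {i : Fin k // i ≠ i₀})
      (fun i => br (lamField σ s lam (σ (.inl i))) (lam (.inl i)))
      (fun i => s (.inl i) • lam (.inl i)) (fun i => lam (.inl i)) (fun i => σ (.inl i)) *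
    rhoCorr (V := {p : Fin m // p ≠ p₀})
      (fun p => br (ltField σ s lt [] (σ (.inr p))) (lt (.inr p)))
      (fun p => s (.inr p) • lt (.inr p)) (fun p => lt (.inr p)) (fun p => σ (.inr p))

/-- Scale `⟨ξ s⟩ / ⟨ξ λ(z)⟩` of the soft particle at `z`, fixed by its delta functions. -/
def softScale {k m : ℕ} (ξ ls : Spinor) (lam : Leg k m → Spinor) (σ s : Leg k m → ℂ) (z : ℂ) :
    ℂ :=
  br ξ ls / br ξ (lamField σ s lam z)

/-- `gluonKernel` with an insertion of the soft vertex operator `softGluonTw` at `z`. -/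
def gluonSoftKernel {N k m n 𝒩 : ℕ} (G : Gauge N k m) (ell : GrassEta 𝒩 k m →ₗ[ℂ] ℂ)
    (col : Fin (n + 1) ≃ Leg k m) (lam : Leg k m → Spinor) (ξ ls lts : Spinor) (τ z : ℂ)
    (σ s : Leg k m → ℂ) (lt : Leg k m → Spinor) : ℂ :=
  baseKernel G ell lam [(z, (τ * softScale ξ ls lam σ s z) • lts)] σ s lt *
    (∏ a, (s a)⁻¹) * ptSoft col σ z *
    (br ξ (lamField σ s lam z) / (br ξ ls * br ls (lamField σ s lam z)))

/-- `gravitonKernel` with an insertion at `z` of the soft vertex operator `softGravitonTw`,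
extended to `ρ` and `ρ̃`; the terms of the latter with undotted components of `ρ` do not contribute,
as these components can not be saturated. -/
def gravitonSoftKernel {N k m 𝒩 : ℕ} (G : Gauge N k m) (ell : GrassEta 𝒩 k m →ₗ[ℂ] ℂ)
    (i₀ : Fin k) (p₀ : Fin m) (lam : Leg k m → Spinor) (ξ ls lts : Spinor) (τ z : ℂ)
    (σ s : Leg k m → ℂ) (lt : Leg k m → Spinor) : ℂ :=
  baseKernel G ell lam [(z, (τ * softScale ξ ls lam σ s z) • lts)] σ s lt *
    (∏ a, (s a ^ 2)⁻¹) * (s (.inl i₀) * s (.inr p₀))⁻¹ *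
    rhoCorr (V := {i : Fin k // i ≠ i₀})
      (fun i => br (lamField σ s lam (σ (.inl i))) (lam (.inl i)))
      (fun i => s (.inl i) • lam (.inl i)) (fun i => lam (.inl i)) (fun i => σ (.inl i)) *
    rhoCorr (V := Option {p : Fin m // p ≠ p₀})
      (fun v => v.elim (br lts (ltField σ s lt [] z)) fun p =>
        br (ltField σ s lt [(z, (τ * softScale ξ ls lam σ s z) • lts)] (σ (.inr p)))
          (lt (.inr p)))
      (fun v => v.elim (-(τ * softScale ξ ls lam σ s z) • lts) fun p => s (.inr p) • lt (.inr p))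
      (fun v => v.elim lts fun p => lt (.inr p))
      (fun v => v.elim z fun p => σ (.inr p)) *
    (br ξ (lamField σ s lam z) ^ 2 / (br ξ ls ^ 2 * br ls (lamField σ s lam z)))

/-- The pairing of the test function `Φ` of the spinors `λ̃` with the correlator with integrand
`K`, whose spinors `λ̃` are translated by `shift`. -/
def smeared {N k m : ℕ} (G : Gauge N k m) (S : Finset (Fin N → ℂ))
    (φ : (Fin N → ℂ) → (Fin N → ℂ) → (Fin N → ℂ)) (r : ℝ) (lt₀ : Leg k m → Spinor)
    (K : (Leg k m → ℂ) → (Leg k m → ℂ) → (Leg k m → Spinor) → ℂ)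
    (Φ : (Leg k m → Spinor) → ℂ) (shift : Leg k m → Spinor) : ℂ :=
  contourSum S φ r fun x =>
    Φ (G.tilde lt₀ x) * K (G.sig x) (G.scl x) (G.tilde lt₀ x + shift)

/-- The pairing of `Φ` with the correlator with an insertion of the term of order `l` of a soft
vertex operator, integrated over circles around all the punctures. -/
def smearedSoft {N k m : ℕ} (G : Gauge N k m) (S : Finset (Fin N → ℂ))
    (φ : (Fin N → ℂ) → (Fin N → ℂ) → (Fin N → ℂ)) (r : ℝ) (lt₀ : Leg k m → Spinor)
    (K : ℂ → ℂ → (Leg k m → ℂ) → (Leg k m → ℂ) → (Leg k m → Spinor) → ℂ)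
    (Φ : (Leg k m → Spinor) → ℂ) (l : ℕ) : ℂ :=
  contourSum S φ r fun x =>
    Φ (G.tilde lt₀ x) * ∑ a : Leg k m, residueAt (fun z => softTerm l fun τ =>
      K τ z (G.sig x) (G.scl x) (G.tilde lt₀ x)) (G.sig x a)

/-- The pairing of `Φ` with `c (λ̃_s·∂/∂λ̃_a)^l` applied to the correlator with integrand `K`,
where the coefficient `c` is a function of the spinors `λ̃`. -/
def smearedDeriv {N k m : ℕ} (G : Gauge N k m) (S : Finset (Fin N → ℂ))
    (φ : (Fin N → ℂ) → (Fin N → ℂ) → (Fin N → ℂ)) (r : ℝ) (lt₀ : Leg k m → Spinor)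
    (K : (Leg k m → ℂ) → (Leg k m → ℂ) → (Leg k m → Spinor) → ℂ)
    (Φ : (Leg k m → Spinor) → ℂ) (c : (Leg k m → Spinor) → ℂ) (lts : Spinor) (a : Leg k m)
    (l : ℕ) : ℂ :=
  iteratedDeriv l (fun t : ℂ =>
    smeared G S φ r lt₀ K (fun e => c e * Φ e) (Pi.single a (t • lts))) 0

end Ambi

end

open Ambi Complex Filter
open scoped Topology

noncomputable section

namespace Ambi

open Complex Filter Finset
open scoped Topology

-- ## Holomorphic families and differentiation under the integral

section Families

open MeasureTheory Metric

/-! Any dimension. The Ward identities reduce to an identity of integrands. Inserting at `z` the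
first-order rotation operator built from `p(z)` does three things to the hard integrand: it shifts
the zero-mode phase, shifts every `p(σ_b)` by a pole at `z`, and adds one fermion bilinear. By
partial fractions these effects together are the derivative of the hard integrand along the
infinitesimal Lorentz map `v ↦ (ε·v) s - (s·v) ε`, applied to the momentum and polarisations of each
particle `a` with weight `1 / (z - σ_a)` (`hasDerivAt_kernel_boost`; its fermionic half is
`hasDerivAt_wick`). Wick's theorem omits contractions at coincident points, and this leaves double
poles; they are exactly the self-terms that partial fractions produce in `p`
(`wickProdWith_contractPairs`, `mdot_poleShift_lorentz`).

The insertion is thus a function of `z` times a sum of simple poles whose residues are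
single-particle Lorentz derivatives. For gravitons the function is `ε·p / s·p`, regular at `σ_a`
with value `ε·k_a / s·k_a`. For gluons it is `1 / s·p` times the colour factor `1/(z - σ_1) - 1/(z -
σ_n)`. Residues give the soft factors (`hasResidue_quotient_mul`). The full vertex operator differs
from the rotation by a product of pole sums whose residues cancel in total, by momentum conservation
for gravitons and by opposite colour charges for gluons (`softTerm_softVertex`,
`exists_hasResidue_product`). Derivatives pass under the contour integral because the integrand is
jointly holomorphic and the delta function denominators do not vanish on the tori
(`HolomorphicOnTori.hasFDerivAt`).

Four dimensions. A soft insertion at `z` is a source for `λ̃`. At the puncture of `a` its residue is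
a coefficient times a Taylor coefficient of the hard integrand with `λ̃_a` translated by `t λ̃_s`
(`residueAt_gluonSoft`, `residueAt_gravitonSoft`). Power counting in `z - σ_a` makes the pole simple
at a dual twistor operator. At a twistor operator the graviton matrix has a rank-one pole, which row
and column operations remove, leaving the hard matrix with the translated spinor (`det_resolved`,
`minor_eq_hardMatrix`).

The coefficient involves `s_p λ(σ_p)` or `s_i λ̃(σ_i)` rather than `λ_p` or `λ̃_i`. The differences
are combinations of delta function denominators. Each such term cancels one denominator, so its
integral vanishes by Cauchy's theorem (`contourSum_erase_eq_zero`, `contourSum_softTerm`, assembled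
in `smearedSoft_eq`). The replacement is compatible with the translation by `t λ̃_s` because `[λ̃_s
λ̃_s] = 0`.

Generators are Taylor coefficients of explicit exponentials. In four dimensions all of them have the
form `A u ^ l / l!` times the same linear function of `W`. The relation `2 h₀ h₂ = h₁²` is then `2 A
(A u² / 2) = (A u)²` together with Leibniz' rule, the term with four fermions vanishing by
nilpotence. -/

theorem continuous_slice {A B C : Type*} [TopologicalSpace A] [TopologicalSpace B]
    [TopologicalSpace C] {U : Set A} {g : A × B → C} (hg : ContinuousOn g (U ×ˢ Set.univ)) {a : A}
    (ha : a ∈ U) : Continuous fun b => g (a, b) := by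
  rw [← continuousOn_univ]
  exact hg.comp (by fun_prop) fun x _ => ⟨ha, trivial⟩

variable {E F X : Type*} [NormedAddCommGroup E] [NormedSpace ℂ E] [FiniteDimensional ℂ E]
  [NormedAddCommGroup F] [NormedSpace ℂ F] [TopologicalSpace X]

/-- The derivative of a continuous family of holomorphic maps is a continuous family. -/
theorem continuousOn_fderiv_family {U : Set E} (hU : IsOpen U) {f : E → X → F}
    (hc : ContinuousOn (Function.uncurry f) (U ×ˢ Set.univ))
    (hd : ∀ x, DifferentiableOn ℂ (fun κ => f κ x) U) :
    ContinuousOn (fun p : E × X => fderiv ℂ (fun κ => f κ p.2) p.1) (U ×ˢ Set.univ) := by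
  have : ProperSpace E := FiniteDimensional.proper ℂ E
  rintro ⟨κ₀, x₀⟩ ⟨hκ, -⟩
  simp only at hκ
  refine ContinuousAt.continuousWithinAt ?_
  obtain ⟨R, hR, hRU⟩ : ∃ R > 0, closedBall κ₀ (2 * R) ⊆ U := by
    obtain ⟨R, hR, h⟩ := Metric.nhds_basis_closedBall.mem_iff.1 (hU.mem_nhds hκ)
    exact ⟨R / 2, by positivity, by rwa [mul_div_cancel₀ R two_ne_zero]⟩
  have hmem : ∀ κ ∈ ball κ₀ R, ∀ v ∈ closedBall (0 : E) R, κ + v ∈ U := by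
    intro κ hκ v hv
    apply hRU
    rw [mem_closedBall, dist_eq_norm]
    rw [mem_ball, dist_eq_norm] at hκ
    rw [mem_closedBall, dist_zero_right] at hv
    calc ‖κ + v - κ₀‖ = ‖(κ - κ₀) + v‖ := by congr 1; abel
      _ ≤ ‖κ - κ₀‖ + ‖v‖ := norm_add_le _ _
      _ ≤ 2 * R := by linarith
  rw [Metric.continuousAt_iff']
  intro ε hε
  -- Compactness of the ball makes the increment uniformly small. Two values below `ε * R / 4`,
  -- divided by the radius `R` in Cauchy's estimate, bound the derivative by `ε / 2`.
  have key : ∀ᶠ p : E × X in 𝓝 (κ₀, x₀), ∀ v ∈ closedBall (0 : E) R,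
      ‖f (p.1 + v) p.2 - f (κ₀ + v) x₀‖ < ε * R / 4 := by
    refine (isCompact_closedBall (0 : E) R).eventually_forall_of_forall_eventually ?_
    intro v hv
    have h1 : ContinuousAt (fun z : (E × X) × E => f (z.1.1 + z.2) z.1.2) ((κ₀, x₀), v) := by
      have : ContinuousAt (Function.uncurry f) (κ₀ + v, x₀) :=
        hc.continuousAt ((hU.prod isOpen_univ).mem_nhds
          ⟨hmem κ₀ (mem_ball_self hR) v hv, trivial⟩)
      exact ContinuousAt.comp (g := Function.uncurry f)
        (f := fun z : (E × X) × E => (z.1.1 + z.2, z.1.2)) this (by fun_prop)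
    have h2 : ContinuousAt (fun z : (E × X) × E => f (κ₀ + z.2) x₀) ((κ₀, x₀), v) := by
      have : ContinuousAt (Function.uncurry f) (κ₀ + v, x₀) :=
        hc.continuousAt ((hU.prod isOpen_univ).mem_nhds
          ⟨hmem κ₀ (mem_ball_self hR) v hv, trivial⟩)
      exact ContinuousAt.comp (g := Function.uncurry f)
        (f := fun z : (E × X) × E => (κ₀ + z.2, x₀)) this (by fun_prop)
    have h3 := (h1.sub h2).norm
    have h4 : (‖f (κ₀ + v) x₀ - f (κ₀ + v) x₀‖ : ℝ) < ε * R / 4 := by simp; positivity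
    exact h3.eventually_lt_const h4
  have hball : ∀ᶠ p : E × X in 𝓝 (κ₀, x₀), p.1 ∈ ball κ₀ R :=
    continuousAt_fst.eventually (ball_mem_nhds κ₀ hR)
  filter_upwards [key, hball] with p hp hpb
  set h : E → F := fun v => f (p.1 + v) p.2 - f (κ₀ + v) x₀ with hh
  have hd1 : DifferentiableOn ℂ h (ball 0 R) := by
    refine DifferentiableOn.sub ?_ ?_
    · exact (hd p.2).comp (by fun_prop) fun v hv => hmem _ hpb v (ball_subset_closedBall hv)
    · exact (hd x₀).comp (by fun_prop)
        fun v hv => hmem _ (mem_ball_self hR) v (ball_subset_closedBall hv)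
  have hmaps : Set.MapsTo h (ball 0 R) (closedBall (h 0) (ε * R / 2)) := by
    intro v hv
    rw [mem_closedBall, dist_eq_norm]
    have h1 := hp v (ball_subset_closedBall hv)
    have h2 := hp 0 (mem_closedBall_self hR.le)
    calc ‖h v - h 0‖ ≤ ‖h v‖ + ‖h 0‖ := norm_sub_le _ _
      _ ≤ ε * R / 2 := by simp only [hh]; linarith
  have hb := norm_fderiv_le_div_of_mapsTo_ball hd1 hmaps hR
  have hda : ∀ (κ : E) (x : X), κ ∈ U →
      fderiv ℂ (fun v => f (κ + v) x) 0 = fderiv ℂ (fun κ => f κ x) κ := by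
    intro κ x _
    have := fderiv_comp_add_left (𝕜 := ℂ) (f := fun κ => f κ x) (x := 0) κ
    simpa using this
  have hdiff : fderiv ℂ h 0 = fderiv ℂ (fun κ => f κ p.2) p.1 - fderiv ℂ (fun κ => f κ x₀) κ₀ := by
    have hpU : p.1 ∈ U := by simpa using hmem _ hpb 0 (mem_closedBall_self hR.le)
    rw [← hda _ _ hpU, ← hda _ _ hκ]
    refine fderiv_fun_sub ?_ ?_
    · have : DifferentiableAt ℂ (fun κ => f κ p.2) (p.1 + 0) := by
        rw [add_zero]; exact (hd p.2).differentiableAt (hU.mem_nhds hpU)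
      exact DifferentiableAt.comp (g := fun κ => f κ p.2) (0 : E) this (by fun_prop)
    · have : DifferentiableAt ℂ (fun κ => f κ x₀) (κ₀ + 0) := by
        rw [add_zero]; exact (hd x₀).differentiableAt (hU.mem_nhds hκ)
      exact DifferentiableAt.comp (g := fun κ => f κ x₀) (0 : E) this (by fun_prop)
  rw [dist_eq_norm, ← hdiff]
  refine hb.trans_lt ?_
  rw [div_lt_iff₀ hR]
  nlinarith [mul_pos hε hR]

variable [MeasurableSpace X] [OpensMeasurableSpace X] [T2Space X] {μ : Measure X}
  [IsFiniteMeasureOnCompacts μ]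

/-- Differentiation under the integral sign for holomorphic families. -/
theorem hasFDerivAt_integral_family [CompleteSpace F] {U : Set E} (hU : IsOpen U) {f : E → X → F}
    (hc : ContinuousOn (Function.uncurry f) (U ×ˢ Set.univ))
    (hd : ∀ x, DifferentiableOn ℂ (fun κ => f κ x) U) {K : Set X} (hK : IsCompact K)
    {κ₀ : E} (hκ : κ₀ ∈ U) :
    IntegrableOn (fun x => fderiv ℂ (fun κ => f κ x) κ₀) K μ ∧
    HasFDerivAt (fun κ => ∫ x in K, f κ x ∂μ) (∫ x in K, fderiv ℂ (fun κ => f κ x) κ₀ ∂μ) κ₀ := by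
  have hc' := continuousOn_fderiv_family hU hc hd
  -- The dominating function is the norm of the derivative at `κ₀` plus one; compactness of `K`
  -- makes the bound uniform near `κ₀`.
  have key : ∀ᶠ κ in 𝓝 κ₀, ∀ x ∈ K,
      ‖fderiv ℂ (fun κ => f κ x) κ‖ < ‖fderiv ℂ (fun κ => f κ x) κ₀‖ + 1 := by
    refine hK.eventually_forall_of_forall_eventually fun x _ => ?_
    have h1 : ContinuousAt (fun p : E × X => fderiv ℂ (fun κ => f κ p.2) p.1) (κ₀, x) :=
      hc'.continuousAt ((hU.prod isOpen_univ).mem_nhds ⟨hκ, trivial⟩)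
    have h2 : ContinuousAt (fun p : E × X => fderiv ℂ (fun κ => f κ p.2) κ₀) (κ₀, x) :=
      (continuous_slice hc' hκ).continuousAt.comp continuousAt_snd
    have h3 := h1.norm.sub h2.norm
    have h4 : ‖fderiv ℂ (fun κ => f κ x) κ₀‖ - ‖fderiv ℂ (fun κ => f κ x) κ₀‖ < 1 := by simp
    filter_upwards [h3.eventually_lt_const h4] with p hp
    simp only [Pi.sub_apply] at hp
    linarith
  have hint : IntegrableOn (fun x => fderiv ℂ (fun κ => f κ x) κ₀) K μ :=
    (continuous_slice hc' hκ).continuousOn.integrableOn_compact hK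
  refine ⟨hint, ?_⟩
  refine hasFDerivAt_integral_of_dominated_of_fderiv_le
    (F' := fun κ x => fderiv ℂ (fun κ => f κ x) κ)
    (bound := fun x => ‖fderiv ℂ (fun κ => f κ x) κ₀‖ + 1)
    (Filter.inter_mem key (hU.mem_nhds hκ)) ?_ ?_ hint.aestronglyMeasurable ?_ ?_ ?_
  · filter_upwards [hU.mem_nhds hκ] with κ hκ
    exact ((continuous_slice hc hκ).continuousOn.integrableOn_compact hK).aestronglyMeasurable
  · exact (continuous_slice hc hκ).continuousOn.integrableOn_compact hK
  · filter_upwards [ae_restrict_mem hK.measurableSet] with x hx κ hκ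
    exact (hκ.1 x hx).le
  · exact hint.norm.add (integrableOn_const hK.measure_lt_top.ne)
  · filter_upwards with x κ hκ
    exact ((hd x).differentiableAt (hU.mem_nhds hκ.2)).hasFDerivAt

end Families

section Holomorphic

open MeasureTheory Metric

variable {E F : Type*} [NormedAddCommGroup E] [NormedSpace ℂ E] [FiniteDimensional ℂ E]
  [NormedAddCommGroup F] [NormedSpace ℂ F] [CompleteSpace F]

/-- The derivative of a holomorphic map in several variables is holomorphic. -/
theorem differentiableAt_fderiv_apply {f : E → F} {κ₀ : E}
    (hf : ∀ᶠ κ in 𝓝 κ₀, DifferentiableAt ℂ f κ) (v : E) :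
    DifferentiableAt ℂ (fun κ => fderiv ℂ f κ v) κ₀ := by
  obtain ⟨U, hUsub, hU, hκ⟩ := _root_.mem_nhds_iff.1 hf
  obtain ⟨R, hR, hRU⟩ := Metric.isOpen_iff.1 hU κ₀ hκ
  -- Chosen so that `z • v` has norm at most `R / 2` for `|z| ≤ r`; adding one covers `v = 0`.
  set r : ℝ := R / (2 * (‖v‖ + 1)) with hr
  have hv1 : 0 < ‖v‖ + 1 := by positivity
  have hr0 : 0 < r := by positivity
  have hmem : ∀ κ ∈ ball κ₀ (R / 2), ∀ z ∈ closedBall (0 : ℂ) r, κ + z • v ∈ U := by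
    intro κ hκ z hz
    apply hRU
    rw [mem_ball, dist_eq_norm] at *
    rw [mem_closedBall, dist_zero_right] at hz
    have h1 : ‖z • v‖ ≤ R / 2 := by
      rw [norm_smul]
      calc ‖z‖ * ‖v‖ ≤ r * (‖v‖ + 1) := by
            apply mul_le_mul hz (by linarith) (norm_nonneg _) hr0.le
        _ = R / 2 := by rw [hr]; field_simp
    calc ‖κ + z • v - κ₀‖ = ‖(κ - κ₀) + z • v‖ := by congr 1; abel
      _ ≤ ‖κ - κ₀‖ + ‖z • v‖ := norm_add_le _ _
      _ < R := by linarith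
  have hUd : ∀ κ ∈ U, DifferentiableAt ℂ f κ := fun κ h => hUsub h
  -- Cauchy's formula on the complex line in the direction `v` expresses the derivative through
  -- values of `f`, so its differentiability follows from differentiation under the integral.
  have hcauchy : ∀ κ ∈ ball κ₀ (R / 2), fderiv ℂ f κ v =
      (2 * (Real.pi : ℂ) * I)⁻¹ • ∮ z in C(0, r), (1 / (z - 0) ^ 2) • f (κ + z • v) := by
    intro κ hκ
    have hdc : DifferentiableOn ℂ (fun z : ℂ => f (κ + z • v)) (closedBall 0 r) := fun z hz =>
      ((hUd _ (hmem κ hκ z hz)).comp z (by fun_prop)).differentiableWithinAt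
    have h1 : deriv (fun z : ℂ => f (κ + z • v)) 0 = fderiv ℂ f κ v := by
      have h2 : HasFDerivAt f (fderiv ℂ f κ) (κ + (0 : ℂ) • v) := by
        rw [zero_smul, add_zero]
        have := hmem κ hκ 0 (mem_closedBall_self hr0.le)
        rw [zero_smul, add_zero] at this
        exact (hUd _ this).hasFDerivAt
      have h3 : HasDerivAt (fun z : ℂ => κ + z • v) v 0 := by
        simpa using ((hasDerivAt_id (0 : ℂ)).smul_const v).const_add κ
      exact (h2.comp_hasDerivAt (0 : ℂ) h3).deriv
    rw [← h1, (hdc.mono closure_ball_subset_closedBall).diffContOnCl.deriv_eq_smul_circleIntegral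
      hr0, inv_smul_smul₀ Complex.two_pi_I_ne_zero]
  have hint : DifferentiableAt ℂ (fun κ => ∫ θ in Set.Icc 0 (2 * Real.pi),
      deriv (circleMap 0 r) θ • ((1 / (circleMap 0 r θ - 0) ^ 2) • f (κ + circleMap 0 r θ • v)))
      κ₀ := by
    have hcm : ∀ θ, circleMap 0 r θ ∈ closedBall (0 : ℂ) r := fun θ =>
      circleMap_mem_closedBall 0 hr0.le θ
    have hcm0 : ∀ θ, circleMap 0 r θ - 0 ≠ 0 := fun θ => by
      rw [sub_zero]; exact circleMap_ne_center hr0.ne'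
    refine (hasFDerivAt_integral_family (U := ball κ₀ (R / 2)) isOpen_ball
      (f := fun κ θ => deriv (circleMap 0 r) θ •
        ((1 / (circleMap 0 r θ - 0) ^ 2) • f (κ + circleMap 0 r θ • v))) ?_ ?_ isCompact_Icc
      (mem_ball_self (by positivity))).2.differentiableAt
    · rintro ⟨κ, θ⟩ ⟨hκ, -⟩
      refine ContinuousAt.continuousWithinAt ?_
      have h1 : ContinuousAt (fun p : E × ℝ => f (p.1 + circleMap 0 r p.2 • v)) (κ, θ) :=
        ContinuousAt.comp (g := f) (f := fun p : E × ℝ => p.1 + circleMap 0 r p.2 • v)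
          (hUd _ (hmem κ hκ _ (hcm θ))).continuousAt (by fun_prop)
      simp only [deriv_circleMap]
      have h2 : ContinuousAt (fun p : E × ℝ => 1 / (circleMap 0 r p.2 - 0) ^ 2) (κ, θ) :=
        continuousAt_const.div (by fun_prop) (pow_ne_zero 2 (hcm0 θ))
      exact ContinuousAt.smul (by fun_prop) (h2.smul h1)
    · intro θ κ hκ
      refine DifferentiableAt.differentiableWithinAt ?_
      have h1 : DifferentiableAt ℂ (fun κ => f (κ + circleMap 0 r θ • v)) κ :=
        (hUd _ (hmem κ hκ _ (hcm θ))).comp κ (by fun_prop)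
      exact (h1.const_smul _).const_smul _
  have : (fun κ => fderiv ℂ f κ v) =ᶠ[𝓝 κ₀] fun κ => (2 * (Real.pi : ℂ) * I)⁻¹ •
      ∫ θ in Set.Icc 0 (2 * Real.pi), deriv (circleMap 0 r) θ •
        ((1 / (circleMap 0 r θ - 0) ^ 2) • f (κ + circleMap 0 r θ • v)) := by
    filter_upwards [ball_mem_nhds κ₀ (half_pos hR)] with κ hκ
    rw [hcauchy κ hκ, circleIntegral_def_Icc]
  exact (hint.const_smul _).congr_of_eventuallyEq this

theorem differentiableAt_prod {ι E : Type*} [NormedAddCommGroup E] [NormedSpace ℂ E]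
    {s : Finset ι} {f : ι → E → ℂ} {x : E} (h : ∀ i ∈ s, DifferentiableAt ℂ (f i) x) :
    DifferentiableAt ℂ (fun y => ∏ i ∈ s, f i y) x := by
  classical
  exact (HasFDerivAt.finsetProd fun i hi => (h i hi).hasFDerivAt).differentiableAt

/-- The Jacobian of a holomorphic map is holomorphic. -/
theorem differentiableAt_det_fderiv {n : ℕ} {f : (Fin n → ℂ) → (Fin n → ℂ)} {y₀ : Fin n → ℂ}
    (hf : ∀ᶠ y in 𝓝 y₀, DifferentiableAt ℂ f y) :
    DifferentiableAt ℂ (fun y => (fderiv ℂ f y).det) y₀ := by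
  have h1 : ∀ y, (fderiv ℂ f y).det =
      (Matrix.of fun i j => fderiv ℂ f y (Pi.single j 1) i : Matrix (Fin n) (Fin n) ℂ).det := by
    intro y
    rw [ContinuousLinearMap.det, ← LinearMap.det_toMatrix']
    congr 1
  simp_rw [h1, Matrix.det_apply]
  refine DifferentiableAt.fun_sum fun σ _ => DifferentiableAt.const_smul ?_ _
  refine differentiableAt_prod fun i _ => ?_
  simp only [Matrix.of_apply]
  exact differentiableAt_pi.1 (differentiableAt_fderiv_apply hf _) _

end Holomorphic

-- ## Contour sums

section ContourSum

open MeasureTheory Metric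

variable {n : ℕ} {S : Finset (Fin n → ℂ)} {φ : (Fin n → ℂ) → (Fin n → ℂ) → (Fin n → ℂ)} {r : ℝ}

theorem norm_torusMap_apply (hr : 0 ≤ r) (θ : Fin n → ℝ) (i : Fin n) :
    ‖torusMap 0 (fun _ => r) θ i‖ = r := by
  simp [torusMap, Complex.norm_exp_ofReal_mul_I, abs_of_nonneg hr]

/-- Only points with all `|y_i| = r` are visited. This is how identities valid away from the zeros
of the delta function arguments get used under the integral. -/
theorem contourSum_congr (hr : 0 ≤ r) {f g : (Fin n → ℂ) → ℂ}
    (h : ∀ u ∈ S, ∀ y : Fin n → ℂ, (∀ i, ‖y i‖ = r) → f (φ u y) = g (φ u y)) :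
    contourSum S φ r f = contourSum S φ r g := by
  unfold contourSum torusIntegral
  refine Finset.sum_congr rfl fun u hu => ?_
  congr 2
  ext θ
  simp only
  rw [h u hu _ (norm_torusMap_apply hr θ)]

/-- The integrand of a contour sum is continuous along the tori. -/
def ContinuousOnTori (S : Finset (Fin n → ℂ)) (φ : (Fin n → ℂ) → (Fin n → ℂ) → (Fin n → ℂ))
    (r : ℝ) (f : (Fin n → ℂ) → ℂ) : Prop :=
  ∀ u ∈ S, Continuous fun θ : Fin n → ℝ => f (φ u (torusMap 0 (fun _ => r) θ)) *
    (fderiv ℂ (φ u) (torusMap 0 (fun _ => r) θ)).det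

theorem ContinuousOnTori.torusIntegrable {f : (Fin n → ℂ) → ℂ} (hf : ContinuousOnTori S φ r f)
    {u : Fin n → ℂ} (hu : u ∈ S) :
    TorusIntegrable (fun y => f (φ u y) * (fderiv ℂ (φ u) y).det) 0 (fun _ => r) :=
  (hf u hu).continuousOn.integrableOn_compact isCompact_Icc

theorem ContinuousOnTori.const_mul {f : (Fin n → ℂ) → ℂ} (hf : ContinuousOnTori S φ r f) (c : ℂ) :
    ContinuousOnTori S φ r fun x => c * f x := fun u hu => by
  simpa only [mul_assoc] using (hf u hu).const_mul c

theorem ContinuousOnTori.sum {ι : Type*} {s : Finset ι} {f : ι → (Fin n → ℂ) → ℂ}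
    (hf : ∀ i ∈ s, ContinuousOnTori S φ r (f i)) :
    ContinuousOnTori S φ r fun x => ∑ i ∈ s, f i x := fun u hu => by
  simp only [Finset.sum_mul]
  exact continuous_finsetSum _ fun i hi => hf i hi u hu

theorem contourSum_add {f g : (Fin n → ℂ) → ℂ} (hf : ContinuousOnTori S φ r f)
    (hg : ContinuousOnTori S φ r g) :
    contourSum S φ r (fun x => f x + g x) = contourSum S φ r f + contourSum S φ r g := by
  unfold contourSum
  rw [← Finset.sum_add_distrib]
  refine Finset.sum_congr rfl fun u hu => ?_
  simp only [add_mul]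
  rw [torusIntegral_add (hf.torusIntegrable hu) (hg.torusIntegrable hu), mul_add]

theorem contourSum_const_mul (c : ℂ) (f : (Fin n → ℂ) → ℂ) :
    contourSum S φ r (fun x => c * f x) = c * contourSum S φ r f := by
  unfold contourSum
  rw [Finset.mul_sum]
  refine Finset.sum_congr rfl fun u _ => ?_
  simp only [mul_assoc]
  rw [torusIntegral_const_mul]
  ring

theorem contourSum_sum {ι : Type*} {s : Finset ι} {f : ι → (Fin n → ℂ) → ℂ}
    (hf : ∀ i ∈ s, ContinuousOnTori S φ r (f i)) :
    contourSum S φ r (fun x => ∑ i ∈ s, f i x) = ∑ i ∈ s, contourSum S φ r (f i) := by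
  classical
  induction s using Finset.induction_on with
  | empty =>
    have := contourSum_const_mul (S := S) (φ := φ) (r := r) 0 (fun _ => 0)
    simpa using this
  | insert a s ha ih =>
    simp only [Finset.sum_insert ha]
    rw [contourSum_add (hf a (Finset.mem_insert_self _ _))
      (ContinuousOnTori.sum fun i hi => hf i (Finset.mem_insert_of_mem hi)),
      ih fun i hi => hf i (Finset.mem_insert_of_mem hi)]

variable {E : Type*} [NormedAddCommGroup E] [NormedSpace ℂ E]

/-- A family of integrands that is continuous along the tori and holomorphic in the parameter. -/
structure HolomorphicOnTori (S : Finset (Fin n → ℂ))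
    (φ : (Fin n → ℂ) → (Fin n → ℂ) → (Fin n → ℂ)) (r : ℝ) (U : Set E)
    (f : E → (Fin n → ℂ) → ℂ) : Prop where
  cont : ∀ u ∈ S, ContinuousOn (Function.uncurry fun (κ : E) (θ : Fin n → ℝ) =>
    f κ (φ u (torusMap 0 (fun _ => r) θ)) * (fderiv ℂ (φ u) (torusMap 0 (fun _ => r) θ)).det)
    (U ×ˢ Set.univ)
  diff : ∀ u ∈ S, ∀ θ : Fin n → ℝ,
    DifferentiableOn ℂ (fun κ => f κ (φ u (torusMap 0 (fun _ => r) θ))) U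

theorem HolomorphicOnTori.continuousOnTori {U : Set E} {f : E → (Fin n → ℂ) → ℂ}
    (h : HolomorphicOnTori S φ r U f) {κ : E} (hκ : κ ∈ U) : ContinuousOnTori S φ r (f κ) :=
  fun u hu => continuous_slice (h.cont u hu) hκ

theorem HolomorphicOnTori.fderiv_mul {U : Set E} (hU : IsOpen U)
    {f : E → (Fin n → ℂ) → ℂ} (h : HolomorphicOnTori S φ r U f) {κ : E} (hκ : κ ∈ U)
    {u : Fin n → ℂ} (hu : u ∈ S) (θ : Fin n → ℝ) (c : ℂ) :
    fderiv ℂ (fun κ => f κ (φ u (torusMap 0 (fun _ => r) θ)) * c) κ =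
      c • fderiv ℂ (fun κ => f κ (φ u (torusMap 0 (fun _ => r) θ))) κ :=
  fderiv_mul_const ((h.diff u hu θ).differentiableAt (hU.mem_nhds hκ)) c

variable [FiniteDimensional ℂ E]

theorem HolomorphicOnTori.continuousOn_fderiv {U : Set E} (hU : IsOpen U)
    {f : E → (Fin n → ℂ) → ℂ} (h : HolomorphicOnTori S φ r U f) (v : E) {u : Fin n → ℂ}
    (hu : u ∈ S) : ContinuousOn (Function.uncurry fun (κ : E) (θ : Fin n → ℝ) =>
      fderiv ℂ (fun κ => f κ (φ u (torusMap 0 (fun _ => r) θ))) κ v *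
        (fderiv ℂ (φ u) (torusMap 0 (fun _ => r) θ)).det) (U ×ˢ Set.univ) := by
  have h1 := continuousOn_fderiv_family hU (h.cont u hu)
    fun θ => (h.diff u hu θ).mul (differentiableOn_const _)
  have h2 := h1.clm_apply (continuousOn_const (c := v))
  refine h2.congr fun p hp => ?_
  simp only [Function.uncurry]
  rw [h.fderiv_mul hU hp.1 hu]
  simp [mul_comm]

/-- Contour sums of holomorphic families may be differentiated under the integral. -/
theorem HolomorphicOnTori.hasFDerivAt {U : Set E} (hU : IsOpen U)
    {f : E → (Fin n → ℂ) → ℂ} (h : HolomorphicOnTori S φ r U f) {κ : E} (hκ : κ ∈ U) :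
    DifferentiableAt ℂ (fun κ => contourSum S φ r (f κ)) κ ∧
    ∀ v, fderiv ℂ (fun κ => contourSum S φ r (f κ)) κ v =
      contourSum S φ r (fun x => fderiv ℂ (fun κ => f κ x) κ v) := by
  set J : (Fin n → ℝ) → ℂ := fun θ => ∏ i, (r : ℂ) * exp (θ i * I) * I with hJ
  have hJc : Continuous J := by rw [hJ]; fun_prop
  have key : ∀ u ∈ S, _ := fun u hu => hasFDerivAt_integral_family (μ := volume) hU
    (f := fun (κ : E) (θ : Fin n → ℝ) => J θ *
      (f κ (φ u (torusMap 0 (fun _ => r) θ)) * (fderiv ℂ (φ u) (torusMap 0 (fun _ => r) θ)).det))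
    ((hJc.comp continuous_snd).continuousOn.mul (h.cont u hu))
    (fun θ => (differentiableOn_const _).mul ((h.diff u hu θ).mul (differentiableOn_const _)))
    (isCompact_Icc (a := (0 : Fin n → ℝ)) (b := fun _ => 2 * Real.pi)) hκ
  have hsum : HasFDerivAt (fun κ => contourSum S φ r (f κ)) _ κ :=
    HasFDerivAt.fun_sum fun u hu => ((key u hu).2.const_mul (((2 * (Real.pi : ℂ) * I)⁻¹) ^ n))
  refine ⟨hsum.differentiableAt, fun v => ?_⟩
  rw [hsum.fderiv]
  simp only [contourSum, torusIntegral, _root_.sum_apply]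
  refine Finset.sum_congr rfl fun u hu => ?_
  rw [_root_.smul_apply, smul_eq_mul,
    ContinuousLinearMap.integral_apply (key u hu).1]
  congr 1
  refine integral_congr_ae (Filter.Eventually.of_forall fun θ => ?_)
  simp only
  rw [fderiv_const_mul (((h.diff u hu θ).differentiableAt (hU.mem_nhds hκ)).mul_const _),
    h.fderiv_mul hU hκ hu]
  simp [hJ, mul_comm]

/-- Stability under differentiation drives the induction on the order of Taylor coefficients. -/
theorem HolomorphicOnTori.deriv {U : Set ℂ} (hU : IsOpen U)
    {f : ℂ → (Fin n → ℂ) → ℂ} (h : HolomorphicOnTori S φ r U f) :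
    HolomorphicOnTori S φ r U fun t x => deriv (fun t => f t x) t where
  cont _ hu := h.continuousOn_fderiv hU 1 hu
  diff u hu θ := (h.diff u hu θ).deriv hU

/-- Taylor coefficients may be taken under the integral. -/
theorem HolomorphicOnTori.iteratedDeriv_eq {U : Set ℂ} (hU : IsOpen U) (l : ℕ) :
    ∀ {f : ℂ → (Fin n → ℂ) → ℂ}, HolomorphicOnTori S φ r U f → ∀ t ∈ U,
    iteratedDeriv l (fun t => contourSum S φ r (f t)) t =
      contourSum S φ r fun x => iteratedDeriv l (fun t => f t x) t := by
  induction l with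
  | zero => intro f _ t _; simp
  | succ l ih =>
    intro f h t ht
    simp only [iteratedDeriv_succ']
    rw [← ih (h.deriv hU) t ht]
    refine Filter.EventuallyEq.iteratedDeriv_eq l ?_
    filter_upwards [hU.mem_nhds ht] with t ht
    exact (h.hasFDerivAt hU ht).2 1

theorem HolomorphicOnTori.analyticAt {U : Set ℂ} (hU : IsOpen U)
    {f : ℂ → (Fin n → ℂ) → ℂ} (h : HolomorphicOnTori S φ r U f) {t : ℂ} (ht : t ∈ U) :
    AnalyticAt ℂ (fun t => contourSum S φ r (f t)) t :=
  DifferentiableOn.analyticAt (s := U)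
    (fun _ ht => (h.hasFDerivAt hU ht).1.differentiableWithinAt) (hU.mem_nhds ht)

/-- Cauchy's theorem in one of the variables of a torus integral. -/
theorem torusIntegral_eq_zero (hr : 0 ≤ r) {f : (Fin n → ℂ) → ℂ} (j : Fin n)
    (hf : ∀ y : Fin n → ℂ, (∀ i, i ≠ j → ‖y i‖ = r) → ‖y j‖ ≤ r → DifferentiableAt ℂ f y) :
    torusIntegral f 0 (fun _ => r) = 0 := by
  obtain ⟨n, rfl⟩ : ∃ m, n = m + 1 := ⟨n - 1, by have := j.pos; omega⟩
  have hTI : TorusIntegrable f 0 (fun _ => r) := by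
    refine Continuous.continuousOn ?_ |>.integrableOn_compact isCompact_Icc
    refine continuous_iff_continuousAt.2 fun θ => ?_
    refine ContinuousAt.comp (g := f) (hf _ (fun i _ => norm_torusMap_apply hr θ i)
      (norm_torusMap_apply hr θ j).le).continuousAt ?_
    have : Continuous (torusMap (0 : Fin n.succ → ℂ) fun _ => r) :=
      continuous_pi fun i => continuous_const.add (continuous_const.mul (Complex.continuous_exp.comp
        ((Complex.continuous_ofReal.comp (continuous_apply i)).mul continuous_const)))
    exact this.continuousAt
  have hem : MeasurePreserving (MeasurableEquiv.piFinSuccAbove (fun _ => ℝ) j).symm :=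
    (volume_preserving_piFinSuccAbove (fun _ : Fin (n + 1) => ℝ) j).symm _
  have heπ : ((MeasurableEquiv.piFinSuccAbove (fun _ => ℝ) j).symm ⁻¹'
      Set.Icc 0 fun _ => 2 * Real.pi) =
      Set.Icc 0 (2 * Real.pi) ×ˢ Set.Icc (0 : Fin n → ℝ) fun _ => 2 * Real.pi :=
    ((Fin.insertNthOrderIso (fun _ => ℝ) j).preimage_Icc _ _).trans (Set.Icc_prod_eq _ _)
  have hint := hTI.function_integrable
  rw [← hem.integrableOn_comp_preimage (MeasurableEquiv.measurableEmbedding _), heπ] at hint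
  -- Fubini with the `j`-th angle innermost: for fixed other angles the inner integral is a circle
  -- integral of a holomorphic function.
  rw [torusIntegral, ← hem.map_eq, setIntegral_map_equiv, heπ, Measure.volume_eq_prod,
    ← setIntegral_prod_swap, setIntegral_prod]
  · refine (setIntegral_congr_fun measurableSet_Icc fun Θ _ => ?_).trans
      (integral_zero _ _)
    have hcirc : (∮ z in C(0, r), f (j.insertNth z (torusMap 0 (fun _ => r) Θ))) = 0 := by
      refine Complex.circleIntegral_eq_zero_of_differentiable_on_off_countable hr
        Set.countable_empty ?_ ?_
      · intro z hz
        refine ContinuousAt.continuousWithinAt ?_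
        refine ContinuousAt.comp (g := f) (hf _ ?_ ?_).continuousAt (by fun_prop)
        · intro i hi
          obtain ⟨k, rfl⟩ := Fin.exists_succAbove_eq hi
          simpa using norm_torusMap_apply hr Θ k
        · simpa using hz
      · intro z hz
        refine DifferentiableAt.comp (g := f) z (hf _ ?_ ?_) ?_
        · intro i hi
          obtain ⟨k, rfl⟩ := Fin.exists_succAbove_eq hi
          simpa using norm_torusMap_apply hr Θ k
        · have := hz.1
          rw [mem_ball, dist_zero_right] at this
          simpa using this.le
        · refine differentiableAt_pi.2 fun i => ?_
          rcases eq_or_ne i j with rfl | hi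
          · simp
          · obtain ⟨k, rfl⟩ := Fin.exists_succAbove_eq hi
            simp
    rw [circleIntegral_def_Icc] at hcirc
    have h2 := congrArg (fun c => (∏ i : Fin n, (r : ℂ) * exp (Θ i * I) * I) * c) hcirc
    simp only [mul_zero] at h2
    rw [← integral_const_mul] at h2
    rw [← h2]
    refine setIntegral_congr_fun measurableSet_Icc fun θ _ => ?_
    simp only [Prod.swap, deriv_circleMap,
      j.prod_univ_succAbove, smul_eq_mul]
    simp only [MeasurableEquiv.piFinSuccAbove_symm_apply, Fin.insertNth_apply_same,
      Fin.insertNth_apply_succAbove, Fin.insertNthEquiv, Equiv.coe_fn_mk, circleMap_zero]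
    have : torusMap 0 (fun _ => r) (j.insertNth θ Θ) =
        j.insertNth ((r : ℂ) * exp (θ * I)) (torusMap 0 (fun _ => r) Θ) := by
      simp [funext_iff, j.forall_iff_succAbove, torusMap]
    rw [this]
    ring
  · have := (MeasureTheory.Measure.measurePreserving_swap (μ := (volume : Measure (Fin n → ℝ)))
      (ν := (volume : Measure ℝ))).integrableOn_comp_preimage
        (MeasurableEquiv.prodComm.measurableEmbedding)
        (f := (fun θ : Fin (n + 1) → ℝ => (∏ i, (r : ℂ) * exp (θ i * I) * I) •
        f (torusMap 0 (fun _ => r) θ)) ∘ (MeasurableEquiv.piFinSuccAbove (fun _ => ℝ) j).symm)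
        (s := Set.Icc 0 (2 * Real.pi) ×ˢ Set.Icc (0 : Fin n → ℝ) fun _ => 2 * Real.pi)
    have h3 := this.2 (by rw [← Measure.volume_eq_prod]; exact hint)
    rw [Set.preimage_swap_prod] at h3
    exact h3

theorem contourSum_eq_zero (hr : 0 ≤ r) {f : (Fin n → ℂ) → ℂ}
    (hf : ∀ u ∈ S, ∃ j, ∀ y : Fin n → ℂ, (∀ i, i ≠ j → ‖y i‖ = r) → ‖y j‖ ≤ r →
      DifferentiableAt ℂ (fun y => f (φ u y) * (fderiv ℂ (φ u) y).det) y) :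
    contourSum S φ r f = 0 := by
  refine Finset.sum_eq_zero fun u hu => ?_
  obtain ⟨j, hj⟩ := hf u hu
  rw [torusIntegral_eq_zero hr j hj, mul_zero]

end ContourSum

-- ## Residues and Taylor coefficients

/-- `f` has at `c` at most a double pole, and residue `R`. -/
def HasResidue (f : ℂ → ℂ) (c R : ℂ) : Prop :=
  ∃ (α : ℂ) (g : ℂ → ℂ), AnalyticAt ℂ g c ∧ g c = R ∧
    ∀ᶠ z in 𝓝[≠] c, f z = α * (1 / (z - c) ^ 2) + (z - c)⁻¹ * g z

theorem HasResidue.residueAt_eq {f : ℂ → ℂ} {c R : ℂ} (h : HasResidue f c R) :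
    residueAt f c = R := by
  obtain ⟨α, g, hg, rfl, hf⟩ := h
  -- For all small `δ` the normalised integral equals the residue exactly, so the limit is that of
  -- an eventually constant function. The double pole integrates to zero on each circle.
  refine Tendsto.limUnder_eq ?_
  refine Tendsto.congr' ?_ tendsto_const_nhds
  obtain ⟨ε, hε, hball⟩ := Metric.eventually_nhds_iff.1
    ((eventually_nhdsWithin_iff.1 hf).and hg.eventually_analyticAt)
  filter_upwards [Ioo_mem_nhdsGT hε] with δ hδ
  have hcirc : ∀ z ∈ Metric.sphere c δ, z ≠ c := by
    rintro z hz rfl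
    have h0 : (0 : ℝ) = δ := by simpa using hz
    exact hδ.1.ne h0
  have h1 : (∮ z in C(c, δ), f z) =
      ∮ z in C(c, δ), (α * (1 / (z - c) ^ 2) + (z - c)⁻¹ • g z) := by
    refine circleIntegral.integral_congr hδ.1.le fun z hz => ?_
    have hd : dist z c < ε := by rw [Metric.mem_sphere.1 hz]; exact hδ.2
    exact (hball hd).1 (hcirc z hz)
  have hgd : DifferentiableOn ℂ g (Metric.closedBall c δ) := fun z hz =>
    (hball (lt_of_le_of_lt (Metric.mem_closedBall.1 hz) hδ.2)).2.differentiableAt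
      |>.differentiableWithinAt
  have hi1 : CircleIntegrable (fun z => α * (1 / (z - c) ^ 2)) c δ := by
    refine ContinuousOn.circleIntegrable hδ.1.le ?_
    refine continuousOn_const.mul (continuousOn_const.div (by fun_prop) fun z hz => ?_)
    exact pow_ne_zero 2 (sub_ne_zero.2 (hcirc z hz))
  have hi2 : CircleIntegrable (fun z => (z - c)⁻¹ • g z) c δ := by
    refine ContinuousOn.circleIntegrable hδ.1.le ?_
    refine ContinuousOn.smul (ContinuousOn.inv₀ (f := fun z => z - c) (by fun_prop) fun z hz => ?_)
      (hgd.continuousOn.mono Metric.sphere_subset_closedBall)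
    exact sub_ne_zero.2 (hcirc z hz)
  have h2 : (∮ z in C(c, δ), (α * (1 / (z - c) ^ 2))) = 0 := by
    rw [circleIntegral.integral_const_mul]
    have h3 := circleIntegral.integral_sub_zpow_of_ne (n := -2) (by norm_num) c c δ
    have h4 : (∮ z in C(c, δ), 1 / (z - c) ^ 2) = ∮ z in C(c, δ), (z - c) ^ (-2 : ℤ) := by
      congr 1
      ext z
      rw [zpow_neg, one_div]
      rfl
    rw [h4, h3, mul_zero]
  rw [h1, circleIntegral.integral_add hi1 hi2, h2, zero_add]
  have h5 := (hgd.mono Metric.closure_ball_subset_closedBall).diffContOnCl.circleIntegral_sub_inv_smul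
    (Metric.mem_ball_self hδ.1)
  rw [h5, smul_eq_mul, inv_mul_cancel_left₀ Complex.two_pi_I_ne_zero]

theorem HasResidue.congr {f f' : ℂ → ℂ} {c R : ℂ} (h : HasResidue f c R)
    (hff : ∀ᶠ z in 𝓝[≠] c, f' z = f z) : HasResidue f' c R := by
  obtain ⟨α, g, hg, hR, hf⟩ := h
  exact ⟨α, g, hg, hR, by filter_upwards [hf, hff] with z h1 h2; rw [h2, h1]⟩

theorem HasResidue.simplePole {g : ℂ → ℂ} {c : ℂ} (hg : AnalyticAt ℂ g c) :
    HasResidue (fun z => (z - c)⁻¹ * g z) c (g c) :=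
  ⟨0, g, hg, rfl, by simp⟩

theorem HasResidue.doublePole (α c : ℂ) : HasResidue (fun z => α * (1 / (z - c) ^ 2)) c 0 :=
  ⟨α, fun _ => 0, analyticAt_const, rfl, by simp⟩

theorem HasResidue.regular {g : ℂ → ℂ} {c : ℂ} (hg : AnalyticAt ℂ g c) : HasResidue g c 0 := by
  have := HasResidue.simplePole (g := fun z => (z - c) * g z) (c := c)
    ((analyticAt_id.sub analyticAt_const).mul hg)
  simp only [sub_self, zero_mul] at this
  refine this.congr ?_
  filter_upwards [self_mem_nhdsWithin] with z hz
  rw [inv_mul_cancel_left₀ (sub_ne_zero.2 hz)]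

theorem HasResidue.add {f f' : ℂ → ℂ} {c R R' : ℂ} (h : HasResidue f c R)
    (h' : HasResidue f' c R') : HasResidue (fun z => f z + f' z) c (R + R') := by
  obtain ⟨α, g, hg, rfl, hf⟩ := h
  obtain ⟨α', g', hg', rfl, hf'⟩ := h'
  refine ⟨α + α', fun z => g z + g' z, hg.add hg', rfl, ?_⟩
  filter_upwards [hf, hf'] with z h1 h2
  rw [h1, h2]
  ring

theorem HasResidue.const_mul {f : ℂ → ℂ} {c R : ℂ} (h : HasResidue f c R) (k : ℂ) :
    HasResidue (fun z => k * f z) c (k * R) := by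
  obtain ⟨α, g, hg, rfl, hf⟩ := h
  refine ⟨k * α, fun z => k * g z, analyticAt_const.mul hg, rfl, ?_⟩
  filter_upwards [hf] with z h1
  rw [h1]
  ring

theorem softTerm_zero (f : ℂ → ℂ) : softTerm 0 f = f 0 := by simp [softTerm]

theorem softTerm_one (f : ℂ → ℂ) : softTerm 1 f = deriv f 0 := by simp [softTerm]

theorem softTerm_const_mul (l : ℕ) (c : ℂ) (f : ℂ → ℂ) :
    softTerm l (fun τ => c * f τ) = c * softTerm l f := by
  unfold softTerm
  have : iteratedDeriv l (fun τ => c * f τ) 0 = c * iteratedDeriv l f 0 := by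
    simp
  rw [this, mul_div_assoc]

theorem softTerm_congr (l : ℕ) {f g : ℂ → ℂ} (h : f =ᶠ[𝓝 0] g) : softTerm l f = softTerm l g := by
  unfold softTerm
  rw [h.iteratedDeriv_eq l]

theorem iteratedDeriv_comp_mul_const (l : ℕ) (f : ℂ → ℂ) (c : ℂ) :
    ∀ x, iteratedDeriv l (fun τ => f (τ * c)) x = c ^ l * iteratedDeriv l f (x * c) := by
  induction l with
  | zero => simp
  | succ l ih =>
    intro x
    rw [iteratedDeriv_succ]
    simp_rw [funext ih]
    rw [deriv_const_mul_field, iteratedDeriv_succ]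
    have := deriv_comp_mul_left c (iteratedDeriv l f) x
    simp only [smul_eq_mul, mul_comm c] at this
    rw [this, pow_succ]
    ring

/-- Rescaling of the soft momentum. -/
theorem softTerm_comp_mul (l : ℕ) (f : ℂ → ℂ) (c : ℂ) :
    softTerm l (fun τ => f (τ * c)) = c ^ l * softTerm l f := by
  unfold softTerm
  rw [iteratedDeriv_comp_mul_const, zero_mul, mul_div_assoc]

/-- Taylor coefficients in one variable of an analytic function of two variables are analytic. -/
theorem analyticAt_softTerm (l : ℕ) {f : ℂ → ℂ → ℂ} {c : ℂ}
    (hf : AnalyticAt ℂ (fun p : ℂ × ℂ => f p.1 p.2) (0, c)) :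
    AnalyticAt ℂ (fun z => softTerm l fun τ => f τ z) c := by
  -- The statement carried through the induction is joint analyticity of the `τ`-derivatives, each
  -- being a partial derivative of the preceding one.
  have key : ∀ (l : ℕ), AnalyticAt ℂ (fun p : ℂ × ℂ => iteratedDeriv l (fun τ => f τ p.2) p.1)
      (0, c) := by
    intro l
    induction l with
    | zero => simpa using hf
    | succ l ih =>
      have h1 : AnalyticAt ℂ (fun p : ℂ × ℂ => fderiv ℂ
          (fun p : ℂ × ℂ => iteratedDeriv l (fun τ => f τ p.2) p.1) p (1, 0)) (0, c) :=
        ((ContinuousLinearMap.apply ℂ ℂ ((1 : ℂ), (0 : ℂ))).analyticAt _).comp ih.fderiv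
      refine h1.congr ?_
      filter_upwards [ih.eventually_analyticAt] with p hp
      rw [iteratedDeriv_succ]
      have h2 : HasDerivAt (fun τ : ℂ => (τ, p.2)) ((1 : ℂ), (0 : ℂ)) p.1 :=
        (hasDerivAt_id p.1).prodMk (hasDerivAt_const p.1 p.2)
      have h3 := (hp.differentiableAt.hasFDerivAt (x := (p.1, p.2))).comp_hasDerivAt p.1 h2
      exact h3.deriv.symm
  have h4 : AnalyticAt ℂ (fun z : ℂ => ((0 : ℂ), z)) c := by fun_prop
  have h5 := AnalyticAt.fun_comp (g := fun p : ℂ × ℂ => iteratedDeriv l (fun τ => f τ p.2) p.1)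
    (f := fun z : ℂ => ((0 : ℂ), z)) (key l) h4
  exact h5.div analyticAt_const (by exact_mod_cast l.factorial_ne_zero)

-- ## Wick expansion by antiderivations

section Antiderivation

variable {α β : Type*}

/-- The antiderivation `∑ⱼ (-1)ʲ ϕ(lⱼ) F(l without lⱼ)`. -/
def contractWith (ϕ : α → ℂ) : List α → (List α → ℂ) → ℂ
  | [], _ => 0
  | y :: l, F => ϕ y * F l - contractWith ϕ l fun l' => F (y :: l')

/-- Links the recursion, in which signs take care of themselves, to the sum over positions that
defines `wick`. -/
theorem contractWith_eq_sum (ϕ : α → ℂ) (l : List α) : ∀ F : List α → ℂ,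
    contractWith ϕ l F = ∑ j : Fin l.length, (-1) ^ (j : ℕ) * ϕ (l.get j) * F (l.eraseIdx j) := by
  induction l with
  | nil => intro F; simp [contractWith]
  | cons y l ih =>
    intro F
    rw [contractWith, ih]
    simp only [List.length_cons]
    rw [Fin.sum_univ_succ, sub_eq_add_neg, ← Finset.sum_neg_distrib]
    congr 1
    · simp
    · refine Finset.sum_congr rfl fun j _ => ?_
      simp [pow_succ]

theorem contractWith_congr (ϕ : α → ℂ) (l : List α) : ∀ {F G : List α → ℂ},
    (∀ l', l'.length + 1 = l.length → F l' = G l') → contractWith ϕ l F = contractWith ϕ l G := by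
  induction l with
  | nil => intro F G _; rfl
  | cons y l ih =>
    intro F G h
    rw [contractWith, contractWith, h l (by simp),
      ih fun l' hl' => h (y :: l') (by simp [hl'])]

theorem contractWith_congr_left {ϕ ψ : α → ℂ} (l : List α) : ∀ (F : List α → ℂ),
    (∀ y ∈ l, ϕ y = ψ y) → contractWith ϕ l F = contractWith ψ l F := by
  induction l with
  | nil => intro F _; rfl
  | cons y l ih =>
    intro F h
    rw [contractWith, contractWith, h y (by simp), ih _ fun y hy => h y (by simp [hy])]

theorem contractWith_add (ϕ : α → ℂ) (l : List α) : ∀ (F G : List α → ℂ),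
    contractWith ϕ l (fun l' => F l' + G l') = contractWith ϕ l F + contractWith ϕ l G := by
  induction l with
  | nil => intro F G; simp [contractWith]
  | cons y l ih => intro F G; simp only [contractWith, ih]; ring

theorem contractWith_const_mul (ϕ : α → ℂ) (c : ℂ) (l : List α) : ∀ (F : List α → ℂ),
    contractWith ϕ l (fun l' => c * F l') = c * contractWith ϕ l F := by
  induction l with
  | nil => intro F; simp [contractWith]
  | cons y l ih => intro F; simp only [contractWith, ih]; ring

theorem contractWith_sub (ϕ : α → ℂ) (l : List α) (F G : List α → ℂ) :
    contractWith ϕ l (fun l' => F l' - G l') = contractWith ϕ l F - contractWith ϕ l G := by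
  have := contractWith_add ϕ l F fun l' => -1 * G l'
  rw [contractWith_const_mul] at this
  simpa [sub_eq_add_neg] using this

theorem contractWith_add_left (ϕ ψ : α → ℂ) (l : List α) : ∀ F : List α → ℂ,
    contractWith (fun y => ϕ y + ψ y) l F = contractWith ϕ l F + contractWith ψ l F := by
  induction l with
  | nil => intro F; simp [contractWith]
  | cons y l ih => intro F; simp only [contractWith, ih]; ring

theorem contractWith_smul_left (c : ℂ) (ϕ : α → ℂ) (l : List α) : ∀ F : List α → ℂ,
    contractWith (fun y => c * ϕ y) l F = c * contractWith ϕ l F := by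
  induction l with
  | nil => intro F; simp [contractWith]
  | cons y l ih => intro F; simp only [contractWith, ih]; ring

theorem contractWith_sub_left (ϕ ψ : α → ℂ) (l : List α) (F : List α → ℂ) :
    contractWith (fun y => ϕ y - ψ y) l F = contractWith ϕ l F - contractWith ψ l F := by
  have := contractWith_add_left ϕ (fun y => -1 * ψ y) l F
  rw [contractWith_smul_left] at this
  simpa [sub_eq_add_neg] using this

/-- Every pair of entries is removed in both orders. The entry removed second has moved by one
position exactly when the other stood before it, hence the relative sign. -/
theorem contractWith_anticomm (ϕ ψ : α → ℂ) (l : List α) : ∀ F : List α → ℂ,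
    contractWith ϕ l (fun l' => contractWith ψ l' F) =
      -contractWith ψ l (fun l' => contractWith ϕ l' F) := by
  induction l with
  | nil => intro F; simp [contractWith]
  | cons y l ih =>
    intro F
    simp only [contractWith, contractWith_sub, contractWith_const_mul, ih]
    ring

/-- The last entry is reached after passing all the others, each of which costs a sign. -/
theorem contractWith_append_singleton (ϕ : α → ℂ) (x : α) (l : List α) : ∀ F : List α → ℂ,
    contractWith ϕ (l ++ [x]) F =
      contractWith ϕ l (fun l' => F (l' ++ [x])) + (-1) ^ l.length * (ϕ x * F l) := by
  induction l with
  | nil => intro F; simp [contractWith]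
  | cons y l ih =>
    intro F
    simp only [contractWith, List.cons_append, ih, List.length_cons, pow_succ]
    ring

theorem contractWith_map (ϕ : β → ℂ) (Y : α → β) (l : List α) : ∀ F : List β → ℂ,
    contractWith ϕ (l.map Y) F = contractWith (fun y => ϕ (Y y)) l fun l' => F (l'.map Y) := by
  induction l with
  | nil => intro F; simp [contractWith]
  | cons y l ih => intro F; simp only [contractWith, List.map_cons, ih]

/-- Leibniz' rule. Asking for derivatives only on lists shorter by one is what allows strong
induction on the length for `wick`. -/
theorem hasDerivAt_contractWith {ϕ : ℂ → α → ℂ} {ϕ' : α → ℂ} {t : ℂ}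
    (hϕ : ∀ y, HasDerivAt (fun t => ϕ t y) (ϕ' y) t) (l : List α) :
    ∀ {F : ℂ → List α → ℂ} {F' : List α → ℂ},
      (∀ l', l'.length + 1 = l.length → HasDerivAt (fun t => F t l') (F' l') t) →
      HasDerivAt (fun t => contractWith (ϕ t) l (F t))
        (contractWith ϕ' l (F t) + contractWith (ϕ t) l F') t := by
  induction l with
  | nil => intro F F' _; simpa [contractWith] using hasDerivAt_const t (0 : ℂ)
  | cons y l ih =>
    intro F F' h
    simp only [contractWith]
    have h1 := (hϕ y).mul (h l (by simp))
    have h2 := ih (F := fun t l' => F t (y :: l')) (F' := fun l' => F' (y :: l'))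
      fun l' hl' => h (y :: l') (by simp [hl'])
    exact (h1.sub h2).congr_deriv (add_sub_add_comm _ _ _ _)

/-- The sum over pairs `i < j` of `± ψ(lᵢ, lⱼ) F(l without lᵢ and lⱼ)`. -/
def contractPairs (ψ : α → α → ℂ) : List α → (List α → ℂ) → ℂ
  | [], _ => 0
  | a :: l, F => contractWith (ψ a) l F + contractPairs ψ l fun l' => F (a :: l')

theorem contractPairs_add (ψ : α → α → ℂ) (l : List α) : ∀ (F G : List α → ℂ),
    contractPairs ψ l (fun l' => F l' + G l') = contractPairs ψ l F + contractPairs ψ l G := by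
  induction l with
  | nil => intro F G; simp [contractPairs]
  | cons y l ih => intro F G; simp only [contractPairs, ih, contractWith_add]; ring

theorem contractPairs_const_mul (ψ : α → α → ℂ) (c : ℂ) (l : List α) : ∀ (F : List α → ℂ),
    contractPairs ψ l (fun l' => c * F l') = c * contractPairs ψ l F := by
  induction l with
  | nil => intro F; simp [contractPairs]
  | cons y l ih => intro F; simp only [contractPairs, ih, contractWith_const_mul]; ring

/-- A pair contraction is even: it consists of two antiderivations, and passing a third one changes
the sign twice. -/
theorem contractPairs_comm_contractWith (ψ : α → α → ℂ) (ϕ : α → ℂ) (l : List α) :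
    ∀ F : List α → ℂ, contractPairs ψ l (fun l' => contractWith ϕ l' F) =
      contractWith ϕ l (fun l' => contractPairs ψ l' F) := by
  induction l with
  | nil => intro F; simp [contractPairs, contractWith]
  | cons y l ih =>
    intro F
    have hsub : ∀ F G : List α → ℂ, contractPairs ψ l (fun l' => F l' - G l') =
        contractPairs ψ l F - contractPairs ψ l G := fun F G => by
      have := contractPairs_add ψ l F fun l' => -1 * G l'
      rw [contractPairs_const_mul] at this
      simpa [sub_eq_add_neg] using this
    simp only [contractPairs, contractWith, hsub, contractPairs_const_mul, contractWith_add, ih]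
    rw [contractWith_anticomm]
    ring

/-- If the appended pair does not couple to the rest, only its internal contraction is new, and its
two entries are adjacent, hence no sign. -/
theorem contractPairs_append_pair {ψ : α → α → ℂ} {x y : α} (l : List α) :
    ∀ F : List α → ℂ, (∀ a ∈ l, ψ a x = 0 ∧ ψ a y = 0) →
    contractPairs ψ (l ++ [x, y]) F =
      contractPairs ψ l (fun l' => F (l' ++ [x, y])) + ψ x y * F l := by
  induction l with
  | nil => intro F _; simp [contractPairs, contractWith]
  | cons a l ih =>
    intro F h
    have h1 : contractWith (ψ a) (l ++ [x, y]) F =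
        contractWith (ψ a) l fun l' => F (l' ++ [x, y]) := by
      have : l ++ [x, y] = (l ++ [x]) ++ [y] := by simp
      rw [this, contractWith_append_singleton, contractWith_append_singleton]
      simp [h a (by simp)]
    simp only [contractPairs, List.cons_append, h1]
    rw [ih _ fun b hb => h b (by simp [hb])]
    ring

end Antiderivation

/-! ### The Lorentz Ward identity for free fermions -/

section Wick

variable {d : ℕ}

theorem mdot_comm (x y : Vec d) : mdot x y = mdot y x := by
  unfold mdot; exact Finset.sum_congr rfl fun μ _ => by ring

theorem mdot_add_left (x y z : Vec d) : mdot (x + y) z = mdot x z + mdot y z := by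
  simp only [mdot, Pi.add_apply, ← Finset.sum_add_distrib]
  exact Finset.sum_congr rfl fun μ _ => by ring

theorem mdot_add_right (x y z : Vec d) : mdot x (y + z) = mdot x y + mdot x z := by
  rw [mdot_comm, mdot_add_left, mdot_comm y, mdot_comm z]

theorem mdot_smul_left (c : ℂ) (x y : Vec d) : mdot (c • x) y = c * mdot x y := by
  simp only [mdot, Pi.smul_apply, smul_eq_mul, Finset.mul_sum]
  exact Finset.sum_congr rfl fun μ _ => by ring

theorem mdot_smul_right (c : ℂ) (x y : Vec d) : mdot x (c • y) = c * mdot x y := by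
  rw [mdot_comm, mdot_smul_left, mdot_comm]

theorem mdot_neg_right (x y : Vec d) : mdot x (-y) = -mdot x y := by
  rw [← neg_one_smul ℂ, mdot_smul_right]; ring

theorem mdot_sub_left (x y z : Vec d) : mdot (x - y) z = mdot x z - mdot y z := by
  rw [sub_eq_add_neg, mdot_add_left, mdot_comm (-y), mdot_neg_right, mdot_comm z]; ring

theorem mdot_sub_right (x y z : Vec d) : mdot x (y - z) = mdot x y - mdot x z := by
  rw [mdot_comm, mdot_sub_left, mdot_comm y, mdot_comm z]

theorem mdot_zero_right (x : Vec d) : mdot x 0 = 0 := by simp [mdot]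

theorem mdot_sum_right {ι : Type*} (s : Finset ι) (x : Vec d) (f : ι → Vec d) :
    mdot x (∑ i ∈ s, f i) = ∑ i ∈ s, mdot x (f i) := by
  classical
  induction s using Finset.induction_on with
  | empty => simp [mdot_zero_right]
  | insert a s ha ih => rw [Finset.sum_insert ha, Finset.sum_insert ha, mdot_add_right, ih]

/-- The infinitesimal Lorentz transformation `v ↦ (ε·v) s - (s·v) ε`. -/
def lorentz (ε s v : Vec d) : Vec d := mdot ε v • s - mdot s v • ε

theorem mdot_lorentz_left (ε s v w : Vec d) :
    mdot (lorentz ε s v) w = mdot ε v * mdot s w - mdot s v * mdot ε w := by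
  rw [lorentz, mdot_sub_left, mdot_smul_left, mdot_smul_left]

theorem mdot_lorentz_right (ε s v w : Vec d) :
    mdot v (lorentz ε s w) = -mdot (lorentz ε s v) w := by
  rw [mdot_comm, mdot_lorentz_left, mdot_lorentz_left]; ring

theorem wick_cons (x : Vec d × ℂ) (l : List (Vec d × ℂ)) :
    wick (x :: l) = contractWith (contract x) l wick := by
  rw [wick, contractWith_eq_sum]

theorem contract_comm (x y : Vec d × ℂ) : contract x y = -contract y x := by
  unfold contract
  by_cases h : x.2 = y.2
  · simp [h]
  · rw [if_neg h, if_neg (Ne.symm h), mdot_comm, ← neg_sub y.2, div_neg]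

/-- The Wick sum is antisymmetric, so moving the last field to the front costs one sign for each
field passed. -/
theorem wick_append_singleton (S : Vec d × ℂ) : ∀ (n : ℕ) (l : List (Vec d × ℂ)), l.length = n →
    wick (l ++ [S]) = (-1) ^ l.length * contractWith (contract S) l wick := by
  intro n
  induction n using Nat.strong_induction_on with
  | _ n ih =>
    rintro (_ | ⟨x, l⟩) hl
    · simp [wick_cons, contractWith]
    · rw [List.cons_append, wick_cons, contractWith_append_singleton]
      have h1 : contractWith (contract x) l (fun l' => wick (l' ++ [S])) =
          contractWith (contract x) l
            (fun l' => (-1) ^ (l.length + 1) * contractWith (contract S) l' wick) := by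
        refine contractWith_congr _ _ fun l' hl' => ?_
        rw [ih l'.length (by simp at hl; omega) l' rfl, ← hl', pow_succ, pow_succ]
        ring
      have h2 : contractWith (contract S) (x :: l) wick =
          contract S x * wick l - contractWith (contract S) l
            (fun l' => contractWith (contract x) l' wick) := by
        simp only [contractWith, wick_cons]
      rw [h1, contractWith_const_mul, contractWith_anticomm, h2, contract_comm S x,
        List.length_cons, pow_succ]
      ring

/-- The correlator with an additional bilinear `E S` of fields. -/
def wickInsert (E S : Vec d × ℂ) (l : List (Vec d × ℂ)) : ℂ :=
  contractWith (contract S) l fun l' => contractWith (contract E) l' wick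

/-- Both fields are moved to the front. The first move passes one field more and the second takes
place after one field has been contracted, so the two signs agree and cancel. The mutual contraction
is zero at coincident points. -/
theorem wick_append_pair (E S : Vec d × ℂ) (h : E.2 = S.2) (l : List (Vec d × ℂ)) :
    wick (l ++ [E, S]) = wickInsert E S l := by
  have h1 : l ++ [E, S] = (l ++ [E]) ++ [S] := by simp
  have h2 : contractWith (contract S) l (fun l' => wick (l' ++ [E])) =
      contractWith (contract S) l
        (fun l' => (-1) ^ (l.length + 1) * contractWith (contract E) l' wick) := by
    refine contractWith_congr _ _ fun l' hl' => ?_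
    rw [wick_append_singleton E _ l' rfl, ← hl', pow_succ, pow_succ]
    ring
  have h3 : contract S E = 0 := by rw [contract, if_pos h.symm]
  rw [h1, wick_append_singleton S _ _ rfl, contractWith_append_singleton, h2,
    contractWith_const_mul, h3, wickInsert, List.length_append, List.length_singleton]
  have h4 : ((-1 : ℂ) ^ (l.length + 1)) * (-1) ^ (l.length + 1) = 1 := by
    rw [← mul_pow]; simp
  linear_combination (contractWith (contract S) l fun l' => contractWith (contract E) l' wick) * h4

/-- Simultaneous infinitesimal transformation of a field at `x.2`, weighted by a pole at `z`. -/
def boost (ε s : Vec d) (z : ℂ) (x : Vec d × ℂ) : Vec d × ℂ :=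
  ((z - x.2)⁻¹ • lorentz ε s x.1, x.2)

def boostBy (ε s : Vec d) (z t : ℂ) (x : Vec d × ℂ) : Vec d × ℂ :=
  (x.1 + t • (boost ε s z x).1, x.2)

/-- The failure of the Ward identity for a contraction; supported at coincident points. -/
def wardDefect (ε s : Vec d) (z : ℂ) (x y : Vec d × ℂ) : ℂ :=
  I * (contract (s, z) x * contract (ε, z) y - contract (ε, z) x * contract (s, z) y) -
    (contract (boost ε s z x) y + contract x (boost ε s z y))

/-- Since the Lorentz map is antisymmetric, the two boosted contractions combine by `1/(z - x) -
1/(z - y) = (x - y) / ((z - x)(z - y))`, which removes the pole at `x = y` and leaves the product of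
soft contractions. -/
theorem wardDefect_of_ne {ε s : Vec d} {z : ℂ} {x y : Vec d × ℂ} (hx : x.2 ≠ z) (hy : y.2 ≠ z)
    (h : x.2 ≠ y.2) : wardDefect ε s z x y = 0 := by
  have h1 : z - x.2 ≠ 0 := sub_ne_zero.2 hx.symm
  have h2 : z - y.2 ≠ 0 := sub_ne_zero.2 hy.symm
  have h3 : x.2 - y.2 ≠ 0 := sub_ne_zero.2 h
  simp only [wardDefect, contract, boost, if_neg hx.symm, if_neg hy.symm, if_neg h,
    mdot_smul_left, mdot_smul_right, mdot_lorentz_right, mdot_lorentz_left]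
  field_simp
  linear_combination (-I * (mdot ε x.1 * mdot s y.1 - mdot s x.1 * mdot ε y.1) * (x.2 - y.2)) *
    Complex.I_sq

/-- Contractions between coincident fields are zero by convention, whereas the soft contractions
with both of them survive and form a double pole. -/
theorem wardDefect_of_eq {ε s : Vec d} {z : ℂ} {x y : Vec d × ℂ} (hx : x.2 ≠ z)
    (h : x.2 = y.2) :
    wardDefect ε s z x y = I * mdot (lorentz ε s x.1) y.1 * ((z - x.2)⁻¹) ^ 2 := by
  have h1 : z - x.2 ≠ 0 := sub_ne_zero.2 hx.symm
  simp only [wardDefect, contract, boost, if_neg hx.symm, ← h, ↓reduceIte, mdot_lorentz_left]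
  field_simp
  linear_combination (-I * (mdot ε x.1 * mdot s y.1 - mdot s x.1 * mdot ε y.1)) * Complex.I_sq

theorem hasDerivAt_contract (ε s : Vec d) (z : ℂ) (x y : Vec d × ℂ) :
    HasDerivAt (fun t => contract (boostBy ε s z t x) (boostBy ε s z t y))
      (contract (boost ε s z x) y + contract x (boost ε s z y)) 0 := by
  by_cases h : x.2 = y.2
  · simpa [contract, boostBy, boost, h] using hasDerivAt_const (0 : ℂ) (0 : ℂ)
  · simp only [contract, boostBy, boost, if_neg h, mdot_add_left, mdot_add_right, mdot_smul_left,
      mdot_smul_right]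
    set A := mdot x.1 y.1
    set B := (z - x.2)⁻¹ * mdot (lorentz ε s x.1) y.1
    set C := (z - y.2)⁻¹ * mdot x.1 (lorentz ε s y.1)
    set D := (z - x.2)⁻¹ * ((z - y.2)⁻¹ * mdot (lorentz ε s x.1) (lorentz ε s y.1))
    have h1 : HasDerivAt (fun t : ℂ => I * (A + t * B + t * (C + t * D)) / (x.2 - y.2))
        (I * ((1 * B) + (1 * (C + 0 * D) + 0 * (1 * D))) / (x.2 - y.2)) 0 :=
      (((((hasDerivAt_id (0 : ℂ)).mul_const B).const_add A).add
        ((hasDerivAt_id (0 : ℂ)).mul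
          (((hasDerivAt_id (0 : ℂ)).mul_const D).const_add C))).const_mul I).div_const _
    convert h1 using 1
    · ext t
      simp only [D]
      ring
    · ring

/-- The fermionic Ward identity. -/
theorem hasDerivAt_wick (ε s : Vec d) (z : ℂ) : ∀ (n : ℕ) (l : List (Vec d × ℂ)), l.length = n →
    HasDerivAt (fun t => wick (l.map (boostBy ε s z t)))
      (I * wickInsert (ε, z) (s, z) l - contractPairs (wardDefect ε s z) l wick) 0 := by
  have hb0 : boostBy ε s z 0 = id := funext fun x => by simp [boostBy]
  intro n
  induction n using Nat.strong_induction_on with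
  | _ n ih =>
    rintro (_ | ⟨x, l⟩) hl
    · simpa [wick, wickInsert, contractWith, contractPairs] using hasDerivAt_const (0 : ℂ) (1 : ℂ)
    · simp only [List.map_cons, wick_cons, contractWith_map]
      have h1 := hasDerivAt_contractWith
        (ϕ := fun t y => contract (boostBy ε s z t x) (boostBy ε s z t y))
        (fun y => hasDerivAt_contract ε s z x y) l
        (F := fun t l' => wick (l'.map (boostBy ε s z t)))
        fun l' hl' => ih l'.length (by simp at hl; omega) l' rfl
      convert h1 using 1
      simp only [hb0, List.map_id, id, contractWith_sub, contractWith_const_mul]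
      -- Either exactly one soft field contracts with `x`, giving the antisymmetrised product, or
      -- both contract inside `l`.
      have h2 : wickInsert (ε, z) (s, z) (x :: l) =
          contractWith (fun y => contract (s, z) x * contract (ε, z) y -
            contract (ε, z) x * contract (s, z) y) l wick +
          contractWith (contract x) l (wickInsert (ε, z) (s, z)) := by
        -- The contraction with `x` passes two soft contractions, so the signs cancel.
        have h3 : contractWith (contract x) l (wickInsert (ε, z) (s, z)) =
            contractWith (contract (s, z)) l fun l' => contractWith (contract (ε, z)) l'
              fun l'' => contractWith (contract x) l'' wick := by
          unfold wickInsert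
          rw [contractWith_anticomm]
          have : ∀ l', contractWith (contract x) l'
              (fun l'' => contractWith (contract (ε, z)) l'' wick) =
              -1 * contractWith (contract (ε, z)) l'
              (fun l'' => contractWith (contract x) l'' wick) := fun l' => by
            rw [contractWith_anticomm]; ring
          simp only [this, contractWith_const_mul]
          ring
        rw [h3, contractWith_sub_left, contractWith_smul_left, contractWith_smul_left]
        simp only [wickInsert, contractWith, wick_cons, contractWith_sub, contractWith_const_mul]
        ring
      have h4 : contractPairs (wardDefect ε s z) (x :: l) wick =
          contractWith (wardDefect ε s z x) l wick +
            contractWith (contract x) l fun l' => contractPairs (wardDefect ε s z) l' wick := by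
        simp only [contractPairs, wick_cons]
        rw [contractPairs_comm_contractWith]
      have h5 : contractWith (wardDefect ε s z x) l wick =
          I * contractWith (fun y => contract (s, z) x * contract (ε, z) y -
            contract (ε, z) x * contract (s, z) y) l wick -
          contractWith (fun y => contract (boost ε s z x) y + contract x (boost ε s z y)) l
            wick := by
        rw [← contractWith_smul_left, ← contractWith_sub_left]
        rfl
      rw [h2, h4, h5]
      ring

end Wick

/-! ### Products of factors with a scalar part and a fermion bilinear -/

section WickProd

variable {d : ℕ} {β : Type*}

/-- `wickProd` with `wick` replaced by another function of lists of fields. -/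
def wickProdWith (F : List (Vec d × ℂ) → ℂ) :
    List (ℂ × Vec d × Vec d × ℂ) → List (Vec d × ℂ) → ℂ
  | [], L => F L
  | (c, a, b, z) :: T, L => c * wickProdWith F T L + I * wickProdWith F T (L ++ [(a, z), (b, z)])

theorem wickProd_eq (T : List (ℂ × Vec d × Vec d × ℂ)) : ∀ L,
    wickProd T L = wickProdWith wick T L := by
  induction T with
  | nil => intro L; rfl
  | cons t T ih => intro L; obtain ⟨c, a, b, z⟩ := t; rw [wickProd, wickProdWith, ih, ih]

theorem wickProdWith_sub (F G : List (Vec d × ℂ) → ℂ) (T : List (ℂ × Vec d × Vec d × ℂ)) : ∀ L,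
    wickProdWith (fun l => F l - G l) T L = wickProdWith F T L - wickProdWith G T L := by
  induction T with
  | nil => intro L; rfl
  | cons t T ih =>
    intro L
    obtain ⟨c, a, b, z⟩ := t
    simp only [wickProdWith, ih]
    ring

theorem wickProdWith_const_mul (k : ℂ) (F : List (Vec d × ℂ) → ℂ)
    (T : List (ℂ × Vec d × Vec d × ℂ)) : ∀ L,
    wickProdWith (fun l => k * F l) T L = k * wickProdWith F T L := by
  induction T with
  | nil => intro L; rfl
  | cons t T ih =>
    intro L
    obtain ⟨c, a, b, z⟩ := t
    simp only [wickProdWith, ih]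
    ring

/-- Derivative of `wickProdWith` along a variation `γ` of the scalar parts of the factors. -/
def wickProdVar (γ : β → ℂ) (fac : β → ℂ × Vec d × Vec d × ℂ) (F : List (Vec d × ℂ) → ℂ) :
    List β → List (Vec d × ℂ) → ℂ
  | [], _ => 0
  | b :: T, L => γ b * wickProdWith F (T.map fac) L + (fac b).1 * wickProdVar γ fac F T L +
      I * wickProdVar γ fac F T (L ++ [((fac b).2.1, (fac b).2.2.2), ((fac b).2.2.1, (fac b).2.2.2)])

variable {fac : β → ℂ × Vec d × Vec d × ℂ}

theorem wickProdVar_sub (γ γ' : β → ℂ) (F : List (Vec d × ℂ) → ℂ) (T : List β) : ∀ L,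
    wickProdVar (fun t => γ t - γ' t) fac F T L =
      wickProdVar γ fac F T L - wickProdVar γ' fac F T L := by
  induction T with
  | nil => intro L; simp [wickProdVar]
  | cons t T ih =>
    intro L
    simp only [wickProdVar, ih]
    ring

theorem wickProdVar_congr {γ γ' : β → ℂ} (F : List (Vec d × ℂ) → ℂ)
    (T : List β) : ∀ L, (∀ t ∈ T, γ t = γ' t) →
    wickProdVar γ fac F T L = wickProdVar γ' fac F T L := by
  induction T with
  | nil => intro L _; rfl
  | cons t T ih =>
    intro L h
    have h' := fun t ht => h t (List.mem_cons_of_mem _ ht)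
    simp only [wickProdVar, ih _ h', h _ List.mem_cons_self]

/-- For separated punctures a contraction supported at coincident points joins only the two fields
of one and the same bilinear. Removing that bilinear has the same effect as varying the scalar part
of its factor, which turns the defect of the Ward identity into a shift of `ε·p`. -/
theorem wickProdWith_contractPairs {ψ : Vec d × ℂ → Vec d × ℂ → ℂ} {z₀ : ℂ}
    (hψ : ∀ x y, x.2 ≠ z₀ → y.2 ≠ z₀ → x.2 ≠ y.2 → ψ x y = 0) (F : List (Vec d × ℂ) → ℂ)
    (T : List β) : ∀ L : List (Vec d × ℂ),
    T.Pairwise (fun t t' => (fac t).2.2.2 ≠ (fac t').2.2.2) → (∀ t ∈ T, (fac t).2.2.2 ≠ z₀) →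
    (∀ x ∈ L, x.2 ≠ z₀) → (∀ t ∈ T, ∀ x ∈ L, x.2 ≠ (fac t).2.2.2) →
    wickProdWith (fun l => contractPairs ψ l F) (T.map fac) L =
      wickProdVar (fun t => I * ψ ((fac t).2.1, (fac t).2.2.2) ((fac t).2.2.1, (fac t).2.2.2))
        fac F T L + contractPairs ψ L (wickProdWith F (T.map fac)) := by
  induction T with
  | nil => intro L _ _ _ _; simp [wickProdWith, wickProdVar]
  | cons t T ih =>
    intro L hT hTz hL hTL
    rw [List.pairwise_cons] at hT
    have hTz' := fun t ht => hTz t (List.mem_cons_of_mem _ ht)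
    have hz : (fac t).2.2.2 ≠ z₀ := hTz t List.mem_cons_self
    have hLz : ∀ x ∈ L, x.2 ≠ (fac t).2.2.2 := hTL t List.mem_cons_self
    have hTL' := fun t' ht => hTL t' (List.mem_cons_of_mem t ht)
    rw [List.map_cons]
    rcases hfac : fac t with ⟨c, a, b, z⟩
    simp only [hfac] at hz hLz hT
    have hL2 : ∀ x ∈ L ++ [(a, z), (b, z)], x.2 ≠ z₀ := by
      intro x hx
      simp only [List.mem_append, List.mem_cons, List.not_mem_nil, or_false] at hx
      rcases hx with hx | rfl | rfl
      exacts [hL x hx, hz, hz]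
    have hTL2 : ∀ t ∈ T, ∀ x ∈ L ++ [(a, z), (b, z)], x.2 ≠ (fac t).2.2.2 := by
      intro t ht x hx
      simp only [List.mem_append, List.mem_cons, List.not_mem_nil, or_false] at hx
      rcases hx with hx | rfl | rfl
      exacts [hTL' t ht x hx, hT.1 t ht, hT.1 t ht]
    have hP : contractPairs ψ L (wickProdWith F ((c, a, b, z) :: T.map fac)) =
        c * contractPairs ψ L (wickProdWith F (T.map fac)) +
          I * contractPairs ψ L (fun l => wickProdWith F (T.map fac) (l ++ [(a, z), (b, z)])) := by
      rw [← contractPairs_const_mul, ← contractPairs_const_mul, ← contractPairs_add]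
      rfl
    rw [wickProdWith, ih L hT.2 hTz' hL hTL', ih _ hT.2 hTz' hL2 hTL2,
      contractPairs_append_pair L _ fun x hx => ⟨hψ _ _ (hL x hx) hz (hLz x hx),
        hψ _ _ (hL x hx) hz (hLz x hx)⟩, hP]
    simp only [wickProdVar, hfac]
    ring

theorem contractPairs_eq_zero {ψ : Vec d × ℂ → Vec d × ℂ → ℂ} {x y : Vec d × ℂ}
    (h : ψ x y = 0) (F : List (Vec d × ℂ) → ℂ) : contractPairs ψ [x, y] F = 0 := by
  simp [contractPairs, contractWith, h]

theorem hasDerivAt_wickProdWith {Y : ℂ → Vec d × ℂ → Vec d × ℂ} (hY0 : Y 0 = id)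
    (hY2 : ∀ t x, (Y t x).2 = x.2)
    {F F' : List (Vec d × ℂ) → ℂ} (hF : ∀ l, HasDerivAt (fun t => F (l.map (Y t))) (F' l) 0)
    {C : ℂ → β → ℂ} {γ : β → ℂ} (hC0 : ∀ b, C 0 b = (fac b).1)
    (hC : ∀ b, HasDerivAt (fun t => C t b) (γ b) 0) (T : List β) : ∀ L,
    HasDerivAt (fun t => wickProdWith F
      (T.map fun b => (C t b, (Y t ((fac b).2.1, (fac b).2.2.2)).1,
        (Y t ((fac b).2.2.1, (fac b).2.2.2)).1, (fac b).2.2.2)) (L.map (Y t)))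
      (wickProdVar γ fac F T L + wickProdWith F' (T.map fac) L) 0 := by
  induction T with
  | nil => intro L; simpa [wickProdWith, wickProdVar] using hF L
  | cons f T ih =>
    intro L
    have h1 := ih L
    have h2 := ih (L ++ [((fac f).2.1, (fac f).2.2.2), ((fac f).2.2.1, (fac f).2.2.2)])
    have h4 := ((hC f).mul h1).add (h2.const_mul I)
    simp only [hY0, hC0, List.map_id, id, Prod.mk.eta] at h4
    refine (h4.congr_of_eventuallyEq (Filter.Eventually.of_forall fun t => ?_)).congr_deriv ?_
    · simp only [List.map_cons, wickProdWith, List.map_append, List.map_nil, Pi.add_apply,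
        Pi.mul_apply]
      have hp : ∀ v, ((Y t (v, (fac f).2.2.2)).1, (fac f).2.2.2) = Y t (v, (fac f).2.2.2) :=
        fun v => Prod.ext rfl (hY2 t (v, _)).symm
      congr 5
      · exact hp _
      · exact congrArg (fun p => [p]) (hp _)
    · simp only [wickProdVar, wickProdWith, List.map_cons]
      ring

/-- The soft factor stands last, so its two fields end every list of fields, where
`wick_append_pair` applies; its bilinear is linear in `τ`. -/
theorem wickProd_append_insert (c : ℂ) (ε s : Vec d) (z τ : ℂ)
    (T : List (ℂ × Vec d × Vec d × ℂ)) : ∀ L, wickProd (T ++ [(c, ε, τ • s, z)]) L =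
      c * wickProd T L + I * (τ * wickProdWith (wickInsert (ε, z) (s, z)) T L) := by
  induction T with
  | nil =>
    intro L
    simp only [List.nil_append, wickProd, wickProdWith]
    rw [wick_append_pair (ε, z) (τ • s, z) rfl]
    congr 2
    rw [wickInsert, wickInsert, ← contractWith_smul_left]
    refine contractWith_congr_left _ _ fun y _ => ?_
    simp only [contract, mdot_smul_left]
    split_ifs
    · simp
    · ring
  | cons t T ih =>
    intro L
    obtain ⟨c', a, b, z'⟩ := t
    simp only [List.cons_append, wickProd, wickProdWith, ih]
    ring

/-- Derivative of the fermion correlator under a variation `γ` of the scalar parts. -/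
theorem hasDerivAt_wickProdWith_scalar (F : List (Vec d × ℂ) → ℂ) {C : ℂ → β → ℂ} {γ : β → ℂ}
    (hC0 : ∀ b, C 0 b = (fac b).1) (hC : ∀ b, HasDerivAt (fun t => C t b) (γ b) 0) (T : List β)
    (L : List (Vec d × ℂ)) :
    HasDerivAt (fun τ => wickProdWith F (T.map fun b => (C τ b, (fac b).2)) L)
      (wickProdVar γ fac F T L) 0 := by
  have h1 := hasDerivAt_wickProdWith (Y := fun _ x => x) rfl
    (fun _ _ => rfl) (F := F) (F' := fun _ => 0)
    (fun l => by simpa using hasDerivAt_const (0 : ℂ) (F l)) hC0 hC T L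
  have h0 : wickProdWith (fun _ => 0) (T.map fac) L = 0 := by
    simpa using wickProdWith_const_mul 0 (fun _ => 0) (T.map fac) L
  simpa only [h0, add_zero, Prod.mk.eta, List.map_id'] using h1

/-- Derivative of the fermion correlator under the weighted Lorentz transformation of the fields
and a variation `γ` of the scalar parts. -/
theorem hasDerivAt_wickProd_boost (ε s : Vec d) (z : ℂ) {C : ℂ → β → ℂ} {γ : β → ℂ}
    (hC0 : ∀ b, C 0 b = (fac b).1) (hC : ∀ b, HasDerivAt (fun t => C t b) (γ b) 0)
    (T : List β) (x y : Vec d × ℂ)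
    (hT : T.Pairwise fun t t' => (fac t).2.2.2 ≠ (fac t').2.2.2)
    (hTz : ∀ t ∈ T, (fac t).2.2.2 ≠ z)
    (hx : x.2 ≠ z) (hy : y.2 ≠ z) (hxy : x.2 ≠ y.2)
    (hTx : ∀ t ∈ T, x.2 ≠ (fac t).2.2.2) (hTy : ∀ t ∈ T, y.2 ≠ (fac t).2.2.2) :
    HasDerivAt (fun t => wickProd
      (T.map fun f => (C t f, (boostBy ε s z t ((fac f).2.1, (fac f).2.2.2)).1,
        (boostBy ε s z t ((fac f).2.2.1, (fac f).2.2.2)).1, (fac f).2.2.2))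
      [boostBy ε s z t x, boostBy ε s z t y])
      (wickProdVar (fun f => γ f + mdot (lorentz ε s (fac f).2.1) (fac f).2.2.1 *
        ((z - (fac f).2.2.2)⁻¹) ^ 2) fac wick T [x, y] +
        I * wickProdWith (wickInsert (ε, z) (s, z)) (T.map fac) [x, y]) 0 := by
  simp only [wickProd_eq]
  have h1 := hasDerivAt_wickProdWith (Y := boostBy ε s z)
    (funext fun x => by simp [boostBy]) (fun _ _ => rfl)
    (fun l => hasDerivAt_wick ε s z l.length l rfl) hC0 hC T [x, y]
  refine h1.congr_deriv ?_
  rw [wickProdWith_sub, wickProdWith_const_mul, wickProdWith_contractPairs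
    (fun x y hx hy h => wardDefect_of_ne hx hy h) wick T [x, y] hT hTz (by simp [hx, hy])
    (by simpa using fun t ht => ⟨hTx t ht, hTy t ht⟩),
    contractPairs_eq_zero (wardDefect_of_ne hx hy hxy)]
  rw [add_zero, add_sub, add_sub_right_comm, ← wickProdVar_sub]
  congr 1
  refine wickProdVar_congr _ _ _ fun f hf => ?_
  rw [wardDefect_of_eq (x := ((fac f).2.1, (fac f).2.2.2)) (y := ((fac f).2.2.1, (fac f).2.2.2))
    (hTz f hf) rfl]
  linear_combination (-mdot (lorentz ε s (fac f).2.1) (fac f).2.2.1 *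
    ((z - (fac f).2.2.2)⁻¹) ^ 2) * Complex.I_sq

end WickProd

/-! ### Holomorphy of fermion correlators in parameters -/

section Differentiability

variable {d : ℕ} {α β Q : Type*} [NormedAddCommGroup Q] [NormedSpace ℂ Q] {q₀ : Q}

theorem differentiableAt_contractWith {ϕ : Q → α → ℂ}
    (hϕ : ∀ y, DifferentiableAt ℂ (fun q => ϕ q y) q₀) (l : List α) : ∀ {F : Q → List α → ℂ},
      (∀ l', l'.length + 1 = l.length → DifferentiableAt ℂ (fun q => F q l') q₀) →
      DifferentiableAt ℂ (fun q => contractWith (ϕ q) l (F q)) q₀ := by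
  induction l with
  | nil => intro F _; simp [contractWith]
  | cons y l ih =>
    intro F h
    simp only [contractWith]
    exact ((hϕ y).mul (h l (by simp))).sub
      (ih (F := fun q l' => F q (y :: l')) fun l' hl' => h (y :: l') (by simp [hl']))

theorem differentiableAt_mdot {f g : Q → Vec d} (hf : DifferentiableAt ℂ f q₀)
    (hg : DifferentiableAt ℂ g q₀) : DifferentiableAt ℂ (fun q => mdot (f q) (g q)) q₀ := by
  unfold mdot
  fun_prop

/-- Fields at pairwise separated or identical points, depending holomorphically on parameters. -/
structure HolomorphicFields (X : Q → α → Vec d × ℂ) (q₀ : Q) : Prop where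
  vec : ∀ a, DifferentiableAt ℂ (fun q => (X q a).1) q₀
  point : ∀ a, DifferentiableAt ℂ (fun q => (X q a).2) q₀
  separated : ∀ a b, (∀ q, (X q a).2 = (X q b).2) ∨ (X q₀ a).2 ≠ (X q₀ b).2

/-- For points identical throughout, the contraction is the constant zero; separated points stay
separated nearby, and there it is a quotient with nonvanishing denominator. -/
theorem HolomorphicFields.contract {X : Q → α → Vec d × ℂ} (h : HolomorphicFields X q₀) (a b : α) :
    DifferentiableAt ℂ (fun q => contract (X q a) (X q b)) q₀ := by
  rcases h.separated a b with h1 | h1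
  · simp [Ambi.contract, h1]
  · have hne : ∀ᶠ q in 𝓝 q₀, (X q a).2 - (X q b).2 ≠ 0 :=
      ((h.point a).sub (h.point b)).continuousAt.eventually_ne (sub_ne_zero.2 h1)
    have hd : DifferentiableAt ℂ
        (fun q => I * mdot (X q a).1 (X q b).1 * ((X q a).2 - (X q b).2)⁻¹) q₀ :=
      ((differentiableAt_mdot (h.vec a) (h.vec b)).const_mul I).mul
        (((h.point a).fun_sub (h.point b)).fun_inv (sub_ne_zero.2 h1))
    refine hd.congr_of_eventuallyEq ?_
    filter_upwards [hne] with q hq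
    rw [Ambi.contract, if_neg (sub_ne_zero.1 hq), div_eq_mul_inv]

theorem HolomorphicFields.wick {X : Q → α → Vec d × ℂ} (h : HolomorphicFields X q₀) :
    ∀ (n : ℕ) (l : List α), l.length = n →
    DifferentiableAt ℂ (fun q => wick (l.map (X q))) q₀ := by
  intro n
  induction n using Nat.strong_induction_on with
  | _ n ih =>
    rintro (_ | ⟨x, l⟩) hl
    · simp [Ambi.wick]
    · simp only [List.map_cons, wick_cons, contractWith_map]
      exact differentiableAt_contractWith (fun y => h.contract x y) l
        fun l' hl' => ih l'.length (by simp at hl; omega) l' rfl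

theorem HolomorphicFields.wickProd {X : Q → α → Vec d × ℂ} (h : HolomorphicFields X q₀)
    {C : Q → β → ℂ} {A B : β → α} (hAB : ∀ q b, (X q (A b)).2 = (X q (B b)).2)
    (hC : ∀ b, DifferentiableAt ℂ (fun q => C q b) q₀) (T : List β) : ∀ L : List α,
    DifferentiableAt ℂ (fun q => wickProd
      (T.map fun b => (C q b, (X q (A b)).1, (X q (B b)).1, (X q (A b)).2)) (L.map (X q))) q₀ := by
  induction T with
  | nil => intro L; exact h.wick _ L rfl
  | cons b T ih =>
    intro L
    simp only [List.map_cons, Ambi.wickProd]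
    refine ((hC b).mul (ih L)).add ((differentiableAt_const _).mul ?_)
    have := ih (L ++ [A b, B b])
    refine this.congr_of_eventuallyEq (Filter.Eventually.of_forall fun q => ?_)
    simp only [List.map_append, List.map_cons, List.map_nil]
    congr 4
    rw [hAB]

end Differentiability

/-! ### The hard integrand: first-order insertions and weighted Lorentz variations -/

section HardKernel

variable {N m d : ℕ}

theorem lorentz_add (ε s v w : Vec d) : lorentz ε s (v + w) = lorentz ε s v + lorentz ε s w := by
  simp only [lorentz, mdot_add_right, add_smul]; abel

theorem lorentz_smul (ε s : Vec d) (c : ℂ) (v : Vec d) :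
    lorentz ε s (c • v) = c • lorentz ε s v := by
  simp only [lorentz, mdot_smul_right, mul_smul, smul_sub]

theorem lorentz_sum {ι : Type*} (ε s : Vec d) (t : Finset ι) (f : ι → Vec d) :
    lorentz ε s (∑ i ∈ t, f i) = ∑ i ∈ t, lorentz ε s (f i) := by
  classical
  induction t using Finset.induction_on with
  | empty => simp [lorentz, mdot_zero_right]
  | insert a t ha ih => rw [Finset.sum_insert ha, Finset.sum_insert ha, lorentz_add, ih]

/-- Labels of the hard particles whose vertex operators contain a fermion bilinear. -/
def integratedLabels (m : ℕ) : List (Hard m) :=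
  Sum.inl 2 :: List.ofFn fun j : Fin m => (Sum.inr j : Hard m)

theorem integratedLabels_nodup (m : ℕ) : (integratedLabels m).Nodup := by
  rw [integratedLabels, List.nodup_cons]
  refine ⟨by simp [List.mem_ofFn], List.nodup_ofFn.2 Sum.inr_injective⟩

theorem ne_of_mem_integratedLabels {b : Hard m} (hb : b ∈ integratedLabels m) :
    Sum.inl 0 ≠ b ∧ Sum.inl 1 ≠ b := by
  simp only [integratedLabels, List.mem_cons, List.mem_ofFn] at hb
  rcases hb with rfl | ⟨j, rfl⟩ <;> simp

def fermiFactor (σ : Hard m → ℂ) (κ : Kin N m d) (r : Fin N) (b : Hard m) :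
    ℂ × Vec d × Vec d × ℂ :=
  (mdot (κ.2 r b) (pAt σ κ.1 b), κ.2 r b, κ.1 b, σ b)

def fermiEnds (σ : Hard m → ℂ) (κ : Kin N m d) (r : Fin N) : List (Vec d × ℂ) :=
  [(κ.2 r (.inl 0), σ (.inl 0)), (κ.2 r (.inl 1), σ (.inl 1))]

/-- Fermion factors with the field `p(σ_b)` shifted by `η_b`. -/
def shiftedFactors (σ : Hard m → ℂ) (κ : Kin N m d) (η : Hard m → Vec d) (r : Fin N) :
    List (ℂ × Vec d × Vec d × ℂ) :=
  (integratedLabels m).map fun b =>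
    (mdot (κ.2 r b) (pAt σ κ.1 b + η b), (fermiFactor σ κ r b).2)

def shiftedFermion (σ : Hard m → ℂ) (κ : Kin N m d) (η : Hard m → Vec d) (r : Fin N) : ℂ :=
  wickProd (shiftedFactors σ κ η r) (fermiEnds σ κ r)

def scattering (σ : Hard m → ℂ) (κ : Kin N m d) (η : Hard m → Vec d) (j : Fin m) : ℂ :=
  mdot (κ.1 (.inr j)) (pAt σ κ.1 (.inr j) + η (.inr j))

/-- Ghost factor. -/
def ghosts (σ : Hard m → ℂ) : ℂ :=
  ((σ (.inl 0) - σ (.inl 1)) * (σ (.inl 1) - σ (.inl 2)) * (σ (.inl 2) - σ (.inl 0))) ^ 2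

theorem kernel_nil (colour : ℂ) (x : Vec d) (σ : Hard m → ℂ) (κ : Kin N m d) :
    kernel colour x σ κ [] = ghosts σ * colour * (exp (I * mdot x (∑ a, κ.1 a)) *
      (∏ r, (σ (.inl 0) - σ (.inl 1))⁻¹ * shiftedFermion σ κ 0 r) *
      ∏ j, (scattering σ κ 0 j)⁻¹) := by
  have h1 : ∀ r, fermionCorr σ κ ([] : List (ℂ × LocalOp N d)) r = shiftedFermion σ κ 0 r := by
    intro r
    simp [fermionCorr, shiftedFermion, shiftedFactors, fermiFactor, fermiEnds, integratedLabels,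
      pTot]
  simp only [kernel, h1, List.map_nil, List.sum_nil, List.prod_nil, add_zero, mul_one, pTot,
    scattering, Pi.zero_apply, ghosts]
  ring

/-- Local operator with source and fermion bilinear of first order in `τ`. -/
def insertOp (N : ℕ) (pre c : ℂ) (v ε s : Vec d) (τ : ℂ) : LocalOp N d where
  pre := pre
  src := τ • v
  cnum := fun _ => c
  fl := fun _ => ε
  fr := fun _ => τ • s

theorem rotationOp_eq (c : ℂ) (ε s : Vec d) (τ : ℂ) (p : Vec d) :
    rotationOp N c 1 ε s τ p = insertOp N c 1 (lorentz ε s p) ε s τ := by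
  simp [rotationOp, insertOp, lorentz]

theorem softVertex_eq (ε s : Vec d) (τ : ℂ) (p : Vec d) :
    softVertex N 1 ε s τ p = insertOp N (1 / mdot s p) (mdot ε p) s ε s τ := by
  simp [softVertex, insertOp]

/-- The extra term in `p` at the puncture of `b` caused by a source `v` at `z`. -/
def poleShift (σ : Hard m → ℂ) (z : ℂ) (v : Vec d) (b : Hard m) : Vec d := (σ b - z)⁻¹ • v

def insertedFermion (ε s : Vec d) (z : ℂ) (σ : Hard m → ℂ) (κ : Kin N m d) (η : Hard m → Vec d)
    (r : Fin N) : ℂ :=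
  wickProdWith (wickInsert (ε, z) (s, z)) (shiftedFactors σ κ η r) (fermiEnds σ κ r)

/-- The source acts only through the phase, the scalar parts of the fermion factors and the
scattering functions. This makes the rotation operator and the soft vertex two cases of one
computation. -/
theorem kernel_insert (colour : ℂ) (x : Vec d) (σ : Hard m → ℂ) (κ : Kin N m d) (z pre c : ℂ)
    (v ε s : Vec d) (τ : ℂ) :
    kernel colour x σ κ [(z, insertOp N pre c v ε s τ)] = ghosts σ * colour * pre *
      (exp (I * (mdot x (∑ a, κ.1 a) + τ * mdot x v)) *
      (∏ r, (σ (.inl 0) - σ (.inl 1))⁻¹ * (c * shiftedFermion σ κ (τ • poleShift σ z v) r +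
        I * (τ * insertedFermion ε s z σ κ (τ • poleShift σ z v) r))) *
      ∏ j, (scattering σ κ (τ • poleShift σ z v) j)⁻¹) := by
  have hp : ∀ b, pTot σ κ.1 [(z, insertOp N pre c v ε s τ)] b =
      pAt σ κ.1 b + (τ • poleShift σ z v) b := by
    intro b
    simp [pTot, insertOp, poleShift, smul_smul, mul_comm]
  have h1 : ∀ r, fermionCorr σ κ [(z, insertOp N pre c v ε s τ)] r =
      c * shiftedFermion σ κ (τ • poleShift σ z v) r +
        I * (τ * insertedFermion ε s z σ κ (τ • poleShift σ z v) r) := by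
    intro r
    simp only [fermionCorr, hp]
    exact wickProd_append_insert c ε s z τ (shiftedFactors σ κ (τ • poleShift σ z v) r) _
  simp only [kernel, h1, hp, List.map_cons, List.map_nil, List.sum_cons, List.sum_nil,
    List.prod_cons, List.prod_nil, add_zero, mul_one, scattering, ghosts, mdot_add_right]
  simp only [insertOp, mdot_smul_right]
  ring

/-- Derivative of a product `E * ∏ A * Q`. -/
def productVar (E E' : ℂ) (A A' : Fin N → ℂ) (Q Q' : ℂ) : ℂ :=
  E' * (∏ r, A r) * Q + E * (∑ r, (∏ r' ∈ univ.erase r, A r') * A' r) * Q + E * (∏ r, A r) * Q'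

theorem hasDerivAt_product {E Q : ℂ → ℂ} {A : ℂ → Fin N → ℂ} {E' Q' t : ℂ} {A' : Fin N → ℂ}
    (hE : HasDerivAt E E' t) (hA : ∀ r, HasDerivAt (fun τ => A τ r) (A' r) t)
    (hQ : HasDerivAt Q Q' t) :
    HasDerivAt (fun τ => E τ * (∏ r, A τ r) * Q τ)
      (productVar (E t) E' (A t) A' (Q t) Q') t := by
  have h := (hE.mul (HasDerivAt.fun_finsetProd (u := univ) fun r _ => hA r)).mul hQ
  refine h.congr_deriv ?_
  simp only [productVar, smul_eq_mul, Pi.mul_apply]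
  ring

/-- Derivative of the product of inverse scattering functions when the `j`-th function varies at
rate `δ j`. -/
def scatteringVar (σ : Hard m → ℂ) (κ : Kin N m d) (δ : Fin m → ℂ) : ℂ :=
  ∑ j, (∏ i ∈ univ.erase j, (scattering σ κ 0 i)⁻¹) * (-δ j / scattering σ κ 0 j ^ 2)

theorem hasDerivAt_scattering {σ : Hard m → ℂ} {κ : Kin N m d} {F : ℂ → Fin m → ℂ} {δ : Fin m → ℂ}
    (h0 : ∀ j, F 0 j = scattering σ κ 0 j) (hne : ∀ j, scattering σ κ 0 j ≠ 0)
    (h : ∀ j, HasDerivAt (fun τ => F τ j) (δ j) 0) :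
    HasDerivAt (fun τ => ∏ j, (F τ j)⁻¹) (scatteringVar σ κ δ) 0 := by
  have h1 := HasDerivAt.fun_finsetProd (u := univ) fun j (_ : j ∈ univ) =>
    (h j).fun_inv (by rw [h0]; exact hne j)
  simpa [scatteringVar, h0] using h1

theorem scatteringVar_linear (σ : Hard m → ℂ) (κ : Kin N m d) :
    IsLinearMap ℂ (scatteringVar σ κ) where
  map_add δ δ' := by
    simp only [scatteringVar, ← Finset.sum_add_distrib, Pi.add_apply]
    exact Finset.sum_congr rfl fun j _ => by ring
  map_smul c δ := by
    simp only [scatteringVar, Pi.smul_apply, smul_eq_mul]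
    rw [Finset.mul_sum]
    exact Finset.sum_congr rfl fun j _ => by ring

def fermionVar (σ : Hard m → ℂ) (κ : Kin N m d) (r : Fin N) (γ : Hard m → ℂ) : ℂ :=
  wickProdVar γ (fermiFactor σ κ r) wick (integratedLabels m) (fermiEnds σ κ r)

theorem wickProdVar_add {β : Type*} {fac : β → ℂ × Vec d × Vec d × ℂ} (γ γ' : β → ℂ)
    (F : List (Vec d × ℂ) → ℂ) (T : List β) : ∀ L,
    wickProdVar (γ + γ') fac F T L = wickProdVar γ fac F T L + wickProdVar γ' fac F T L := by
  induction T with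
  | nil => intro L; simp [wickProdVar]
  | cons t T ih => intro L; simp only [wickProdVar, ih, Pi.add_apply]; ring

theorem wickProdVar_smul {β : Type*} {fac : β → ℂ × Vec d × Vec d × ℂ} (c : ℂ) (γ : β → ℂ)
    (F : List (Vec d × ℂ) → ℂ) (T : List β) : ∀ L,
    wickProdVar (c • γ) fac F T L = c * wickProdVar γ fac F T L := by
  induction T with
  | nil => intro L; simp [wickProdVar]
  | cons t T ih => intro L; simp only [wickProdVar, ih, Pi.smul_apply, smul_eq_mul]; ring

/-- Derivative of the hard kernel under a shift `θ` of the phase and `η` of the field `p`. -/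
def translationVar (x : Vec d) (σ : Hard m → ℂ) (κ : Kin N m d) :
    ℂ × (Hard m → Vec d) →ₗ[ℂ] ℂ where
  toFun p := productVar (exp (I * mdot x (∑ a, κ.1 a))) (exp (I * mdot x (∑ a, κ.1 a)) * (I * p.1))
    (fun r => (σ (.inl 0) - σ (.inl 1))⁻¹ * shiftedFermion σ κ 0 r)
    (fun r => (σ (.inl 0) - σ (.inl 1))⁻¹ * fermionVar σ κ r fun b => mdot (κ.2 r b) (p.2 b))
    (∏ j, (scattering σ κ 0 j)⁻¹)
    (scatteringVar σ κ fun j => mdot (κ.1 (.inr j)) (p.2 (.inr j)))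
  map_add' p q := by
    have h1 : (fun j => mdot (κ.1 (.inr j)) ((p + q).2 (.inr j))) =
        (fun j => mdot (κ.1 (.inr j)) (p.2 (.inr j))) +
          fun j => mdot (κ.1 (.inr j)) (q.2 (.inr j)) :=
      funext fun j => mdot_add_right _ _ _
    have h2 : ∀ r, (fun b => mdot (κ.2 r b) ((p + q).2 b)) =
        (fun b => mdot (κ.2 r b) (p.2 b)) + fun b => mdot (κ.2 r b) (q.2 b) :=
      fun r => funext fun b => mdot_add_right _ _ _
    simp only [productVar, h1, (scatteringVar_linear σ κ).map_add, h2, fermionVar,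
      wickProdVar_add, mul_add, Finset.sum_add_distrib, Prod.fst_add]
    ring
  map_smul' c p := by
    have h1 : (fun j => mdot (κ.1 (.inr j)) ((c • p).2 (.inr j))) =
        c • fun j => mdot (κ.1 (.inr j)) (p.2 (.inr j)) :=
      funext fun j => mdot_smul_right _ _ _
    have h2 : ∀ r, (fun b => mdot (κ.2 r b) ((c • p).2 b)) =
        c • fun b => mdot (κ.2 r b) (p.2 b) :=
      fun r => funext fun b => mdot_smul_right _ _ _
    have h3 : ∀ f g : Fin N → ℂ, ∑ r, f r * ((σ (.inl 0) - σ (.inl 1))⁻¹ * (c * g r)) =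
        c * ∑ r, f r * ((σ (.inl 0) - σ (.inl 1))⁻¹ * g r) := fun f g => by
      rw [Finset.mul_sum]; exact Finset.sum_congr rfl fun r _ => by ring
    simp only [productVar, h1, (scatteringVar_linear σ κ).map_smul, h2, fermionVar,
      wickProdVar_smul, h3, Prod.smul_fst, smul_eq_mul, RingHom.id_apply]
    ring

/-- Contribution of an inserted fermion bilinear at first order. -/
def bilinearVar (x ε s : Vec d) (z : ℂ) (σ : Hard m → ℂ) (κ : Kin N m d) : ℂ :=
  exp (I * mdot x (∑ a, κ.1 a)) * (∑ r, (∏ r' ∈ univ.erase r,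
    (σ (.inl 0) - σ (.inl 1))⁻¹ * shiftedFermion σ κ 0 r') *
      ((σ (.inl 0) - σ (.inl 1))⁻¹ * (I * insertedFermion ε s z σ κ 0 r))) *
    ∏ j, (scattering σ κ 0 j)⁻¹

theorem hasDerivAt_mdot_shift (e p v : Vec d) :
    HasDerivAt (fun τ : ℂ => mdot e (p + τ • v)) (mdot e v) 0 := by
  simp only [mdot_add_right, mdot_smul_right]
  simpa using ((hasDerivAt_id (0 : ℂ)).mul_const (mdot e v)).const_add (mdot e p)

theorem shiftedFactors_zero (σ : Hard m → ℂ) (κ : Kin N m d) (r : Fin N) :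
    shiftedFactors σ κ 0 r = (integratedLabels m).map (fermiFactor σ κ r) := by
  simp [shiftedFactors, fermiFactor]

theorem hasDerivAt_shiftedFactors (F : List (Vec d × ℂ) → ℂ) (σ : Hard m → ℂ) (κ : Kin N m d)
    (η : Hard m → Vec d) (r : Fin N) :
    HasDerivAt (fun τ : ℂ => wickProdWith F (shiftedFactors σ κ (τ • η) r) (fermiEnds σ κ r))
      (wickProdVar (fun b => mdot (κ.2 r b) (η b)) (fermiFactor σ κ r) F (integratedLabels m)
        (fermiEnds σ κ r)) 0 :=
  hasDerivAt_wickProdWith_scalar F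
    (C := fun τ b => mdot (κ.2 r b) (pAt σ κ.1 b + τ • η b)) (by simp [fermiFactor])
    (fun b => hasDerivAt_mdot_shift _ _ _) _ _

/-- First order term of an inserted operator. -/
theorem hasDerivAt_kernel_insert (colour : ℂ) (x : Vec d) {σ : Hard m → ℂ} {κ : Kin N m d}
    (hne : ∀ j, scattering σ κ 0 j ≠ 0) (z pre c : ℂ) (v ε s : Vec d) :
    HasDerivAt (fun τ => kernel colour x σ κ [(z, insertOp N pre c v ε s τ)])
      (ghosts σ * colour * pre * (c ^ N * translationVar x σ κ (mdot x v, poleShift σ z v) +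
        c ^ (N - 1) * bilinearVar x ε s z σ κ)) 0 := by
  simp only [kernel_insert]
  have hE : HasDerivAt (fun τ : ℂ => exp (I * (mdot x (∑ a, κ.1 a) + τ * mdot x v)))
      (exp (I * mdot x (∑ a, κ.1 a)) * (I * mdot x v)) 0 := by
    have := (((hasDerivAt_id (0 : ℂ)).mul_const (mdot x v)).const_add
      (mdot x (∑ a, κ.1 a))).const_mul I |>.cexp
    simpa using this
  have hA : ∀ r, HasDerivAt (fun τ : ℂ => (σ (.inl 0) - σ (.inl 1))⁻¹ *
      (c * shiftedFermion σ κ (τ • poleShift σ z v) r +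
        I * (τ * insertedFermion ε s z σ κ (τ • poleShift σ z v) r)))
      ((σ (.inl 0) - σ (.inl 1))⁻¹ *
        (c * (fermionVar σ κ r fun b => mdot (κ.2 r b) (poleShift σ z v b)) +
        I * insertedFermion ε s z σ κ 0 r)) 0 := by
    intro r
    have h1 := hasDerivAt_shiftedFactors wick σ κ (poleShift σ z v) r
    have h2 := hasDerivAt_shiftedFactors (wickInsert (ε, z) (s, z)) σ κ (poleShift σ z v) r
    have h3 := ((h1.const_mul c).add (((hasDerivAt_id (0 : ℂ)).mul h2).const_mul I)).const_mul
      (σ (.inl 0) - σ (.inl 1))⁻¹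
    simp only [shiftedFermion, wickProd_eq, insertedFermion]
    refine h3.congr_deriv ?_
    simp [fermionVar]
  have hQ : HasDerivAt (fun τ : ℂ => ∏ j, (scattering σ κ (τ • poleShift σ z v) j)⁻¹)
      (scatteringVar σ κ fun j => mdot (κ.1 (.inr j)) (poleShift σ z v (.inr j))) 0 :=
    hasDerivAt_scattering (fun j => by simp) hne fun j => hasDerivAt_mdot_shift _ _ _
  refine ((hasDerivAt_product hE hA hQ).const_mul (ghosts σ * colour * pre)).congr_deriv ?_
  congr 1
  simp only [zero_mul, add_zero, zero_smul, mul_zero, translationVar, LinearMap.coe_mk,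
    AddHom.coe_mk, productVar, bilinearVar]
  -- Each fermion system without the bilinear contributes a factor `c`: `N` of them when only `p` is
  -- shifted, `N - 1` when one system carries the bilinear.
  have h1 : ∀ t : Finset (Fin N), ∏ r ∈ t, (σ (.inl 0) - σ (.inl 1))⁻¹ *
      (c * shiftedFermion σ κ 0 r) =
      c ^ t.card * ∏ r ∈ t, (σ (.inl 0) - σ (.inl 1))⁻¹ * shiftedFermion σ κ 0 r := by
    intro t
    rw [← Finset.prod_const, ← Finset.prod_mul_distrib]
    exact Finset.prod_congr rfl fun r _ => by ring
  -- The index `r` is an argument because it guarantees `N ≠ 0`, without which the truncated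
  -- exponent would be wrong.
  have h2 : ∀ r : Fin N, c ^ N = c ^ (N - 1) * c := fun r => by
    rw [← pow_succ, Nat.sub_add_cancel r.pos]
  simp only [h1, Finset.card_erase_of_mem (Finset.mem_univ _), Finset.card_univ, Fintype.card_fin]
  have h3 : (∑ r, (c ^ (N - 1) * ∏ r' ∈ univ.erase r,
        (σ (.inl 0) - σ (.inl 1))⁻¹ * shiftedFermion σ κ 0 r') *
      ((σ (.inl 0) - σ (.inl 1))⁻¹ *
        (c * (fermionVar σ κ r fun b => mdot (κ.2 r b) (poleShift σ z v b)) +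
        I * insertedFermion ε s z σ κ 0 r))) =
      c ^ N * ∑ r, (∏ r' ∈ univ.erase r,
        (σ (.inl 0) - σ (.inl 1))⁻¹ * shiftedFermion σ κ 0 r') *
        ((σ (.inl 0) - σ (.inl 1))⁻¹ *
          fermionVar σ κ r fun b => mdot (κ.2 r b) (poleShift σ z v b)) +
      c ^ (N - 1) * ∑ r, (∏ r' ∈ univ.erase r,
        (σ (.inl 0) - σ (.inl 1))⁻¹ * shiftedFermion σ κ 0 r') *
        ((σ (.inl 0) - σ (.inl 1))⁻¹ * (I * insertedFermion ε s z σ κ 0 r)) := by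
    rw [Finset.mul_sum, Finset.mul_sum, ← Finset.sum_add_distrib]
    refine Finset.sum_congr rfl fun r _ => ?_
    rw [h2 r]
    ring
  rw [h3]
  ring

/-- Weighted Lorentz transformation of all momenta and polarisations. -/
def boostDirection (ε s : Vec d) (z : ℂ) (σ : Hard m → ℂ) (κ : Kin N m d) : Kin N m d :=
  (fun a => (z - σ a)⁻¹ • lorentz ε s (κ.1 a), fun r a => (z - σ a)⁻¹ • lorentz ε s (κ.2 r a))

theorem pAt_add_smul (σ : Hard m → ℂ) (k v : Hard m → Vec d) (t : ℂ) (b : Hard m) :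
    pAt σ (k + t • v) b = pAt σ k b + t • pAt σ v b := by
  simp only [pAt, Pi.add_apply, Pi.smul_apply, smul_add, Finset.sum_add_distrib, Finset.smul_sum]
  congr 1
  exact Finset.sum_congr rfl fun a _ => smul_comm _ _ _

/-- Partial fractions of a contraction with the Lorentz transform of `p(z)`. -/
theorem mdot_poleShift_lorentz {σ : Hard m → ℂ} (hσ : Function.Injective σ) {z : ℂ}
    (hz : ∀ a, σ a ≠ z) (ε s e : Vec d) (k : Hard m → Vec d) (b : Hard m) :
    mdot e (poleShift σ z (lorentz ε s (pField σ k z)) b) =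
      (z - σ b)⁻¹ * mdot (lorentz ε s e) (pAt σ k b) +
        mdot e (pAt σ (fun a => (z - σ a)⁻¹ • lorentz ε s (k a)) b) +
        mdot (lorentz ε s e) (k b) * ((z - σ b)⁻¹) ^ 2 := by
  have hb : z - σ b ≠ 0 := sub_ne_zero.2 (hz b).symm
  have hb' : σ b - z ≠ 0 := sub_ne_zero.2 (hz b)
  simp only [poleShift, pField, pAt, lorentz_sum, lorentz_smul, mdot_smul_right, mdot_sum_right,
    mdot_lorentz_right]
  rw [← Finset.add_sum_erase _ _ (Finset.mem_univ b), mul_add, Finset.mul_sum, Finset.mul_sum,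
    ← Finset.sum_add_distrib, add_comm]
  congr 1
  · refine Finset.sum_congr rfl fun a ha => ?_
    have h1 : z - σ a ≠ 0 := sub_ne_zero.2 (hz a).symm
    have h2 : σ b - σ a ≠ 0 := sub_ne_zero.2 fun h => (Finset.ne_of_mem_erase ha) (hσ h).symm
    field_simp
    ring
  · field_simp
    ring

/-- The Ward identity at the level of integrands: a rotation by `p(z)` acts on the hard particles
with weights `1 / (z - σ_a)`. -/
theorem hasDerivAt_kernel_boost (colour : ℂ) (x : Vec d) {σ : Hard m → ℂ} {κ : Kin N m d}
    (hσ : Function.Injective σ) (hne : ∀ j, scattering σ κ 0 j ≠ 0) {z : ℂ} (hz : ∀ a, σ a ≠ z)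
    (ε s : Vec d) :
    HasDerivAt (fun t : ℂ => kernel colour x σ (κ + t • boostDirection ε s z σ κ) [])
      (ghosts σ * colour * (translationVar x σ κ (mdot x (lorentz ε s (pField σ κ.1 z)),
        poleShift σ z (lorentz ε s (pField σ κ.1 z))) + bilinearVar x ε s z σ κ)) 0 := by
  simp only [kernel_nil]
  set P := lorentz ε s (pField σ κ.1 z) with hP
  have hk : ∀ t : ℂ, (κ + t • boostDirection ε s z σ κ).1 =
      κ.1 + t • fun a => (z - σ a)⁻¹ • lorentz ε s (κ.1 a) := fun t => rfl
  have hE : HasDerivAt (fun t : ℂ =>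
      exp (I * mdot x (∑ a, (κ + t • boostDirection ε s z σ κ).1 a)))
      (exp (I * mdot x (∑ a, κ.1 a)) * (I * mdot x P)) 0 := by
    have h1 : ∀ t : ℂ, mdot x (∑ a, (κ + t • boostDirection ε s z σ κ).1 a) =
        mdot x (∑ a, κ.1 a) + t * mdot x P := by
      intro t
      simp only [hk, Pi.add_apply, Pi.smul_apply, Finset.sum_add_distrib, mdot_add_right,
        ← Finset.smul_sum, mdot_smul_right]
      congr 3
      simp only [hP, pField, lorentz_sum, lorentz_smul]
    simp only [h1]
    have := (((hasDerivAt_id (0 : ℂ)).mul_const (mdot x P)).const_add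
      (mdot x (∑ a, κ.1 a))).const_mul I |>.cexp
    simpa using this
  have hC : ∀ (e : Vec d) (b : Hard m), HasDerivAt (fun t : ℂ =>
      mdot (e + t • (z - σ b)⁻¹ • lorentz ε s e)
        (pAt σ (κ + t • boostDirection ε s z σ κ).1 b))
      ((z - σ b)⁻¹ * mdot (lorentz ε s e) (pAt σ κ.1 b) +
        mdot e (pAt σ (fun a => (z - σ a)⁻¹ • lorentz ε s (κ.1 a)) b)) 0 := by
    intro e b
    simp only [hk, pAt_add_smul, mdot_add_left, mdot_smul_left]
    have h1 := hasDerivAt_mdot_shift e (pAt σ κ.1 b)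
      (pAt σ (fun a => (z - σ a)⁻¹ • lorentz ε s (κ.1 a)) b)
    have h2 := hasDerivAt_mdot_shift (lorentz ε s e) (pAt σ κ.1 b)
      (pAt σ (fun a => (z - σ a)⁻¹ • lorentz ε s (κ.1 a)) b)
    have h3 := h1.add ((hasDerivAt_id (0 : ℂ)).mul (h2.const_mul (z - σ b)⁻¹))
    refine h3.congr_deriv ?_
    simp
    ring
  have hA : ∀ r, HasDerivAt (fun t : ℂ => (σ (.inl 0) - σ (.inl 1))⁻¹ *
      shiftedFermion σ (κ + t • boostDirection ε s z σ κ) 0 r)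
      ((σ (.inl 0) - σ (.inl 1))⁻¹ *
        ((fermionVar σ κ r fun b => mdot (κ.2 r b) (poleShift σ z P b)) +
        I * insertedFermion ε s z σ κ 0 r)) 0 := by
    intro r
    refine HasDerivAt.const_mul _ ?_
    have h1 := hasDerivAt_wickProd_boost (fac := fermiFactor σ κ r) ε s z
      (C := fun t b => mdot (κ.2 r b + t • (z - σ b)⁻¹ • lorentz ε s (κ.2 r b))
        (pAt σ (κ + t • boostDirection ε s z σ κ).1 b))
      (fun b => by simp [fermiFactor]) (fun b => hC _ b) (integratedLabels m)
      (κ.2 r (.inl 0), σ (.inl 0)) (κ.2 r (.inl 1), σ (.inl 1))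
      ((integratedLabels_nodup m).imp fun hab h => hab (hσ h)) (fun b _ => hz b)
      (hz _) (hz _) (fun h => by simpa using hσ h)
      (fun b hb h => (ne_of_mem_integratedLabels hb).1 (hσ h))
      (fun b hb h => (ne_of_mem_integratedLabels hb).2 (hσ h))
    refine (h1.congr_of_eventuallyEq (Filter.Eventually.of_forall fun t => ?_)).congr_deriv ?_
    · rw [shiftedFermion, shiftedFactors_zero]
      rfl
    · rw [fermionVar, insertedFermion, shiftedFactors_zero]
      congr 1
      refine wickProdVar_congr _ _ _ fun b _ => ?_
      -- The double pole left by the coincident contractions is the self-term of the partial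
      -- fractions, so the two variations of `ε·p` agree.
      rw [hP, mdot_poleShift_lorentz hσ hz]
      rfl
  have hQ : HasDerivAt (fun t : ℂ =>
      ∏ j, (scattering σ (κ + t • boostDirection ε s z σ κ) 0 j)⁻¹)
      (scatteringVar σ κ fun j => mdot (κ.1 (.inr j)) (poleShift σ z P (.inr j))) 0 := by
    refine hasDerivAt_scattering (fun j => by simp) hne fun j => ?_
    have h1 := hC (κ.1 (.inr j)) (.inr j)
    -- The scattering functions have no bilinear to compensate a double pole, and need none: the
    -- self-term vanishes by antisymmetry of the Lorentz map.
    have h2 : mdot (lorentz ε s (κ.1 (.inr j))) (κ.1 (.inr j)) = 0 := by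
      rw [mdot_lorentz_left]; ring
    rw [hP, mdot_poleShift_lorentz hσ hz, h2, zero_mul, add_zero]
    simpa [scattering] using! h1
  refine ((hasDerivAt_product hE hA hQ).const_mul (ghosts σ * colour)).congr_deriv ?_
  congr 1
  simp only [zero_smul, add_zero, translationVar, LinearMap.coe_mk, AddHom.coe_mk, productVar,
    bilinearVar, mul_add, Finset.sum_add_distrib]
  ring

end HardKernel

/-! ### Sums of simple poles and their residues -/

section PoleSums

variable {ι : Type*} [Fintype ι]

/-- `∑ₐ f_a / (z - σ_a)`. -/
def poleSum (σ : ι → ℂ) (f : ι → ℂ) (z : ℂ) : ℂ := ∑ a, (z - σ a)⁻¹ * f a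

theorem eventually_ne_punctures {σ : ι → ℂ} (hσ : Function.Injective σ) (b : ι) :
    ∀ᶠ z in 𝓝[≠] (σ b), ∀ a, σ a ≠ z := by
  refine Filter.eventually_all.2 fun a => ?_
  rcases eq_or_ne a b with rfl | h
  · filter_upwards [self_mem_nhdsWithin] with z hz using Ne.symm hz
  · have h1 : ∀ᶠ z in 𝓝 (σ b), z ≠ σ a := isOpen_ne.mem_nhds (hσ.ne h.symm)
    exact (h1.filter_mono nhdsWithin_le_nhds).mono fun z hz => Ne.symm hz

variable [DecidableEq ι]

/-- The part that is analytic at the puncture of `b`. -/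
def poleRest (σ : ι → ℂ) (f : ι → ℂ) (b : ι) (z : ℂ) : ℂ := ∑ a ∈ univ.erase b, (z - σ a)⁻¹ * f a

/-- The pole sum times `z - σ b`, with the removable singularity filled in. -/
def poleNum (σ : ι → ℂ) (f : ι → ℂ) (b : ι) (z : ℂ) : ℂ := f b + (z - σ b) * poleRest σ f b z

theorem poleSum_eq_rest (σ f : ι → ℂ) (b : ι) (z : ℂ) :
    poleSum σ f z = (z - σ b)⁻¹ * f b + poleRest σ f b z :=
  (Finset.add_sum_erase _ _ (Finset.mem_univ b)).symm

theorem poleSum_eq_num (σ f : ι → ℂ) {b : ι} {z : ℂ} (hz : z ≠ σ b) :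
    poleSum σ f z = (z - σ b)⁻¹ * poleNum σ f b z := by
  have := sub_ne_zero.2 hz
  rw [poleSum_eq_rest σ f b, poleNum]
  field_simp

theorem analyticAt_poleRest {σ : ι → ℂ} (hσ : Function.Injective σ) (f : ι → ℂ) (b : ι) :
    AnalyticAt ℂ (poleRest σ f b) (σ b) := by
  refine Finset.analyticAt_fun_sum _ fun a ha => AnalyticAt.mul ?_ analyticAt_const
  refine AnalyticAt.inv (analyticAt_id.sub analyticAt_const) ?_
  exact sub_ne_zero.2 fun h => Finset.ne_of_mem_erase ha (hσ h).symm

theorem analyticAt_poleNum {σ : ι → ℂ} (hσ : Function.Injective σ) (f : ι → ℂ) (b : ι) :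
    AnalyticAt ℂ (poleNum σ f b) (σ b) :=
  analyticAt_const.add ((analyticAt_id.sub analyticAt_const).mul (analyticAt_poleRest hσ f b))

@[simp] theorem poleNum_self (σ f : ι → ℂ) (b : ι) : poleNum σ f b (σ b) = f b := by
  simp [poleNum]

theorem eventually_poleSum_ne {σ g : ι → ℂ} (hσ : Function.Injective σ) {b : ι} (hg : g b ≠ 0) :
    ∀ᶠ z in 𝓝[≠] (σ b), poleSum σ g z ≠ 0 := by
  have h1 : ∀ᶠ z in 𝓝 (σ b), poleNum σ g b z ≠ 0 :=
    (analyticAt_poleNum hσ g b).continuousAt.eventually_ne (by simpa using hg)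
  filter_upwards [h1.filter_mono nhdsWithin_le_nhds, self_mem_nhdsWithin] with z h2 h3
  rw [poleSum_eq_num σ g h3]
  exact mul_ne_zero (inv_ne_zero (sub_ne_zero.2 h3)) h2

/-- The poles of the first two sums cancel in the quotient, which is then regular with value `f b /
g b`; the third sum supplies the simple pole. -/
theorem hasResidue_quotient_mul {σ f g h : ι → ℂ} (hσ : Function.Injective σ) {b : ι}
    (hg : g b ≠ 0) :
    HasResidue (fun z => poleSum σ f z / poleSum σ g z * poleSum σ h z) (σ b)
      (f b / g b * h b) := by
  have h1 := HasResidue.simplePole (((analyticAt_poleNum hσ f b).div (analyticAt_poleNum hσ g b)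
    (by simpa using hg)).mul (analyticAt_poleNum hσ h b))
  simp only [Pi.mul_apply, Pi.div_apply, poleNum_self] at h1
  refine h1.congr ?_
  filter_upwards [self_mem_nhdsWithin] with z hz
  have := sub_ne_zero.2 hz
  rw [poleSum_eq_num σ f hz, poleSum_eq_num σ g hz, poleSum_eq_num σ h hz,
    mul_div_mul_left _ _ (inv_ne_zero this)]
  ring

/-- The residues of a product of pole sums that vanishes fast enough at infinity. -/
theorem exists_hasResidue_product {σ e B : ι → ℂ} (hσ : Function.Injective σ) (A : ℂ)
    (he : ∑ a, e a = 0) : ∃ R : ι → ℂ, ∑ b, R b = 0 ∧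
      ∀ b, HasResidue (fun z => poleSum σ e z * (A + poleSum σ B z)) (σ b) (R b) := by
  -- The residue is read off from the Laurent expansions; its term `a = b` is zero because `0⁻¹ =
  -- 0`. In the sum over `b` the first part vanishes with `∑ e`, and the double sum is antisymmetric
  -- in `a` and `b`.
  refine ⟨fun b => e b * A + ∑ a, (σ b - σ a)⁻¹ * (e b * B a + B b * e a), ?_, fun b => ?_⟩
  · have h1 : ∑ b, ∑ a, (σ b - σ a)⁻¹ * (e b * B a + B b * e a) = 0 := by
      have h2 := Finset.sum_comm (s := univ) (t := univ)
        (f := fun b a => (σ b - σ a)⁻¹ * (e b * B a + B b * e a))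
      have h3 : ∑ a, ∑ b, (σ b - σ a)⁻¹ * (e b * B a + B b * e a) =
          -∑ b, ∑ a, (σ b - σ a)⁻¹ * (e b * B a + B b * e a) := by
        rw [← Finset.sum_neg_distrib]
        refine Finset.sum_congr rfl fun a _ => ?_
        rw [← Finset.sum_neg_distrib]
        refine Finset.sum_congr rfl fun b _ => ?_
        rw [← neg_sub (σ a), inv_neg]
        ring
      rw [h3] at h2
      linear_combination h2 / 2
    rw [Finset.sum_add_distrib, ← Finset.sum_mul, he, h1]
    ring
  · have hR : e b * A + ∑ a, (σ b - σ a)⁻¹ * (e b * B a + B b * e a) =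
        0 + (e b * A + e b * poleRest σ B b (σ b) + B b * poleRest σ e b (σ b)) + 0 := by
      rw [← Finset.add_sum_erase _ _ (Finset.mem_univ b), poleRest, poleRest, Finset.mul_sum,
        Finset.mul_sum]
      simp only [sub_self, inv_zero, zero_mul, zero_add, add_zero]
      rw [add_assoc, ← Finset.sum_add_distrib]
      congr 1
      exact Finset.sum_congr rfl fun a _ => by ring
    have hB := analyticAt_poleRest hσ B b
    have he' := analyticAt_poleRest hσ e b
    have h1 := ((HasResidue.doublePole (e b * B b) (σ b)).add
      (HasResidue.simplePole (((analyticAt_const (v := e b * A)).fun_add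
        ((analyticAt_const (v := e b)).fun_mul hB)).fun_add
        ((analyticAt_const (v := B b)).fun_mul he')))).add
      (HasResidue.regular (he'.fun_mul ((analyticAt_const (v := A)).fun_add hB)))
    simp only [hR]
    refine h1.congr ?_
    filter_upwards [self_mem_nhdsWithin] with z hz
    have := sub_ne_zero.2 hz
    rw [poleSum_eq_rest σ e b, poleSum_eq_rest σ B b]
    field_simp
    ring

end PoleSums

/-! ### Soft insertions as sums of poles -/

section SoftResidues

variable {N m d : ℕ}

/-- Lorentz transformation of the data of one particle. -/
def boostOne (ε s : Vec d) (κ : Kin N m d) (a : Hard m) : Kin N m d :=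
  (Pi.single a (lorentz ε s (κ.1 a)), fun r => Pi.single a (lorentz ε s (κ.2 r a)))

theorem boostDirection_eq_sum (ε s : Vec d) (z : ℂ) (σ : Hard m → ℂ) (κ : Kin N m d) :
    boostDirection ε s z σ κ = ∑ a, (z - σ a)⁻¹ • boostOne ε s κ a := by
  have h1 : ∀ f : Hard m → Vec d, (fun a => (z - σ a)⁻¹ • f a) =
      ∑ a, (z - σ a)⁻¹ • (Pi.single a (f a) : Hard m → Vec d) := by
    intro f
    simp only [← Pi.single_smul]
    exact (Finset.univ_sum_single _).symm
  refine Prod.ext ?_ (funext fun r => ?_)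
  · rw [Prod.fst_sum]
    exact h1 _
  · rw [Prod.snd_sum, Finset.sum_apply]
    exact h1 _

theorem mdot_pField (v : Vec d) (σ : Hard m → ℂ) (k : Hard m → Vec d) (z : ℂ) :
    mdot v (pField σ k z) = poleSum σ (fun a => mdot v (k a)) z := by
  simp only [pField, mdot_sum_right, mdot_smul_right, poleSum]

theorem kernel_colour_mul (c colour : ℂ) (x : Vec d) (σ : Hard m → ℂ) (κ : Kin N m d)
    (ins : List (ℂ × LocalOp N d)) :
    kernel (colour * c) x σ κ ins = c * kernel colour x σ κ ins := by
  simp only [kernel]; ring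

/-- The derivative is linear in its direction, so the weighted boost splits into simple poles in `z`
whose residues are the Lorentz derivatives of single particles. -/
theorem sum_fderiv_boostOne {colour : ℂ} {x : Vec d} {σ : Hard m → ℂ} {κ : Kin N m d}
    (hσ : Function.Injective σ) (hne : ∀ j, scattering σ κ 0 j ≠ 0)
    (hd : DifferentiableAt ℂ (fun κ => kernel colour x σ κ []) κ) (ε s : Vec d) {z : ℂ}
    (hz : ∀ a, σ a ≠ z) :
    poleSum σ (fun a => fderiv ℂ (fun κ => kernel colour x σ κ []) κ (boostOne ε s κ a)) z =
      ghosts σ * colour * (translationVar x σ κ (mdot x (lorentz ε s (pField σ κ.1 z)),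
        poleShift σ z (lorentz ε s (pField σ κ.1 z))) + bilinearVar x ε s z σ κ) := by
  have h1 := hasDerivAt_kernel_boost colour x hσ hne hz ε s
  have h2 : HasDerivAt (fun t : ℂ => κ + t • boostDirection ε s z σ κ)
      (boostDirection ε s z σ κ) 0 := by
    simpa using ((hasDerivAt_id (0 : ℂ)).smul_const (boostDirection ε s z σ κ)).const_add κ
  have h3 := HasFDerivAt.comp_hasDerivAt (f := fun t : ℂ => κ + t • boostDirection ε s z σ κ)
    (l := fun κ => kernel colour x σ κ []) 0 (by simpa using hd.hasFDerivAt) h2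
  rw [h1.unique h3, boostDirection_eq_sum, map_sum]
  simp only [map_smul, smul_eq_mul, poleSum]

/-- Inserting the rotation and boosting the hard data yield the same translation and bilinear terms;
the insertion only carries the extra prefactor `c`. -/
theorem softTerm_rotationOp {colour : ℂ} {x : Vec d} {σ : Hard m → ℂ} {κ : Kin N m d}
    (hσ : Function.Injective σ) (hne : ∀ j, scattering σ κ 0 j ≠ 0)
    (hd : DifferentiableAt ℂ (fun κ => kernel colour x σ κ []) κ) (ε s : Vec d) {z : ℂ}
    (hz : ∀ a, σ a ≠ z) (c : ℂ) :
    softTerm 1 (fun τ => kernel colour x σ κ [(z, rotationOp N c 1 ε s τ (pField σ κ.1 z))]) =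
      c * poleSum σ (fun a => fderiv ℂ (fun κ => kernel colour x σ κ []) κ (boostOne ε s κ a))
        z := by
  rw [softTerm_one, sum_fderiv_boostOne hσ hne hd ε s hz]
  simp only [rotationOp_eq]
  rw [(hasDerivAt_kernel_insert colour x hne z c 1 _ ε s).deriv]
  simp only [one_pow, one_mul]
  ring

/-- Response of the kernel to a shift of `p` by a pole at `σ_a`. -/
def translationResponse (colour : ℂ) (x ε : Vec d) (σ : Hard m → ℂ) (κ : Kin N m d) (a : Hard m) :
    ℂ :=
  ghosts σ * colour * translationVar x σ κ (0, -Pi.single a ε)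

theorem translationVar_poleShift (x ε : Vec d) (σ : Hard m → ℂ) (κ : Kin N m d) (z : ℂ) :
    translationVar x σ κ (mdot x ε, poleShift σ z ε) = translationVar x σ κ (mdot x ε, 0) +
      poleSum σ (fun a => translationVar x σ κ (0, -Pi.single a ε)) z := by
  have h1 : (mdot x ε, poleShift σ z ε) = ((mdot x ε, 0) : ℂ × (Hard m → Vec d)) +
      ∑ a, (z - σ a)⁻¹ • ((0, -Pi.single a ε) : ℂ × (Hard m → Vec d)) := by
    refine Prod.ext ?_ ?_
    · simp [Prod.fst_sum]
    · simp only [Prod.snd_add, Prod.snd_sum, Prod.smul_snd, zero_add]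
      rw [← Finset.univ_sum_single (poleShift σ z ε)]
      refine Finset.sum_congr rfl fun a _ => ?_
      rw [← Pi.single_neg, ← Pi.single_smul, poleShift, smul_neg, ← neg_smul, ← inv_neg, neg_sub]
  rw [h1, map_add, map_sum]
  simp only [map_smul, smul_eq_mul, poleSum]

/-- The source of the rotation is `(ε·p) s - (s·p) ε`. Its first piece, like the bilinear,
reproduces the vertex operator; in the second the factor `s·p` cancels the pole of the prefactor.
The surplus is therefore a power of `ε·p` times a translation response, with no `s·p` in the
denominator. -/
theorem softTerm_softVertex (hN : N ≠ 0) {colour : ℂ} {x : Vec d} {σ : Hard m → ℂ} {κ : Kin N m d}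
    (hσ : Function.Injective σ) (hne : ∀ j, scattering σ κ 0 j ≠ 0)
    (hd : DifferentiableAt ℂ (fun κ => kernel colour x σ κ []) κ) (ε s : Vec d) {z : ℂ}
    (hz : ∀ a, σ a ≠ z) (hs : mdot s (pField σ κ.1 z) ≠ 0) :
    softTerm 1 (fun τ => kernel colour x σ κ [(z, softVertex N 1 ε s τ (pField σ κ.1 z))]) =
      softTerm 1 (fun τ => kernel colour x σ κ [(z, rotationOp N
        (mdot ε (pField σ κ.1 z) ^ (N - 1) / mdot s (pField σ κ.1 z)) 1 ε s τ
          (pField σ κ.1 z))]) +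
      mdot ε (pField σ κ.1 z) ^ (N - 1) * (ghosts σ * colour * translationVar x σ κ (mdot x ε, 0) +
        poleSum σ (translationResponse colour x ε σ κ) z) := by
  rw [softTerm_rotationOp hσ hne hd ε s hz, sum_fderiv_boostOne hσ hne hd ε s hz, softTerm_one]
  simp only [softVertex_eq]
  rw [(hasDerivAt_kernel_insert colour x hne z _ _ _ ε s).deriv]
  set p := pField σ κ.1 z
  have h1 : translationVar x σ κ (mdot x (lorentz ε s p), poleShift σ z (lorentz ε s p)) =
      mdot ε p * translationVar x σ κ (mdot x s, poleShift σ z s) -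
        mdot s p * translationVar x σ κ (mdot x ε, poleShift σ z ε) := by
    rw [← smul_eq_mul, ← smul_eq_mul, ← map_smul, ← map_smul, ← map_sub]
    congr 1
    refine Prod.ext ?_ (funext fun b => ?_)
    · simp [lorentz, mdot_sub_right, mdot_smul_right]
    · simp only [poleShift, lorentz, Prod.snd_sub, Prod.smul_snd, Pi.sub_apply, Pi.smul_apply,
        smul_sub]
      rw [smul_comm, smul_comm (σ b - z)⁻¹ (mdot s p)]
  have h2 : poleSum σ (translationResponse colour x ε σ κ) z = ghosts σ * colour *
      poleSum σ (fun a => translationVar x σ κ (0, -Pi.single a ε)) z := by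
    simp only [poleSum, translationResponse, Finset.mul_sum]
    exact Finset.sum_congr rfl fun a _ => by ring
  rw [h1, h2, ← mul_add, ← translationVar_poleShift]
  obtain ⟨n, rfl⟩ := Nat.exists_eq_succ_of_ne_zero hN
  simp only [Nat.succ_sub_one, pow_succ]
  field_simp
  ring

theorem kernel_softVertex_zero (colour : ℂ) (x : Vec d) (σ : Hard m → ℂ) (κ : Kin N m d)
    (ε s p : Vec d) (z : ℂ) :
    kernel colour x σ κ [(z, softVertex N 1 ε s 0 p)] =
      mdot ε p ^ N / mdot s p * kernel colour x σ κ [] := by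
  rw [softVertex_eq, kernel_insert, kernel_nil]
  simp only [zero_mul, add_zero, zero_smul, mul_zero]
  have : ∏ r : Fin N, (σ (.inl 0) - σ (.inl 1))⁻¹ * (mdot ε p * shiftedFermion σ κ 0 r) =
      mdot ε p ^ N * ∏ r, (σ (.inl 0) - σ (.inl 1))⁻¹ * shiftedFermion σ κ 0 r := by
    have h : mdot ε p ^ N = ∏ _r : Fin N, mdot ε p := by simp
    rw [h, ← Finset.prod_mul_distrib]
    exact Finset.prod_congr rfl fun r _ => by ring
  rw [this]
  ring

end SoftResidues

/-! ### Residue sums for soft gravitons -/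

section SoftSums

variable {m d : ℕ}

variable {colour : ℂ} {x : Vec d} {σ : Hard m → ℂ} {ε s : Vec d}

theorem residue_graviton_zero {κ : Kin 2 m d} (hσ : Function.Injective σ)
    (hs : ∀ a, mdot s (κ.1 a) ≠ 0) :
    ∑ b, residueAt (fun z => softTerm 0 fun τ =>
      kernel colour x σ κ [(z, softVertex 2 1 ε s τ (pField σ κ.1 z))]) (σ b) =
      gravitonS0 ε s κ * kernel colour x σ κ [] := by
  rw [gravitonS0, Finset.sum_mul]
  refine Finset.sum_congr rfl fun b _ => HasResidue.residueAt_eq ?_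
  have h1 := (hasResidue_quotient_mul (f := fun a => mdot ε (κ.1 a))
    (g := fun a => mdot s (κ.1 a)) (h := fun a => mdot ε (κ.1 a)) hσ (hs b)).const_mul
      (kernel colour x σ κ [])
  simp only [softTerm_zero, kernel_softVertex_zero, mdot_pField]
  convert h1 using 1
  · ext z; ring
  · ring

/-- The ratio `ε·p / s·p` is regular at the puncture, so the residue is its value there times the
Lorentz derivative of that particle. -/
theorem hasResidue_superrotation {κ : Kin 2 m d} (hσ : Function.Injective σ)
    (hne : ∀ j, scattering σ κ 0 j ≠ 0)
    (hd : DifferentiableAt ℂ (fun κ => kernel colour x σ κ []) κ) {b : Hard m}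
    (hs : mdot s (κ.1 b) ≠ 0) :
    HasResidue (fun z => softTerm 1 fun τ =>
      kernel colour x σ κ [(z, superrotationOp 1 ε s τ (pField σ κ.1 z))]) (σ b)
      (mdot ε (κ.1 b) / mdot s (κ.1 b) *
        fderiv ℂ (fun κ => kernel colour x σ κ []) κ (boostOne ε s κ b)) := by
  refine (hasResidue_quotient_mul (f := fun a => mdot ε (κ.1 a))
    (g := fun a => mdot s (κ.1 a))
    (h := fun a => fderiv ℂ (fun κ => kernel colour x σ κ []) κ (boostOne ε s κ a))
    hσ hs).congr ?_
  filter_upwards [eventually_ne_punctures hσ b] with z hz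
  simp only [superrotationOp]
  rw [softTerm_rotationOp hσ hne hd ε s hz, mdot_pField, mdot_pField]

theorem residue_superrotation {κ : Kin 2 m d} (hσ : Function.Injective σ)
    (hne : ∀ j, scattering σ κ 0 j ≠ 0)
    (hd : DifferentiableAt ℂ (fun κ => kernel colour x σ κ []) κ)
    (hs : ∀ a, mdot s (κ.1 a) ≠ 0) :
    ∑ b, residueAt (fun z => softTerm 1 fun τ =>
      kernel colour x σ κ [(z, superrotationOp 1 ε s τ (pField σ κ.1 z))]) (σ b) =
      ∑ b, mdot ε (κ.1 b) / mdot s (κ.1 b) *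
        fderiv ℂ (fun κ => kernel colour x σ κ []) κ (boostOne ε s κ b) :=
  Finset.sum_congr rfl fun b _ => (hasResidue_superrotation hσ hne hd (hs b)).residueAt_eq

/-- The surplus over the superrotation is `ε·p` times a constant plus a pole sum. Its residues add
up to zero once `∑ ε·k_a = 0`, which is where momentum conservation enters. -/
theorem residue_graviton_one {κ : Kin 2 m d} (hσ : Function.Injective σ)
    (hne : ∀ j, scattering σ κ 0 j ≠ 0)
    (hd : DifferentiableAt ℂ (fun κ => kernel colour x σ κ []) κ)
    (hs : ∀ a, mdot s (κ.1 a) ≠ 0) (hk : ∑ a, κ.1 a = 0) :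
    ∑ b, residueAt (fun z => softTerm 1 fun τ =>
      kernel colour x σ κ [(z, softVertex 2 1 ε s τ (pField σ κ.1 z))]) (σ b) =
      ∑ b, mdot ε (κ.1 b) / mdot s (κ.1 b) *
        fderiv ℂ (fun κ => kernel colour x σ κ []) κ (boostOne ε s κ b) := by
  obtain ⟨R, hR, hres⟩ := exists_hasResidue_product hσ (e := fun a => mdot ε (κ.1 a))
    (B := translationResponse colour x ε σ κ)
    (ghosts σ * colour * translationVar x σ κ (mdot x ε, 0))
    (by rw [← mdot_sum_right, hk, mdot_zero_right])
  rw [← add_zero (∑ b, _ * _), ← hR, ← Finset.sum_add_distrib]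
  refine Finset.sum_congr rfl fun b _ => HasResidue.residueAt_eq ?_
  refine ((hasResidue_superrotation (ε := ε) hσ hne hd (hs b)).add (hres b)).congr ?_
  filter_upwards [eventually_ne_punctures hσ b,
    eventually_poleSum_ne hσ (g := fun a => mdot s (κ.1 a)) (hs b)] with z hz hz'
  rw [← mdot_pField] at hz'
  rw [softTerm_softVertex two_ne_zero hσ hne hd ε s hz hz', ← mdot_pField]
  simp only [superrotationOp, Nat.add_one_sub_one, pow_one]

end SoftSums

/-! ### The eikonal factor of the colour correlator -/

section ParkeTaylor

variable {ι : Type} {n : ℕ}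

/-- Insertion of a soft gluon between the last and the first hard one. -/
theorem ptSoft_eq [Fintype ι] [DecidableEq ι] (col : Fin (n + 1) ≃ ι) {σ : ι → ℂ}
    (hσ : Function.Injective σ) (hn : col 0 ≠ col (Fin.last n)) {z : ℂ} (hz : ∀ a, σ a ≠ z) :
    ptSoft col σ z = ptHard col σ *
      poleSum σ (Pi.single (col 0) 1 - Pi.single (col (Fin.last n)) 1) z := by
  have h1 : poleSum σ (Pi.single (col 0) 1 - Pi.single (col (Fin.last n)) 1) z =
      (z - σ (col 0))⁻¹ - (z - σ (col (Fin.last n)))⁻¹ := by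
    simp [poleSum, mul_sub, Finset.sum_sub_distrib, Pi.single_apply]
  have e1 : z - σ (col 0) ≠ 0 := sub_ne_zero.2 (hz _).symm
  have e2 : z - σ (col (Fin.last n)) ≠ 0 := sub_ne_zero.2 (hz _).symm
  have e2' : σ (col (Fin.last n)) - z ≠ 0 := sub_ne_zero.2 (hz _)
  have e3 : σ (col (Fin.last n)) - σ (col 0) ≠ 0 := sub_ne_zero.2 fun h => hn (hσ h).symm
  rw [h1, ptSoft, ptHard, parkeTaylor, parkeTaylor, Fin.prod_univ_castSucc, Fin.prod_univ_castSucc,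
    Fin.prod_univ_castSucc (n := n)]
  have h0 : (Fin.snoc (α := fun _ => ℂ) (fun j => σ (col j)) z : Fin (n + 2) → ℂ) 0 =
      σ (col 0) := Fin.snoc_castSucc (α := fun _ => ℂ) z (fun j => σ (col j)) 0
  have hj : ∀ j : Fin n, (Fin.snoc (α := fun _ => ℂ) (fun j => σ (col j)) z : Fin (n + 2) → ℂ)
      j.castSucc.succ = σ (col j.succ) := fun j => by
    rw [Fin.succ_castSucc]
    exact Fin.snoc_castSucc (α := fun _ => ℂ) z (fun j => σ (col j)) j.succ
  simp only [Fin.last_add_one, h0, hj, Fin.snoc_castSucc, Fin.coeSucc_eq_succ, Fin.succ_last,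
    Fin.snoc_last]
  field_simp
  ring

end ParkeTaylor

/-! ### Residue sums for soft gluons -/

section GluonSums

variable {m d : ℕ}

variable {x : Vec d} {σ : Hard m → ℂ} {ε s : Vec d} {col : Fin (m + 2 + 1) ≃ Hard m}

theorem first_ne_last (col : Fin (m + 2 + 1) ≃ Hard m) : col 0 ≠ col (Fin.last _) :=
  fun h => by simpa [Fin.ext_iff] using col.injective h

/-- Charges of the first and the last gluon. -/
def chargePair {ι : Type} [DecidableEq ι] {n : ℕ} (col : Fin (n + 1) ≃ ι) : ι → ℂ :=
  Pi.single (col 0) 1 - Pi.single (col (Fin.last n)) 1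

theorem sum_chargePair_mul {ι : Type} [Fintype ι] [DecidableEq ι] {n : ℕ} (col : Fin (n + 1) ≃ ι)
    (f : ι → ℂ) : ∑ a, f a * chargePair col a = f (col 0) - f (col (Fin.last n)) := by
  simp [chargePair, mul_sub, Finset.sum_sub_distrib, Pi.single_apply]

theorem kernel_ptSoft {κ : Kin 1 m d} (hσ : Function.Injective σ) {z : ℂ} (hz : ∀ a, σ a ≠ z)
    (l : ℕ) (O : ℂ → LocalOp 1 d) :
    softTerm l (fun τ => kernel (ptSoft col σ z) x σ κ [(z, O τ)]) =
      poleSum σ (chargePair col) z *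
        softTerm l (fun τ => kernel (ptHard col σ) x σ κ [(z, O τ)]) := by
  rw [← softTerm_const_mul, ptSoft_eq col hσ (first_ne_last col) hz]
  simp only [kernel_colour_mul, chargePair]

theorem residue_gluon_zero {κ : Kin 1 m d} (hσ : Function.Injective σ)
    (hs : ∀ a, mdot s (κ.1 a) ≠ 0) :
    ∑ b, residueAt (fun z => softTerm 0 fun τ =>
      kernel (ptSoft col σ z) x σ κ [(z, softVertex 1 1 ε s τ (pField σ κ.1 z))]) (σ b) =
      gluonS0 ε s (col 0) (col (Fin.last _)) κ * kernel (ptHard col σ) x σ κ [] := by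
  rw [gluonS0, ← sum_chargePair_mul col (fun a => mdot ε (κ.1 a) / mdot s (κ.1 a)), Finset.sum_mul]
  refine Finset.sum_congr rfl fun b _ => HasResidue.residueAt_eq ?_
  have h1 := (hasResidue_quotient_mul (f := fun a => mdot ε (κ.1 a))
    (g := fun a => mdot s (κ.1 a)) (h := chargePair col) hσ (hs b)).const_mul
      (kernel (ptHard col σ) x σ κ [])
  rw [mul_comm] at h1
  refine h1.congr ?_
  filter_upwards [eventually_ne_punctures hσ b] with z hz
  rw [kernel_ptSoft hσ hz]
  simp only [softTerm_zero, kernel_softVertex_zero, mdot_pField, pow_one]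
  ring

/-- The Lorentz derivatives and the colour factor bring one simple pole each, and `s·p` in the
denominator removes one. Particles other than the first and the last have charge zero. -/
theorem hasResidue_gaugeRotation {κ : Kin 1 m d} (hσ : Function.Injective σ)
    (hne : ∀ j, scattering σ κ 0 j ≠ 0)
    (hd : DifferentiableAt ℂ (fun κ => kernel (ptHard col σ) x σ κ []) κ) {b : Hard m}
    (hs : mdot s (κ.1 b) ≠ 0) :
    HasResidue (fun z => softTerm 1 fun τ =>
      kernel (ptSoft col σ z) x σ κ [(z, gaugeRotationOp 1 ε s τ (pField σ κ.1 z))]) (σ b)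
      (fderiv ℂ (fun κ => kernel (ptHard col σ) x σ κ []) κ (boostOne ε s κ b) /
        mdot s (κ.1 b) * chargePair col b) := by
  refine (hasResidue_quotient_mul (g := fun a => mdot s (κ.1 a)) (h := chargePair col)
    (f := fun a => fderiv ℂ (fun κ => kernel (ptHard col σ) x σ κ []) κ (boostOne ε s κ a))
    hσ hs).congr ?_
  filter_upwards [eventually_ne_punctures hσ b] with z hz
  rw [kernel_ptSoft hσ hz]
  simp only [gaugeRotationOp]
  rw [softTerm_rotationOp hσ hne hd ε s hz, mdot_pField]
  ring

theorem residue_gaugeRotation {κ : Kin 1 m d} (hσ : Function.Injective σ)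
    (hne : ∀ j, scattering σ κ 0 j ≠ 0)
    (hd : DifferentiableAt ℂ (fun κ => kernel (ptHard col σ) x σ κ []) κ)
    (hs : ∀ a, mdot s (κ.1 a) ≠ 0) :
    ∑ b, residueAt (fun z => softTerm 1 fun τ =>
      kernel (ptSoft col σ z) x σ κ [(z, gaugeRotationOp 1 ε s τ (pField σ κ.1 z))]) (σ b) =
      fderiv ℂ (fun κ => kernel (ptHard col σ) x σ κ []) κ (boostOne ε s κ (col 0)) /
        mdot s (κ.1 (col 0)) -
      fderiv ℂ (fun κ => kernel (ptHard col σ) x σ κ []) κ (boostOne ε s κ (col (Fin.last _))) /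
        mdot s (κ.1 (col (Fin.last _))) := by
  rw [← sum_chargePair_mul col (fun a => fderiv ℂ (fun κ => kernel (ptHard col σ) x σ κ []) κ
    (boostOne ε s κ a) / mdot s (κ.1 a))]
  exact Finset.sum_congr rfl fun b _ => (hasResidue_gaugeRotation hσ hne hd (hs b)).residueAt_eq

/-- The surplus is the colour factor times a constant plus a pole sum. The two charges add up to
zero, so its residues cancel without momentum conservation. -/
theorem residue_gluon_one {κ : Kin 1 m d} (hσ : Function.Injective σ)
    (hne : ∀ j, scattering σ κ 0 j ≠ 0)
    (hd : DifferentiableAt ℂ (fun κ => kernel (ptHard col σ) x σ κ []) κ)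
    (hs : ∀ a, mdot s (κ.1 a) ≠ 0) :
    ∑ b, residueAt (fun z => softTerm 1 fun τ =>
      kernel (ptSoft col σ z) x σ κ [(z, softVertex 1 1 ε s τ (pField σ κ.1 z))]) (σ b) =
    ∑ b, residueAt (fun z => softTerm 1 fun τ =>
      kernel (ptSoft col σ z) x σ κ [(z, gaugeRotationOp 1 ε s τ (pField σ κ.1 z))]) (σ b) := by
  obtain ⟨R, hR, hres⟩ := exists_hasResidue_product hσ (e := chargePair col)
    (B := translationResponse (ptHard col σ) x ε σ κ)
    (ghosts σ * ptHard col σ * translationVar x σ κ (mdot x ε, 0))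
    (by simpa using sum_chargePair_mul col fun _ => 1)
  rw [← add_zero (∑ b, residueAt (fun z => softTerm 1 fun τ =>
      kernel (ptSoft col σ z) x σ κ [(z, gaugeRotationOp 1 ε s τ (pField σ κ.1 z))]) (σ b)), ← hR,
    ← Finset.sum_add_distrib]
  refine Finset.sum_congr rfl fun b _ => ?_
  have h1 := hasResidue_gaugeRotation (ε := ε) hσ hne hd (hs b)
  rw [h1.residueAt_eq]
  refine ((h1.add (hres b)).congr ?_).residueAt_eq
  filter_upwards [eventually_ne_punctures hσ b,
    eventually_poleSum_ne hσ (g := fun a => mdot s (κ.1 a)) (hs b)] with z hz hz'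
  rw [← mdot_pField] at hz'
  rw [kernel_ptSoft hσ hz, kernel_ptSoft hσ hz, softTerm_softVertex one_ne_zero hσ hne hd ε s hz hz']
  simp only [gaugeRotationOp, Nat.sub_self, pow_zero]
  ring

end GluonSums

/-! ### Joint holomorphy in kinematics and punctures -/

section JointHolomorphy

variable {N m d : ℕ}

theorem differentiableAt_pAt {q₀ : Kin N m d × (Hard m → ℂ)} (hσ : Function.Injective q₀.2)
    (b : Hard m) : DifferentiableAt ℂ
      (fun q : Kin N m d × (Hard m → ℂ) => pAt q.2 q.1.1 b) q₀ := by
  refine DifferentiableAt.fun_sum fun a ha => ?_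
  refine DifferentiableAt.fun_smul (DifferentiableAt.fun_inv (by fun_prop) ?_) (by fun_prop)
  exact sub_ne_zero.2 fun h => Finset.ne_of_mem_erase ha (hσ h).symm

/-- Polarisation (`false`) or momentum (`true`) of a hard particle, at its puncture. -/
def hardField (r : Fin N) (q : Kin N m d × (Hard m → ℂ)) (p : Hard m × Bool) : Vec d × ℂ :=
  (cond p.2 (q.1.1 p.1) (q.1.2 r p.1), q.2 p.1)

theorem holomorphicFields_hardField (r : Fin N) {q₀ : Kin N m d × (Hard m → ℂ)}
    (hσ : Function.Injective q₀.2) : HolomorphicFields (hardField r) q₀ where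
  vec := by
    rintro ⟨a, _ | _⟩ <;> simp only [hardField, cond_true, cond_false] <;> fun_prop
  point := by rintro ⟨a, i⟩; simp only [hardField]; fun_prop
  separated := by
    rintro ⟨a, i⟩ ⟨b, j⟩
    rcases eq_or_ne a b with rfl | h
    · exact Or.inl fun _ => rfl
    · exact Or.inr (hσ.ne h)

theorem differentiableAt_shiftedFermion (r : Fin N) {q₀ : Kin N m d × (Hard m → ℂ)}
    (hσ : Function.Injective q₀.2) : DifferentiableAt ℂ
      (fun q : Kin N m d × (Hard m → ℂ) => shiftedFermion q.2 q.1 0 r) q₀ := by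
  have h := (holomorphicFields_hardField r hσ).wickProd
    (C := fun q b => mdot (q.1.2 r b) (pAt q.2 q.1.1 b)) (A := fun b => (b, false))
    (B := fun b => (b, true)) (fun _ _ => rfl)
    (fun b => differentiableAt_mdot (by fun_prop) (differentiableAt_pAt hσ b))
    (integratedLabels m) [(.inl 0, false), (.inl 1, false)]
  refine h.congr_of_eventuallyEq (Filter.Eventually.of_forall fun q => ?_)
  simp only [shiftedFermion, shiftedFactors_zero]
  rfl

theorem differentiableAt_scattering (j : Fin m) {q₀ : Kin N m d × (Hard m → ℂ)}
    (hσ : Function.Injective q₀.2) : DifferentiableAt ℂ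
      (fun q : Kin N m d × (Hard m → ℂ) => scattering q.2 q.1 0 j) q₀ := by
  simp only [scattering, Pi.zero_apply, add_zero]
  exact differentiableAt_mdot (by fun_prop) (differentiableAt_pAt hσ _)

/-- The integrand is jointly holomorphic in the kinematics and in the punctures. -/
theorem differentiableAt_kernel {colour : (Hard m → ℂ) → ℂ} (x : Vec d)
    {q₀ : Kin N m d × (Hard m → ℂ)} (hσ : Function.Injective q₀.2)
    (hne : ∀ j, scattering q₀.2 q₀.1 0 j ≠ 0) (hcol : DifferentiableAt ℂ colour q₀.2) :
    DifferentiableAt ℂ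
      (fun q : Kin N m d × (Hard m → ℂ) => kernel (colour q.2) x q.2 q.1 []) q₀ := by
  simp only [kernel_nil]
  have hc : DifferentiableAt ℂ (fun q : Kin N m d × (Hard m → ℂ) => colour q.2) q₀ :=
    DifferentiableAt.comp (g := colour) q₀ hcol differentiableAt_snd
  have hg : DifferentiableAt ℂ (fun q : Kin N m d × (Hard m → ℂ) => ghosts q.2) q₀ := by
    simp only [ghosts]; fun_prop
  have hE : DifferentiableAt ℂ (fun q : Kin N m d × (Hard m → ℂ) =>
      exp (I * mdot x (∑ a, q.1.1 a))) q₀ :=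
    ((differentiableAt_mdot (differentiableAt_const x)
      (DifferentiableAt.fun_sum fun a _ => by fun_prop)).const_mul I).cexp
  have h01 : q₀.2 (.inl 0) - q₀.2 (.inl 1) ≠ 0 := sub_ne_zero.2 fun h => by simpa using hσ h
  have h01' : DifferentiableAt ℂ (fun q : Kin N m d × (Hard m → ℂ) =>
      (q.2 (.inl 0) - q.2 (.inl 1))⁻¹) q₀ := DifferentiableAt.fun_inv (by fun_prop) h01
  exact (hg.mul hc).mul ((hE.mul (differentiableAt_prod fun r _ =>
    h01'.mul (differentiableAt_shiftedFermion r hσ))).mul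
    (differentiableAt_prod fun j _ => (differentiableAt_scattering j hσ).fun_inv (hne j)))

theorem differentiableAt_punctures (g : Fin 3 → ℂ) (u : Fin m → ℂ) :
    DifferentiableAt ℂ (punctures g) u := by
  refine differentiableAt_pi.2 fun a => ?_
  rcases a with a | a <;> simp only [punctures, Sum.elim_inl, Sum.elim_inr] <;> fun_prop

/-- Cyclic neighbours are distinct as soon as there are two labels; with a single one the factor
would be `1 / (z₀ - z₀)`. -/
theorem differentiableAt_ptHard {ι : Type} [Fintype ι] {n : ℕ} (col : Fin (n + 1) ≃ ι) (hn : n ≠ 0)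
    {σ : ι → ℂ} (hσ : Function.Injective σ) : DifferentiableAt ℂ (ptHard col) σ := by
  unfold ptHard parkeTaylor
  refine differentiableAt_prod fun j _ => DifferentiableAt.fun_inv (by fun_prop) ?_
  refine sub_ne_zero.2 fun h => ?_
  have h1 : j = j + 1 := col.injective (hσ h)
  have h2 : (1 : Fin (n + 1)) = 0 := by simpa using h1.symm
  have h3 := congrArg Fin.val h2
  obtain ⟨k, rfl⟩ := Nat.exists_eq_succ_of_ne_zero hn
  simp at h3

theorem scattering_eq (g : Fin 3 → ℂ) (κ : Kin N m d) (u : Fin m → ℂ) (j : Fin m) :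
    scattering (punctures g u) κ 0 j = scatteringMap g κ.1 u j := by
  simp [scattering, scatteringMap]

end JointHolomorphy

/-! ### Small tori around the solutions -/

section SmallTori

variable {n : ℕ}

theorem eventually_polydisc {P : (Fin n → ℂ) → Prop} (h : ∀ᶠ y in 𝓝 0, P y) :
    ∀ᶠ ρ in 𝓝[>] (0 : ℝ), ∀ y : Fin n → ℂ, (∀ i, ‖y i‖ ≤ ρ) → P y := by
  obtain ⟨δ, hδ, hP⟩ := Metric.eventually_nhds_iff.1 h
  filter_upwards [Ioo_mem_nhdsGT hδ] with ρ hρ y hy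
  refine hP (lt_of_le_of_lt ?_ hρ.2)
  rw [dist_zero_right]
  exact (pi_norm_le_iff_of_nonneg hρ.1.le).2 hy

theorem continuous_torusMap (ρ : ℝ) : Continuous (torusMap (0 : Fin n → ℂ) fun _ => ρ) :=
  continuous_pi fun i => continuous_const.add (continuous_const.mul (Complex.continuous_exp.comp
    ((Complex.continuous_ofReal.comp (continuous_apply i)).mul continuous_const)))

theorem isCompact_torus (ρ : ℝ) : IsCompact {y : Fin n → ℂ | ∀ i, ‖y i‖ = ρ} := by
  have : {y : Fin n → ℂ | ∀ i, ‖y i‖ = ρ} = Set.pi Set.univ fun _ => Metric.sphere (0 : ℂ) ρ := by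
    ext y; simp
  rw [this]
  exact isCompact_univ_pi fun _ => isCompact_sphere _ _

variable {S : Finset (Fin n → ℂ)} {φ : (Fin n → ℂ) → (Fin n → ℂ) → (Fin n → ℂ)}
  {F : (Fin n → ℂ) → (Fin n → ℂ)} {D : (Fin n → ℂ) → Prop}

/-- Local inverses are holomorphic, take values in an open domain and invert `F` in the closed
polydisc of radius `ρ`. -/
structure AdmissibleRadius (D : (Fin n → ℂ) → Prop) (F : (Fin n → ℂ) → (Fin n → ℂ))
    (S : Finset (Fin n → ℂ)) (φ : (Fin n → ℂ) → (Fin n → ℂ) → (Fin n → ℂ)) (ρ : ℝ) : Prop where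
  pos : 0 < ρ
  differentiable : ∀ u ∈ S, ∀ y : Fin n → ℂ, (∀ i, ‖y i‖ ≤ ρ) →
    ∀ᶠ y in 𝓝 y, DifferentiableAt ℂ (φ u) y
  inverse : ∀ u ∈ S, ∀ y : Fin n → ℂ, (∀ i, ‖y i‖ ≤ ρ) → ∀ᶠ y in 𝓝 y, F (φ u y) = y
  domain : ∀ u ∈ S, ∀ y : Fin n → ℂ, (∀ i, ‖y i‖ ≤ ρ) → D (φ u y)

/-- All the conditions are open at the finitely many solutions. They are required in a neighbourhood
of each point of the closed polydisc, so that derivatives are available on its boundary too. -/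
theorem IsSolutionSet.admissible {D' : (Fin n → ℂ) → Prop} (h : IsSolutionSet D' F S φ)
    (hD : ∀ u ∈ S, ∀ᶠ x in 𝓝 u, D x) :
    ∀ᶠ ρ in 𝓝[>] (0 : ℝ), AdmissibleRadius D F S φ ρ := by
  have hcont : ∀ u ∈ S, ContinuousAt (φ u) 0 := fun u hu =>
    (h.2 u hu).2.1.self_of_nhds.continuousAt
  have h1 : ∀ u ∈ S, ∀ᶠ y in 𝓝 (0 : Fin n → ℂ), (∀ᶠ y in 𝓝 y, DifferentiableAt ℂ (φ u) y) ∧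
      (∀ᶠ y in 𝓝 y, F (φ u y) = y) ∧ D (φ u y) := fun u hu =>
    (h.2 u hu).2.1.eventually_nhds.and ((h.2 u hu).2.2.eventually_nhds.and
      ((hcont u hu).eventually (by rw [(h.2 u hu).1]; exact hD u hu)))
  have h2 := (Filter.eventually_all_finset S).2 fun u hu => eventually_polydisc (h1 u hu)
  filter_upwards [h2, self_mem_nhdsWithin] with ρ hρ hpos
  exact ⟨hpos, fun u hu y hy => (hρ u hu y hy).1, fun u hu y hy => (hρ u hu y hy).2.1,
    fun u hu y hy => (hρ u hu y hy).2.2⟩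

variable {ρ : ℝ}

/-- An open condition on the solutions near a compact part of the closed polydisc persists for
nearby parameters. -/
theorem AdmissibleRadius.eventually_compact (h : AdmissibleRadius D F S φ ρ)
    {E : Type*} [TopologicalSpace E] {P : E → (Fin n → ℂ) → Prop} {κ₀ : E} {T : Set (Fin n → ℂ)}
    (hT : IsCompact T) (hle : ∀ y ∈ T, ∀ i, ‖y i‖ ≤ ρ)
    (hP : ∀ u ∈ S, ∀ y ∈ T, ∀ᶠ q : E × (Fin n → ℂ) in 𝓝 (κ₀, φ u y), P q.1 q.2) :
    ∀ᶠ κ in 𝓝 κ₀, ∀ u ∈ S, ∀ y ∈ T, P κ (φ u y) := by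
  refine (Filter.eventually_all_finset S).2 fun u hu => ?_
  refine hT.eventually_forall_of_forall_eventually fun y hy => ?_
  have h1 : ContinuousAt (φ u) y :=
    (h.differentiable u hu y (hle y hy)).self_of_nhds.continuousAt
  have h2 : ContinuousAt (fun p : E × (Fin n → ℂ) => (p.1, φ u p.2)) (κ₀, y) :=
    continuousAt_fst.prodMk (ContinuousAt.comp (g := φ u) h1 continuousAt_snd)
  exact h2.eventually (hP u hu y hy)

variable {E : Type*} [NormedAddCommGroup E] [NormedSpace ℂ E]

/-- Joint holomorphy of the integrand in parameter and moduli gives continuity along the torus; the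
Jacobian is continuous there because it is holomorphic. -/
theorem AdmissibleRadius.holomorphicOnTori (h : AdmissibleRadius D F S φ ρ) {U : Set E}
    {f : E → (Fin n → ℂ) → ℂ} (hf : ∀ u ∈ S, ∀ y : Fin n → ℂ, (∀ i, ‖y i‖ = ρ) → ∀ κ ∈ U,
      DifferentiableAt ℂ (fun q : E × (Fin n → ℂ) => f q.1 q.2) (κ, φ u y)) :
    HolomorphicOnTori S φ ρ U f where
  cont u hu := by
    rintro ⟨κ, θ⟩ ⟨hκ, -⟩
    refine ContinuousAt.continuousWithinAt ?_
    have hy := norm_torusMap_apply h.pos.le θ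
    have hd := h.differentiable u hu _ fun i => (hy i).le
    have ht : ContinuousAt (fun p : E × (Fin n → ℝ) => torusMap 0 (fun _ => ρ) p.2) (κ, θ) :=
      ((continuous_torusMap ρ).comp continuous_snd).continuousAt
    have h1 : ContinuousAt (fun p : E × (Fin n → ℝ) => φ u (torusMap 0 (fun _ => ρ) p.2)) (κ, θ) :=
      ContinuousAt.comp (g := φ u) (f := fun p : E × (Fin n → ℝ) => torusMap 0 (fun _ => ρ) p.2)
        hd.self_of_nhds.continuousAt ht
    refine ContinuousAt.mul ?_ ?_
    · exact ContinuousAt.comp (g := fun q : E × (Fin n → ℂ) => f q.1 q.2)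
        (f := fun p : E × (Fin n → ℝ) => (p.1, φ u (torusMap 0 (fun _ => ρ) p.2)))
        (hf u hu _ hy κ hκ).continuousAt (continuousAt_fst.prodMk h1)
    · exact ContinuousAt.comp (g := fun y => (fderiv ℂ (φ u) y).det)
        (f := fun p : E × (Fin n → ℝ) => torusMap 0 (fun _ => ρ) p.2)
        (differentiableAt_det_fderiv hd).continuousAt ht
  diff u hu θ κ hκ :=
    (DifferentiableAt.comp (g := fun q : E × (Fin n → ℂ) => f q.1 q.2)
      (f := fun κ : E => (κ, φ u (torusMap 0 (fun _ => ρ) θ))) κ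
      (hf u hu _ (norm_torusMap_apply h.pos.le θ) κ hκ)
      (differentiableAt_id.prodMk (differentiableAt_const _))).differentiableWithinAt

end SmallTori

/-! ### Angular momentum operators as directional derivatives -/

section AngularMomentum

variable {N m d : ℕ}

theorem eta_mul_self (μ : Fin (d + 1)) : eta μ * eta μ = 1 := by
  unfold eta; split_ifs <;> norm_num

theorem sum_low_mul (x y : Vec d) : ∑ μ, low x μ * y μ = mdot x y := rfl

/-- The metric signs that lower the index of the derivative cancel against those of `ε` and `s`,
leaving the components of the Lorentz image as coefficients. -/
theorem sum_rotation (ε s v : Vec d) (l : Fin (d + 1) → ℂ) :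
    ∑ ν, ∑ ρ, low ε ν * low s ρ * (v ν * (eta ρ * l ρ) - v ρ * (eta ν * l ν)) =
      ∑ ν, lorentz ε s v ν * l ν := by
  have h1 : ∀ w : Vec d, ∑ ρ, low w ρ * (eta ρ * l ρ) = ∑ ρ, w ρ * l ρ := fun w =>
    Finset.sum_congr rfl fun ρ _ => by
      rw [low]; linear_combination w ρ * l ρ * eta_mul_self ρ
  have h2 : ∑ ν, ∑ ρ, low ε ν * low s ρ * (v ν * (eta ρ * l ρ) - v ρ * (eta ν * l ν)) =
      (∑ ν, low ε ν * v ν) * (∑ ρ, low s ρ * (eta ρ * l ρ)) -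
        (∑ ν, low ε ν * (eta ν * l ν)) * ∑ ρ, low s ρ * v ρ := by
    rw [Finset.sum_mul_sum, Finset.sum_mul_sum, ← Finset.sum_sub_distrib]
    refine Finset.sum_congr rfl fun ν _ => ?_
    rw [← Finset.sum_sub_distrib]
    exact Finset.sum_congr rfl fun ρ _ => by ring
  rw [h2, h1, h1, sum_low_mul, sum_low_mul, Finset.mul_sum, Finset.sum_mul,
    ← Finset.sum_sub_distrib]
  refine Finset.sum_congr rfl fun ν _ => ?_
  simp only [lorentz, Pi.sub_apply, Pi.smul_apply, smul_eq_mul]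
  ring

/-- Contracted with `ε` and `s`, the operator is a first-order operator whose coefficients are the
Lorentz images of the momentum and polarisations of `a`, hence the derivative along that direction.
-/
theorem sum_angMomOp (ε s : Vec d) (F : Kin N m d → ℂ) (κ : Kin N m d) (a : Hard m) :
    ∑ ν, ∑ ρ, low ε ν * low s ρ * angMomOp a ν ρ F κ = fderiv ℂ F κ (boostOne ε s κ a) := by
  have hv : ∀ v : Vec d, v = ∑ ν, v ν • (Pi.single ν 1 : Vec d) := fun v => by
    simp only [← Pi.single_smul, smul_eq_mul, mul_one]
    exact (Finset.univ_sum_single v).symm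
  have h1 : boostOne ε s κ a =
      ∑ ν, lorentz ε s (κ.1 a) ν • ((Pi.single a (Pi.single ν 1), 0) : Kin N m d) +
        ∑ r, ∑ ν, lorentz ε s (κ.2 r a) ν •
          ((0, Pi.single r (Pi.single a (Pi.single ν 1))) : Kin N m d) := by
    refine Prod.ext ?_ ?_
    · simp only [boostOne, Prod.fst_add, Prod.fst_sum, Prod.smul_fst, smul_zero,
        Finset.sum_const_zero, add_zero]
      conv_lhs => rw [hv (lorentz ε s (κ.1 a))]
      exact (map_sum (LinearMap.single ℂ (fun _ : Hard m => Vec d) a) _ _).trans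
        (Finset.sum_congr rfl fun ν _ => map_smul
          (LinearMap.single ℂ (fun _ : Hard m => Vec d) a) _ _)
    · simp only [boostOne, Prod.snd_add, Prod.snd_sum, Prod.smul_snd, smul_zero,
        Finset.sum_const_zero, zero_add]
      rw [← Finset.univ_sum_single (fun r => (Pi.single a (lorentz ε s (κ.2 r a)) :
        Hard m → Vec d))]
      refine Finset.sum_congr rfl fun r _ => ?_
      conv_lhs => rw [hv (lorentz ε s (κ.2 r a))]
      exact (map_sum (LinearMap.single ℂ (fun _ : Fin N => Hard m → Vec d) r ∘ₗ
        LinearMap.single ℂ (fun _ : Hard m => Vec d) a) _ _).trans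
          (Finset.sum_congr rfl fun ν _ => map_smul (LinearMap.single ℂ
            (fun _ : Fin N => Hard m → Vec d) r ∘ₗ
              LinearMap.single ℂ (fun _ : Hard m => Vec d) a) _ _)
  rw [h1, map_add, map_sum, map_sum]
  simp only [map_sum, map_smul, smul_eq_mul]
  rw [← sum_rotation, Finset.sum_congr rfl fun r _ => (sum_rotation ε s (κ.2 r a) _).symm]
  simp only [angMomOp, dMom, dPol, mul_add, Finset.sum_add_distrib, Finset.mul_sum]
  congr 1
  exact (Finset.sum_congr rfl fun ν _ => Finset.sum_comm).trans Finset.sum_comm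

theorem gravitonS1_eq (ε s : Vec d) (F : Kin N m d → ℂ) (κ : Kin N m d) :
    gravitonS1 ε s F κ =
      ∑ a, mdot ε (κ.1 a) / mdot s (κ.1 a) * fderiv ℂ F κ (boostOne ε s κ a) := by
  refine Finset.sum_congr rfl fun a _ => ?_
  rw [← sum_angMomOp, ← sum_low_mul ε, div_mul_eq_mul_div, Finset.sum_mul]
  congr 1
  refine Finset.sum_congr rfl fun μ _ => ?_
  simp only [Finset.mul_sum]
  exact Finset.sum_congr rfl fun ν _ => Finset.sum_congr rfl fun ρ _ => by ring

theorem gluonS1_eq (ε s : Vec d) (first last : Hard m) (F : Kin N m d → ℂ) (κ : Kin N m d) :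
    gluonS1 ε s first last F κ = fderiv ℂ F κ (boostOne ε s κ first) / mdot s (κ.1 first) -
      fderiv ℂ F κ (boostOne ε s κ last) / mdot s (κ.1 last) := by
  rw [gluonS1, sum_angMomOp, sum_angMomOp]

end AngularMomentum

/-! ### Ward identities in any dimension -/

section WardIdentities

variable {N m d : ℕ} {g : Fin 3 → ℂ} {S : Finset (Fin m → ℂ)}
  {φ : (Fin m → ℂ) → (Fin m → ℂ) → (Fin m → ℂ)} {κ₀ : Kin N m d} {ρ : ℝ}

theorem isOpen_injective_punctures (g : Fin 3 → ℂ) :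
    IsOpen {u : Fin m → ℂ | Function.Injective (punctures g u)} := by
  have : {u : Fin m → ℂ | Function.Injective (punctures g u)} =
      ⋂ a, ⋂ b, {u | a ≠ b → punctures g u a ≠ punctures g u b} := by
    ext u
    simp only [Set.mem_ofPred_eq, Set.mem_iInter]
    exact ⟨fun h a b hab => h.ne hab, fun h a b hab => by_contra fun hne => h a b hne hab⟩
  rw [this]
  refine isOpen_iInter_of_finite fun a => isOpen_iInter_of_finite fun b => ?_
  by_cases hab : a = b
  · simp [hab]
  · have hc : Continuous (punctures g : (Fin m → ℂ) → Hard m → ℂ) :=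
      Differentiable.continuous fun u => differentiableAt_punctures g u
    simpa [hab] using isOpen_ne_fun ((continuous_apply a).comp hc) ((continuous_apply b).comp hc)

/-- Kinematics for which all hypotheses of the local Ward identities hold along the tori. -/
structure RegularKinematics (g : Fin 3 → ℂ) (S : Finset (Fin m → ℂ))
    (φ : (Fin m → ℂ) → (Fin m → ℂ) → (Fin m → ℂ)) (ρ : ℝ) (s : Vec d) (κ : Kin N m d) : Prop where
  separated : ∀ u ∈ S, ∀ y : Fin m → ℂ, (∀ i, ‖y i‖ = ρ) →
    Function.Injective (punctures g (φ u y))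
  scattering_ne : ∀ u ∈ S, ∀ y : Fin m → ℂ, (∀ i, ‖y i‖ = ρ) →
    ∀ j, scattering (punctures g (φ u y)) κ 0 j ≠ 0
  soft_ne : ∀ a, mdot s (κ.1 a) ≠ 0

theorem continuous_mdot (v : Vec d) : Continuous (mdot v) := by
  unfold mdot; fun_prop

/-- At `κ₀` the scattering functions along the torus are the coordinates `y_j`, of modulus `ρ > 0`;
compactness carries their nonvanishing to nearby kinematics. -/
theorem eventually_regularKinematics {s : Vec d}
    (h : AdmissibleRadius (fun u => Function.Injective (punctures g u)) (scatteringMap g κ₀.1)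
      S φ ρ) (hs : ∀ a, mdot s (κ₀.1 a) ≠ 0) :
    ∀ᶠ κ in 𝓝 κ₀, RegularKinematics g S φ ρ s κ := by
  have h1 := h.eventually_compact (κ₀ := κ₀) (isCompact_torus ρ)
    (fun y hy i => (hy i).le) (P := fun κ u => ∀ j, scattering (punctures g u) κ 0 j ≠ 0) fun u hu y hy => by
      have hle : ∀ i, ‖y i‖ ≤ ρ := fun i => (hy i).le
      have hinj := h.domain u hu y hle
      refine Filter.eventually_all.2 fun j => ?_
      have hd : ContinuousAt (fun q : Kin N m d × (Fin m → ℂ) =>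
          scattering (punctures g q.2) q.1 0 j) (κ₀, φ u y) :=
        (DifferentiableAt.comp (g := fun q : Kin N m d × (Hard m → ℂ) => scattering q.2 q.1 0 j)
          (f := fun q : Kin N m d × (Fin m → ℂ) => (q.1, punctures g q.2)) (κ₀, φ u y)
          (differentiableAt_scattering j hinj) (differentiableAt_fst.prodMk
            ((differentiableAt_punctures g _).comp _ differentiableAt_snd))).continuousAt
      refine hd.eventually_ne ?_
      have h2 := congrFun (h.inverse u hu y hle).self_of_nhds j
      simp only [scattering_eq, h2]
      intro h0
      have := hy j
      rw [h0, norm_zero] at this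
      exact h.pos.ne this
  have h2 : ∀ᶠ κ in 𝓝 κ₀, ∀ a, mdot s (κ.1 a) ≠ 0 := Filter.eventually_all.2 fun a => by
    have hc : Continuous fun κ : Kin N m d => mdot s (κ.1 a) :=
      (continuous_mdot s).comp ((continuous_apply a).comp continuous_fst)
    exact hc.continuousAt.eventually_ne (hs a)
  filter_upwards [h1, h2] with κ hκ1 hκ2
  exact ⟨fun u hu y hy => h.domain u hu y fun i => (hy i).le, hκ1, hκ2⟩

variable {colour : (Hard m → ℂ) → ℂ}

theorem differentiableAt_kernel_punctures (x : Vec d) {u : Fin m → ℂ} {κ : Kin N m d}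
    (hσ : Function.Injective (punctures g u)) (hne : ∀ j, scattering (punctures g u) κ 0 j ≠ 0)
    (hcol : DifferentiableAt ℂ colour (punctures g u)) :
    DifferentiableAt ℂ (fun q : Kin N m d × (Fin m → ℂ) =>
      kernel (colour (punctures g q.2)) x (punctures g q.2) q.1 []) (κ, u) :=
  DifferentiableAt.comp (g := fun q : Kin N m d × (Hard m → ℂ) =>
      kernel (colour q.2) x q.2 q.1 [])
    (f := fun q : Kin N m d × (Fin m → ℂ) => (q.1, punctures g q.2)) (κ, u)
    (differentiableAt_kernel x hσ hne hcol) (differentiableAt_fst.prodMk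
      ((differentiableAt_punctures g _).comp _ differentiableAt_snd))

theorem differentiableAt_kernel_kinematics (x : Vec d) {u : Fin m → ℂ} {κ : Kin N m d}
    (hσ : Function.Injective (punctures g u)) (hne : ∀ j, scattering (punctures g u) κ 0 j ≠ 0)
    (hcol : DifferentiableAt ℂ colour (punctures g u)) :
    DifferentiableAt ℂ (fun κ => kernel (colour (punctures g u)) x (punctures g u) κ []) κ :=
  DifferentiableAt.comp (g := fun q : Kin N m d × (Fin m → ℂ) =>
      kernel (colour (punctures g q.2)) x (punctures g q.2) q.1 [])
    (f := fun κ : Kin N m d => (κ, u)) κ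
    (differentiableAt_kernel_punctures x hσ hne hcol)
    (differentiableAt_id.prodMk (differentiableAt_const _))

/-- Differentiation of the correlator under the contour integral. -/
theorem eventually_correlator {s : Vec d}
    (hS : IsSolutionSet (fun u => Function.Injective (punctures g u)) (scatteringMap g κ₀.1) S φ)
    (hs : ∀ a, mdot s (κ₀.1 a) ≠ 0)
    (hcol : ∀ σ, Function.Injective σ → DifferentiableAt ℂ colour σ) :
    ∀ᶠ ρ in 𝓝[>] (0 : ℝ), ∀ᶠ κ in 𝓝 κ₀, 0 ≤ ρ ∧ RegularKinematics g S φ ρ s κ ∧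
      ∀ x : Vec d, DifferentiableAt ℂ (correlator g S φ ρ colour x) κ ∧ ∀ v,
        ContinuousOnTori S φ ρ (fun u => fderiv ℂ
          (fun κ => kernel (colour (punctures g u)) x (punctures g u) κ []) κ v) ∧
        fderiv ℂ (correlator g S φ ρ colour x) κ v = contourSum S φ ρ fun u => fderiv ℂ
          (fun κ => kernel (colour (punctures g u)) x (punctures g u) κ []) κ v := by
  filter_upwards [hS.admissible fun u hu =>
    (isOpen_injective_punctures g).mem_nhds ((hS.1 u).1 hu).1] with ρ hρ
  obtain ⟨U, hUsub, hU, hκU⟩ := _root_.mem_nhds_iff.1 (eventually_regularKinematics hρ hs)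
  filter_upwards [hU.mem_nhds hκU] with κ hκ
  refine ⟨hρ.pos.le, hUsub hκ, fun x => ?_⟩
  have hol : HolomorphicOnTori S φ ρ U fun (κ : Kin N m d) (u : Fin m → ℂ) =>
      kernel (colour (punctures g u)) x (punctures g u) κ [] :=
    hρ.holomorphicOnTori fun u hu y hy κ hκ => differentiableAt_kernel_punctures x
      ((hUsub hκ).separated u hu y hy) ((hUsub hκ).scattering_ne u hu y hy)
      (hcol _ ((hUsub hκ).separated u hu y hy))
  have h := hol.hasFDerivAt hU hκ
  exact ⟨h.1, fun v => ⟨fun u hu => continuous_slice (hol.continuousOn_fderiv hU v hu) hκ, h.2 v⟩⟩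

/-- The residue identities hold pointwise along the tori, so it remains to bring the derivatives in
the soft factor under the contour integral. -/
theorem graviton_ward {κ₀ : Kin 2 m d} (ε s : Vec d)
    (hS : IsSolutionSet (fun u => Function.Injective (punctures g u)) (scatteringMap g κ₀.1) S φ)
    (hs : ∀ a, mdot s (κ₀.1 a) ≠ 0) :
    ∀ᶠ ρ in 𝓝[>] (0 : ℝ), ∀ᶠ κ in 𝓝 κ₀, ∀ x : Vec d,
      DifferentiableAt ℂ (correlator g S φ ρ (fun _ => 1) x) κ ∧
      softCorrelator g S φ ρ (fun _ _ => 1) x κ (softVertex 2 1 ε s) 0 =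
        gravitonS0 ε s κ * correlator g S φ ρ (fun _ => 1) x κ ∧
      softCorrelator g S φ ρ (fun _ _ => 1) x κ (superrotationOp 1 ε s) 1 =
        gravitonS1 ε s (correlator g S φ ρ (fun _ => 1) x) κ ∧
      (∑ a, κ.1 a = 0 →
        softCorrelator g S φ ρ (fun _ _ => 1) x κ (softVertex 2 1 ε s) 1 =
          gravitonS1 ε s (correlator g S φ ρ (fun _ => 1) x) κ) := by
  filter_upwards [eventually_correlator (colour := fun _ => 1) hS hs
    fun _ _ => differentiableAt_const _] with ρ hρ
  filter_upwards [hρ] with κ ⟨hρ0, hreg, hcorr⟩ x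
  have hdiff : ∀ u ∈ S, ∀ y : Fin m → ℂ, (∀ i, ‖y i‖ = ρ) → DifferentiableAt ℂ
      (fun κ => kernel 1 x (punctures g (φ u y)) κ []) κ := fun u hu y hy =>
    differentiableAt_kernel_kinematics (colour := fun _ => 1) x (hreg.separated u hu y hy)
      (hreg.scattering_ne u hu y hy) (differentiableAt_const _)
  have key : gravitonS1 ε s (correlator g S φ ρ (fun _ => 1) x) κ = contourSum S φ ρ fun u =>
      ∑ b, mdot ε (κ.1 b) / mdot s (κ.1 b) *
        fderiv ℂ (fun κ => kernel 1 x (punctures g u) κ []) κ (boostOne ε s κ b) := by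
    rw [gravitonS1_eq, contourSum_sum fun b _ => ((hcorr x).2 _).1.const_mul _]
    refine Finset.sum_congr rfl fun b _ => ?_
    rw [contourSum_const_mul, ((hcorr x).2 _).2]
  refine ⟨(hcorr x).1, ?_, ?_, fun hk => ?_⟩
  · rw [correlator, ← contourSum_const_mul]
    exact contourSum_congr hρ0 fun u hu y hy =>
      residue_graviton_zero (hreg.separated u hu y hy) hreg.soft_ne
  · rw [key]
    exact contourSum_congr hρ0 fun u hu y hy => residue_superrotation (hreg.separated u hu y hy)
      (hreg.scattering_ne u hu y hy) (hdiff u hu y hy) hreg.soft_ne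
  · rw [key]
    exact contourSum_congr hρ0 fun u hu y hy => residue_graviton_one (hreg.separated u hu y hy)
      (hreg.scattering_ne u hu y hy) (hdiff u hu y hy) hreg.soft_ne hk

theorem gluon_ward {κ₀ : Kin 1 m d} (col : Fin (m + 2 + 1) ≃ Hard m) (ε s : Vec d)
    (hS : IsSolutionSet (fun u => Function.Injective (punctures g u)) (scatteringMap g κ₀.1) S φ)
    (hs : ∀ a, mdot s (κ₀.1 a) ≠ 0) :
    ∀ᶠ ρ in 𝓝[>] (0 : ℝ), ∀ᶠ κ in 𝓝 κ₀, ∀ x : Vec d,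
      DifferentiableAt ℂ (correlator g S φ ρ (ptHard col) x) κ ∧
      softCorrelator g S φ ρ (ptSoft col) x κ (softVertex 1 1 ε s) 0 =
        gluonS0 ε s (col 0) (col (Fin.last _)) κ * correlator g S φ ρ (ptHard col) x κ ∧
      softCorrelator g S φ ρ (ptSoft col) x κ (softVertex 1 1 ε s) 1 =
        gluonS1 ε s (col 0) (col (Fin.last _)) (correlator g S φ ρ (ptHard col) x) κ ∧
      softCorrelator g S φ ρ (ptSoft col) x κ (gaugeRotationOp 1 ε s) 1 =
        gluonS1 ε s (col 0) (col (Fin.last _)) (correlator g S φ ρ (ptHard col) x) κ := by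
  filter_upwards [eventually_correlator (colour := ptHard col) hS hs
    fun _ hσ => differentiableAt_ptHard col (by omega) hσ] with ρ hρ
  filter_upwards [hρ] with κ ⟨hρ0, hreg, hcorr⟩ x
  have hdiff : ∀ u ∈ S, ∀ y : Fin m → ℂ, (∀ i, ‖y i‖ = ρ) → DifferentiableAt ℂ
      (fun κ => kernel (ptHard col (punctures g (φ u y))) x (punctures g (φ u y)) κ []) κ :=
    fun u hu y hy => differentiableAt_kernel_kinematics x (hreg.separated u hu y hy)
      (hreg.scattering_ne u hu y hy)
      (differentiableAt_ptHard col (by omega) (hreg.separated u hu y hy))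
  have key : softCorrelator g S φ ρ (ptSoft col) x κ (gaugeRotationOp 1 ε s) 1 =
      gluonS1 ε s (col 0) (col (Fin.last _)) (correlator g S φ ρ (ptHard col) x) κ := by
    have h0 := ((hcorr x).2 (boostOne ε s κ (col 0)))
    have h1 := ((hcorr x).2 (boostOne ε s κ (col (Fin.last _))))
    rw [gluonS1_eq, h0.2, h1.2, div_eq_inv_mul, div_eq_inv_mul, sub_eq_add_neg, ← neg_mul,
      ← contourSum_const_mul, ← contourSum_const_mul,
      ← contourSum_add (h0.1.const_mul _) (h1.1.const_mul _)]
    refine contourSum_congr hρ0 fun u hu y hy => ?_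
    rw [residue_gaugeRotation (hreg.separated u hu y hy)
      (hreg.scattering_ne u hu y hy) (hdiff u hu y hy) hreg.soft_ne]
    ring
  refine ⟨(hcorr x).1, ?_, ?_, key⟩
  · rw [correlator, ← contourSum_const_mul]
    exact contourSum_congr hρ0 fun u hu y hy =>
      residue_gluon_zero (hreg.separated u hu y hy) hreg.soft_ne
  · rw [← key]
    exact contourSum_congr hρ0 fun u hu y hy => residue_gluon_one (hreg.separated u hu y hy)
      (hreg.scattering_ne u hu y hy) (hdiff u hu y hy) hreg.soft_ne

end WardIdentities

/-! ### Four dimensions: holomorphy of the delta function arguments -/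

section TwistorKernel

variable {k m : ℕ}

/-- Punctures, scales and spinors `λ̃`. -/
abbrev TwistorData (k m : ℕ) := (Leg k m → ℂ) × (Leg k m → ℂ) × (Leg k m → Spinor)

theorem differentiableAt_lamField (lam : Leg k m → Spinor) (a : Leg k m) {q₀ : TwistorData k m}
    (hσ : Function.Injective q₀.1) : DifferentiableAt ℂ
      (fun q : TwistorData k m => lamField q.1 q.2.1 lam (q.1 a)) q₀ := by
  unfold lamField
  refine DifferentiableAt.fun_sum fun i _ => ?_
  -- The term of the particle at its own puncture is identically zero by the convention for division
  -- by zero.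
  rcases eq_or_ne a (.inl i) with rfl | h
  · simp
  · have hne : q₀.1 a - q₀.1 (.inl i) ≠ 0 := sub_ne_zero.2 fun h' => h (hσ h')
    fun_prop (disch := assumption)

theorem differentiableAt_ltField (a : Leg k m) {q₀ : TwistorData k m}
    (hσ : Function.Injective q₀.1) : DifferentiableAt ℂ
      (fun q : TwistorData k m => ltField q.1 q.2.1 q.2.2 [] (q.1 a)) q₀ := by
  simp only [ltField, List.map_nil, List.sum_nil, add_zero]
  refine DifferentiableAt.fun_sum fun p _ => ?_
  rcases eq_or_ne a (.inr p) with rfl | h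
  · simp
  · have hne : q₀.1 a - q₀.1 (.inr p) ≠ 0 := sub_ne_zero.2 fun h' => h (hσ h')
    fun_prop (disch := assumption)

theorem differentiableAt_deltaArg (lam : Leg k m → Spinor) (b : Leg k m) (β : Fin 2)
    {q₀ : TwistorData k m} (hσ : Function.Injective q₀.1) : DifferentiableAt ℂ
      (fun q : TwistorData k m => deltaArg q.1 q.2.1 lam q.2.2 [] b β) q₀ := by
  rcases b with i | p
  · simp only [deltaArg, Pi.sub_apply, Pi.smul_apply, smul_eq_mul]
    have := differentiableAt_pi.1 (differentiableAt_ltField (.inl i) hσ) β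
    exact DifferentiableAt.fun_sub (by fun_prop) (DifferentiableAt.fun_mul (by fun_prop) this)
  · simp only [deltaArg, Pi.sub_apply, Pi.smul_apply, smul_eq_mul]
    have := differentiableAt_pi.1 (differentiableAt_lamField lam (.inr p) hσ) β
    exact DifferentiableAt.fun_sub (by fun_prop) (DifferentiableAt.fun_mul (by fun_prop) this)

/-- `R` times the delta function denominators in `T`. -/
def deltaKernel (lam : Leg k m → Spinor) (T : Finset (Leg k m × Fin 2))
    (R : (Leg k m → ℂ) → (Leg k m → ℂ) → (Leg k m → Spinor) → ℂ) (σ s : Leg k m → ℂ)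
    (lt : Leg k m → Spinor) : ℂ :=
  R σ s lt * ∏ b ∈ T, (deltaArg σ s lam lt [] b.1 b.2)⁻¹

/-- Holomorphy for distinct punctures and nonzero scales. -/
def HolomorphicWeight (R : (Leg k m → ℂ) → (Leg k m → ℂ) → (Leg k m → Spinor) → ℂ) : Prop :=
  ∀ q : TwistorData k m, Function.Injective q.1 → (∀ a, q.2.1 a ≠ 0) →
    DifferentiableAt ℂ (fun q : TwistorData k m => R q.1 q.2.1 q.2.2) q

theorem HolomorphicWeight.deltaKernel {lam : Leg k m → Spinor} {T : Finset (Leg k m × Fin 2)}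
    {R : (Leg k m → ℂ) → (Leg k m → ℂ) → (Leg k m → Spinor) → ℂ} (hR : HolomorphicWeight R)
    {q : TwistorData k m} (hσ : Function.Injective q.1) (hs : ∀ a, q.2.1 a ≠ 0)
    (hT : ∀ b ∈ T, deltaArg q.1 q.2.1 lam q.2.2 [] b.1 b.2 ≠ 0) :
    DifferentiableAt ℂ (fun q : TwistorData k m => deltaKernel lam T R q.1 q.2.1 q.2.2) q :=
  (hR q hσ hs).mul (differentiableAt_prod fun b hb =>
    (differentiableAt_deltaArg lam b.1 b.2 hσ).fun_inv (hT b hb))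

end TwistorKernel

/-! ### Holomorphy of the gauge slice -/

namespace Gauge

variable {N k m : ℕ} (G : Gauge N k m) (lt₀ : Leg k m → Spinor)

theorem differentiable_elim (j : Fin N ⊕ Fin 4) :
    Differentiable ℂ fun x : Fin N → ℂ => (Sum.elim x G.value j : ℂ) := by
  rcases j with j | j <;> simp only [Sum.elim_inl, Sum.elim_inr] <;> fun_prop

theorem differentiable_sig : Differentiable ℂ G.sig :=
  differentiable_pi.2 fun _ => G.differentiable_elim _

theorem differentiable_scl : Differentiable ℂ G.scl :=
  differentiable_pi.2 fun _ => G.differentiable_elim _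

theorem differentiable_tilde : Differentiable ℂ (G.tilde lt₀) := by
  refine differentiable_pi.2 fun a => differentiable_pi.2 fun α => ?_
  simp only [tilde, Function.update_apply]
  split_ifs
  · exact G.differentiable_elim _
  · exact G.differentiable_elim _
  · exact differentiable_const _

/-- The data at a point of the gauge slice, with the spinor of `a` translated by `t lts`. -/
def point (a : Leg k m) (lts : Spinor) (p : ℂ × (Fin N → ℂ)) : TwistorData k m :=
  (G.sig p.2, G.scl p.2, G.tilde lt₀ p.2 + Pi.single a (p.1 • lts))

theorem differentiable_point (a : Leg k m) (lts : Spinor) :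
    Differentiable ℂ (G.point lt₀ a lts) := by
  have h1 : Differentiable ℂ fun p : ℂ × (Fin N → ℂ) => p.2 := differentiable_snd
  have h2 : Differentiable ℂ fun p : ℂ × (Fin N → ℂ) =>
      (Pi.single a (p.1 • lts) : Leg k m → Spinor) := by
    refine differentiable_pi.2 fun b => ?_
    simp only [Pi.single_apply]
    split_ifs <;> fun_prop
  exact (G.differentiable_sig.comp h1).prodMk ((G.differentiable_scl.comp h1).prodMk
    (((G.differentiable_tilde lt₀).comp h1).add h2))

theorem eventually_domain {x : Fin N → ℂ} (h : G.domain x) : ∀ᶠ x in 𝓝 x, G.domain x := by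
  have h1 : ∀ᶠ x in 𝓝 x, ∀ a b, a ≠ b → G.sig x a ≠ G.sig x b := by
    refine Filter.eventually_all.2 fun a => Filter.eventually_all.2 fun b => ?_
    by_cases hab : a = b
    · simp [hab]
    · have hc := G.differentiable_sig.continuous
      have := (isOpen_ne_fun ((continuous_apply a).comp hc) ((continuous_apply b).comp hc)).mem_nhds
        (h.1.ne hab)
      filter_upwards [this] with x hx _ using hx
  have h2 : ∀ᶠ x in 𝓝 x, ∀ a, G.scl x a ≠ 0 := Filter.eventually_all.2 fun a =>
    ((continuous_apply a).comp G.differentiable_scl.continuous).continuousAt.eventually_ne (h.2 a)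
  filter_upwards [h1, h2] with x hx1 hx2
  exact ⟨fun a b hab => by_contra fun hne => hx1 a b hne hab, hx2⟩

end Gauge

/-! ### Exchanging coefficients on the support of the delta functions -/

section Transfer

variable {N k m : ℕ} {G : Gauge N k m} {lam lt₀ : Leg k m → Spinor} {S : Finset (Fin N → ℂ)}
  {φ : (Fin N → ℂ) → (Fin N → ℂ) → (Fin N → ℂ)} {ρ : ℝ} {D : (Fin N → ℂ) → Prop}
  {R : (Leg k m → ℂ) → (Leg k m → ℂ) → (Leg k m → Spinor) → ℂ}

/-- The torus of radius `ρ`, with the directions in `J` filled in. -/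
def filledTorus (N : ℕ) (ρ : ℝ) (J : Finset (Fin N)) : Set (Fin N → ℂ) :=
  {y | (∀ i, ‖y i‖ ≤ ρ) ∧ ∀ i ∉ J, ‖y i‖ = ρ}

theorem isCompact_filledTorus (ρ : ℝ) (J : Finset (Fin N)) : IsCompact (filledTorus N ρ J) := by
  have h1 : filledTorus N ρ J = Set.pi Set.univ fun i =>
      if i ∈ J then Metric.closedBall (0 : ℂ) ρ else Metric.sphere (0 : ℂ) ρ := by
    ext y
    simp only [filledTorus, Set.mem_ofPred_eq, Set.mem_pi, Set.mem_univ, true_implies]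
    constructor
    · rintro ⟨h1, h2⟩ i
      split_ifs with hi
      · simpa using h1 i
      · simpa using h2 i hi
    · intro h
      refine ⟨fun i => ?_, fun i hi => ?_⟩
      · have := h i
        split_ifs at this
        · simpa using this
        · simpa using (Metric.mem_sphere.1 this).le
      · simpa [hi] using h i
  rw [h1]
  refine isCompact_univ_pi fun i => ?_
  split_ifs
  · exact isCompact_closedBall _ _
  · exact isCompact_sphere _ _

/-- The shifted denominator. -/
def shiftedDelta (G : Gauge N k m) (lam lt₀ : Leg k m → Spinor) (a : Leg k m) (lts : Spinor)
    (t : ℂ) (x : Fin N → ℂ) (b : Leg k m × Fin 2) : ℂ :=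
  deltaArg (G.sig x) (G.scl x) lam (G.tilde lt₀ x + Pi.single a (t • lts)) [] b.1 b.2

theorem shiftedDelta_zero (a : Leg k m) (lts : Spinor) (x : Fin N → ℂ) (b : Leg k m × Fin 2) :
    shiftedDelta G lam lt₀ a lts 0 x b = G.equations lam lt₀ x (G.row.symm b) := by
  simp [shiftedDelta, Gauge.equations]

theorem differentiableAt_shiftedDelta (a : Leg k m) (lts : Spinor) {p : ℂ × (Fin N → ℂ)}
    (hp : G.domain p.2) (b : Leg k m × Fin 2) : DifferentiableAt ℂ
      (fun p : ℂ × (Fin N → ℂ) => shiftedDelta G lam lt₀ a lts p.1 p.2 b) p :=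
  DifferentiableAt.comp (g := fun q : TwistorData k m => deltaArg q.1 q.2.1 lam q.2.2 [] b.1 b.2)
    (f := G.point lt₀ a lts) p (differentiableAt_deltaArg lam _ _ hp.1)
    (G.differentiable_point lt₀ a lts p)

/-- Without translation the denominators are the coordinates `y`, and those outside `J` keep modulus
`ρ` on the filled torus, which is compact. -/
theorem eventually_shiftedDelta_ne
    (h : AdmissibleRadius D (G.equations lam lt₀) S φ ρ) (hD : ∀ x, D x → G.domain x)
    (a : Leg k m) (lts : Spinor) (J : Finset (Fin N)) :
    ∀ᶠ t in 𝓝 (0 : ℂ), ∀ u ∈ S, ∀ y ∈ filledTorus N ρ J, ∀ b, G.row.symm b ∉ J →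
      shiftedDelta G lam lt₀ a lts t (φ u y) b ≠ 0 := by
  refine h.eventually_compact (κ₀ := (0 : ℂ)) (isCompact_filledTorus ρ J) (fun y hy => hy.1)
    (P := fun t x => ∀ b, G.row.symm b ∉ J → shiftedDelta G lam lt₀ a lts t x b ≠ 0)
    fun u hu y hy => Filter.eventually_all.2 fun b => ?_
  by_cases hb : G.row.symm b ∈ J
  · simp [hb]
  · have hc := (differentiableAt_shiftedDelta (lam := lam) (lt₀ := lt₀) a lts
      (p := ((0 : ℂ), φ u y)) (hD _ (h.domain u hu y hy.1)) b).continuousAt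
    have h0 : shiftedDelta G lam lt₀ a lts 0 (φ u y) b ≠ 0 := by
      rw [shiftedDelta_zero, (h.inverse u hu y hy.1).self_of_nhds]
      intro h0
      have := hy.2 _ hb
      rw [h0, norm_zero] at this
      exact h.pos.ne this
    filter_upwards [hc.eventually_ne h0] with q hq _ using hq

/-- The integrand with coefficient `C` and denominators `T`. -/
def shiftedIntegrand (G : Gauge N k m) (lam lt₀ : Leg k m → Spinor)
    (R : (Leg k m → ℂ) → (Leg k m → ℂ) → (Leg k m → Spinor) → ℂ) (T : Finset (Leg k m × Fin 2))
    (C : (Fin N → ℂ) → ℂ) (a : Leg k m) (lts : Spinor) (t : ℂ) (x : Fin N → ℂ) : ℂ :=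
  C x * deltaKernel lam T R (G.sig x) (G.scl x) (G.tilde lt₀ x + Pi.single a (t • lts))

theorem differentiableAt_shiftedIntegrand (hR : HolomorphicWeight R)
    {T : Finset (Leg k m × Fin 2)} {C : (Fin N → ℂ) → ℂ} (a : Leg k m) (lts : Spinor)
    {t : ℂ} {x : Fin N → ℂ} (hx : G.domain x) (hC : DifferentiableAt ℂ C x)
    (hT : ∀ b ∈ T, shiftedDelta G lam lt₀ a lts t x b ≠ 0) :
    DifferentiableAt ℂ (fun p : ℂ × (Fin N → ℂ) =>
      shiftedIntegrand G lam lt₀ R T C a lts p.1 p.2) (t, x) :=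
  (DifferentiableAt.comp (g := C) (f := fun p : ℂ × (Fin N → ℂ) => p.2) (t, x) hC
    differentiableAt_snd).mul
  (DifferentiableAt.comp (g := fun q : TwistorData k m => deltaKernel lam T R q.1 q.2.1 q.2.2)
    (f := G.point lt₀ a lts) (t, x) (hR.deltaKernel hx.1 hx.2 hT)
    (G.differentiable_point lt₀ a lts _))

theorem mem_filledTorus_empty {y : Fin N → ℂ} (hy : ∀ i, ‖y i‖ = ρ) :
    y ∈ filledTorus N ρ ∅ := ⟨fun i => (hy i).le, fun i _ => hy i⟩

/-- Neighbourhood of zero in which the shifted denominators do not vanish. -/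
theorem exists_shift_neighbourhood
    (h : AdmissibleRadius D (G.equations lam lt₀) S φ ρ) (hD : ∀ x, D x → G.domain x)
    (a : Leg k m) (lts : Spinor) : ∃ U : Set ℂ, IsOpen U ∧ 0 ∈ U ∧ ∀ t ∈ U,
      ∀ J, J.card ≤ 1 → ∀ u ∈ S, ∀ y ∈ filledTorus N ρ J, ∀ b, G.row.symm b ∉ J →
      shiftedDelta G lam lt₀ a lts t (φ u y) b ≠ 0 := by
  -- The empty `J` serves the torus itself, a singleton serves Cauchy's theorem in the direction of
  -- a missing denominator.
  have h1 : ∀ᶠ t in 𝓝 (0 : ℂ), ∀ J : Finset (Fin N), J.card ≤ 1 → ∀ u ∈ S,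
      ∀ y ∈ filledTorus N ρ J, ∀ b, G.row.symm b ∉ J →
      shiftedDelta G lam lt₀ a lts t (φ u y) b ≠ 0 := by
    refine Filter.eventually_all.2 fun J => ?_
    filter_upwards [eventually_shiftedDelta_ne h hD a lts J] with t ht _ using ht
  obtain ⟨U, hUsub, hU, h0⟩ := _root_.mem_nhds_iff.1 h1
  exact ⟨U, hU, h0, fun t ht => hUsub ht⟩

theorem holomorphicOnTori_shiftedIntegrand (hR : HolomorphicWeight R)
    (h : AdmissibleRadius D (G.equations lam lt₀) S φ ρ) (hD : ∀ x, D x → G.domain x)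
    {a : Leg k m} {lts : Spinor} {U : Set ℂ}
    (hU : ∀ t ∈ U, ∀ J, J.card ≤ 1 → ∀ u ∈ S, ∀ y ∈ filledTorus N ρ J, ∀ b, G.row.symm b ∉ J →
      shiftedDelta G lam lt₀ a lts t (φ u y) b ≠ 0)
    (T : Finset (Leg k m × Fin 2)) {C : (Fin N → ℂ) → ℂ} (hC : ∀ x, D x → DifferentiableAt ℂ C x) :
    HolomorphicOnTori S φ ρ U (shiftedIntegrand G lam lt₀ R T C a lts) :=
  h.holomorphicOnTori fun u hu y hy t ht =>
    have hx := h.domain u hu y fun i => (hy i).le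
    differentiableAt_shiftedIntegrand hR a lts (hD _ hx) (hC _ hx) fun b _ =>
      hU t ht ∅ (by simp) u hu y (mem_filledTorus_empty hy) b (by simp)

/-- Cauchy's theorem: an integrand that lacks one of the denominators integrates to zero. -/
theorem contourSum_erase_eq_zero (hR : HolomorphicWeight R)
    (h : AdmissibleRadius D (G.equations lam lt₀) S φ ρ) (hD : ∀ x, D x → G.domain x)
    {a : Leg k m} {lts : Spinor} {t : ℂ}
    (ht : ∀ J, J.card ≤ 1 → ∀ u ∈ S, ∀ y ∈ filledTorus N ρ J, ∀ b, G.row.symm b ∉ J →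
      shiftedDelta G lam lt₀ a lts t (φ u y) b ≠ 0)
    (b₀ : Leg k m × Fin 2) {C : (Fin N → ℂ) → ℂ} (hC : ∀ x, D x → DifferentiableAt ℂ C x) :
    contourSum S φ ρ (shiftedIntegrand G lam lt₀ R (univ.erase b₀) C a lts t) = 0 := by
  -- In the direction belonging to the missing denominator the integrand extends holomorphically
  -- over the whole disc.
  refine contourSum_eq_zero h.pos.le fun u hu => ⟨G.row.symm b₀, fun y hy1 hy2 => ?_⟩
  have hle : ∀ i, ‖y i‖ ≤ ρ := fun i => by
    rcases eq_or_ne i (G.row.symm b₀) with rfl | hi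
    · exact hy2
    · exact (hy1 i hi).le
  have hx := h.domain u hu y hle
  have hd := h.differentiable u hu y hle
  refine DifferentiableAt.mul ?_ (differentiableAt_det_fderiv hd)
  have h1 := differentiableAt_shiftedIntegrand (lam := lam) (lt₀ := lt₀) hR
    (T := univ.erase b₀) a lts (t := t) (hD _ hx)
    (hC _ hx) fun b hb => ht {G.row.symm b₀} (by simp) u hu y
      ⟨hle, fun i hi => hy1 i (by simpa using hi)⟩ b (by
        simpa using fun h => Finset.ne_of_mem_erase hb h)
  exact DifferentiableAt.comp (f := fun y => (t, φ u y)) y h1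
    ((differentiableAt_const _).prodMk hd.self_of_nhds)

/-- Coefficients that differ by multiples of the denominators of one particle may be exchanged
under the contour integral, and Taylor coefficients taken outside. -/
theorem contourSum_softTerm (hR : HolomorphicWeight R)
    (h : AdmissibleRadius D (G.equations lam lt₀) S φ ρ) (hD : ∀ x, D x → G.domain x)
    {a : Leg k m} {lts : Spinor} {C C' : (Fin N → ℂ) → ℂ} {E : Fin 2 → (Fin N → ℂ) → ℂ}
    (hC : ∀ x, D x → DifferentiableAt ℂ C x) (hC' : ∀ x, D x → DifferentiableAt ℂ C' x)
    (hE : ∀ α x, D x → DifferentiableAt ℂ (E α) x)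
    (hCC' : ∀ x, D x → ∀ t,
      C x = C' x + ∑ α, shiftedDelta G lam lt₀ a lts t x (a, α) * E α x) (l : ℕ) :
    contourSum S φ ρ (fun x => C x * softTerm l fun t => deltaKernel lam univ R (G.sig x)
      (G.scl x) (G.tilde lt₀ x + Pi.single a (t • lts))) =
    softTerm l fun t => contourSum S φ ρ (shiftedIntegrand G lam lt₀ R univ C' a lts t) := by
  obtain ⟨U, hU, h0, hne⟩ := exists_shift_neighbourhood (lam := lam) (lt₀ := lt₀) h hD a lts
  have hol := holomorphicOnTori_shiftedIntegrand (lam := lam) (lt₀ := lt₀) hR h hD hne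
  -- The exchange is made for each small `t` before expanding, because the denominators to be
  -- cancelled may themselves depend on `t`.
  have h1 : softTerm l (fun t => contourSum S φ ρ (shiftedIntegrand G lam lt₀ R univ C' a lts t)) =
      softTerm l fun t => contourSum S φ ρ (shiftedIntegrand G lam lt₀ R univ C a lts t) := by
    refine softTerm_congr l ?_
    filter_upwards [hU.mem_nhds h0] with t ht
    have h2 : contourSum S φ ρ (shiftedIntegrand G lam lt₀ R univ C a lts t) =
        contourSum S φ ρ fun x => shiftedIntegrand G lam lt₀ R univ C' a lts t x +
          ∑ α, shiftedIntegrand G lam lt₀ R (univ.erase (a, α)) (E α) a lts t x := by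
      refine contourSum_congr h.pos.le fun u hu y hy => ?_
      have hx := h.domain u hu y fun i => (hy i).le
      have hd : ∀ α, shiftedDelta G lam lt₀ a lts t (φ u y) (a, α) ≠ 0 := fun α =>
        hne t ht ∅ (by simp) u hu y (mem_filledTorus_empty hy) _ (by simp)
      simp only [shiftedIntegrand, hCC' _ hx t, add_mul, Finset.sum_mul]
      congr 1
      refine Finset.sum_congr rfl fun α _ => ?_
      simp only [deltaKernel, ← Finset.mul_prod_erase _ _ (Finset.mem_univ (a, α))]
      have := hd α
      rw [shiftedDelta] at this ⊢
      field_simp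
    rw [h2, contourSum_add ((hol univ hC').continuousOnTori ht)
      (ContinuousOnTori.sum fun α _ => (hol (univ.erase (a, α)) (hE α)).continuousOnTori ht),
      contourSum_sum fun α _ => (hol (univ.erase (a, α)) (hE α)).continuousOnTori ht]
    simp only [contourSum_erase_eq_zero hR h hD (hne t ht) _ (hE _), Finset.sum_const_zero,
      add_zero]
  rw [h1, softTerm, (hol univ hC).iteratedDeriv_eq hU l 0 h0, div_eq_inv_mul,
    ← contourSum_const_mul]
  congr 1
  ext x
  have h3 := softTerm_const_mul l (C x) fun t => deltaKernel lam univ R (G.sig x)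
      (G.scl x) (G.tilde lt₀ x + Pi.single a (t • lts))
  rw [← h3, softTerm, div_eq_inv_mul]
  rfl

/-- Supplies the integrability needed to split the contour integral over the hard particles. -/
theorem continuousOnTori_softTerm (hR : HolomorphicWeight R)
    (h : AdmissibleRadius D (G.equations lam lt₀) S φ ρ) (hD : ∀ x, D x → G.domain x)
    {a : Leg k m} {lts : Spinor} {C : (Fin N → ℂ) → ℂ}
    (hC : ∀ x, D x → DifferentiableAt ℂ C x) (l : ℕ) :
    ContinuousOnTori S φ ρ (fun x => C x * softTerm l fun t => deltaKernel lam univ R (G.sig x)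
      (G.scl x) (G.tilde lt₀ x + Pi.single a (t • lts))) := by
  obtain ⟨U, hU, h0, hne⟩ := exists_shift_neighbourhood (lam := lam) (lt₀ := lt₀) h hD a lts
  have key : ∀ l, HolomorphicOnTori S φ ρ U fun t x =>
      iteratedDeriv l (fun t => shiftedIntegrand G lam lt₀ R univ C a lts t x) t := by
    intro l
    induction l with
    | zero => simpa using! holomorphicOnTori_shiftedIntegrand hR h hD hne univ hC
    | succ l ih => simpa only [iteratedDeriv_succ] using ih.deriv hU
  have h1 := ((key l).continuousOnTori h0).const_mul ((l.factorial : ℂ)⁻¹)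
  convert h1 using 2 with x
  rw [← softTerm_const_mul, softTerm, div_eq_inv_mul]
  rfl

end Transfer

/-! ### Determinants with a rank-one pole -/

section Determinants

variable {V : Type} [Fintype V] [DecidableEq V]

theorem analyticAt_det {E : Type*} [NormedAddCommGroup E] [NormedSpace ℂ E] {A : E → Matrix V V ℂ}
    {x : E} (h : ∀ v w, AnalyticAt ℂ (fun q => A q v w) x) :
    AnalyticAt ℂ (fun q => (A q).det) x := by
  simp only [Matrix.det_apply, Units.smul_def, zsmul_eq_mul]
  exact Finset.analyticAt_fun_sum _ fun σ _ => analyticAt_const.mul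
    (Finset.analyticAt_fun_prod _ fun v _ => h _ _)

/-- After reordering the index `none` the matrix is block triangular. -/
theorem det_option_of_row {A : Matrix (Option V) (Option V) ℂ} (h : ∀ v, A none (some v) = 0) :
    A.det = A none none * (A.submatrix some some).det := by
  rw [← Matrix.det_submatrix_equiv_self (Equiv.optionEquivSumPUnit.{0} V).symm A]
  have h1 : A.submatrix (Equiv.optionEquivSumPUnit.{0} V).symm (Equiv.optionEquivSumPUnit V).symm =
      Matrix.fromBlocks (A.submatrix some some) (Matrix.of fun v _ => A (some v) none) 0
        (Matrix.of fun _ _ => A none none) := by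
    ext (i | i) (j | j) <;> simp [h]
  rw [h1, Matrix.det_fromBlocks_zero₂₁, Matrix.det_unique (Matrix.of _)]
  simp [mul_comm]

/-- Result of row and column operations that remove a pole of rank one. -/
def resolved (x a u : ℂ) (δ : V → ℂ) (Q : Matrix (Option V) (Option V) ℂ) :
    Matrix (Option V) (Option V) ℂ := Matrix.of fun v w =>
  v.elim (w.elim (a + x * Q none none) fun q => x * (Q none (some q) + u * δ q * Q none none))
    fun p => w.elim (Q (some p) none - δ p * Q none none) fun q =>
      Q (some p) (some q) - δ p * Q none (some q) +
        u * δ q * (Q (some p) none - δ p * Q none none)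

/-- Subtracting `δ v` times the row `none` confines the pole to that row, adding `u * δ w` times the
column `none` confines it to the corner, and scaling the row `none` by `x` removes it. The result
makes sense at `x = 0`. -/
theorem det_resolved {M Q : Matrix (Option V) (Option V) ℂ} {δ : V → ℂ} {x a u : ℂ} (hx : x ≠ 0)
    (hM : ∀ v w, M v w = x⁻¹ * (v.elim 1 δ * w.elim a fun q => -(u * a) * δ q) + Q v w) :
    x * M.det = (resolved x a u δ Q).det := by
  set δ' : Option V → ℂ := fun v => v.elim 0 δ with hδ'
  set M₁ : Matrix (Option V) (Option V) ℂ := Matrix.of fun v w => M v w - δ' v * M none w with hM₁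
  set M₂ : Matrix (Option V) (Option V) ℂ := Matrix.of fun v w => M₁ v w + u * δ' w * M₁ v none
    with hM₂
  have h1 : M₁.det = M.det :=
    Matrix.det_eq_of_forall_row_eq_smul_add_const (fun v => -δ' v) none (by simp [hδ'])
      fun v w => by simp [hM₁]; ring
  have h2 : M₂.det = M₁.det := by
    rw [← Matrix.det_transpose M₂, ← Matrix.det_transpose M₁]
    exact Matrix.det_eq_of_forall_row_eq_smul_add_const (fun w => u * δ' w) none (by simp [hδ'])
      fun v w => by simp [hM₂]
  have h3 := Matrix.det_mul_column (fun v : Option V => v.elim x fun _ => 1) M₂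
  rw [Fintype.prod_option] at h3
  simp only [Option.elim_none, Option.elim_some, Finset.prod_const_one, mul_one] at h3
  rw [← h1, ← h2, ← h3]
  congr 1
  ext v w
  rcases v with _ | p <;> rcases w with _ | q <;>
    simp only [hM₂, hM₁, hδ', resolved, Matrix.of_apply, hM, Option.elim_none, Option.elim_some] <;>
    field_simp <;> ring

/-- At the pole the row `none` has only its diagonal entry `a` left. -/
theorem det_resolved_zero (a u : ℂ) (δ : V → ℂ) (Q : Matrix (Option V) (Option V) ℂ) :
    (resolved 0 a u δ Q).det = a * (Matrix.of fun p q => Q (some p) (some q) -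
      δ p * Q none (some q) + u * δ q * (Q (some p) none - δ p * Q none none)).det := by
  rw [det_option_of_row fun v => by simp [resolved]]
  simp only [resolved, Matrix.of_apply, Option.elim_none, zero_mul, add_zero]
  rfl

theorem analyticAt_det_resolved {E : Type*} [NormedAddCommGroup E] [NormedSpace ℂ E] {x a u : E → ℂ}
    {δ : V → ℂ} {Q : E → Matrix (Option V) (Option V) ℂ} {q₀ : E} (hx : AnalyticAt ℂ x q₀)
    (ha : AnalyticAt ℂ a q₀) (hu : AnalyticAt ℂ u q₀)
    (hQ : ∀ v w, AnalyticAt ℂ (fun q => Q q v w) q₀) :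
    AnalyticAt ℂ (fun q => (resolved (x q) (a q) (u q) δ (Q q)).det) q₀ := by
  refine analyticAt_det fun v w => ?_
  have h1 := hQ none none
  rcases v with _ | p <;> rcases w with _ | r <;>
    simp only [resolved, Matrix.of_apply, Option.elim_none, Option.elim_some]
  · fun_prop
  · have h2 := hQ none (some r); fun_prop
  · have h2 := hQ (some p) none; fun_prop
  · have h2 := hQ none (some r)
    have h3 := hQ (some p) none
    have h4 := hQ (some p) (some r)
    fun_prop

end Determinants

/-! ### Residues of soft operators at regular and singular points of `λ(z)` -/

section SoftResidueLemmas

/-- Coefficient of the term of order `l` of a soft operator of order `e` in `⟨ξ λ⟩`. -/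
def softCoeff (e l : ℕ) (ξ ls v : Spinor) : ℂ := br ξ v ^ (e - l) / (br ξ ls ^ (e - l) * br ls v)

/-- The expansion parameter enters multiplied by `X / A`, so order `l` uses up `l` of the `e` powers
in the prefactor. -/
theorem softTerm_rescaled {e l : ℕ} (hl : l ≤ e) {X A B : ℂ} (hX : X ≠ 0) (hA : A ≠ 0)
    (h : ℂ → ℂ) : softTerm l (fun τ => h (τ * (X / A)) * (A ^ e / (X ^ e * B))) =
      A ^ (e - l) / (X ^ (e - l) * B) * softTerm l h := by
  simp only [mul_comm _ (A ^ e / (X ^ e * B))]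
  rw [softTerm_const_mul, softTerm_comp_mul]
  obtain ⟨r, rfl⟩ := Nat.exists_eq_add_of_le hl
  rw [Nat.add_sub_cancel_left, pow_add, pow_add, div_pow]
  field_simp

/-- The case of a twistor operator: `λ(z)` is regular at the puncture, and the pole comes from the
rest `H` of the integrand. -/
theorem hasResidue_regular_field {e l : ℕ} (hl : l ≤ e) {X c : ℂ} (hX : X ≠ 0) {A B : ℂ → ℂ}
    (hA : AnalyticAt ℂ A c) (hB : AnalyticAt ℂ B c) (hB0 : B c ≠ 0)
    (hA0 : ∀ᶠ z in 𝓝[≠] c, A z ≠ 0) {f H H' : ℂ → ℂ → ℂ}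
    (hH' : AnalyticAt ℂ (fun p : ℂ × ℂ => H' p.1 p.2) (0, c))
    (hH : ∀ᶠ z in 𝓝[≠] c, ∀ t, H t z = (z - c)⁻¹ * H' t z)
    (hf : ∀ᶠ z in 𝓝[≠] c, ∀ τ, f τ z = H (τ * (X / A z)) z * (A z ^ e / (X ^ e * B z))) :
    HasResidue (fun z => softTerm l fun τ => f τ z) c
      (A c ^ (e - l) / (X ^ (e - l) * B c) * softTerm l fun t => H' t c) := by
  have h1 := HasResidue.simplePole ((((hA.fun_pow (e - l)).fun_div
    ((analyticAt_const (v := X ^ (e - l))).fun_mul hB)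
    (mul_ne_zero (pow_ne_zero _ hX) hB0))).fun_mul (analyticAt_softTerm l hH'))
  refine h1.congr ?_
  filter_upwards [hA0, hH, hf] with z hz1 hz2 hz3
  simp only [hz3]
  rw [softTerm_rescaled hl hX hz1 fun t => H t z]
  simp only [hz2]
  rw [softTerm_const_mul]
  ring

/-- The case of a dual twistor operator: `A` and `B` have simple poles themselves, and the
translation parameter is rescaled by `1 / (z - c)`. Counting powers shows that the pole is simple
for every order `l`. -/
theorem hasResidue_singular_field {e l : ℕ} (he : e ≤ 2) (hl : l ≤ e) {X c : ℂ} (hX : X ≠ 0)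
    {A B A' B' : ℂ → ℂ} (hA : AnalyticAt ℂ A' c) (hB : AnalyticAt ℂ B' c) (hB0 : B' c ≠ 0)
    (hA' : ∀ᶠ z in 𝓝[≠] c, A z = (z - c)⁻¹ * A' z) (hB' : ∀ᶠ z in 𝓝[≠] c, B z = (z - c)⁻¹ * B' z)
    (hA0 : ∀ᶠ z in 𝓝[≠] c, A z ≠ 0) {f H H' : ℂ → ℂ → ℂ}
    (hH' : AnalyticAt ℂ (fun p : ℂ × ℂ => H' p.1 p.2) (0, c))
    (hH : ∀ᶠ z in 𝓝[≠] c, ∀ t, H t z = ((z - c)⁻¹) ^ (2 - e) * H' (t * (z - c)⁻¹) z)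
    (hf : ∀ᶠ z in 𝓝[≠] c, ∀ τ, f τ z = H (τ * (X / A z)) z * (A z ^ e / (X ^ e * B z))) :
    HasResidue (fun z => softTerm l fun τ => f τ z) c
      (A' c ^ (e - l) / (X ^ (e - l) * B' c) * softTerm l fun t => H' t c) := by
  have h1 := HasResidue.simplePole ((((hA.fun_pow (e - l)).fun_div
    ((analyticAt_const (v := X ^ (e - l))).fun_mul hB)
    (mul_ne_zero (pow_ne_zero _ hX) hB0))).fun_mul (analyticAt_softTerm l hH'))
  refine h1.congr ?_
  filter_upwards [hA0, hH, hf, hA', hB', self_mem_nhdsWithin] with z hz1 hz2 hz3 hz4 hz5 hz6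
  have hz : z - c ≠ 0 := sub_ne_zero.2 hz6
  simp only [hz3]
  rw [softTerm_rescaled hl hX hz1 fun t => H t z]
  simp only [hz2]
  rw [softTerm_const_mul, softTerm_comp_mul l (fun t => H' t z), hz4, hz5, mul_pow]
  -- The exponents `e - l`, `2 - e` and `l` add up to two, and the pole of `B` in the denominator
  -- takes one away.
  have h2 : ((z - c)⁻¹) ^ (e - l) * (((z - c)⁻¹) ^ (2 - e) * ((z - c)⁻¹) ^ l) =
      (z - c)⁻¹ * (z - c)⁻¹ := by
    rw [← pow_add, ← pow_add, ← pow_two]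
    congr 1
    omega
  calc _ = (((z - c)⁻¹) ^ (e - l) * (((z - c)⁻¹) ^ (2 - e) * ((z - c)⁻¹) ^ l)) *
        (A' z ^ (e - l) / (X ^ (e - l) * ((z - c)⁻¹ * B' z)) * softTerm l fun t => H' t z) := by ring
    _ = _ := by
      rw [h2]
      have hw := inv_ne_zero hz
      field_simp

/-- A nonzero sum of simple poles has isolated zeros. -/
theorem eventually_poleSum_ne_zero {ι : Type*} [Fintype ι] [DecidableEq ι] {σ f : ι → ℂ}
    (hσ : Function.Injective σ) {b : ι} (hb : f b ≠ 0) (c : ℂ) :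
    ∀ᶠ z in 𝓝[≠] c, poleSum σ f z ≠ 0 := by
  -- Clearing denominators gives a polynomial, which is nonzero because at `σ b` only the term of
  -- `b` survives.
  set P : Polynomial ℂ := ∑ a, Polynomial.C (f a) *
    ∏ b ∈ univ.erase a, (Polynomial.X - Polynomial.C (σ b)) with hP
  have hev : ∀ z, P.eval z = ∑ a, f a * ∏ b ∈ univ.erase a, (z - σ b) := by
    intro z
    simp [hP, Polynomial.eval_finsetSum, Polynomial.eval_prod]
  have hP0 : P ≠ 0 := by
    intro h0
    have h1 := hev (σ b)
    rw [h0, Polynomial.eval_zero, Finset.sum_eq_single b] at h1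
    · exact mul_ne_zero hb (Finset.prod_ne_zero_iff.2 fun a ha => sub_ne_zero.2
        fun h => Finset.ne_of_mem_erase ha (hσ h).symm) h1.symm
    · intro a _ ha
      rw [Finset.prod_eq_zero (Finset.mem_erase.2 ⟨ha.symm, Finset.mem_univ b⟩) (sub_self _),
        mul_zero]
    · simp
  have hfin : ∀ᶠ z in 𝓝[≠] c, ¬P.IsRoot z := by
    have h2 : ({z | P.IsRoot z} \ {c})ᶜ ∈ 𝓝 c :=
      ((Polynomial.finite_setOfPred_isRoot hP0).subset Set.sdiff_subset).isClosed.isOpen_compl.mem_nhds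
        (by simp)
    filter_upwards [nhdsWithin_le_nhds h2, self_mem_nhdsWithin] with z hz hzc hr
    exact hz ⟨hr, hzc⟩
  have hne : ∀ᶠ z in 𝓝[≠] c, ∀ a, σ a ≠ z := by
    refine Filter.eventually_all.2 fun a => ?_
    rcases eq_or_ne (σ a) c with h | h
    · filter_upwards [self_mem_nhdsWithin] with z hz
      rw [h]; exact Ne.symm hz
    · have h1 : ∀ᶠ z in 𝓝 c, z ≠ σ a := isOpen_ne.mem_nhds h.symm
      exact (h1.filter_mono nhdsWithin_le_nhds).mono fun z hz => Ne.symm hz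
  filter_upwards [hfin, hne] with z hz1 hz2 h0
  refine hz1 ?_
  rw [Polynomial.IsRoot, hev]
  have h1 : ∑ a, f a * ∏ b ∈ univ.erase a, (z - σ b) = (∏ b, (z - σ b)) * poleSum σ f z := by
    rw [poleSum, Finset.mul_sum]
    refine Finset.sum_congr rfl fun a _ => ?_
    rw [← Finset.mul_prod_erase univ (fun b => z - σ b) (Finset.mem_univ a)]
    have := sub_ne_zero.2 (hz2 a).symm
    field_simp
  rw [h1, h0, mul_zero]

end SoftResidueLemmas

/-! ### Bilinearity of the spinor brackets -/

section Brackets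

theorem br_add_right (x y z : Spinor) : br x (y + z) = br x y + br x z := by
  simp only [br, Pi.add_apply]; ring

theorem br_add_left (x y z : Spinor) : br (x + y) z = br x z + br y z := by
  simp only [br, Pi.add_apply]; ring

theorem br_smul_right (c : ℂ) (x y : Spinor) : br x (c • y) = c * br x y := by
  simp only [br, Pi.smul_apply, smul_eq_mul]; ring

theorem br_smul_left (c : ℂ) (x y : Spinor) : br (c • x) y = c * br x y := by
  simp only [br, Pi.smul_apply, smul_eq_mul]; ring

theorem br_sum_right {ι : Type*} (t : Finset ι) (x : Spinor) (f : ι → Spinor) :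
    br x (∑ i ∈ t, f i) = ∑ i ∈ t, br x (f i) := by
  simp only [br, Finset.sum_apply, Finset.mul_sum, Finset.sum_sub_distrib]

theorem br_neg_swap (x y : Spinor) : br x y = -br y x := by
  simp only [br]; ring

end Brackets

/-! ### Shifts of the denominators by soft sources -/

section TwistorFields

variable {k m : ℕ} {σ s : Leg k m → ℂ} {lam lt : Leg k m → Spinor}

theorem br_lamField (v : Spinor) (σ s : Leg k m → ℂ) (lam : Leg k m → Spinor) (z : ℂ) :
    br v (lamField σ s lam z) =
      poleSum (fun i : Fin k => σ (.inl i)) (fun i => s (.inl i) * br v (lam (.inl i))) z := by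
  simp only [lamField, br_sum_right, br_smul_right, poleSum]
  exact Finset.sum_congr rfl fun i _ => by ring

theorem br_ltField (v : Spinor) (σ s : Leg k m → ℂ) (lt : Leg k m → Spinor) (z : ℂ) :
    br v (ltField σ s lt [] z) =
      poleSum (fun p : Fin m => σ (.inr p)) (fun p => s (.inr p) * br v (lt (.inr p))) z := by
  simp only [ltField, List.map_nil, List.sum_nil, add_zero, br_sum_right, br_smul_right, poleSum]
  exact Finset.sum_congr rfl fun i _ => by ring

theorem ltField_src (σ s : Leg k m → ℂ) (lt : Leg k m → Spinor) (z c : ℂ) (v : Spinor) :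
    ltField σ s lt [(z, v)] c = ltField σ s lt [] c + (c - z)⁻¹ • v := by
  simp [ltField]

theorem ltField_add_single_inr (σ s : Leg k m → ℂ) (lt : Leg k m → Spinor) (p : Fin m) (v : Spinor)
    (z : ℂ) : ltField σ s (lt + Pi.single (.inr p) v) [] z =
      ltField σ s lt [] z + (s (.inr p) / (z - σ (.inr p))) • v := by
  simp only [ltField, List.map_nil, List.sum_nil, add_zero, Pi.add_apply, smul_add,
    Finset.sum_add_distrib]
  congr 1
  rw [Finset.sum_eq_single p]
  · simp
  · intro q _ hq
    simp [hq]
  · simp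

theorem ltField_add_single_inl (σ s : Leg k m → ℂ) (lt : Leg k m → Spinor) (i : Fin k) (v : Spinor)
    (z : ℂ) : ltField σ s (lt + Pi.single (.inl i) v) [] z = ltField σ s lt [] z := by
  simp [ltField]

/-- Product of the denominators, shifted by multiples of the spinor `lts`. -/
def deltaProduct (σ s : Leg k m → ℂ) (lam lt : Leg k m → Spinor) (lts : Spinor)
    (ω : Leg k m → ℂ) : ℂ :=
  ∏ b : Leg k m × Fin 2, (deltaArg σ s lam lt [] b.1 b.2 + ω b.1 * lts b.2)⁻¹

theorem analyticAt_deltaProduct {E : Type*} [NormedAddCommGroup E] [NormedSpace ℂ E] {lts : Spinor}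
    (hne : ∀ b β, deltaArg σ s lam lt [] b β ≠ 0) {ω : E → Leg k m → ℂ} {q₀ : E}
    (hω : ∀ b, AnalyticAt ℂ (fun q => ω q b) q₀) (h0 : ∀ b, ω q₀ b = 0) :
    AnalyticAt ℂ (fun q => deltaProduct σ s lam lt lts (ω q)) q₀ :=
  Finset.analyticAt_fun_prod _ fun b _ => AnalyticAt.fun_inv
    (analyticAt_const.fun_add ((hω b.1).fun_mul analyticAt_const)) (by simpa [h0] using hne _ _)

/-- Shift caused by a source `t lts` at `z`. -/
def sourceShift (σ s : Leg k m → ℂ) (t z : ℂ) : Leg k m → ℂ :=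
  Sum.elim (fun i => s (.inl i) * t * (z - σ (.inl i))⁻¹) fun _ => 0

/-- A source for `λ̃` is felt only through the values `λ̃(σ_i)`, so only the denominators of dual
twistor operators move. -/
theorem prod_deltaArg_src (σ s : Leg k m → ℂ) (lam lt : Leg k m → Spinor) (lts : Spinor)
    (t z : ℂ) : ∏ a, ∏ α, (deltaArg σ s lam lt [(z, t • lts)] a α)⁻¹ =
      deltaProduct σ s lam lt lts (sourceShift σ s t z) := by
  rw [deltaProduct, Fintype.prod_prod_type]
  refine Finset.prod_congr rfl fun a _ => Finset.prod_congr rfl fun α _ => ?_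
  congr 1
  rcases a with i | p
  · simp only [deltaArg, ltField_src, sourceShift, Sum.elim_inl, Pi.sub_apply, Pi.smul_apply,
      Pi.add_apply, smul_eq_mul]
    rw [← neg_sub z, inv_neg]
    ring
  · simp [deltaArg, sourceShift]

variable {R : (Leg k m → ℂ) → (Leg k m → ℂ) → (Leg k m → Spinor) → ℂ}

/-- The spinor `λ̃_i` is not a source of the field `λ̃(z)`; it occurs only in the denominators of
its own particle. -/
theorem deltaKernel_shift_inl (i : Fin k) (lts : Spinor) (t : ℂ) :
    deltaKernel lam univ R σ s (lt + Pi.single (.inl i) (t • lts)) =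
      R σ s (lt + Pi.single (.inl i) (t • lts)) *
        deltaProduct σ s lam lt lts (Pi.single (.inl i) t) := by
  rw [deltaKernel, deltaProduct]
  congr 1
  refine Finset.prod_congr rfl fun b _ => ?_
  congr 1
  rcases b with ⟨j | p, β⟩
  · simp only [deltaArg, ltField_add_single_inl, Pi.add_apply, Pi.sub_apply]
    rcases eq_or_ne j i with rfl | h
    · simp; ring
    · simp [h]
  · simp [deltaArg]

/-- Translating `λ̃_p` amounts to placing a source of strength `s_p t` at its puncture. This is why
the residue of the soft operator there acts as a translation. -/
theorem deltaKernel_shift_inr (p : Fin m) (lts : Spinor) (t : ℂ) :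
    deltaKernel lam univ R σ s (lt + Pi.single (.inr p) (t • lts)) =
      R σ s (lt + Pi.single (.inr p) (t • lts)) *
        deltaProduct σ s lam lt lts (sourceShift σ s (s (.inr p) * t) (σ (.inr p))) := by
  rw [deltaKernel, deltaProduct]
  congr 1
  refine Finset.prod_congr rfl fun b _ => ?_
  congr 1
  rcases b with ⟨j | q, β⟩
  · simp only [deltaArg, ltField_add_single_inr, Pi.add_apply, Pi.sub_apply, sourceShift,
      Sum.elim_inl, Pi.smul_apply, smul_eq_mul]
    rw [← neg_sub (σ (.inr p)), div_neg, div_eq_mul_inv]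
    simp
    ring
  · simp [deltaArg, sourceShift]

theorem analyticAt_sourceShift (hσ : Function.Injective σ) (p : Fin m) (b : Leg k m) :
    AnalyticAt ℂ (fun q : ℂ × ℂ => sourceShift σ s q.1 q.2 b) (0, σ (.inr p)) := by
  rcases b with i | q
  · simp only [sourceShift, Sum.elim_inl]
    have : σ (.inr p) - σ (.inl i) ≠ 0 := sub_ne_zero.2 fun h => by simpa using hσ h
    exact (analyticAt_const.fun_mul analyticAt_fst).fun_mul
      ((analyticAt_snd.fun_sub analyticAt_const).fun_inv this)
  · exact analyticAt_const

/-- The shift caused by a source at a puncture `σ_i`, with the pole removed. -/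
def dampedShift (σ s : Leg k m → ℂ) (i : Fin k) (t z : ℂ) : Leg k m → ℂ :=
  Sum.elim (fun j => s (.inl j) * t *
    if j = i then 1 else (z - σ (.inl i)) * (z - σ (.inl j))⁻¹) fun _ => 0

/-- Absorbing `1 / (z - σ_i)` into `t` leaves a shift that is analytic at the puncture. -/
theorem sourceShift_eq_damped {i : Fin k} {z : ℂ} (hz : z ≠ σ (.inl i)) (t : ℂ) :
    sourceShift σ s t z = dampedShift σ s i (t * (z - σ (.inl i))⁻¹) z := by
  have := sub_ne_zero.2 hz
  funext b
  rcases b with j | p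
  · simp only [sourceShift, dampedShift, Sum.elim_inl]
    split_ifs with h
    · rw [h]; ring
    · field_simp
  · rfl

/-- All other particles are suppressed by `z - σ_i`, so at the puncture only particle `i` is
translated. -/
theorem dampedShift_self (σ s : Leg k m → ℂ) (i : Fin k) (t : ℂ) :
    dampedShift σ s i t (σ (.inl i)) = Pi.single (.inl i) (s (.inl i) * t) := by
  funext b
  rcases b with j | p
  · rcases eq_or_ne j i with rfl | h
    · simp [dampedShift]
    · simp [dampedShift, h]
  · simp [dampedShift]

theorem analyticAt_dampedShift (hσ : Function.Injective σ) (i : Fin k) (b : Leg k m) :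
    AnalyticAt ℂ (fun q : ℂ × ℂ => dampedShift σ s i q.1 q.2 b) (0, σ (.inl i)) := by
  rcases b with j | q
  · simp only [dampedShift, Sum.elim_inl]
    split_ifs with h
    · exact (analyticAt_const.fun_mul analyticAt_fst).fun_mul analyticAt_const
    · have : σ (.inl i) - σ (.inl j) ≠ 0 := sub_ne_zero.2 fun h' => h (by simpa using (hσ h').symm)
      exact (analyticAt_const.fun_mul analyticAt_fst).fun_mul
        ((analyticAt_snd.fun_sub analyticAt_const).fun_mul
          ((analyticAt_snd.fun_sub analyticAt_const).fun_inv this))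
  · exact analyticAt_const

/-- Genericity of a point of the contour. -/
structure GenericPoint (σ s : Leg k m → ℂ) (lam lt : Leg k m → Spinor) (ξ ls : Spinor) : Prop where
  inj : Function.Injective σ
  scale_ne : ∀ a, s a ≠ 0
  delta_ne : ∀ b β, deltaArg σ s lam lt [] b β ≠ 0
  soft_ne : ∀ a, br ls (lam a) ≠ 0
  field_ne : ∀ p : Fin m, br ls (lamField σ s lam (σ (.inr p))) ≠ 0
  ref_ne : br ξ ls ≠ 0
  exists_ne : ∃ i : Fin k, br ξ (lam (.inl i)) ≠ 0

variable {ξ ls : Spinor}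

theorem GenericPoint.inj_inl (h : GenericPoint σ s lam lt ξ ls) :
    Function.Injective fun i : Fin k => σ (.inl i) := h.inj.comp Sum.inl_injective

theorem GenericPoint.eventually_ne (h : GenericPoint σ s lam lt ξ ls) (c : ℂ) :
    ∀ᶠ z in 𝓝[≠] c, br ξ (lamField σ s lam z) ≠ 0 := by
  obtain ⟨i, hi⟩ := h.exists_ne
  simp only [br_lamField]
  exact eventually_poleSum_ne_zero (f := fun i => s (.inl i) * br ξ (lam (.inl i))) h.inj_inl
    (mul_ne_zero (h.scale_ne (.inl i)) hi) c

theorem analyticAt_poleSum {ι : Type*} [Fintype ι] {σ : ι → ℂ} (f : ι → ℂ) {c : ℂ}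
    (hc : ∀ a, c ≠ σ a) : AnalyticAt ℂ (poleSum σ f) c :=
  Finset.analyticAt_fun_sum _ fun a _ => AnalyticAt.fun_mul
    ((analyticAt_id.sub analyticAt_const).inv (sub_ne_zero.2 (hc a))) analyticAt_const

/-- The powers of `s_p` combine to the exponent `e - l - 1`, the degree of homogeneity of
`softCoeff`. They are absorbed by evaluating it at `s_p λ(σ_p)`, which the delta functions set equal
to `λ_p`. -/
theorem GenericPoint.residueAt_inr (h : GenericPoint σ s lam lt ξ ls) (p : Fin m) {e l : ℕ}
    (he : 1 ≤ e) (hl : l ≤ e) {f H H' : ℂ → ℂ → ℂ} {K : ℂ → ℂ} {α : ℂ}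
    (hf : ∀ z τ, f τ z = H (τ * softScale ξ ls lam σ s z) z *
      (br ξ (lamField σ s lam z) ^ e / (br ξ ls ^ e * br ls (lamField σ s lam z))))
    (hH' : AnalyticAt ℂ (fun q : ℂ × ℂ => H' q.1 q.2) (0, σ (.inr p)))
    (hH : ∀ᶠ z in 𝓝[≠] (σ (.inr p)), ∀ t, H t z = (z - σ (.inr p))⁻¹ * H' t z)
    (hK : ∀ t, H' t (σ (.inr p)) = s (.inr p) ^ (e - 1) * α * K (t * (s (.inr p))⁻¹)) :
    residueAt (fun z => softTerm l fun τ => f τ z) (σ (.inr p)) =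
      softCoeff e l ξ ls (s (.inr p) • lamField σ s lam (σ (.inr p))) * α * softTerm l K := by
  have hne : ∀ i : Fin k, σ (.inr p) ≠ σ (.inl i) := fun i h' => by simpa using h.inj h'
  have h1 := hasResidue_regular_field hl h.ref_ne
    (A := fun z => br ξ (lamField σ s lam z)) (B := fun z => br ls (lamField σ s lam z))
    (c := σ (.inr p))
    (by simp only [br_lamField]; exact analyticAt_poleSum _ hne)
    (by simp only [br_lamField]; exact analyticAt_poleSum _ hne)
    (h.field_ne p) (h.eventually_ne _) hH' hH (f := f) (Filter.Eventually.of_forall fun z τ => hf z τ)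
  rw [h1.residueAt_eq]
  simp only [hK]
  have hs := h.scale_ne (.inr p)
  rw [softTerm_const_mul, softTerm_comp_mul, softCoeff, br_smul_right, br_smul_right]
  obtain ⟨r, rfl⟩ := Nat.exists_eq_add_of_le hl
  have h2 : s (.inr p) ^ (l + r - 1) * (s (.inr p))⁻¹ ^ l = s (.inr p) ^ r * (s (.inr p))⁻¹ := by
    have h3 : s (.inr p) ^ (l + r - 1) * s (.inr p) = s (.inr p) ^ l * s (.inr p) ^ r := by
      rw [← pow_succ, ← pow_add]; congr 1; omega
    rw [inv_pow]
    field_simp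
    exact h3
  rw [Nat.add_sub_cancel_left, mul_pow]
  calc _ = br ξ (lamField σ s lam (σ (.inr p))) ^ r / (br ξ ls ^ r *
        br ls (lamField σ s lam (σ (.inr p)))) * α * softTerm l K *
          (s (.inr p) ^ (l + r - 1) * (s (.inr p))⁻¹ ^ l) := by ring
    _ = _ := by rw [h2]; field_simp

/-- Here the numerators of the poles of `λ(z)` are `s_i λ_i`. Together with the `s_i ^ l` from
rescaling the translation they leave `s_i ^ (e - 1)`, which for gravitons completes `λ̃(σ_i)` to
`s_i λ̃(σ_i)`. -/
theorem GenericPoint.residueAt_inl (h : GenericPoint σ s lam lt ξ ls) (i : Fin k) {e l : ℕ}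
    (he : 1 ≤ e) (he2 : e ≤ 2) (hl : l ≤ e) {f H H' : ℂ → ℂ → ℂ} {K : ℂ → ℂ} {α : ℂ}
    (hf : ∀ z τ, f τ z = H (τ * softScale ξ ls lam σ s z) z *
      (br ξ (lamField σ s lam z) ^ e / (br ξ ls ^ e * br ls (lamField σ s lam z))))
    (hH' : AnalyticAt ℂ (fun q : ℂ × ℂ => H' q.1 q.2) (0, σ (.inl i)))
    (hH : ∀ᶠ z in 𝓝[≠] (σ (.inl i)), ∀ t,
      H t z = ((z - σ (.inl i))⁻¹) ^ (2 - e) * H' (t * (z - σ (.inl i))⁻¹) z)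
    (hK : ∀ t, H' t (σ (.inl i)) = α * K (t * s (.inl i))) :
    residueAt (fun z => softTerm l fun τ => f τ z) (σ (.inl i)) =
      softCoeff e l ξ ls (lam (.inl i)) * (s (.inl i) ^ (e - 1) * α) * softTerm l K := by
  have hs := h.scale_ne (.inl i)
  have h1 := hasResidue_singular_field he2 hl h.ref_ne
    (A := fun z => br ξ (lamField σ s lam z)) (B := fun z => br ls (lamField σ s lam z))
    (c := σ (.inl i))
    (analyticAt_poleNum h.inj_inl (fun i => s (.inl i) * br ξ (lam (.inl i))) i)
    (analyticAt_poleNum h.inj_inl (fun i => s (.inl i) * br ls (lam (.inl i))) i)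
    (by rw [poleNum_self]; exact mul_ne_zero hs (h.soft_ne _))
    (by
      filter_upwards [self_mem_nhdsWithin] with z hz
      rw [br_lamField]
      exact poleSum_eq_num (fun i : Fin k => σ (.inl i)) _ (b := i) hz)
    (by
      filter_upwards [self_mem_nhdsWithin] with z hz
      rw [br_lamField]
      exact poleSum_eq_num (fun i : Fin k => σ (.inl i)) _ (b := i) hz)
    (h.eventually_ne _) hH' hH (f := f) (Filter.Eventually.of_forall fun z τ => hf z τ)
  rw [h1.residueAt_eq]
  simp only [hK]
  rw [softTerm_const_mul, softTerm_comp_mul, softCoeff, poleNum_self, poleNum_self]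
  obtain ⟨r, rfl⟩ := Nat.exists_eq_add_of_le hl
  have h2 : s (.inl i) ^ r * s (.inl i) ^ l * (s (.inl i))⁻¹ = s (.inl i) ^ (l + r - 1) := by
    rw [mul_inv_eq_iff_eq_mul₀ hs, ← pow_succ, ← pow_add]; congr 1; omega
  rw [Nat.add_sub_cancel_left, mul_pow, ← h2]
  have h3 := h.ref_ne
  have h4 := h.soft_ne (.inl i)
  field_simp

end TwistorFields

/-! ### Residues of the soft gluon -/

section GluonResidues

variable {N k m n 𝒩 : ℕ} {G : Gauge N k m} {ell : GrassEta 𝒩 k m →ₗ[ℂ] ℂ}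
  {col : Fin (n + 1) ≃ Leg k m} {σ s : Leg k m → ℂ} {lam lt : Leg k m → Spinor} {ξ ls : Spinor}

/-- `gluonKernel` without the delta functions. -/
def gluonWeight (G : Gauge N k m) (ell : GrassEta 𝒩 k m →ₗ[ℂ] ℂ) (col : Fin (n + 1) ≃ Leg k m)
    (σ s : Leg k m → ℂ) (_lt : Leg k m → Spinor) : ℂ :=
  G.ghost σ s * ell (superDelta 𝒩 σ s) * (∏ a, (s a)⁻¹) * ptHard col σ

theorem gluonKernel_eq (G : Gauge N k m) (ell : GrassEta 𝒩 k m →ₗ[ℂ] ℂ)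
    (col : Fin (n + 1) ≃ Leg k m) (lam : Leg k m → Spinor) :
    gluonKernel G ell col lam = deltaKernel lam univ (gluonWeight G ell col) := by
  funext σ s lt
  rw [gluonKernel, baseKernel, deltaKernel, gluonWeight, Fintype.prod_prod_type]
  ring

/-- At either kind of puncture the colour factor contributes the pole and the charge, while the
shifted denominators at the puncture are those of the hard kernel with the translated spinor. -/
theorem residueAt_gluonSoft (h : GenericPoint σ s lam lt ξ ls) (hn : col 0 ≠ col (Fin.last n))
    (lts : Spinor) {l : ℕ} (hl : l ≤ 1) (a : Leg k m) :
    residueAt (fun z => softTerm l fun τ => gluonSoftKernel G ell col lam ξ ls lts τ z σ s lt)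
      (σ a) =
    softCoeff 1 l ξ ls (Sum.elim (fun i => lam (.inl i))
      (fun p => s (.inr p) • lamField σ s lam (σ (.inr p))) a) * chargePair col a *
      softTerm l fun t => gluonKernel G ell col lam σ s (lt + Pi.single a (t • lts)) := by
  set H : ℂ → ℂ → ℂ := fun t z => deltaProduct σ s lam lt lts (sourceShift σ s t z) *
    (G.ghost σ s * ell (superDelta 𝒩 σ s) * ∏ a, (s a)⁻¹) * ptSoft col σ z with hH
  have hf : ∀ z τ, gluonSoftKernel G ell col lam ξ ls lts τ z σ s lt =
      H (τ * softScale ξ ls lam σ s z) z *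
      (br ξ (lamField σ s lam z) ^ 1 / (br ξ ls ^ 1 * br ls (lamField σ s lam z))) := by
    intro z τ
    simp only [gluonSoftKernel, baseKernel, prod_deltaArg_src, hH, pow_one]
    ring
  have hpt : ∀ b, ∀ᶠ z in 𝓝[≠] (σ b), ptSoft col σ z =
      ptHard col σ * ((z - σ b)⁻¹ * poleNum σ (chargePair col) b z) := fun b => by
    filter_upwards [eventually_ne_punctures h.inj b] with z hz
    rw [ptSoft_eq col h.inj hn hz, ← poleSum_eq_num σ _ (hz b).symm, chargePair]
  have hnum : ∀ b, AnalyticAt ℂ (fun q : ℂ × ℂ => poleNum σ (chargePair col) b q.2) (0, σ b) :=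
    fun b => AnalyticAt.fun_comp (g := poleNum σ (chargePair col) b) (f := fun q : ℂ × ℂ => q.2)
      (analyticAt_poleNum h.inj _ b) analyticAt_snd
  rw [gluonKernel_eq]
  rcases a with i | p
  · have h1 := h.residueAt_inl i (e := 1) le_rfl one_le_two hl hf
      (H' := fun t z => deltaProduct σ s lam lt lts (dampedShift σ s i t z) *
        gluonWeight G ell col σ s lt * poleNum σ (chargePair col) (.inl i) z)
      (K := fun t => deltaKernel lam univ (gluonWeight G ell col) σ s
        (lt + Pi.single (.inl i) (t • lts))) (α := chargePair col (.inl i))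
      (((analyticAt_deltaProduct h.delta_ne (analyticAt_dampedShift h.inj i)
        (fun b => by rcases b with j | q <;> simp [dampedShift])).fun_mul analyticAt_const).fun_mul
          (hnum _))
      (by
        filter_upwards [hpt (.inl i), self_mem_nhdsWithin] with z hz hz' t
        simp only [hH, hz, gluonWeight, sourceShift_eq_damped hz' t]
        ring)
      (fun t => by
        simp only [dampedShift_self, poleNum_self, deltaKernel_shift_inl, gluonWeight,
          mul_comm t]
        ring)
    rw [h1]
    simp
  · have hs := h.scale_ne (.inr p)
    have h1 := h.residueAt_inr p (e := 1) le_rfl hl hf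
      (H' := fun t z => deltaProduct σ s lam lt lts (sourceShift σ s t z) *
        gluonWeight G ell col σ s lt * poleNum σ (chargePair col) (.inr p) z)
      (K := fun t => deltaKernel lam univ (gluonWeight G ell col) σ s
        (lt + Pi.single (.inr p) (t • lts))) (α := chargePair col (.inr p))
      (((analyticAt_deltaProduct h.delta_ne (analyticAt_sourceShift h.inj p)
        (fun b => by rcases b with j | q <;> simp [sourceShift])).fun_mul analyticAt_const).fun_mul
          (hnum _))
      (by
        filter_upwards [hpt (.inr p)] with z hz t
        simp only [hH, hz, gluonWeight]
        ring)
      (fun t => by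
        have : s (.inr p) * (t * (s (.inr p))⁻¹) = t := by field_simp
        simp only [poleNum_self, deltaKernel_shift_inr, gluonWeight, this]
        ring)
    rw [h1]
    simp

end GluonResidues

/-! ### Residues of the soft graviton -/

section GravitonResidues

variable {N k m 𝒩 : ℕ} {G : Gauge N k m} {ell : GrassEta 𝒩 k m →ₗ[ℂ] ℂ} {i₀ : Fin k} {p₀ : Fin m}
  {σ s : Leg k m → ℂ} {lam lt : Leg k m → Spinor} {ξ ls : Spinor}

/-- The factors of `gravitonKernel` that do not depend on the spinors `λ̃`. -/
def gravitonFactor (G : Gauge N k m) (ell : GrassEta 𝒩 k m →ₗ[ℂ] ℂ) (i₀ : Fin k) (p₀ : Fin m)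
    (lam : Leg k m → Spinor) (σ s : Leg k m → ℂ) : ℂ :=
  G.ghost σ s * ell (superDelta 𝒩 σ s) * (∏ a, (s a ^ 2)⁻¹) * (s (.inl i₀) * s (.inr p₀))⁻¹ *
    rhoCorr (V := {i : Fin k // i ≠ i₀})
      (fun i => br (lamField σ s lam (σ (.inl i))) (lam (.inl i)))
      (fun i => s (.inl i) • lam (.inl i)) (fun i => lam (.inl i)) (fun i => σ (.inl i))

def hardMatrix (p₀ : Fin m) (σ s : Leg k m → ℂ) (lt : Leg k m → Spinor) :
    Matrix {p : Fin m // p ≠ p₀} {p : Fin m // p ≠ p₀} ℂ := Matrix.of fun p q =>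
  if p = q then br (ltField σ s lt [] (σ (.inr p))) (lt (.inr p))
  else br (s (.inr p) • lt (.inr p)) (lt (.inr q)) / (σ (.inr p) - σ (.inr q))

/-- `gravitonKernel` without the delta functions. -/
def gravitonWeight (G : Gauge N k m) (ell : GrassEta 𝒩 k m →ₗ[ℂ] ℂ) (i₀ : Fin k) (p₀ : Fin m)
    (lam : Leg k m → Spinor) (σ s : Leg k m → ℂ) (lt : Leg k m → Spinor) : ℂ :=
  gravitonFactor G ell i₀ p₀ lam σ s * (hardMatrix p₀ σ s lt).det

theorem gravitonKernel_eq (G : Gauge N k m) (ell : GrassEta 𝒩 k m →ₗ[ℂ] ℂ) (i₀ : Fin k)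
    (p₀ : Fin m) (lam : Leg k m → Spinor) :
    gravitonKernel G ell i₀ p₀ lam = deltaKernel lam univ (gravitonWeight G ell i₀ p₀ lam) := by
  funext σ s lt
  have h1 : (hardMatrix p₀ σ s lt).det = rhoCorr (V := {p : Fin m // p ≠ p₀})
      (fun p => br (ltField σ s lt [] (σ (.inr p))) (lt (.inr p)))
      (fun p => s (.inr p) • lt (.inr p)) (fun p => lt (.inr p)) (fun p => σ (.inr p)) := rfl
  rw [gravitonKernel, baseKernel, deltaKernel, gravitonWeight, gravitonFactor,
    Fintype.prod_prod_type, h1]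
  ring

/-- The matrix of the `ρ ρ̃` system with the soft particle as `none`. -/
def softMatrix (p₀ : Fin m) (σ s : Leg k m → ℂ) (lt : Leg k m → Spinor) (lts : Spinor) (t z : ℂ) :
    Matrix (Option {p : Fin m // p ≠ p₀}) (Option {p : Fin m // p ≠ p₀}) ℂ := Matrix.of fun v w =>
  v.elim (w.elim (br lts (ltField σ s lt [] z)) fun q =>
      -t * br lts (lt (.inr q)) / (z - σ (.inr q)))
    fun p => w.elim (s (.inr p) * br (lt (.inr p)) lts / (σ (.inr p) - z)) fun q =>
      hardMatrix p₀ σ s lt p q +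
        if p = q then (σ (.inr p) - z)⁻¹ * (t * br lts (lt (.inr p))) else 0

theorem rhoCorr_soft (p₀ : Fin m) (σ s : Leg k m → ℂ) (lt : Leg k m → Spinor) (lts : Spinor)
    (t z : ℂ) : rhoCorr (V := Option {p : Fin m // p ≠ p₀})
      (fun v => v.elim (br lts (ltField σ s lt [] z)) fun p =>
        br (ltField σ s lt [(z, t • lts)] (σ (.inr p))) (lt (.inr p)))
      (fun v => v.elim (-t • lts) fun p => s (.inr p) • lt (.inr p))
      (fun v => v.elim lts fun p => lt (.inr p))
      (fun v => v.elim z fun p => σ (.inr p)) = (softMatrix p₀ σ s lt lts t z).det := by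
  unfold rhoCorr
  congr 1
  ext v w
  rcases v with _ | p <;> rcases w with _ | q
  · simp [softMatrix]
  · simp [softMatrix, br_smul_left, -neg_smul]
  · simp [softMatrix, br_smul_left]
  · simp only [softMatrix, hardMatrix, Matrix.of_apply, Option.some.injEq, Option.elim_some]
    split_ifs with h
    · rw [ltField_src, br_add_left, br_smul_left, br_smul_left]
    · rw [add_zero]

/-- The soft matrix without its pole at `σ_p`. -/
def regularMatrix (p₀ p : Fin m) (σ s : Leg k m → ℂ) (lt : Leg k m → Spinor) (lts : Spinor)
    (t z : ℂ) :
    Matrix (Option {p : Fin m // p ≠ p₀}) (Option {p : Fin m // p ≠ p₀}) ℂ := Matrix.of fun v w =>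
  v.elim (w.elim (poleRest (fun q : Fin m => σ (.inr q))
      (fun q => s (.inr q) * br lts (lt (.inr q))) p z) fun q =>
      if q.1 = p then 0 else -t * br lts (lt (.inr q)) / (z - σ (.inr q)))
    fun r => w.elim (if r.1 = p then 0 else s (.inr r) * br (lt (.inr r)) lts / (σ (.inr r) - z))
      fun q => hardMatrix p₀ σ s lt r q +
        if r = q ∧ r.1 ≠ p then (σ (.inr r) - z)⁻¹ * (t * br lts (lt (.inr r))) else 0

def legIndicator (p₀ p : Fin m) (q : {q : Fin m // q ≠ p₀}) : ℂ := if q.1 = p then 1 else 0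

/-- All entries singular at `σ_p` lie in the rows and columns of the soft particle and of `p`, and
their residues form a matrix of rank one. If `p = p₀`, the indicator vanishes and only the diagonal
entry of the soft particle is singular. -/
theorem softMatrix_eq_pole (hs : ∀ a, s a ≠ 0) (p : Fin m) (lts : Spinor) (t : ℂ) {z : ℂ}
    (v w : Option {p : Fin m // p ≠ p₀}) :
    softMatrix p₀ σ s lt lts t z v w = (z - σ (.inr p))⁻¹ *
      (v.elim 1 (legIndicator p₀ p) * w.elim (s (.inr p) * br lts (lt (.inr p))) fun q =>
        -(t * (s (.inr p))⁻¹ * (s (.inr p) * br lts (lt (.inr p)))) * legIndicator p₀ p q) +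
      regularMatrix p₀ p σ s lt lts t z v w := by
  have hp := hs (.inr p)
  have h1 : t * (s (.inr p))⁻¹ * (s (.inr p) * br lts (lt (.inr p))) = t * br lts (lt (.inr p)) := by
    field_simp
  rw [h1]
  rcases v with _ | ⟨r, hr⟩ <;> rcases w with _ | ⟨q, hq⟩ <;>
    simp only [softMatrix, regularMatrix, Matrix.of_apply, Option.elim_none, Option.elim_some,
      legIndicator]
  · rw [br_ltField, poleSum_eq_rest _ _ p]
    ring
  · split_ifs with h
    · subst h; ring
    · ring
  · split_ifs with h
    · subst h
      rw [← neg_sub z, div_neg, br_neg_swap]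
      ring
    · ring
  · by_cases hrq : r = q
    · subst hrq
      by_cases hrp : r = p
      · subst hrp
        simp only [↓reduceIte, ne_eq, not_true_eq_false, and_false, add_zero]
        rw [← neg_sub z, inv_neg]
        ring
      · simp [hrp]
    · have h2 : ¬(r = p ∧ q = p) := fun h => hrq (h.1.trans h.2.symm)
      rcases not_and_or.1 h2 with h2 | h2 <;> simp [h2, hrq]

theorem mul_det_softMatrix (hs : ∀ a, s a ≠ 0) (p : Fin m) (lts : Spinor) (t : ℂ) {z : ℂ}
    (hz : z - σ (.inr p) ≠ 0) :
    (z - σ (.inr p)) * (softMatrix p₀ σ s lt lts t z).det =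
      (resolved (z - σ (.inr p)) (s (.inr p) * br lts (lt (.inr p))) (t * (s (.inr p))⁻¹)
        (legIndicator p₀ p) (regularMatrix p₀ p σ s lt lts t z)).det :=
  det_resolved hz (softMatrix_eq_pole hs p lts t)

theorem analyticAt_regularMatrix (hσ : Function.Injective σ) (p : Fin m) (lts : Spinor)
    (v w : Option {p : Fin m // p ≠ p₀}) :
    AnalyticAt ℂ (fun q : ℂ × ℂ => regularMatrix p₀ p σ s lt lts q.1 q.2 v w)
      (0, σ (.inr p)) := by
  have hne : ∀ q, q ≠ p → σ (.inr p) - σ (.inr q) ≠ 0 := fun q hq =>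
    sub_ne_zero.2 fun h => hq (by simpa using (hσ h).symm)
  have hne' : ∀ q, q ≠ p → σ (.inr q) - σ (.inr p) ≠ 0 := fun q hq =>
    sub_ne_zero.2 fun h => hq (by simpa using hσ h)
  rcases v with _ | ⟨r, hr⟩ <;> rcases w with _ | ⟨q, hq⟩ <;>
    simp only [regularMatrix, Matrix.of_apply, Option.elim_none, Option.elim_some]
  · exact AnalyticAt.fun_comp (g := poleRest (fun q : Fin m => σ (.inr q))
      (fun q => s (.inr q) * br lts (lt (.inr q))) p) (f := fun q : ℂ × ℂ => q.2)
      (analyticAt_poleRest (hσ.comp Sum.inr_injective) _ p) analyticAt_snd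
  · split_ifs with h
    · exact analyticAt_const
    · exact (analyticAt_fst.fun_neg.fun_mul analyticAt_const).fun_div
        (analyticAt_snd.fun_sub analyticAt_const) (hne q h)
  · split_ifs with h
    · exact analyticAt_const
    · exact analyticAt_const.fun_div (analyticAt_const.fun_sub analyticAt_snd) (hne' r h)
  · refine analyticAt_const.fun_add ?_
    split_ifs with h
    · exact ((analyticAt_const.fun_sub analyticAt_snd).fun_inv (hne' r h.2)).fun_mul
        (analyticAt_fst.fun_mul analyticAt_const)
    · exact analyticAt_const

/-- The residual minor is the matrix of the hard particles with the spinor of `p` translated. -/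
theorem minor_eq_hardMatrix (hσ : Function.Injective σ) (hs : ∀ a, s a ≠ 0) (p : Fin m)
    (lts : Spinor) (t : ℂ) :
    (Matrix.of fun r q => regularMatrix p₀ p σ s lt lts t (σ (.inr p)) (some r) (some q) -
      legIndicator p₀ p r * regularMatrix p₀ p σ s lt lts t (σ (.inr p)) none (some q) +
      t * (s (.inr p))⁻¹ * legIndicator p₀ p q *
        (regularMatrix p₀ p σ s lt lts t (σ (.inr p)) (some r) none -
          legIndicator p₀ p r * regularMatrix p₀ p σ s lt lts t (σ (.inr p)) none none)) =
    hardMatrix p₀ σ s (lt + Pi.single (.inr p) ((t * (s (.inr p))⁻¹) • lts)) := by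
  have hp := hs (.inr p)
  have hinv : ∀ q, q ≠ p → σ (.inr q) - σ (.inr p) ≠ 0 := fun q hq =>
    sub_ne_zero.2 fun h => hq (by simpa using hσ h)
  have hinv' : ∀ q, q ≠ p → σ (.inr p) - σ (.inr q) ≠ 0 := fun q hq =>
    sub_ne_zero.2 fun h => hq (by simpa using (hσ h).symm)
  have h0 : poleRest (fun q : Fin m => σ (.inr q))
      (fun q => s (.inr q) * br lts (lt (.inr q))) p (σ (.inr p)) =
      br lts (ltField σ s lt [] (σ (.inr p))) := by
    rw [br_ltField, poleSum_eq_rest _ _ p]; simp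
  ext ⟨r, hr⟩ ⟨q, hq⟩
  simp only [regularMatrix, hardMatrix, legIndicator, Matrix.of_apply, Option.elim_none,
    Option.elim_some, ltField_add_single_inr, h0, Subtype.mk.injEq, Pi.add_apply]
  by_cases hrq : r = q
  · subst hrq
    by_cases hrp : r = p
    · subst hrp
      simp only [↓reduceIte, ne_eq, not_true_eq_false, and_false, add_zero, sub_self, div_zero,
        zero_smul, Pi.single_eq_same, br_add_right, br_smul_right]
      rw [br_neg_swap lts]
      ring
    · have h1 := hinv r hrp
      have h3 : (Pi.single (Sum.inr p) ((t * (s (.inr p))⁻¹) • lts) : Leg k m → Spinor)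
          (.inr r) = 0 := by simp [hrp]
      simp only [hrp, ↓reduceIte, ne_eq, not_false_eq_true, and_self, h3, add_zero, br_add_left,
        br_smul_left]
      field_simp
      ring
  · by_cases hrp : r = p
    · subst hrp
      have hqr : q ≠ r := Ne.symm hrq
      have h1 := hinv' q hqr
      have h3 : (Pi.single (Sum.inr r) ((t * (s (.inr r))⁻¹) • lts) : Leg k m → Spinor)
          (.inr q) = 0 := by simp [hqr]
      simp only [hrq, hqr, ↓reduceIte, false_and, h3, add_zero, Pi.single_eq_same, br_smul_left,
        br_add_left]
      field_simp
      ring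
    · by_cases hqp : q = p
      · subst hqp
        have h1 := hinv r hrp
        have h3 : (Pi.single (Sum.inr q) ((t * (s (.inr q))⁻¹) • lts) : Leg k m → Spinor)
            (.inr r) = 0 := by simp [hrp]
        simp only [hrp, ↓reduceIte, false_and, h3, add_zero, Pi.single_eq_same, br_smul_left,
          br_add_right, br_smul_right]
        field_simp
        ring
      · simp [hrq, hrp, hqp]

/-- At a dual twistor puncture the matrix has no poles of its own; the factor `z - σ_i` undoes the
rescaling of the translation parameter made in `dampedShift`. -/
theorem analyticAt_softMatrix (hσ : Function.Injective σ) (i : Fin k) (lts : Spinor)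
    (v w : Option {p : Fin m // p ≠ p₀}) :
    AnalyticAt ℂ (fun q : ℂ × ℂ =>
      softMatrix p₀ σ s lt lts ((q.2 - σ (.inl i)) * q.1) q.2 v w) (0, σ (.inl i)) := by
  have hne : ∀ q : Fin m, σ (.inl i) ≠ σ (.inr q) := fun q h => by simpa using hσ h
  have ht : AnalyticAt ℂ (fun q : ℂ × ℂ => (q.2 - σ (.inl i)) * q.1) (0, σ (.inl i)) :=
    (analyticAt_snd.fun_sub analyticAt_const).fun_mul analyticAt_fst
  rcases v with _ | r <;> rcases w with _ | q <;>
    simp only [softMatrix, Matrix.of_apply, Option.elim_none, Option.elim_some]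
  · simp only [br_ltField]
    exact AnalyticAt.fun_comp (g := poleSum (fun q : Fin m => σ (.inr q))
      (fun q => s (.inr q) * br lts (lt (.inr q)))) (f := fun q : ℂ × ℂ => q.2)
      (analyticAt_poleSum _ hne) analyticAt_snd
  · exact (ht.fun_neg.fun_mul analyticAt_const).fun_div
      (analyticAt_snd.fun_sub analyticAt_const) (sub_ne_zero.2 (hne q))
  · exact analyticAt_const.fun_div (analyticAt_const.fun_sub analyticAt_snd)
      (sub_ne_zero.2 (hne r).symm)
  · refine analyticAt_const.fun_add ?_
    split_ifs with h
    · exact ((analyticAt_const.fun_sub analyticAt_snd).fun_inv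
        (sub_ne_zero.2 (hne r).symm)).fun_mul (ht.fun_mul analyticAt_const)
    · exact analyticAt_const

/-- Without `ρ` in the soft operator its row is diagonal. This is the value needed at a dual twistor
puncture, where the rescaled parameter vanishes. -/
theorem det_softMatrix_zero (lts : Spinor) (z : ℂ) :
    (softMatrix p₀ σ s lt lts 0 z).det =
      br lts (ltField σ s lt [] z) * (hardMatrix p₀ σ s lt).det := by
  rw [det_option_of_row fun v => by simp [softMatrix]]
  congr 2
  ext p q
  simp [softMatrix]

/-- At `Ṽ_i` the determinant factorises into `[λ̃_s λ̃(σ_i)]` and the hard one. At `V_p` its pole is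
resolved, and the residue is `s_p [λ̃_s λ̃_p]` times the hard determinant with `λ̃_p` translated. -/
theorem residueAt_gravitonSoft (h : GenericPoint σ s lam lt ξ ls)
    (lts : Spinor) {l : ℕ} (hl : l ≤ 2) (a : Leg k m) :
    residueAt (fun z => softTerm l fun τ => gravitonSoftKernel G ell i₀ p₀ lam ξ ls lts τ z σ s lt)
      (σ a) =
    softCoeff 2 l ξ ls (Sum.elim (fun i => lam (.inl i))
      (fun p => s (.inr p) • lamField σ s lam (σ (.inr p))) a) *
      br lts (Sum.elim (fun i => s (.inl i) • ltField σ s lt [] (σ (.inl i)))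
        (fun p => lt (.inr p)) a) *
      softTerm l fun t => gravitonKernel G ell i₀ p₀ lam σ s (lt + Pi.single a (t • lts)) := by
  set H : ℂ → ℂ → ℂ := fun t z => deltaProduct σ s lam lt lts (sourceShift σ s t z) *
    gravitonFactor G ell i₀ p₀ lam σ s * (softMatrix p₀ σ s lt lts t z).det with hH
  have hf : ∀ z τ, gravitonSoftKernel G ell i₀ p₀ lam ξ ls lts τ z σ s lt =
      H (τ * softScale ξ ls lam σ s z) z *
      (br ξ (lamField σ s lam z) ^ 2 / (br ξ ls ^ 2 * br ls (lamField σ s lam z))) := by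
    intro z τ
    simp only [gravitonSoftKernel, baseKernel, prod_deltaArg_src, hH, gravitonFactor, rhoCorr_soft]
    ring
  rw [gravitonKernel_eq]
  rcases a with i | p
  · have h1 := h.residueAt_inl i (e := 2) one_le_two le_rfl hl hf
      (H' := fun t z => deltaProduct σ s lam lt lts (dampedShift σ s i t z) *
        gravitonFactor G ell i₀ p₀ lam σ s *
          (softMatrix p₀ σ s lt lts ((z - σ (.inl i)) * t) z).det)
      (K := fun t => deltaKernel lam univ (gravitonWeight G ell i₀ p₀ lam) σ s
        (lt + Pi.single (.inl i) (t • lts))) (α := br lts (ltField σ s lt [] (σ (.inl i))))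
      (((analyticAt_deltaProduct h.delta_ne (analyticAt_dampedShift h.inj i)
        (fun b => by rcases b with j | q <;> simp [dampedShift])).fun_mul analyticAt_const).fun_mul
          (analyticAt_det fun v w => analyticAt_softMatrix h.inj i lts v w))
      (by
        filter_upwards [self_mem_nhdsWithin] with z hz t
        have hz' : (z - σ (.inl i)) * (t * (z - σ (.inl i))⁻¹) = t := by
          have := sub_ne_zero.2 hz
          field_simp
        simp only [hH, hz', sourceShift_eq_damped hz t, Nat.sub_self, pow_zero, one_mul])
      (fun t => by
        have hw : hardMatrix p₀ σ s (lt + Pi.single (.inl i) ((t * s (.inl i)) • lts)) =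
            hardMatrix p₀ σ s lt := by
          ext p q
          simp [hardMatrix, ltField_add_single_inl]
        simp only [dampedShift_self, sub_self, zero_mul, det_softMatrix_zero,
          deltaKernel_shift_inl, gravitonWeight, hw, mul_comm (s (Sum.inl i)) t]
        ring)
    rw [h1]
    simp [br_smul_right]
  · have hs := h.scale_ne (.inr p)
    have h1 := h.residueAt_inr p (e := 2) one_le_two hl hf
      (H' := fun t z => deltaProduct σ s lam lt lts (sourceShift σ s t z) *
        gravitonFactor G ell i₀ p₀ lam σ s *
          (resolved (z - σ (.inr p)) (s (.inr p) * br lts (lt (.inr p))) (t * (s (.inr p))⁻¹)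
            (legIndicator p₀ p) (regularMatrix p₀ p σ s lt lts t z)).det)
      (K := fun t => deltaKernel lam univ (gravitonWeight G ell i₀ p₀ lam) σ s
        (lt + Pi.single (.inr p) (t • lts))) (α := br lts (lt (.inr p)))
      (((analyticAt_deltaProduct h.delta_ne (analyticAt_sourceShift h.inj p)
        (fun b => by rcases b with j | q <;> simp [sourceShift])).fun_mul analyticAt_const).fun_mul
          (analyticAt_det_resolved (analyticAt_snd.fun_sub analyticAt_const) analyticAt_const
            (analyticAt_fst.fun_mul analyticAt_const) fun v w =>
              analyticAt_regularMatrix h.inj p lts v w))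
      (by
        filter_upwards [self_mem_nhdsWithin] with z hz t
        have hz' := sub_ne_zero.2 hz
        rw [← mul_det_softMatrix h.scale_ne p lts t hz']
        simp only [hH]
        generalize (softMatrix p₀ σ s lt lts t z).det = M
        field_simp)
      (fun t => by
        have : s (.inr p) * (t * (s (.inr p))⁻¹) = t := by field_simp
        simp only [sub_self, det_resolved_zero]
        rw [minor_eq_hardMatrix h.inj h.scale_ne, deltaKernel_shift_inr, gravitonWeight, this]
        ring)
    rw [h1]
    simp

end GravitonResidues

/-! ### Holomorphy of the integrands apart from the delta functions -/

section HolomorphicWeights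

/-- A function with values in an algebra that is a finite sum of constants with holomorphic
coefficients. -/
def HasHolomorphicCoeffs {Q A : Type*} [NormedAddCommGroup Q] [NormedSpace ℂ Q] [Ring A]
    [Algebra ℂ A] (x : Q → A) (q₀ : Q) : Prop :=
  ∃ (ι : Type) (_ : Fintype ι) (c : ι → Q → ℂ) (e : ι → A),
    (∀ i, DifferentiableAt ℂ (c i) q₀) ∧ ∀ q, x q = ∑ i, c i q • e i

section Coeffs

variable {Q A : Type*} [NormedAddCommGroup Q] [NormedSpace ℂ Q] [Ring A] [Algebra ℂ A] {q₀ : Q}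

theorem HasHolomorphicCoeffs.mul {x y : Q → A} (hx : HasHolomorphicCoeffs x q₀)
    (hy : HasHolomorphicCoeffs y q₀) : HasHolomorphicCoeffs (fun q => x q * y q) q₀ := by
  obtain ⟨ι, _, c, e, hc, hx⟩ := hx
  obtain ⟨ι', _, c', e', hc', hy⟩ := hy
  refine ⟨ι × ι', inferInstance, fun i q => c i.1 q * c' i.2 q, fun i => e i.1 * e' i.2,
    fun i => (hc i.1).mul (hc' i.2), fun q => ?_⟩
  simp only []
  rw [hx, hy, Finset.sum_mul_sum, Fintype.sum_prod_type]
  exact Finset.sum_congr rfl fun i _ => Finset.sum_congr rfl fun j _ => smul_mul_smul_comm _ _ _ _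

theorem HasHolomorphicCoeffs.prod_ofFn {n : ℕ} {x : Fin n → Q → A}
    (hx : ∀ i, HasHolomorphicCoeffs (x i) q₀) :
    HasHolomorphicCoeffs (fun q => (List.ofFn fun i => x i q).prod) q₀ := by
  induction n with
  | zero => exact ⟨Unit, inferInstance, fun _ _ => 1, fun _ => 1,
      fun _ => differentiableAt_const _, fun q => by simp⟩
  | succ n ih =>
    simp only [List.ofFn_succ, List.prod_cons]
    exact (hx 0).mul (ih fun i => hx i.succ)

/-- Components of Grassmann-valued functions are handled through coefficients, which avoids choosing
a topology on the algebra. -/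
theorem HasHolomorphicCoeffs.apply {x : Q → A} (hx : HasHolomorphicCoeffs x q₀) (ell : A →ₗ[ℂ] ℂ) :
    DifferentiableAt ℂ (fun q => ell (x q)) q₀ := by
  obtain ⟨ι, _, c, e, hc, hx⟩ := hx
  simp only [hx, map_sum, map_smul, smul_eq_mul]
  exact DifferentiableAt.fun_sum fun i _ => (hc i).mul (differentiableAt_const _)

end Coeffs

variable {N k m n 𝒩 : ℕ} {G : Gauge N k m} {ell : GrassEta 𝒩 k m →ₗ[ℂ] ℂ}

theorem differentiableAt_superDelta (ell : GrassEta 𝒩 k m →ₗ[ℂ] ℂ) {q₀ : TwistorData k m}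
    (hσ : Function.Injective q₀.1) : DifferentiableAt ℂ
      (fun q : TwistorData k m => ell (superDelta 𝒩 q.1 q.2.1)) q₀ := by
  refine HasHolomorphicCoeffs.apply ?_ ell
  refine HasHolomorphicCoeffs.prod_ofFn fun p => HasHolomorphicCoeffs.prod_ofFn fun r => ?_
  refine ⟨Option (Fin k), inferInstance, fun o q => o.elim 1 fun i =>
      -(q.2.1 (.inr p) * (q.2.1 (.inl i) / (q.1 (.inr p) - q.1 (.inl i)))),
    fun o => o.elim (ExteriorAlgebra.ι ℂ (Pi.single (r, (.inr p : Leg k m)) (1 : ℂ)))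
      fun i => ExteriorAlgebra.ι ℂ (Pi.single (r, (.inl i : Leg k m)) (1 : ℂ)), ?_, fun q => ?_⟩
  · rintro (_ | i)
    · exact differentiableAt_const _
    · have hne : q₀.1 (.inr p) - q₀.1 (.inl i) ≠ 0 := sub_ne_zero.2 fun h => by simpa using hσ h
      simp only [Option.elim_some]
      fun_prop (disch := assumption)
  · rw [Fintype.sum_option]
    simp only [Option.elim_none, Option.elim_some, one_smul, neg_smul, Finset.sum_neg_distrib]
    rw [← sub_eq_add_neg, map_sub, map_sum]
    simp only [map_smul]

theorem differentiableAt_ghost (G : Gauge N k m) (q₀ : TwistorData k m) :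
    DifferentiableAt ℂ (fun q : TwistorData k m => G.ghost q.1 q.2.1) q₀ := by
  unfold Gauge.ghost
  fun_prop

theorem differentiableAt_det {E V : Type*} [NormedAddCommGroup E] [NormedSpace ℂ E] [Fintype V]
    [DecidableEq V] {A : E → Matrix V V ℂ} {x : E}
    (h : ∀ v w, DifferentiableAt ℂ (fun q => A q v w) x) :
    DifferentiableAt ℂ (fun q => (A q).det) x := by
  simp only [Matrix.det_apply, Units.smul_def, zsmul_eq_mul]
  exact DifferentiableAt.fun_sum fun σ _ => (differentiableAt_const _).mul
    (differentiableAt_prod fun v _ => h _ _)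

theorem differentiableAt_br {E : Type*} [NormedAddCommGroup E] [NormedSpace ℂ E] {f g : E → Spinor}
    {x : E} (hf : DifferentiableAt ℂ f x) (hg : DifferentiableAt ℂ g x) :
    DifferentiableAt ℂ (fun q => br (f q) (g q)) x := by
  simp only [br]
  have hf0 := differentiableAt_pi.1 hf
  have hg0 := differentiableAt_pi.1 hg
  exact ((hf0 0).mul (hg0 1)).sub ((hf0 1).mul (hg0 0))

theorem Gauge.puncture_injective (G : Gauge N k m) : Function.Injective G.puncture := by
  intro i j hij
  have h1 : G.coord (.inr i.castSucc) = G.coord (.inr j.castSucc) := by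
    rw [G.coord_puncture, G.coord_puncture, hij]
  exact Fin.castSucc_injective _ (Sum.inr_injective (G.coord.injective h1))

/-- The gauge-fixed punctures belong to distinct particles, so there is more than one label. -/
theorem Gauge.colour_ne_zero (G : Gauge N k m) (col : Fin (n + 1) ≃ Leg k m) : n ≠ 0 := by
  rintro rfl
  have h1 := G.puncture_injective.ne (a₁ := 0) (a₂ := 1) (by decide)
  exact h1 (col.symm.injective (Fin.ext (by omega)))

theorem Gauge.first_ne_last (G : Gauge N k m) (col : Fin (n + 1) ≃ Leg k m) :
    col 0 ≠ col (Fin.last n) := fun h =>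
  G.colour_ne_zero col (by simpa [Fin.ext_iff] using (col.injective h).symm)

theorem holomorphicWeight_gluon (G : Gauge N k m) (ell : GrassEta 𝒩 k m →ₗ[ℂ] ℂ)
    (col : Fin (n + 1) ≃ Leg k m) : HolomorphicWeight (gluonWeight G ell col) := by
  intro q hσ hs
  have h1 : DifferentiableAt ℂ (fun q : TwistorData k m => ptHard col q.1) q :=
    DifferentiableAt.comp (g := ptHard col) q
      (differentiableAt_ptHard col (G.colour_ne_zero col) hσ) differentiableAt_fst
  have h2 : DifferentiableAt ℂ (fun q : TwistorData k m => ∏ a, (q.2.1 a)⁻¹) q :=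
    differentiableAt_prod fun a _ => by
      have := hs a
      fun_prop (disch := assumption)
  exact (((differentiableAt_ghost G q).mul (differentiableAt_superDelta ell hσ)).mul h2).mul h1

theorem differentiableAt_gravitonFactor (G : Gauge N k m) (ell : GrassEta 𝒩 k m →ₗ[ℂ] ℂ)
    (i₀ : Fin k) (p₀ : Fin m) (lam : Leg k m → Spinor) {q : TwistorData k m}
    (hσ : Function.Injective q.1) (hs : ∀ a, q.2.1 a ≠ 0) : DifferentiableAt ℂ
      (fun q : TwistorData k m => gravitonFactor G ell i₀ p₀ lam q.1 q.2.1) q := by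
  have h2 : DifferentiableAt ℂ (fun q : TwistorData k m => ∏ a, (q.2.1 a ^ 2)⁻¹) q :=
    differentiableAt_prod fun a _ => by
      have := pow_ne_zero 2 (hs a)
      fun_prop (disch := assumption)
  have h3 : DifferentiableAt ℂ (fun q : TwistorData k m =>
      (q.2.1 (.inl i₀) * q.2.1 (.inr p₀))⁻¹) q := by
    have := mul_ne_zero (hs (.inl i₀)) (hs (.inr p₀))
    fun_prop (disch := assumption)
  refine ((((differentiableAt_ghost G q).mul (differentiableAt_superDelta ell hσ)).mul h2).mul
    h3).mul (differentiableAt_det fun v w => ?_)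
  simp only [Matrix.of_apply]
  split_ifs with h
  · exact differentiableAt_br (differentiableAt_lamField lam _ hσ) (differentiableAt_const _)
  · have hne : q.1 (.inl v.1) - q.1 (.inl w.1) ≠ 0 := sub_ne_zero.2 fun h' =>
      h (Subtype.ext (by simpa using hσ h'))
    simp only [br_smul_left]
    fun_prop (disch := assumption)

theorem holomorphicWeight_graviton (G : Gauge N k m) (ell : GrassEta 𝒩 k m →ₗ[ℂ] ℂ)
    (i₀ : Fin k) (p₀ : Fin m) (lam : Leg k m → Spinor) :
    HolomorphicWeight (gravitonWeight G ell i₀ p₀ lam) := by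
  intro q hσ hs
  refine (differentiableAt_gravitonFactor G ell i₀ p₀ lam hσ hs).mul
    (differentiableAt_det fun v w => ?_)
  simp only [hardMatrix, Matrix.of_apply]
  split_ifs with h
  · exact differentiableAt_br (differentiableAt_ltField _ hσ) (by fun_prop)
  · have hne : q.1 (.inr v.1) - q.1 (.inr w.1) ≠ 0 := sub_ne_zero.2 fun h' =>
      h (Subtype.ext (by simpa using hσ h'))
    have hden : DifferentiableAt ℂ
        (fun q : TwistorData k m => q.1 (.inr v.1) - q.1 (.inr w.1)) q := by fun_prop
    have hnum : DifferentiableAt ℂ (fun q : TwistorData k m =>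
        br (q.2.1 (.inr v.1) • q.2.2 (.inr v.1)) (q.2.2 (.inr w.1))) q :=
      differentiableAt_br (by fun_prop) (by fun_prop)
    simp only [div_eq_mul_inv]
    exact hnum.mul (hden.fun_inv hne)

end HolomorphicWeights

/-! ### Genericity of the points of the contours -/

section Genericity

variable {N k m : ℕ} {G : Gauge N k m} {lam lt₀ : Leg k m → Spinor} {S : Finset (Fin N → ℂ)}
  {φ : (Fin N → ℂ) → (Fin N → ℂ) → (Fin N → ℂ)} {ρ : ℝ} {ξ ls : Spinor}

/-- A local inverse makes the equations locally onto. In particular the two rows of `b` take the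
values `t ls` for all small `t`, on which the bracket with `ξ` is `t ⟨ξ s⟩` and not constant. -/
theorem IsLocalInverse.false_of_constant {u : Fin N → ℂ} {ψ : (Fin N → ℂ) → (Fin N → ℂ)}
    (h : IsLocalInverse (G.equations lam lt₀) u ψ) (hX : br ξ ls ≠ 0) (b : Leg k m) (c : ℂ)
    (hc : ∀ x, br ξ (deltaArg (G.sig x) (G.scl x) lam (G.tilde lt₀ x) [] b) = c) : False := by
  have h1 : Tendsto (fun t : ℂ => (fun j => t * ls (G.row j).2 : Fin N → ℂ)) (𝓝 0) (𝓝 0) := by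
    have : Continuous fun t : ℂ => (fun j => t * ls (G.row j).2 : Fin N → ℂ) := by fun_prop
    simpa [Pi.zero_def] using! this.tendsto 0
  have h2 : ∀ᶠ t in 𝓝 (0 : ℂ), t * br ξ ls = c := by
    filter_upwards [h1.eventually h.2.2] with t ht
    have h3 : deltaArg (G.sig (ψ fun j => t * ls (G.row j).2)) (G.scl (ψ fun j => t * ls (G.row j).2))
        lam (G.tilde lt₀ (ψ fun j => t * ls (G.row j).2)) [] b = t • ls := by
      funext α
      have := congrFun ht (G.row.symm (b, α))
      simpa [Gauge.equations] using this
    rw [← hc (ψ fun j => t * ls (G.row j).2), h3, br_smul_right]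
  have h0 : c = 0 := by simpa using h2.self_of_nhds.symm
  have h4 : ∀ᶠ t in 𝓝[≠] (0 : ℂ), t * br ξ ls = c := h2.filter_mono nhdsWithin_le_nhds
  obtain ⟨t, ht, ht'⟩ := (h4.and self_mem_nhdsWithin).exists
  rw [h0] at ht
  exact mul_ne_zero ht' hX ht

/-- Otherwise `⟨ξ λ(z)⟩` vanishes identically and the equations of any twistor operator `p`
degenerate along `ξ`. Without such operators `λ̃(z)` is zero, and the equations of a particle whose
spinor is not integrated over are constant; one of the three gauge-fixed particles is of this kind,
as only two spinors are integrated. -/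
theorem IsLocalInverse.exists_ne {u : Fin N → ℂ} {ψ : (Fin N → ℂ) → (Fin N → ℂ)}
    (h : IsLocalInverse (G.equations lam lt₀) u ψ) (hX : br ξ ls ≠ 0) :
    ∃ i : Fin k, br ξ (lam (.inl i)) ≠ 0 := by
  by_contra! hall
  rcases isEmpty_or_nonempty (Fin m) with hm | ⟨⟨p⟩⟩
  · obtain ⟨j, hj⟩ : ∃ j : Fin 3, G.puncture j ≠ G.smear 0 ∧ G.puncture j ≠ G.smear 1 := by
      by_contra! hj
      have hp := G.puncture_injective
      have h01 := hp.ne (a₁ := 0) (a₂ := 1) (by decide)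
      have h02 := hp.ne (a₁ := 0) (a₂ := 2) (by decide)
      have h12 := hp.ne (a₁ := 1) (a₂ := 2) (by decide)
      by_cases h0 : G.puncture 0 = G.smear 0
      · have h1 := hj 1 fun h => h01 (h0.trans h.symm)
        have h2 := hj 2 fun h => h02 (h0.trans h.symm)
        exact h12 (h1.trans h2.symm)
      · have h0' := hj 0 h0
        by_cases h1 : G.puncture 1 = G.smear 0
        · exact h02 (h0'.trans (hj 2 fun h => h12 (h1.trans h.symm)).symm)
        · exact h01 (h0'.trans (hj 1 h1).symm)
    refine h.false_of_constant hX (G.puncture j) (br ξ (lt₀ (G.puncture j))) fun x => ?_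
    have h1 : G.tilde lt₀ x (G.puncture j) = lt₀ (G.puncture j) := by
      simp [Gauge.tilde, hj.1, hj.2]
    rcases hl : G.puncture j with i | p
    · rw [hl] at h1
      simp [deltaArg, ltField, h1]
    · exact hm.elim p
  · refine h.false_of_constant hX (.inr p) (br ξ (lam (.inr p))) fun x => ?_
    have h1 : br ξ (lamField (G.sig x) (G.scl x) lam (G.sig x (.inr p))) = 0 := by
      rw [br_lamField]; simp [hall, poleSum]
    simp only [deltaArg, sub_eq_add_neg, br_add_right]
    rw [← neg_smul, br_smul_right, h1, mul_zero, add_zero]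

/-- Domain on which the coefficients of the soft factors are holomorphic. -/
def softDomain (G : Gauge N k m) (lam : Leg k m → Spinor) (ls : Spinor) (x : Fin N → ℂ) : Prop :=
  G.domain x ∧ ∀ p : Fin m, br ls (lamField (G.sig x) (G.scl x) lam (G.sig x (.inr p))) ≠ 0

theorem differentiableAt_lamField_gauge (lam : Leg k m → Spinor) (a : Leg k m) {x : Fin N → ℂ}
    (hx : G.domain x) :
    DifferentiableAt ℂ (fun x => lamField (G.sig x) (G.scl x) lam (G.sig x a)) x :=
  DifferentiableAt.comp (g := fun q : TwistorData k m => lamField q.1 q.2.1 lam (q.1 a))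
    (f := fun x => (G.sig x, G.scl x, (0 : Leg k m → Spinor))) x
    (differentiableAt_lamField lam a hx.1)
    ((G.differentiable_sig x).prodMk ((G.differentiable_scl x).prodMk (differentiableAt_const _)))

/-- On a solution `λ_p = s_p λ(σ_p)`, so that `⟨s p⟩ ≠ 0` keeps `⟨s λ(σ_p)⟩` away from zero nearby.
-/
theorem IsSolutionSet.softDomain (hS : IsSolutionSet G.domain (G.equations lam lt₀) S φ)
    (hsoft : ∀ a, br ls (lam a) ≠ 0) :
    ∀ u ∈ S, ∀ᶠ x in 𝓝 u, softDomain G lam ls x := by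
  intro u hu
  obtain ⟨hd, h0⟩ := (hS.1 u).1 hu
  refine (G.eventually_domain hd).and (Filter.eventually_all.2 fun p => ?_)
  refine (differentiableAt_br (differentiableAt_const ls)
    (differentiableAt_lamField_gauge lam (.inr p) hd)).continuousAt.eventually_ne fun hz => ?_
  have h1 : lam (.inr p) = G.scl u (.inr p) •
      lamField (G.sig u) (G.scl u) lam (G.sig u (.inr p)) := by
    funext α
    have := congrFun h0 (G.row.symm (.inr p, α))
    simp only [Gauge.equations, Equiv.apply_symm_apply, deltaArg, Pi.sub_apply, Pi.zero_apply] at this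
    exact sub_eq_zero.1 this
  apply hsoft (.inr p)
  rw [h1, br_smul_right, hz, mul_zero]

/-- The delta function arguments along the torus are the coordinates `y`, of modulus `ρ > 0`. -/
theorem AdmissibleRadius.genericPoint
    (h : AdmissibleRadius (Ambi.softDomain G lam ls) (G.equations lam lt₀) S φ ρ)
    (hS : IsSolutionSet G.domain (G.equations lam lt₀) S φ)
    (hsoft : ∀ a, br ls (lam a) ≠ 0) (hX : br ξ ls ≠ 0) {u : Fin N → ℂ} (hu : u ∈ S)
    {y : Fin N → ℂ} (hy : ∀ i, ‖y i‖ = ρ) :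
    GenericPoint (G.sig (φ u y)) (G.scl (φ u y)) lam (G.tilde lt₀ (φ u y)) ξ ls where
  inj := (h.domain u hu y fun i => (hy i).le).1.1
  scale_ne := (h.domain u hu y fun i => (hy i).le).1.2
  delta_ne b β := by
    have h1 := congrFun (h.inverse u hu y fun i => (hy i).le).self_of_nhds (G.row.symm (b, β))
    simp only [Gauge.equations, Equiv.apply_symm_apply] at h1
    rw [h1]
    intro h0
    have := hy (G.row.symm (b, β))
    rw [h0, norm_zero] at this
    exact h.pos.ne this
  soft_ne := hsoft
  field_ne := (h.domain u hu y fun i => (hy i).le).2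
  ref_ne := hX
  exists_ne := (hS.2 u hu).exists_ne hX

end Genericity

/-! ### Soft coefficients on and off the support of the delta functions -/

section CoefficientGap

/-- Divided difference of `softCoeff`. -/
def softGap (e l : ℕ) (ξ ls v v' : Spinor) : Fin 2 → ℂ :=
  let g := ∑ j ∈ range (e - l), br ξ v' ^ j * br ξ v ^ (e - l - 1 - j)
  fun α => (if α = 0 then ξ 1 * g * br ls v - ls 1 * br ξ v ^ (e - l)
    else -(ξ 0 * g * br ls v) + ls 0 * br ξ v ^ (e - l)) /
      (br ξ ls ^ (e - l) * br ls v' * br ls v)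

/-- Both brackets of `v' - v` are linear in `Y`, and the geometric sum does the same for the
difference of powers. Hence the coefficients differ by a combination of the two components of `Y`,
with no condition on its size. -/
theorem softCoeff_eq_add_gap {e l : ℕ} {ξ ls v v' Y : Spinor} (hX : br ξ ls ≠ 0)
    (hv : br ls v ≠ 0) (hv' : br ls v' ≠ 0) (hY : v' = v - Y) :
    softCoeff e l ξ ls v' = softCoeff e l ξ ls v + ∑ α, Y α * softGap e l ξ ls v v' α := by
  have hg := geom_sum₂_mul (br ξ v') (br ξ v) (e - l)
  have h1 : br ξ v' - br ξ v = -br ξ Y := by rw [hY]; simp [br]; ring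
  have h2 : br ls v - br ls v' = br ls Y := by rw [hY]; simp [br]; ring
  rw [h1] at hg
  simp only [softCoeff, softGap, Fin.sum_univ_two, ↓reduceIte, one_ne_zero]
  set g := ∑ j ∈ range (e - l), br ξ v' ^ j * br ξ v ^ (e - l - 1 - j)
  have hXr := pow_ne_zero (e - l) hX
  have hsum : ∀ a b D : ℂ, Y 0 * (a / D) + Y 1 * (b / D) = (Y 0 * a + Y 1 * b) / D := by
    intros; ring
  rw [hsum, div_add_div _ _ (mul_ne_zero hXr hv) (mul_ne_zero (mul_ne_zero hXr hv') hv),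
    div_eq_div_iff (mul_ne_zero hXr hv') (mul_ne_zero (mul_ne_zero hXr hv)
      (mul_ne_zero (mul_ne_zero hXr hv') hv))]
  have e1 : br ξ Y = ξ 0 * Y 1 - ξ 1 * Y 0 := rfl
  have e2 : br ls Y = ls 0 * Y 1 - ls 1 * Y 0 := rfl
  rw [e1] at hg
  rw [e2] at h2
  generalize br ξ v' ^ (e - l) = a' at *
  generalize br ξ v ^ (e - l) = a at *
  generalize br ls v' = b' at *
  generalize br ls v = b at *
  generalize br ξ ls ^ (e - l) = c at *
  linear_combination (-c ^ 2 * b ^ 2 * b') * hg + c ^ 2 * b' * b * a * h2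

end CoefficientGap

/-! ### From residues to operators acting on smeared correlators -/

section SoftTheorem

variable {N k m : ℕ} {G : Gauge N k m} {lam lt₀ : Leg k m → Spinor} {S : Finset (Fin N → ℂ)}
  {φ : (Fin N → ℂ) → (Fin N → ℂ) → (Fin N → ℂ)} {ρ : ℝ} {ξ ls lts : Spinor}
  {R : (Leg k m → ℂ) → (Leg k m → ℂ) → (Leg k m → Spinor) → ℂ} {Φ : (Leg k m → Spinor) → ℂ}

theorem analyticAt_smeared {D : (Fin N → ℂ) → Prop} (hR : HolomorphicWeight R)
    (h : AdmissibleRadius D (G.equations lam lt₀) S φ ρ) (hD : ∀ x, D x → G.domain x)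
    (hΦ : Differentiable ℂ Φ) (a : Leg k m) (lts : Spinor) :
    AnalyticAt ℂ (fun t : ℂ => smeared G S φ ρ lt₀ (deltaKernel lam univ R) Φ
      (Pi.single a (t • lts))) 0 := by
  obtain ⟨U, hU, h0, hne⟩ := exists_shift_neighbourhood (lam := lam) (lt₀ := lt₀) h hD a lts
  exact (holomorphicOnTori_shiftedIntegrand hR h hD hne univ (C := fun x => Φ (G.tilde lt₀ x))
    fun x _ => (hΦ _).comp x (G.differentiable_tilde lt₀ x)).analyticAt hU h0

theorem differentiableAt_softGap {X : Type*} [NormedAddCommGroup X] [NormedSpace ℂ X] (e l : ℕ)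
    {v : Spinor} {f : X → Spinor} {x : X} (hf : DifferentiableAt ℂ f x)
    (hX : br ξ ls ≠ 0) (hv : br ls v ≠ 0) (hfx : br ls (f x) ≠ 0) (α : Fin 2) :
    DifferentiableAt ℂ (fun x => softGap e l ξ ls v (f x) α) x := by
  have hb : DifferentiableAt ℂ (fun x => br ls (f x)) x :=
    differentiableAt_br (differentiableAt_const _) hf
  have hξ : DifferentiableAt ℂ (fun x => br ξ (f x)) x :=
    differentiableAt_br (differentiableAt_const _) hf
  have hg : DifferentiableAt ℂ (fun x => ∑ j ∈ range (e - l), br ξ (f x) ^ j *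
      br ξ v ^ (e - l - 1 - j)) x :=
    DifferentiableAt.fun_sum fun j _ => (hξ.pow j).mul (differentiableAt_const _)
  have hden : br ξ ls ^ (e - l) * br ls (f x) * br ls v ≠ 0 :=
    mul_ne_zero (mul_ne_zero (pow_ne_zero _ hX) hfx) hv
  simp only [softGap]
  split_ifs <;> fun_prop (disch := assumption)

/-- The soft theorem for a kernel whose residues at the hard punctures are multiples of Taylor
coefficients of shifted hard kernels: on the support of the delta functions the coefficients may
be replaced by functions of the external data. -/
theorem smearedSoft_eq {K : ℂ → ℂ → (Leg k m → ℂ) → (Leg k m → ℂ) → (Leg k m → Spinor) → ℂ}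
    {e l : ℕ} {P : (Fin N → ℂ) → Leg k m → ℂ} {Q : Leg k m → (Leg k m → Spinor) → ℂ}
    {ε : Fin 2 → ℂ} (hR : HolomorphicWeight R)
    (hS : IsSolutionSet G.domain (G.equations lam lt₀) S φ)
    (h : AdmissibleRadius (softDomain G lam ls) (G.equations lam lt₀) S φ ρ)
    (hsoft : ∀ a, br ls (lam a) ≠ 0) (hX : br ξ ls ≠ 0) (hΦ : Differentiable ℂ Φ)
    (hQ : ∀ a, Differentiable ℂ (Q a))
    (hl : ∀ i x t, P x (.inl i) = Q (.inl i) (G.tilde lt₀ x) +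
      ∑ α, shiftedDelta G lam lt₀ (.inl i) lts t x (.inl i, α) * ε α)
    (hr : ∀ p x, P x (.inr p) = Q (.inr p) (G.tilde lt₀ x))
    (hres : ∀ x a, GenericPoint (G.sig x) (G.scl x) lam (G.tilde lt₀ x) ξ ls →
      residueAt (fun z => softTerm l fun τ => K τ z (G.sig x) (G.scl x) (G.tilde lt₀ x))
        (G.sig x a) =
      softCoeff e l ξ ls (Sum.elim (fun i => lam (.inl i))
        (fun p => G.scl x (.inr p) • lamField (G.sig x) (G.scl x) lam (G.sig x (.inr p))) a) *
        P x a * softTerm l fun t => deltaKernel lam univ R (G.sig x) (G.scl x)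
          (G.tilde lt₀ x + Pi.single a (t • lts))) :
    smearedSoft G S φ ρ lt₀ K Φ l = ∑ a, softTerm l fun t =>
      smeared G S φ ρ lt₀ (deltaKernel lam univ R)
        (fun e' => softCoeff e l ξ ls (lam a) * Q a e' * Φ e') (Pi.single a (t • lts)) := by
  have hD : ∀ x, softDomain G lam ls x → G.domain x := fun x hx => hx.1
  have hΦt : ∀ x, DifferentiableAt ℂ (fun x => Φ (G.tilde lt₀ x)) x := fun x =>
    (hΦ _).comp x (G.differentiable_tilde lt₀ x)
  have hQt : ∀ a x, DifferentiableAt ℂ (fun x => Q a (G.tilde lt₀ x)) x := fun a x =>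
    (hQ a _).comp x (G.differentiable_tilde lt₀ x)
  set V : (Fin N → ℂ) → Leg k m → Spinor := fun x => Sum.elim (fun i => lam (.inl i))
    (fun p => G.scl x (.inr p) • lamField (G.sig x) (G.scl x) lam (G.sig x (.inr p))) with hV
  set C : Leg k m → (Fin N → ℂ) → ℂ := fun a x =>
    Φ (G.tilde lt₀ x) * (softCoeff e l ξ ls (V x a) * P x a) with hC
  set C' : Leg k m → (Fin N → ℂ) → ℂ := fun a x =>
    softCoeff e l ξ ls (lam a) * Q a (G.tilde lt₀ x) * Φ (G.tilde lt₀ x) with hC'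
  have hC'd : ∀ a x, DifferentiableAt ℂ (C' a) x := fun a x =>
    ((differentiableAt_const _).mul (hQt a x)).mul (hΦt x)
  -- For dual twistor operators the coefficients differ through `λ̃_i - s_i λ̃(σ_i)`, supplied by
  -- `hl`; for twistor operators through `λ_p - s_p λ(σ_p)`, supplied by `softCoeff_eq_add_gap`.
  obtain ⟨E, hE, hCC'⟩ : ∃ E : Leg k m → Fin 2 → (Fin N → ℂ) → ℂ,
      (∀ a α x, softDomain G lam ls x → DifferentiableAt ℂ (E a α) x) ∧
      ∀ a x, softDomain G lam ls x → ∀ t,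
        C a x = C' a x + ∑ α, shiftedDelta G lam lt₀ a lts t x (a, α) * E a α x := by
    refine ⟨fun a α x => a.elim
      (fun i => Φ (G.tilde lt₀ x) * softCoeff e l ξ ls (lam (.inl i)) * ε α)
      (fun p => Φ (G.tilde lt₀ x) * Q (.inr p) (G.tilde lt₀ x) *
        softGap e l ξ ls (lam (.inr p)) (V x (.inr p)) α), ?_, ?_⟩
    · rintro (i | p) α x hx
      · exact ((hΦt x).mul (differentiableAt_const _)).mul (differentiableAt_const _)
      · have hf : DifferentiableAt ℂ (fun x => V x (.inr p)) x :=
          ((differentiableAt_pi.1 (G.differentiable_scl x) (.inr p))).smul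
            (differentiableAt_lamField_gauge lam (.inr p) hx.1)
        refine ((hΦt x).mul (hQt _ x)).mul (differentiableAt_softGap e l hf hX (hsoft _) ?_ α)
        simp only [hV, Sum.elim_inr, br_smul_right]
        exact mul_ne_zero (hx.1.2 _) (hx.2 p)
    · rintro (i | p) x hx t
      · simp only [hC, hC', hV, Sum.elim_inl, hl i x t, Finset.mul_sum, mul_add]
        congr 1
        · ring
        · exact Finset.sum_congr rfl fun α _ => by ring
      · have hne : br ls (V x (.inr p)) ≠ 0 := by
          simp only [hV, Sum.elim_inr, br_smul_right]
          exact mul_ne_zero (hx.1.2 _) (hx.2 p)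
        have hY : V x (.inr p) = lam (.inr p) -
            fun α => shiftedDelta G lam lt₀ (.inr p) lts t x (.inr p, α) := by
          funext α
          simp [hV, shiftedDelta, deltaArg]
        simp only [hC, hC', hr, Sum.elim_inr]
        rw [softCoeff_eq_add_gap hX (hsoft (.inr p)) hne hY, add_mul, mul_add, Finset.sum_mul,
          Finset.mul_sum]
        congr 1
        · ring
        · exact Finset.sum_congr rfl fun α _ => by ring
  -- No holomorphy is assumed of `P`; it is inherited through the relation with `C'` at `t = 0`.
  have hCd : ∀ a x, softDomain G lam ls x → DifferentiableAt ℂ (C a) x := fun a x hx => by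
    have h1 : C a =ᶠ[𝓝 x] fun x => C' a x +
        ∑ α, shiftedDelta G lam lt₀ a lts 0 x (a, α) * E a α x := by
      have hev : ∀ᶠ x in 𝓝 x, softDomain G lam ls x := by
        refine (G.eventually_domain hx.1).and (Filter.eventually_all.2 fun p => ?_)
        exact (differentiableAt_br (differentiableAt_const ls)
          (differentiableAt_lamField_gauge lam (.inr p) hx.1)).continuousAt.eventually_ne (hx.2 p)
      filter_upwards [hev] with x hx using hCC' a x hx 0
    refine DifferentiableAt.congr_of_eventuallyEq ?_ h1
    refine (hC'd a x).add (DifferentiableAt.fun_sum fun α _ => ?_)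
    refine DifferentiableAt.mul ?_ (hE a α x hx)
    exact DifferentiableAt.comp (g := fun p : ℂ × (Fin N → ℂ) =>
        shiftedDelta G lam lt₀ a lts p.1 p.2 (a, α)) (f := fun x => ((0 : ℂ), x)) x
      (differentiableAt_shiftedDelta a lts hx.1 _)
      ((differentiableAt_const _).prodMk differentiableAt_id)
  have h1 : smearedSoft G S φ ρ lt₀ K Φ l = contourSum S φ ρ fun x => ∑ a, C a x *
      softTerm l fun t => deltaKernel lam univ R (G.sig x) (G.scl x)
        (G.tilde lt₀ x + Pi.single a (t • lts)) := by
    refine contourSum_congr h.pos.le fun u hu y hy => ?_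
    simp only [hC, Finset.mul_sum]
    refine Finset.sum_congr rfl fun a _ => ?_
    rw [hres _ a (h.genericPoint hS hsoft hX hu hy)]
    ring
  rw [h1, contourSum_sum fun a _ => continuousOnTori_softTerm hR h hD (hCd a) l]
  exact Finset.sum_congr rfl fun a _ => contourSum_softTerm hR h hD (hCd a)
    (fun x _ => hC'd a x) (hE a) (hCC' a) l

theorem softTerm_smeared (K : (Leg k m → ℂ) → (Leg k m → ℂ) → (Leg k m → Spinor) → ℂ)
    (c : (Leg k m → Spinor) → ℂ) (a : Leg k m) (l : ℕ) :
    softTerm l (fun t => smeared G S φ ρ lt₀ K (fun e => c e * Φ e) (Pi.single a (t • lts))) =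
      (l.factorial : ℂ)⁻¹ * smearedDeriv G S φ ρ lt₀ K Φ c lts a l := by
  rw [softTerm, smearedDeriv, div_eq_inv_mul]

theorem smeared_const_mul (K : (Leg k m → ℂ) → (Leg k m → ℂ) → (Leg k m → Spinor) → ℂ) (c : ℂ)
    (shift : Leg k m → Spinor) :
    smeared G S φ ρ lt₀ K (fun e => c * Φ e) shift = c * smeared G S φ ρ lt₀ K Φ shift := by
  simp only [smeared, mul_assoc, contourSum_const_mul]

theorem smearedDeriv_const (K : (Leg k m → ℂ) → (Leg k m → ℂ) → (Leg k m → Spinor) → ℂ) (c : ℂ)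
    (a : Leg k m) (l : ℕ) :
    smearedDeriv G S φ ρ lt₀ K Φ (fun _ => c) lts a l =
      c * smearedDeriv G S φ ρ lt₀ K Φ (fun _ => 1) lts a l := by
  simp only [smearedDeriv, smeared_const_mul, one_mul]
  exact iteratedDeriv_const_mul_field c _

theorem smearedDeriv_zero (K : (Leg k m → ℂ) → (Leg k m → ℂ) → (Leg k m → Spinor) → ℂ)
    (c : (Leg k m → Spinor) → ℂ) (a : Leg k m) :
    smearedDeriv G S φ ρ lt₀ K Φ c lts a 0 = smeared G S φ ρ lt₀ K (fun e => c e * Φ e) 0 := by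
  simp [smearedDeriv]

end SoftTheorem

/-! ### Ward identities in four dimensions -/

section Ward

variable {𝒩 N k m n : ℕ} {G : Gauge N k m} {lam lt₀ : Leg k m → Spinor} {S : Finset (Fin N → ℂ)}
  {φ : (Fin N → ℂ) → (Fin N → ℂ) → (Fin N → ℂ)} {ξ ls : Spinor}

theorem gluon_ward_twistor (G : Gauge N k m) (col : Fin (n + 1) ≃ Leg k m)
    (ell : GrassEta 𝒩 k m →ₗ[ℂ] ℂ) (lts : Spinor)
    (hS : IsSolutionSet G.domain (G.equations lam lt₀) S φ)
    (hsoft : ∀ a, br ls (lam a) ≠ 0) (hX : br ξ ls ≠ 0) :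
    ∀ᶠ ρ in 𝓝[>] (0 : ℝ), ∀ Φ : (Leg k m → Spinor) → ℂ, Differentiable ℂ Φ →
      (∀ a, AnalyticAt ℂ (fun t : ℂ => smeared G S φ ρ lt₀ (gluonKernel G ell col lam) Φ
        (Pi.single a (t • lts))) 0) ∧
      smearedSoft G S φ ρ lt₀ (gluonSoftKernel G ell col lam ξ ls lts) Φ 0 =
        br (lam (col 0)) (lam (col (Fin.last n))) /
            (br ls (lam (col 0)) * br ls (lam (col (Fin.last n)))) *
          smeared G S φ ρ lt₀ (gluonKernel G ell col lam) Φ 0 ∧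
      smearedSoft G S φ ρ lt₀ (gluonSoftKernel G ell col lam ξ ls lts) Φ 1 =
        smearedDeriv G S φ ρ lt₀ (gluonKernel G ell col lam) Φ
            (fun _ => 1 / br ls (lam (col 0))) lts (col 0) 1 +
          smearedDeriv G S φ ρ lt₀ (gluonKernel G ell col lam) Φ
            (fun _ => 1 / br (lam (col (Fin.last n))) ls) lts (col (Fin.last n)) 1 := by
  filter_upwards [hS.admissible (hS.softDomain hsoft)] with ρ h Φ hΦ
  have hR := holomorphicWeight_gluon G ell col
  have key : ∀ l ≤ 1, smearedSoft G S φ ρ lt₀ (gluonSoftKernel G ell col lam ξ ls lts) Φ l =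
      ∑ a, (softCoeff 1 l ξ ls (lam a) * ((l.factorial : ℂ)⁻¹ *
        smearedDeriv G S φ ρ lt₀ (gluonKernel G ell col lam) Φ (fun _ => 1) lts a l)) *
        chargePair col a := by
    intro l hl
    rw [smearedSoft_eq (e := 1) (P := fun _ a => chargePair col a)
      (Q := fun a _ => chargePair col a) (ε := 0) hR hS h hsoft hX hΦ
      (fun a => differentiable_const _) (fun i x t => by simp) (fun p x => rfl) fun x a hx => by
        rw [residueAt_gluonSoft hx (G.first_ne_last col) lts hl a, gluonKernel_eq]]
    refine Finset.sum_congr rfl fun a _ => ?_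
    rw [softTerm_smeared _ (fun _ => _), smearedDeriv_const, gluonKernel_eq]
    ring
  refine ⟨fun a => by rw [gluonKernel_eq]; exact analyticAt_smeared hR h (fun x hx => hx.1) hΦ a lts,
    ?_, ?_⟩
  · rw [key 0 zero_le_one, sum_chargePair_mul]
    simp only [smearedDeriv_zero, one_mul, Nat.factorial_zero, Nat.cast_one, inv_one, softCoeff,
      tsub_zero, pow_one]
    have h0 := hsoft (col 0)
    have h1 := hsoft (col (Fin.last n))
    rw [← sub_mul]
    congr 1
    -- What remains is Schouten's identity, which eliminates the reference spinor.
    field_simp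
    simp only [br]
    ring
  · rw [key 1 le_rfl, sum_chargePair_mul, smearedDeriv_const _ (1 / br ls (lam (col 0))),
      smearedDeriv_const _ (1 / br (lam (col (Fin.last n))) ls),
      br_neg_swap (lam (col (Fin.last n))) ls]
    simp [softCoeff, div_neg, sub_eq_add_neg]

theorem graviton_ward_twistor (G : Gauge N k m) (i₀ : Fin k) (p₀ : Fin m)
    (ell : GrassEta 𝒩 k m →ₗ[ℂ] ℂ) (lts : Spinor)
    (hS : IsSolutionSet G.domain (G.equations lam lt₀) S φ)
    (hsoft : ∀ a, br ls (lam a) ≠ 0) (hX : br ξ ls ≠ 0) :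
    ∀ᶠ ρ in 𝓝[>] (0 : ℝ), ∀ Φ : (Leg k m → Spinor) → ℂ, Differentiable ℂ Φ →
      (∀ a, AnalyticAt ℂ (fun t : ℂ => smeared G S φ ρ lt₀ (gravitonKernel G ell i₀ p₀ lam) Φ
        (Pi.single a (t • lts))) 0) ∧
      smearedSoft G S φ ρ lt₀ (gravitonSoftKernel G ell i₀ p₀ lam ξ ls lts) Φ 0 =
        ∑ a, smearedDeriv G S φ ρ lt₀ (gravitonKernel G ell i₀ p₀ lam) Φ
          (fun e => br (e a) lts * br ξ (lam a) ^ 2 / (br (lam a) ls * br ξ ls ^ 2)) lts a 0 ∧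
      smearedSoft G S φ ρ lt₀ (gravitonSoftKernel G ell i₀ p₀ lam ξ ls lts) Φ 1 =
        ∑ a, smearedDeriv G S φ ρ lt₀ (gravitonKernel G ell i₀ p₀ lam) Φ
          (fun e => br (e a) lts * br ξ (lam a) / (br (lam a) ls * br ξ ls)) lts a 1 ∧
      smearedSoft G S φ ρ lt₀ (gravitonSoftKernel G ell i₀ p₀ lam ξ ls lts) Φ 2 =
        1 / 2 * ∑ a, smearedDeriv G S φ ρ lt₀ (gravitonKernel G ell i₀ p₀ lam) Φ
          (fun e => br (e a) lts / br (lam a) ls) lts a 2 := by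
  filter_upwards [hS.admissible (hS.softDomain hsoft)] with ρ h Φ hΦ
  have hR := holomorphicWeight_graviton G ell i₀ p₀ lam
  have key : ∀ l ≤ 2, smearedSoft G S φ ρ lt₀ (gravitonSoftKernel G ell i₀ p₀ lam ξ ls lts) Φ l =
      ∑ a, (l.factorial : ℂ)⁻¹ * smearedDeriv G S φ ρ lt₀ (gravitonKernel G ell i₀ p₀ lam) Φ
        (fun e => br (e a) lts * br ξ (lam a) ^ (2 - l) / (br (lam a) ls * br ξ ls ^ (2 - l)))
        lts a l := by
    intro l hl
    -- The vector `ε` represents `-[λ̃_s ·]`, which turns `λ̃_i` into `s_i λ̃(σ_i)`. Since `[λ̃_s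
    -- λ̃_s] = 0` it does not see the translation, so the relation holds for every `t`.
    rw [smearedSoft_eq (e := 2) (ε := ![lts 1, -lts 0])
      (P := fun x => Sum.elim
        (fun i => br lts (G.scl x (.inl i) •
          ltField (G.sig x) (G.scl x) (G.tilde lt₀ x) [] (G.sig x (.inl i))))
        fun p => br lts (G.tilde lt₀ x (.inr p)))
      (Q := fun a e => br lts (e a)) hR hS h hsoft hX hΦ
      (fun a x => differentiableAt_br (by fun_prop) (by fun_prop)) (fun i x t => ?_)
      (fun p x => rfl) fun x a hx => ?_]
    · refine Finset.sum_congr rfl fun a _ => ?_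
      rw [softTerm_smeared, gravitonKernel_eq]
      congr 3
      ext e
      rw [br_neg_swap (e a) lts, br_neg_swap (lam a) ls, softCoeff]
      have := hsoft a
      field_simp
    · simp [Fin.sum_univ_two, shiftedDelta, deltaArg, br, ltField]
      ring
    · rw [residueAt_gravitonSoft hx lts hl a, gravitonKernel_eq]
      rcases a with i | p <;> rfl
  refine ⟨fun a => by
    rw [gravitonKernel_eq]; exact analyticAt_smeared hR h (fun x hx => hx.1) hΦ a lts, ?_, ?_, ?_⟩
  · simpa using key 0 (by norm_num)
  · simpa using key 1 (by norm_num)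
  · simpa [Nat.factorial, Finset.mul_sum, mul_add] using key 2 le_rfl

end Ward

-- ## Generators

section Taylor

theorem iteratedDeriv_exp_mul_affine (b x y : ℂ) (l : ℕ) :
    iteratedDeriv l (fun τ : ℂ => exp (τ * b) * (x + τ * y)) =
      fun τ => exp (τ * b) * (b ^ l * (x + τ * y) + l * b ^ (l - 1) * y) := by
  induction l with
  | zero => simp
  | succ l ih =>
    rw [iteratedDeriv_succ, ih]
    ext τ
    have h1 : HasDerivAt (fun τ : ℂ => exp (τ * b)) (exp (τ * b) * (1 * b)) τ :=
      ((hasDerivAt_id τ).mul_const b).cexp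
    have h2 : HasDerivAt (fun τ : ℂ => b ^ l * (x + τ * y) + l * b ^ (l - 1) * y)
        (b ^ l * (1 * y)) τ :=
      ((((hasDerivAt_id τ).mul_const y).const_add x).const_mul _).add_const _
    rw [(h1.fun_mul h2).deriv]
    rcases l with _ | l
    · simp; ring
    · simp only [Nat.add_sub_cancel, Nat.cast_add, Nat.cast_one]
      ring

theorem softTerm_exp_mul_affine (b x y : ℂ) (l : ℕ) :
    softTerm l (fun τ : ℂ => exp (τ * b) * (x + τ * y)) =
      (b ^ l * x + l * b ^ (l - 1) * y) / (l.factorial : ℂ) := by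
  simp [softTerm, iteratedDeriv_exp_mul_affine]

theorem softTerm_zero_exp_mul (b x : ℂ) (y : ℂ → ℂ) :
    softTerm 0 (fun τ : ℂ => exp (τ * b) * (x + τ * y τ)) = x := by
  simp [softTerm]

theorem softTerm_one_exp_mul {b x : ℂ} {y : ℂ → ℂ} (hy : DifferentiableAt ℂ y 0) :
    softTerm 1 (fun τ : ℂ => exp (τ * b) * (x + τ * y τ)) = b * x + y 0 := by
  have h1 : HasDerivAt (fun τ : ℂ => exp (τ * b)) (exp (0 * b) * (1 * b)) 0 :=
    ((hasDerivAt_id 0).mul_const b).cexp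
  have h2 : HasDerivAt (fun τ : ℂ => x + τ * y τ) (1 * y 0 + 0 * deriv y 0) 0 :=
    ((hasDerivAt_id 0).mul hy.hasDerivAt).const_add x
  rw [softTerm, iteratedDeriv_one, (h1.fun_mul h2).deriv]
  simp

end Taylor

/-! ### Generators on the cotangent bundle of null infinity -/

section Ambitwistor

variable {N d : ℕ}

theorem psi_smul (r : Fin N) (c : ℂ) (v : Vec d) : psi r (c • v) = c • psi r v := by
  simp [psi, Finset.smul_sum, smul_smul]

theorem psi_mul_psi (r : Fin N) (v v' : Vec d) :
    psi r v * psi r v' = ∑ μ, ∑ ν, (v μ * v' ν) • (psiLow r μ * psiLow r ν) := by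
  simp only [psi, Finset.sum_mul_sum, smul_mul_smul_comm]

theorem psiLow_mul_swap (r : Fin N) (μ ν : Fin (d + 1)) :
    psiLow r μ * psiLow r ν = -(psiLow r ν * psiLow r μ) :=
  eq_neg_of_add_eq_zero_left (ExteriorAlgebra.ι_add_mul_swap _ _)

theorem sum_smul_angMomentum (c : Fin (d + 1) → Fin (d + 1) → ℂ) (w : ℂ) (p q : Vec d) :
    (∑ μ, ∑ ν, c μ ν • angMomentum w p q μ ν : Grass N d) =
      algebraMap ℂ _ (∑ μ, ∑ ν, c μ ν * (low p μ * low q ν - low p ν * low q μ)) +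
        w • ∑ r : Fin N, ∑ μ, ∑ ν, c μ ν • (psiLow r μ * psiLow r ν) := by
  have h1 : (∑ r : Fin N, ∑ μ, ∑ ν, c μ ν • (psiLow r μ * psiLow r ν) : Grass N d) =
      ∑ μ, ∑ ν, c μ ν • ∑ r : Fin N, psiLow r μ * psiLow r ν := by
    rw [Finset.sum_comm]
    refine Finset.sum_congr rfl fun μ _ => ?_
    rw [Finset.sum_comm]
    exact Finset.sum_congr rfl fun ν _ => (Finset.smul_sum).symm
  simp only [angMomentum, smul_add, Finset.sum_add_distrib, h1, map_sum, map_mul, Finset.smul_sum,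
    Algebra.smul_def (R := ℂ) (A := Grass N d) (c _ _) (algebraMap ℂ _ _)]
  congr 1
  exact Finset.sum_congr rfl fun μ _ => Finset.sum_congr rfl fun ν _ =>
    Finset.sum_congr rfl fun r _ => smul_comm _ _ _

theorem sum_mul_low (ε s p q : Vec d) :
    ∑ μ, ∑ ν, ε μ * s ν * (low p μ * low q ν - low p ν * low q μ) =
      mdot ε p * mdot s q - mdot s p * mdot ε q := by
  have h : ∀ x y : Vec d, mdot x y = ∑ μ, x μ * low y μ := fun x y =>
    Finset.sum_congr rfl fun μ _ => by simp only [low]; ring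
  rw [mul_comm (mdot s p)]
  simp only [h, Finset.sum_mul_sum, ← Finset.sum_sub_distrib]
  exact Finset.sum_congr rfl fun μ _ => Finset.sum_congr rfl fun ν _ => by ring

theorem sum_mul_smul_angMomentum (ε s p q : Vec d) (w : ℂ) :
    (∑ μ, ∑ ν, (ε μ * s ν) • angMomentum w p q μ ν : Grass N d) =
      algebraMap ℂ _ (mdot ε p * mdot s q - mdot s p * mdot ε q) +
        w • ∑ r : Fin N, psi r ε * psi r s := by
  simp only [sum_smul_angMomentum (fun μ ν => ε μ * s ν), sum_mul_low, psi_mul_psi]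

theorem angMomentum_swap (w : ℂ) (p q : Vec d) (μ ν : Fin (d + 1)) :
    (angMomentum w p q μ ν : Grass N d) = -angMomentum w p q ν μ := by
  simp only [angMomentum, neg_add, ← map_neg, ← smul_neg, ← Finset.sum_neg_distrib,
    ← psiLow_mul_swap]
  congr 2
  ring

/-- As `J` is antisymmetric, the two halves of the antisymmetrised `r` contribute equally. -/
theorem superrotationH_softRotation (ε s p q : Vec d) (w : ℂ) :
    (superrotationH (softRotation ε s) w p q : Grass N d) =
      (I * (mdot ε p / mdot s p)) • ∑ μ, ∑ ν, (ε μ * s ν) • angMomentum w p q μ ν := by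
  have h1 : (∑ μ, ∑ ν, (s μ * ε ν) • angMomentum w p q μ ν : Grass N d) =
      -∑ μ, ∑ ν, (ε μ * s ν) • angMomentum w p q μ ν := by
    rw [Finset.sum_comm]
    simp only [← Finset.sum_neg_distrib, ← smul_neg, ← angMomentum_swap]
    exact Finset.sum_congr rfl fun μ _ => Finset.sum_congr rfl fun ν _ => by rw [mul_comm]
  have h2 : (superrotationH (softRotation ε s) w p q : Grass N d) =
      (I / 2 * (mdot ε p / mdot s p)) • ((∑ μ, ∑ ν, (ε μ * s ν) • angMomentum w p q μ ν) -
        ∑ μ, ∑ ν, (s μ * ε ν) • angMomentum w p q μ ν) := by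
    simp only [superrotationH, softRotation, ← Finset.sum_sub_distrib, Finset.smul_sum, ← sub_smul,
      smul_smul]
    exact Finset.sum_congr rfl fun μ _ => Finset.sum_congr rfl fun ν _ => by congr 1; ring
  rw [h2, h1, sub_neg_eq_add, ← two_smul ℂ, smul_smul]
  congr 1
  ring

theorem softRotation_swap (ε s p : Vec d) (μ ν : Fin (d + 1)) :
    softRotation ε s p μ ν = -softRotation ε s p ν μ := by
  simp only [softRotation]
  ring

/-- Antisymmetry of `r` folds the two terms `p q` of `J` into one, which produces the factor two in
the vector field. -/
theorem superrotationH_eq_lift (ε s p q : Vec d) (w : ℂ) :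
    (superrotationH (softRotation ε s) w p q : Grass N d) =
      algebraMap ℂ _ (hamiltonianLift w q 0
        (fun μ => 2 * ∑ ν, softRotation ε s p μ ν * low p ν)) +
      w • ∑ r : Fin N, ∑ μ, ∑ ν, softRotation ε s p μ ν • (psiLow r μ * psiLow r ν) := by
  rw [superrotationH, sum_smul_angMomentum (softRotation ε s p)]
  congr 2
  have h1 : ∑ μ, ∑ ν, softRotation ε s p μ ν * (low p μ * low q ν) =
      -∑ μ, ∑ ν, softRotation ε s p μ ν * (low p ν * low q μ) := by
    rw [Finset.sum_comm]
    simp only [← Finset.sum_neg_distrib, ← neg_mul, ← softRotation_swap]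
  simp only [mul_sub, Finset.sum_sub_distrib, h1, hamiltonianLift, mul_zero, zero_sub, mdot]
  rw [← neg_add', ← two_mul, Finset.mul_sum]
  congr 1
  refine Finset.sum_congr rfl fun μ _ => ?_
  simp only [Finset.mul_sum]
  exact Finset.sum_congr rfl fun ν _ => by simp only [low]; ring

theorem softTranslation_smul (ε s p : Vec d) {c : ℂ} (hc : c ≠ 0) :
    softTranslation ε s (c • p) = c * softTranslation ε s p ∧
      ∀ μ ν, softRotation ε s (c • p) μ ν = softRotation ε s p μ ν := by
  have h : ∀ x : Vec d, mdot x (c • p) = c * mdot x p := fun x => by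
    simp only [mdot, Finset.mul_sum, Pi.smul_apply, smul_eq_mul]
    exact Finset.sum_congr rfl fun μ _ => by ring
  refine ⟨?_, fun μ ν => ?_⟩
  · simp only [softTranslation, h]
    rw [mul_pow, pow_two c, mul_assoc, mul_div_mul_left _ _ hc, mul_div_assoc]
  · simp only [softRotation, h, mul_div_mul_left _ _ hc]

/-- Taylor coefficients of an operator with source and fermion bilinears linear in `τ`. -/
theorem softTerm_symbol_two (O : ℂ → LocalOp 2 d) (q : Vec d) (ell : Grass 2 d →ₗ[ℂ] ℂ)
    (b c e : ℂ) (β : Fin 2 → Grass 2 d)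
    (hO : ∀ τ, (O τ).pre = b ∧ mdot (O τ).src q = τ * c ∧ ∀ r, (O τ).cnum r = e ∧
      psi r ((O τ).fl r) * psi r ((O τ).fr r) = τ • β r) :
    softTerm 0 (fun τ => ell ((O τ).symbol q)) = ell (algebraMap ℂ _ (b * e ^ 2)) ∧
    softTerm 1 (fun τ => ell ((O τ).symbol q)) =
      ell (algebraMap ℂ _ (I * b * c * e ^ 2)) + ell ((I * b * e) • ∑ r, β r) := by
  -- The term with four fermions is of second order in `τ`, so orders zero and one do not see it.
  have h1 : ∀ τ, ell ((O τ).symbol q) = exp (τ * (I * c)) * (b * e ^ 2 * ell 1 +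
      τ * (I * b * e * ell (β 0 + β 1) - τ * (b * ell (β 0 * β 1)))) := by
    intro τ
    obtain ⟨hp, hs, hr⟩ := hO τ
    simp only [LocalOp.symbol, hp, hs, List.ofFn_succ, List.ofFn_zero, List.prod_cons,
      List.prod_nil, mul_one, (hr _).1, (hr _).2, Algebra.algebraMap_eq_smul_one, map_smul,
      add_mul, mul_add, smul_mul_assoc, mul_smul_comm, one_mul, map_add, smul_eq_mul, smul_smul,
      Fin.succ_zero_eq_one]
    linear_combination (exp (I * (τ * c)) * b * τ ^ 2 * ell (β 0 * β 1)) * I_sq +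
      (b * e ^ 2 * ell 1 + τ * (I * b * e * (ell (β 0) + ell (β 1)) -
        τ * (b * ell (β 0 * β 1)))) * congrArg exp (show I * (τ * c) = τ * (I * c) by ring)
  simp only [h1]
  rw [softTerm_zero_exp_mul (y := fun τ => I * b * e * ell (β 0 + β 1) - τ * (b * ell (β 0 * β 1))),
    softTerm_one_exp_mul (y := fun τ => I * b * e * ell (β 0 + β 1) - τ * (b * ell (β 0 * β 1)))
      (by fun_prop)]
  simp only [Algebra.algebraMap_eq_smul_one, map_smul, smul_eq_mul, Fin.sum_univ_two, true_and]
  ring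

theorem softTerm_symbol_one (O : ℂ → LocalOp 1 d) (q : Vec d) (ell : Grass 1 d →ₗ[ℂ] ℂ)
    (b c e : ℂ) (β : Fin 1 → Grass 1 d)
    (hO : ∀ τ, (O τ).pre = b ∧ mdot (O τ).src q = τ * c ∧ ∀ r, (O τ).cnum r = e ∧
      psi r ((O τ).fl r) * psi r ((O τ).fr r) = τ • β r) :
    softTerm 0 (fun τ => ell ((O τ).symbol q)) = ell (algebraMap ℂ _ (b * e)) ∧
    softTerm 1 (fun τ => ell ((O τ).symbol q)) =
      ell (algebraMap ℂ _ (I * b * c * e)) + ell ((I * b) • ∑ r, β r) := by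
  have h1 : ∀ τ, ell ((O τ).symbol q) = exp (τ * (I * c)) * (b * e * ell 1 +
      τ * (I * b * ell (β 0))) := by
    intro τ
    obtain ⟨hp, hs, hr⟩ := hO τ
    simp only [LocalOp.symbol, hp, hs, List.ofFn_succ, List.ofFn_zero, List.prod_cons,
      List.prod_nil, mul_one, (hr _).1, (hr _).2, Algebra.algebraMap_eq_smul_one, map_smul,
      smul_add, map_add, smul_eq_mul, smul_smul]
    rw [show I * (τ * c) = τ * (I * c) by ring]
    ring
  simp only [h1]
  rw [softTerm_zero_exp_mul (y := fun τ => I * b * ell (β 0)),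
    softTerm_one_exp_mul (y := fun τ => I * b * ell (β 0)) (by fun_prop)]
  simp only [Algebra.algebraMap_eq_smul_one, map_smul, smul_eq_mul, Fin.sum_univ_one, true_and]
  ring

/-- The vertex operator lacks the part `-(s·p)(ε·q)` of the contracted `J`. With the prefactor `ε·p
/ s·p` this part loses its pole, which explains the extra regular term. -/
theorem graviton_generators (w : ℂ) (ε s p q : Vec d) (hw : w ≠ 0) (hs : mdot s p ≠ 0)
    (ell : Grass 2 d →ₗ[ℂ] ℂ) :
    softTerm 0 (fun τ => ell ((softVertex 2 w ε s τ p).symbol q)) =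
        ell (algebraMap ℂ _ (hamiltonianLift w q (softTranslation ε s p) 0)) ∧
    softTerm 1 (fun τ => ell ((softVertex 2 w ε s τ p).symbol q)) =
        ell (superrotationH (softRotation ε s) w p q) +
          ell (algebraMap ℂ _ (I * mdot ε p * mdot ε q)) ∧
    softTerm 1 (fun τ => ell ((superrotationOp w ε s τ p).symbol q)) =
        ell (superrotationH (softRotation ε s) w p q) := by
  have h1 := softTerm_symbol_two (fun τ => softVertex 2 w ε s τ p) q ell (w / mdot s p)
    (mdot s q / w) (mdot ε p) (fun r => psi r ε * psi r s) fun τ =>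
      ⟨rfl, by simp only [softVertex, mdot_smul_left]; ring, fun r => ⟨rfl, by
        simp only [softVertex, psi_smul, mul_smul_comm]⟩⟩
  have h2 := softTerm_symbol_two (fun τ => superrotationOp w ε s τ p) q ell
    (mdot ε p / mdot s p) (mdot ε p * mdot s q - mdot s p * mdot ε q) 1
    (fun r => w • (psi r ε * psi r s)) fun τ =>
      ⟨rfl, by simp only [superrotationOp, rotationOp, mdot_smul_left, mdot_sub_left], fun r =>
        ⟨rfl, by simp only [superrotationOp, rotationOp, psi_smul, mul_smul_comm, smul_smul]⟩⟩
  have h3 : ∀ z : ℂ, ell (algebraMap ℂ (Grass 2 d) z) = z * ell 1 := fun z => by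
    rw [Algebra.algebraMap_eq_smul_one, map_smul, smul_eq_mul]
  refine ⟨h1.1.trans ?_, h1.2.trans ?_, h2.2.trans ?_⟩
  · congr 2
    simp only [hamiltonianLift, softTranslation, mdot, Pi.zero_apply, mul_zero,
      Finset.sum_const_zero, sub_zero]
    ring
  · simp only [superrotationH_softRotation, sum_mul_smul_angMomentum, smul_add, map_add, map_smul,
      h3, smul_eq_mul]
    field_simp
    ring
  · simp only [superrotationH_softRotation, sum_mul_smul_angMomentum, smul_add, map_add, map_smul,
      h3, smul_eq_mul, ← Finset.smul_sum]
    ring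

theorem gluon_generators (w : ℂ) (ε s p q : Vec d) (hw : w ≠ 0) (hs : mdot s p ≠ 0)
    (ell : Grass 1 d →ₗ[ℂ] ℂ) :
    softTerm 0 (fun τ => ell ((softVertex 1 w ε s τ p).symbol q)) =
        ell (algebraMap ℂ _ (w * (mdot ε p / mdot s p))) ∧
    softTerm 1 (fun τ => ell ((softVertex 1 w ε s τ p).symbol q)) =
        ell ((I / mdot s p) • ∑ μ, ∑ ν, (ε μ * s ν) • angMomentum w p q μ ν) +
          ell (algebraMap ℂ _ (I * mdot ε q)) ∧
    softTerm 1 (fun τ => ell ((gaugeRotationOp w ε s τ p).symbol q)) =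
        ell ((I / mdot s p) • ∑ μ, ∑ ν, (ε μ * s ν) • angMomentum w p q μ ν) := by
  have h1 := softTerm_symbol_one (fun τ => softVertex 1 w ε s τ p) q ell (w / mdot s p)
    (mdot s q / w) (mdot ε p) (fun r => psi r ε * psi r s) fun τ =>
      ⟨rfl, by simp only [softVertex, mdot_smul_left]; ring, fun r => ⟨rfl, by
        simp only [softVertex, psi_smul, mul_smul_comm]⟩⟩
  have h2 := softTerm_symbol_one (fun τ => gaugeRotationOp w ε s τ p) q ell
    (1 / mdot s p) (mdot ε p * mdot s q - mdot s p * mdot ε q) 1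
    (fun r => w • (psi r ε * psi r s)) fun τ =>
      ⟨rfl, by simp only [gaugeRotationOp, rotationOp, mdot_smul_left, mdot_sub_left], fun r =>
        ⟨rfl, by simp only [gaugeRotationOp, rotationOp, psi_smul, mul_smul_comm, smul_smul]⟩⟩
  have h3 : ∀ z : ℂ, ell (algebraMap ℂ (Grass 1 d) z) = z * ell 1 := fun z => by
    rw [Algebra.algebraMap_eq_smul_one, map_smul, smul_eq_mul]
  refine ⟨h1.1.trans ?_, h1.2.trans ?_, h2.2.trans ?_⟩
  · congr 2
    ring
  · simp only [sum_mul_smul_angMomentum, smul_add, map_add, map_smul, h3, smul_eq_mul]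
    field_simp
    ring
  · simp only [sum_mul_smul_angMomentum, smul_add, map_add, map_smul, h3, smul_eq_mul,
      ← Finset.smul_sum]
    ring

end Ambitwistor

/-! ### Generators on twistor space and the square of the superrotation -/

section TwistorSpace

/-- Gradient of a function of `Z`, contracted with `ρ`. -/
def rhoGrad (a : Tw → ℂ) (Z : Tw) : GrassTw :=
  ∑ i, deriv (fun t : ℂ => a (Z + t • Pi.single i 1)) 0 • rho i

/-- A covector contracted with `ρ̃`. -/
def rhoTildeLin (B : Tw →ₗ[ℂ] ℂ) : GrassTw := ∑ j, B (Pi.single j 1) • rhoTilde j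

/-- For a Hamiltonian linear in `W` the gradient in `W` is a constant covector, and the double sum
factorises. -/
theorem extend_mul (a : Tw → ℂ) (B : Tw →ₗ[ℂ] ℂ) (Z W : Tw) :
    extend (fun Z W => a Z * B W) Z W =
      algebraMap ℂ GrassTw (a Z * B W) + rhoGrad a Z * rhoTildeLin B := by
  have h1 : ∀ (x : Tw) (j : Fin 2 ⊕ Fin 2),
      deriv (fun t : ℂ => a x * B (W + t • Pi.single j 1)) 0 = a x * B (Pi.single j 1) := by
    intro x j
    simp only [map_add, map_smul, smul_eq_mul]
    simp
  simp only [extend, h1, deriv_mul_const_field, rhoGrad, rhoTildeLin, Finset.sum_mul_sum,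
    smul_mul_smul_comm]

/-- Agreement near `Z` is enough, as only derivatives at `Z` occur. The Taylor coefficients match
the closed forms of orders one and two only where `⟨ξ λ⟩ ≠ 0`. -/
theorem extend_congr {h h' : Tw → Tw → ℂ} {Z : Tw} (hh : ∀ᶠ Z in 𝓝 Z, h Z = h' Z) (W : Tw) :
    extend h Z W = extend h' Z W := by
  have h1 : ∀ i : Fin 2 ⊕ Fin 2, ∀ᶠ t : ℂ in 𝓝 0,
      h (Z + t • Pi.single i 1) = h' (Z + t • Pi.single i 1) := fun i => by
    have hc : ContinuousAt (fun t : ℂ => Z + t • (Pi.single i 1 : Tw)) 0 := by fun_prop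
    exact hc.eventually (by simpa using hh)
  simp only [extend, hh.self_of_nhds]
  congr 1
  refine Finset.sum_congr rfl fun i _ => Finset.sum_congr rfl fun j _ => ?_
  congr 1
  refine Filter.EventuallyEq.deriv_eq ?_
  filter_upwards [h1 i] with t ht
  rw [ht]

variable {A u : Tw → ℂ} {B : Tw →ₗ[ℂ] ℂ} {Z W : Tw}

theorem rhoGrad_mul_pow (hA : DifferentiableAt ℂ A Z) (hu : DifferentiableAt ℂ u Z) (c : ℂ) (l : ℕ) :
    rhoGrad (fun Z => c * (A Z * u Z ^ l)) Z =
      (c * u Z ^ l) • rhoGrad A Z + (c * (l * u Z ^ (l - 1) * A Z)) • rhoGrad u Z := by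
  simp only [rhoGrad, Finset.smul_sum, smul_smul, ← Finset.sum_add_distrib, ← add_smul]
  refine Finset.sum_congr rfl fun i _ => ?_
  congr 1
  have hline : DifferentiableAt ℂ (fun t : ℂ => Z + t • (Pi.single i 1 : Tw)) 0 := by fun_prop
  have hA' : DifferentiableAt ℂ (fun t : ℂ => A (Z + t • Pi.single i 1)) 0 :=
    DifferentiableAt.comp (g := A) 0 (by simpa using hA) hline
  have hu' : DifferentiableAt ℂ (fun t : ℂ => u (Z + t • Pi.single i 1)) 0 :=
    DifferentiableAt.comp (g := u) 0 (by simpa using hu) hline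
  rw [((hA'.hasDerivAt.fun_mul (hu'.hasDerivAt.fun_pow l)).const_mul c).deriv]
  simp only [zero_smul, add_zero]
  ring

theorem rhoGrad_mul_exp (hA : DifferentiableAt ℂ A Z) (hu : DifferentiableAt ℂ u Z) (τ : ℂ) :
    rhoGrad (fun Z => A Z * exp (τ * u Z)) Z =
      exp (τ * u Z) • (rhoGrad A Z + (τ * A Z) • rhoGrad u Z) := by
  simp only [rhoGrad, Finset.smul_sum, smul_smul, ← Finset.sum_add_distrib, ← add_smul]
  refine Finset.sum_congr rfl fun i _ => ?_
  congr 1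
  have hline : DifferentiableAt ℂ (fun t : ℂ => Z + t • (Pi.single i 1 : Tw)) 0 := by fun_prop
  have hA' : DifferentiableAt ℂ (fun t : ℂ => A (Z + t • Pi.single i 1)) 0 :=
    DifferentiableAt.comp (g := A) 0 (by simpa using hA) hline
  have hu' : DifferentiableAt ℂ (fun t : ℂ => u (Z + t • Pi.single i 1)) 0 :=
    DifferentiableAt.comp (g := u) 0 (by simpa using hu) hline
  rw [(hA'.hasDerivAt.fun_mul (hu'.hasDerivAt.const_mul τ).cexp).deriv]
  simp only [zero_smul, add_zero]
  ring

/-- The extension to the fermions commutes with the expansion in the soft momentum. -/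
theorem softTerm_extend (hA : DifferentiableAt ℂ A Z) (hu : DifferentiableAt ℂ u Z)
    (ell : GrassTw →ₗ[ℂ] ℂ) (l : ℕ) :
    softTerm l (fun τ => ell (extend (fun Z W => A Z * exp (τ * u Z) * B W) Z W)) =
      ell (extend (fun Z W => (l.factorial : ℂ)⁻¹ * (A Z * u Z ^ l) * B W) Z W) := by
  have h1 : ∀ τ, ell (extend (fun Z W => A Z * exp (τ * u Z) * B W) Z W) =
      exp (τ * u Z) * ((A Z * B W * ell 1 + ell (rhoGrad A Z * rhoTildeLin B)) +
        τ * (A Z * ell (rhoGrad u Z * rhoTildeLin B))) := by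
    intro τ
    rw [extend_mul (fun Z => A Z * exp (τ * u Z)), rhoGrad_mul_exp hA hu,
      Algebra.algebraMap_eq_smul_one]
    simp only [map_add, map_smul, smul_mul_assoc, add_mul, smul_eq_mul]
    ring
  simp only [h1]
  rw [softTerm_exp_mul_affine, extend_mul (fun Z => (l.factorial : ℂ)⁻¹ * (A Z * u Z ^ l)),
    rhoGrad_mul_pow hA hu, Algebra.algebraMap_eq_smul_one]
  simp only [map_add, map_smul, smul_mul_assoc, add_mul, smul_eq_mul]
  ring

theorem exists_rhoGrad_eq (a : Tw → ℂ) (Z : Tw) :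
    ∃ v, rhoGrad a Z = ExteriorAlgebra.ι ℂ v :=
  ⟨∑ i, deriv (fun t : ℂ => a (Z + t • Pi.single i 1)) 0 • Pi.single (.inl i) 1, by
    simp only [rhoGrad, rho, map_sum, map_smul]⟩

theorem exists_rhoTildeLin_eq (B : Tw →ₗ[ℂ] ℂ) : ∃ v, rhoTildeLin B = ExteriorAlgebra.ι ℂ v :=
  ⟨∑ j, B (Pi.single j 1) • Pi.single (.inr j) 1, by
    simp only [rhoTildeLin, rhoTilde, map_sum, map_smul]⟩

/-- The same odd element in `ρ̃` occurs twice. -/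
theorem rhoGrad_mul_rhoTildeLin_mul (a a' : Tw → ℂ) (B : Tw →ₗ[ℂ] ℂ) (Z : Tw) :
    rhoGrad a Z * rhoTildeLin B * (rhoGrad a' Z * rhoTildeLin B) = 0 := by
  obtain ⟨v, hv⟩ := exists_rhoGrad_eq a Z
  obtain ⟨v', hv'⟩ := exists_rhoGrad_eq a' Z
  obtain ⟨b, hb⟩ := exists_rhoTildeLin_eq B
  rw [hv, hv', hb]
  have h1 : ExteriorAlgebra.ι ℂ b * ExteriorAlgebra.ι ℂ v' =
      -(ExteriorAlgebra.ι ℂ v' * ExteriorAlgebra.ι ℂ b) :=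
    eq_neg_of_add_eq_zero_left (ExteriorAlgebra.ι_add_mul_swap _ _)
  rw [mul_assoc, ← mul_assoc (ExteriorAlgebra.ι ℂ b), h1, neg_mul, mul_assoc,
    ExteriorAlgebra.ι_sq_zero, mul_zero, neg_zero, mul_zero]

theorem extend_mul_extend (a a' : Tw → ℂ) (B : Tw →ₗ[ℂ] ℂ) (Z W : Tw) :
    extend (fun Z W => a Z * B W) Z W * extend (fun Z W => a' Z * B W) Z W =
      (a Z * a' Z * B W ^ 2) • 1 + (B W * a Z) • (rhoGrad a' Z * rhoTildeLin B) +
        (B W * a' Z) • (rhoGrad a Z * rhoTildeLin B) := by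
  rw [extend_mul, extend_mul]
  simp only [add_mul, mul_add, rhoGrad_mul_rhoTildeLin_mul, add_zero,
    Algebra.algebraMap_eq_smul_one, smul_mul_assoc, mul_smul_comm, one_mul, mul_one]
  module

/-- The terms of order zero, one and two obey `2 h₀ h₂ = h₁²`. -/
theorem two_smul_extend_mul_extend (hA : DifferentiableAt ℂ A Z) (hu : DifferentiableAt ℂ u Z) :
    (2 : ℂ) • (extend (fun Z W => ((0).factorial : ℂ)⁻¹ * (A Z * u Z ^ 0) * B W) Z W *
      extend (fun Z W => ((2).factorial : ℂ)⁻¹ * (A Z * u Z ^ 2) * B W) Z W) =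
      extend (fun Z W => ((1).factorial : ℂ)⁻¹ * (A Z * u Z ^ 1) * B W) Z W ^ 2 := by
  rw [pow_two, extend_mul_extend (fun Z => _) (fun Z => _), extend_mul_extend (fun Z => _) (fun Z => _)]
  -- By Leibniz' rule both sides depend on the functions of `Z` only through their product, and `2 A
  -- (A u² / 2) = (A u)²`.
  simp only [rhoGrad_mul_pow hA hu, add_mul, smul_mul_assoc, smul_add, smul_smul]
  match_scalars <;> norm_num <;> ring

variable {ξ ls lts : Spinor}

/-- `[s λ̃]` as a linear function of `W`. -/
def softBracket (lts : Spinor) : Tw →ₗ[ℂ] ℂ :=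
  lts 0 • LinearMap.proj (.inl 1) - lts 1 • LinearMap.proj (.inl 0)

theorem softBracket_apply (lts : Spinor) (W : Tw) :
    softBracket lts W = br lts fun α => W (.inl α) := by
  simp [softBracket, br]

theorem twistor_graviton_generators (hX : br ξ ls ≠ 0) (hl : br ls (fun α => Z (.inr α)) ≠ 0)
    (hξ : br ξ (fun α => Z (.inr α)) ≠ 0) :
    (∀ ell : GrassTw →ₗ[ℂ] ℂ,
      softTerm 0 (fun τ => ell (extend (softGravitonTw ξ ls lts τ) Z W)) =
          ell (extend (translationTw (softTranslationTw ξ ls lts)) Z W) ∧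
      softTerm 1 (fun τ => ell (extend (softGravitonTw ξ ls lts τ) Z W)) =
          ell (extend (rotationTw 0 (softRotationTw ξ ls lts)) Z W) ∧
      softTerm 2 (fun τ => ell (extend (softGravitonTw ξ ls lts τ) Z W)) =
          ell (extend (softSquareTw ls lts) Z W)) ∧
    (2 : ℂ) • (extend (translationTw (softTranslationTw ξ ls lts)) Z W *
        extend (softSquareTw ls lts) Z W) =
      extend (rotationTw 0 (softRotationTw ξ ls lts)) Z W ^ 2 := by
  set A : Tw → ℂ := fun Z => br ξ (fun α => Z (.inr α)) ^ 2 /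
    (br ξ ls ^ 2 * br ls (fun α => Z (.inr α))) with hA
  set u : Tw → ℂ := fun Z => I * (br ξ ls / br ξ (fun α => Z (.inr α))) *
    ∑ α, Z (.inl α) * lts α with hu
  have hlam : ∀ v : Spinor, Differentiable ℂ fun Z : Tw => br v (fun α => Z (.inr α)) := fun v Z =>
    differentiableAt_br (differentiableAt_const _) (by fun_prop)
  have hAd : DifferentiableAt ℂ A Z := by
    simp only [hA, div_eq_mul_inv]
    exact ((hlam ξ Z).pow 2).mul (((hlam ls Z).const_mul _).fun_inv
      (mul_ne_zero (pow_ne_zero 2 hX) hl))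
  have hud : DifferentiableAt ℂ u Z := by
    simp only [hu, div_eq_mul_inv]
    exact ((((hlam ξ Z).fun_inv hξ).const_mul _).const_mul I).mul (by fun_prop)
  have hV : ∀ τ, softGravitonTw ξ ls lts τ = fun Z W => A Z * exp (τ * u Z) * softBracket lts W := by
    intro τ
    funext Z W
    simp only [softGravitonTw, softBracket_apply, hA, hu]
    rw [show I * τ * (br ξ ls / br ξ (fun α => Z (.inr α))) * ∑ α, Z (.inl α) * lts α =
      τ * (I * (br ξ ls / br ξ (fun α => Z (.inr α))) * ∑ α, Z (.inl α) * lts α) by ring]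
    ring
  have hne : ∀ᶠ Z in 𝓝 Z, br ξ (fun α => Z (.inr α)) ≠ 0 :=
    (hlam ξ Z).continuousAt.eventually_ne hξ
  have e0 : extend (translationTw (softTranslationTw ξ ls lts)) Z W =
      extend (fun Z W => ((0).factorial : ℂ)⁻¹ * (A Z * u Z ^ 0) * softBracket lts W) Z W := by
    refine extend_congr (.of_forall fun Z => funext fun W => ?_) W
    simp only [translationTw, softTranslationTw, hA, softBracket_apply, Nat.factorial_zero,
      Nat.cast_one, inv_one, pow_zero]
    ring
  have e1 : extend (rotationTw 0 (softRotationTw ξ ls lts)) Z W =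
      extend (fun Z W => ((1).factorial : ℂ)⁻¹ * (A Z * u Z ^ 1) * softBracket lts W) Z W := by
    refine extend_congr (hne.mono fun Z hZ => funext fun W => ?_) W
    simp only [rotationTw, softRotationTw, hA, hu, softBracket_apply, Nat.factorial_one,
      Nat.cast_one, inv_one, pow_one, one_mul, Fin.sum_univ_two, Pi.smul_apply, smul_eq_mul,
      Pi.zero_apply, mul_zero, add_zero]
    field_simp
  have e2 : extend (softSquareTw ls lts) Z W =
      extend (fun Z W => ((2).factorial : ℂ)⁻¹ * (A Z * u Z ^ 2) * softBracket lts W) Z W := by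
    refine extend_congr (hne.mono fun Z hZ => funext fun W => ?_) W
    simp only [softSquareTw, hA, hu, softBracket_apply, Nat.factorial_two, Nat.cast_ofNat, mul_pow,
      I_sq]
    field_simp
  refine ⟨fun ell => ?_, ?_⟩
  · simp only [hV, e0, e1, e2]
    exact ⟨softTerm_extend hAd hud ell 0, softTerm_extend hAd hud ell 1,
      softTerm_extend hAd hud ell 2⟩
  · rw [e0, e1, e2]
    exact two_smul_extend_mul_extend hAd hud

theorem softTranslationTw_smul (ξ ls lts l lt : Spinor) {a b : ℂ} (ha : a ≠ 0) :
    softTranslationTw ξ ls lts (a • l) (b • lt) = a * b * softTranslationTw ξ ls lts l lt ∧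
      softRotationTw ξ ls lts (a • l) (b • lt) = b • softRotationTw ξ ls lts l lt := by
  simp only [softTranslationTw, softRotationTw, br_smul_right, smul_smul]
  refine ⟨?_, ?_⟩
  · rw [show (a * br ξ l) ^ 2 * (b * br lts lt) = a * (a * b * (br ξ l ^ 2 * br lts lt)) by ring,
      show br ξ ls ^ 2 * (a * br ls l) = a * (br ξ ls ^ 2 * br ls l) by ring,
      mul_div_mul_left _ _ ha, mul_div_assoc]
  · congr 1
    rw [show a * br ξ l * (b * br lts lt) = a * (b * (br ξ l * br lts lt)) by ring,
      show br ξ ls * (a * br ls l) = a * (br ξ ls * br ls l) by ring, mul_div_mul_left _ _ ha]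
    ring

/-- The vector `r̃` points along `λ̃_s` and depends on `λ̃` only through `[s λ̃]`, so its divergence
is proportional to `[λ̃_s λ̃_s] = 0`. -/
theorem divergence_softRotationTw (ξ ls lts l lt : Spinor) :
    ∑ α, deriv (fun t : ℂ => softRotationTw ξ ls lts l (lt + t • Pi.single α 1) α) 0 = 0 := by
  have h : ∀ α, deriv (fun t : ℂ => softRotationTw ξ ls lts l (lt + t • Pi.single α 1) α) 0 =
      I * br ξ l / (br ξ ls * br ls l) * br lts (Pi.single α 1) * lts α := by
    intro α
    have h1 : (fun t : ℂ => softRotationTw ξ ls lts l (lt + t • Pi.single α 1) α) = fun t =>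
        softRotationTw ξ ls lts l lt α +
          t * (I * br ξ l / (br ξ ls * br ls l) * br lts (Pi.single α 1) * lts α) := by
      funext t
      simp only [softRotationTw, br_add_right, br_smul_right, Pi.smul_apply, smul_eq_mul]
      ring
    rw [h1]
    simp
  simp only [h, Fin.sum_univ_two, br]
  simp
  ring

theorem twistor_gluon_generators (hX : br ξ ls ≠ 0) (hξ : br ξ (fun α => Z (.inr α)) ≠ 0) :
    softTerm 0 (fun τ => softGluonTw ξ ls lts τ Z) =
        br ξ (fun α => Z (.inr α)) / (br ξ ls * br ls (fun α => Z (.inr α))) ∧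
    softTerm 1 (fun τ => softGluonTw ξ ls lts τ Z) =
        I * (∑ α, Z (.inl α) * lts α) / br ls (fun α => Z (.inr α)) := by
  have h : ∀ τ, softGluonTw ξ ls lts τ Z =
      exp (τ * (I * (br ξ ls / br ξ (fun α => Z (.inr α))) * ∑ α, Z (.inl α) * lts α)) *
        (br ξ (fun α => Z (.inr α)) / (br ξ ls * br ls (fun α => Z (.inr α))) + τ * 0) := by
    intro τ
    rw [softGluonTw, mul_comm, mul_zero, add_zero]
    congr 2
    ring
  simp only [h, softTerm_exp_mul_affine]
  refine ⟨by simp, ?_⟩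
  simp only [pow_one, Nat.factorial_one, Nat.cast_one, div_one, mul_zero, add_zero]
  field_simp

end TwistorSpace

end Ambi

end

theorem mainTheorem11 :
    -- Soft gravitons: supertranslation and superrotation generators.
    (∀ (d : ℕ) (w : ℂ) (ε s p q : Vec d), w ≠ 0 → mdot s p ≠ 0 →
      (∀ ell : Grass 2 d →ₗ[ℂ] ℂ,
        softTerm 0 (fun τ => ell ((softVertex 2 w ε s τ p).symbol q)) =
            ell (algebraMap ℂ _ (hamiltonianLift w q (softTranslation ε s p) 0)) ∧
        softTerm 1 (fun τ => ell ((softVertex 2 w ε s τ p).symbol q)) =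
            ell (superrotationH (softRotation ε s) w p q) +
              ell (algebraMap ℂ _ (I * mdot ε p * mdot ε q)) ∧
        softTerm 1 (fun τ => ell ((superrotationOp w ε s τ p).symbol q)) =
            ell (superrotationH (softRotation ε s) w p q)) ∧
      (superrotationH (softRotation ε s) w p q : Grass 2 d) =
        algebraMap ℂ _ (hamiltonianLift w q 0
          (fun μ => 2 * ∑ ν, softRotation ε s p μ ν * low p ν)) +
        w • ∑ r : Fin 2, ∑ μ, ∑ ν, softRotation ε s p μ ν • (psiLow r μ * psiLow r ν) ∧
      (∀ c : ℂ, c ≠ 0 → softTranslation ε s (c • p) = c * softTranslation ε s p ∧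
        ∀ μ ν, softRotation ε s (c • p) μ ν = softRotation ε s p μ ν) ∧
      ∀ μ ν, softRotation ε s p μ ν = -softRotation ε s p ν μ) ∧
    -- Soft gluons: the gauge analogues.
    (∀ (d : ℕ) (w : ℂ) (ε s p q : Vec d), w ≠ 0 → mdot s p ≠ 0 →
      ∀ ell : Grass 1 d →ₗ[ℂ] ℂ,
        softTerm 0 (fun τ => ell ((softVertex 1 w ε s τ p).symbol q)) =
            ell (algebraMap ℂ _ (w * (mdot ε p / mdot s p))) ∧
        softTerm 1 (fun τ => ell ((softVertex 1 w ε s τ p).symbol q)) =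
            ell ((I / mdot s p) • ∑ μ, ∑ ν, (ε μ * s ν) • angMomentum w p q μ ν) +
              ell (algebraMap ℂ _ (I * mdot ε q)) ∧
        softTerm 1 (fun τ => ell ((gaugeRotationOp w ε s τ p).symbol q)) =
            ell ((I / mdot s p) • ∑ μ, ∑ ν, (ε μ * s ν) • angMomentum w p q μ ν)) ∧
    -- Ward identities for gravitons.
    (∀ (d m : ℕ) (g : Fin 3 → ℂ) (κ₀ : Kin 2 m d) (ε s : Vec d) (S : Finset (Fin m → ℂ))
      (φ : (Fin m → ℂ) → (Fin m → ℂ) → (Fin m → ℂ)),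
      IsSolutionSet (fun u => Function.Injective (punctures g u)) (scatteringMap g κ₀.1) S φ →
      (∀ a, mdot s (κ₀.1 a) ≠ 0) →
      ∀ᶠ ρ in 𝓝[>] (0 : ℝ), ∀ᶠ κ in 𝓝 κ₀, ∀ x : Vec d,
        DifferentiableAt ℂ (correlator g S φ ρ (fun _ => 1) x) κ ∧
        softCorrelator g S φ ρ (fun _ _ => 1) x κ (softVertex 2 1 ε s) 0 =
          gravitonS0 ε s κ * correlator g S φ ρ (fun _ => 1) x κ ∧
        softCorrelator g S φ ρ (fun _ _ => 1) x κ (superrotationOp 1 ε s) 1 =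
          gravitonS1 ε s (correlator g S φ ρ (fun _ => 1) x) κ ∧
        (∑ a, κ.1 a = 0 →
          softCorrelator g S φ ρ (fun _ _ => 1) x κ (softVertex 2 1 ε s) 1 =
            gravitonS1 ε s (correlator g S φ ρ (fun _ => 1) x) κ)) ∧
    -- Ward identities for gluons.
    (∀ (d m : ℕ) (g : Fin 3 → ℂ) (col : Fin (m + 2 + 1) ≃ Hard m) (κ₀ : Kin 1 m d)
      (ε s : Vec d) (S : Finset (Fin m → ℂ))
      (φ : (Fin m → ℂ) → (Fin m → ℂ) → (Fin m → ℂ)),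
      IsSolutionSet (fun u => Function.Injective (punctures g u)) (scatteringMap g κ₀.1) S φ →
      (∀ a, mdot s (κ₀.1 a) ≠ 0) →
      ∀ᶠ ρ in 𝓝[>] (0 : ℝ), ∀ᶠ κ in 𝓝 κ₀, ∀ x : Vec d,
        DifferentiableAt ℂ (correlator g S φ ρ (ptHard col) x) κ ∧
        softCorrelator g S φ ρ (ptSoft col) x κ (softVertex 1 1 ε s) 0 =
          gluonS0 ε s (col 0) (col (Fin.last _)) κ * correlator g S φ ρ (ptHard col) x κ ∧
        softCorrelator g S φ ρ (ptSoft col) x κ (softVertex 1 1 ε s) 1 =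
          gluonS1 ε s (col 0) (col (Fin.last _)) (correlator g S φ ρ (ptHard col) x) κ ∧
        softCorrelator g S φ ρ (ptSoft col) x κ (gaugeRotationOp 1 ε s) 1 =
          gluonS1 ε s (col 0) (col (Fin.last _)) (correlator g S φ ρ (ptHard col) x) κ) ∧
    -- Four dimensions, soft gravitons: generators, and the square of the superrotation.
    (∀ (ξ ls lts : Spinor) (Z W : Tw), br ξ ls ≠ 0 → br ls (fun α => Z (.inr α)) ≠ 0 →
      br ξ (fun α => Z (.inr α)) ≠ 0 →
      (∀ ell : GrassTw →ₗ[ℂ] ℂ,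
        softTerm 0 (fun τ => ell (extend (softGravitonTw ξ ls lts τ) Z W)) =
            ell (extend (translationTw (softTranslationTw ξ ls lts)) Z W) ∧
        softTerm 1 (fun τ => ell (extend (softGravitonTw ξ ls lts τ) Z W)) =
            ell (extend (rotationTw 0 (softRotationTw ξ ls lts)) Z W) ∧
        softTerm 2 (fun τ => ell (extend (softGravitonTw ξ ls lts τ) Z W)) =
            ell (extend (softSquareTw ls lts) Z W)) ∧
      (2 : ℂ) • (extend (translationTw (softTranslationTw ξ ls lts)) Z W *
          extend (softSquareTw ls lts) Z W) =
        extend (rotationTw 0 (softRotationTw ξ ls lts)) Z W ^ 2) ∧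
    (∀ (ξ ls lts l lt : Spinor),
      (∀ a b : ℂ, a ≠ 0 → b ≠ 0 →
        softTranslationTw ξ ls lts (a • l) (b • lt) = a * b * softTranslationTw ξ ls lts l lt ∧
        softRotationTw ξ ls lts (a • l) (b • lt) = b • softRotationTw ξ ls lts l lt) ∧
      ∑ α, deriv (fun t : ℂ => softRotationTw ξ ls lts l (lt + t • Pi.single α 1) α) 0 = 0) ∧
    -- Four dimensions, soft gluons: generators.
    (∀ (ξ ls lts : Spinor) (Z : Tw), br ξ ls ≠ 0 → br ξ (fun α => Z (.inr α)) ≠ 0 →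
      softTerm 0 (fun τ => softGluonTw ξ ls lts τ Z) =
          br ξ (fun α => Z (.inr α)) / (br ξ ls * br ls (fun α => Z (.inr α))) ∧
      softTerm 1 (fun τ => softGluonTw ξ ls lts τ Z) =
          I * (∑ α, Z (.inl α) * lts α) / br ls (fun α => Z (.inr α))) ∧
    -- Four dimensions: Ward identities for gluons.
    (∀ (𝒩 N k m n : ℕ) (G : Gauge N k m) (col : Fin (n + 1) ≃ Leg k m)
      (ell : GrassEta 𝒩 k m →ₗ[ℂ] ℂ) (lam lt₀ : Leg k m → Spinor) (ξ ls lts : Spinor)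
      (S : Finset (Fin N → ℂ)) (φ : (Fin N → ℂ) → (Fin N → ℂ) → (Fin N → ℂ)),
      IsSolutionSet G.domain (G.equations lam lt₀) S φ →
      (∀ a, br ls (lam a) ≠ 0) → br ξ ls ≠ 0 →
      ∀ᶠ ρ in 𝓝[>] (0 : ℝ), ∀ Φ : (Leg k m → Spinor) → ℂ, Differentiable ℂ Φ →
        (∀ a, AnalyticAt ℂ (fun t : ℂ => smeared G S φ ρ lt₀ (gluonKernel G ell col lam) Φ
          (Pi.single a (t • lts))) 0) ∧
        smearedSoft G S φ ρ lt₀ (gluonSoftKernel G ell col lam ξ ls lts) Φ 0 =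
          br (lam (col 0)) (lam (col (Fin.last n))) /
              (br ls (lam (col 0)) * br ls (lam (col (Fin.last n)))) *
            smeared G S φ ρ lt₀ (gluonKernel G ell col lam) Φ 0 ∧
        smearedSoft G S φ ρ lt₀ (gluonSoftKernel G ell col lam ξ ls lts) Φ 1 =
          smearedDeriv G S φ ρ lt₀ (gluonKernel G ell col lam) Φ
              (fun _ => 1 / br ls (lam (col 0))) lts (col 0) 1 +
            smearedDeriv G S φ ρ lt₀ (gluonKernel G ell col lam) Φ
              (fun _ => 1 / br (lam (col (Fin.last n))) ls) lts (col (Fin.last n)) 1) ∧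
    -- Four dimensions: Ward identities for gravitons.
    (∀ (𝒩 N k m : ℕ) (G : Gauge N k m) (i₀ : Fin k) (p₀ : Fin m)
      (ell : GrassEta 𝒩 k m →ₗ[ℂ] ℂ) (lam lt₀ : Leg k m → Spinor) (ξ ls lts : Spinor)
      (S : Finset (Fin N → ℂ)) (φ : (Fin N → ℂ) → (Fin N → ℂ) → (Fin N → ℂ)),
      IsSolutionSet G.domain (G.equations lam lt₀) S φ →
      (∀ a, br ls (lam a) ≠ 0) → br ξ ls ≠ 0 →
      ∀ᶠ ρ in 𝓝[>] (0 : ℝ), ∀ Φ : (Leg k m → Spinor) → ℂ, Differentiable ℂ Φ →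
        (∀ a, AnalyticAt ℂ (fun t : ℂ => smeared G S φ ρ lt₀ (gravitonKernel G ell i₀ p₀ lam) Φ
          (Pi.single a (t • lts))) 0) ∧
        smearedSoft G S φ ρ lt₀ (gravitonSoftKernel G ell i₀ p₀ lam ξ ls lts) Φ 0 =
          ∑ a, smearedDeriv G S φ ρ lt₀ (gravitonKernel G ell i₀ p₀ lam) Φ
            (fun e => br (e a) lts * br ξ (lam a) ^ 2 / (br (lam a) ls * br ξ ls ^ 2))
            lts a 0 ∧
        smearedSoft G S φ ρ lt₀ (gravitonSoftKernel G ell i₀ p₀ lam ξ ls lts) Φ 1 =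
          ∑ a, smearedDeriv G S φ ρ lt₀ (gravitonKernel G ell i₀ p₀ lam) Φ
            (fun e => br (e a) lts * br ξ (lam a) / (br (lam a) ls * br ξ ls)) lts a 1 ∧
        smearedSoft G S φ ρ lt₀ (gravitonSoftKernel G ell i₀ p₀ lam ξ ls lts) Φ 2 =
          1 / 2 * ∑ a, smearedDeriv G S φ ρ lt₀ (gravitonKernel G ell i₀ p₀ lam) Φ
            (fun e => br (e a) lts / br (lam a) ls) lts a 2) :=
  ⟨fun _ w ε s p q hw hs => ⟨graviton_generators w ε s p q hw hs,
      superrotationH_eq_lift ε s p q w, fun _ hc => softTranslation_smul ε s p hc,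
      softRotation_swap ε s p⟩,
    fun _ w ε s p q hw hs => gluon_generators w ε s p q hw hs,
    fun _ _ _ _ ε s _ _ hS hs => graviton_ward ε s hS hs,
    fun _ _ _ col _ ε s _ _ hS hs => gluon_ward col ε s hS hs,
    fun _ _ _ _ _ hX hl hξ => twistor_graviton_generators hX hl hξ,
    fun ξ ls lts l lt => ⟨fun _ _ ha _ => softTranslationTw_smul ξ ls lts l lt ha,
      divergence_softRotationTw ξ ls lts l lt⟩,
    fun _ _ _ _ hX hξ => twistor_gluon_generators hX hξ,
    fun _ _ _ _ _ G col ell _ _ _ _ lts _ _ hS hsoft hX =>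
      gluon_ward_twistor G col ell lts hS hsoft hX,
    fun _ _ _ _ G i₀ p₀ ell _ _ _ _ lts _ _ hS hsoft hX =>
      graviton_ward_twistor G i₀ p₀ ell lts hS hsoft hX⟩
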